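/- **Setting.** All Banach spaces are real. $M$ is a Hausdorff topological space and $t:M\to M$, $\omega\mapsto t\omega$ $(t\ge0)$, is a continuous semiflow. Let $\mu_s,\mu_u:M\to\mathbb R$, $C_1\in\mathbb R$ and $c>1$. $Z$ denotes a Banach space, $A:D(A)\subset Z\to Z$ a linear operator, and $Z_0$ a Banach space which is either $Z$ or (in the cases of MR operators below) $\overline{D(A)}$. *(D1)* $L(\omega)\in L(Z_0,Z)$, $(\omega,z)\mapsto L(\omega)z$ is continuous, $\tau(\omega)=\sup_{t\ge0}|L(t\omega)|<\infty$, and $\tau$ is locally bounded. *(D2)* $f(\omega):Z_0\to Z$, $(\omega,z)\mapsto f(\omega)(z)$ is continuous, $\varepsilon(\omega)=\sup_{t\ge0}\operatorname{Lip}f(t\omega)<\infty$, and $\varepsilon$ is locally bounded. Put $\varepsilon'(\omega)=2C_1\varepsilon(\omega)$. For $g(\omega):Z_0\to Z$, a *mild solution* of $u'(t)=Au(t)+g(t\omega)u(t)$ on $[0,r]$ (on $[0,\infty)$: for all $r$) is a continuous $u:[0,r]\to Z_0$ with $\int_0^tu\in D(A)$ and $u(t)=u(0)+A\int_0^tu(s)\,ds+\int_0^tg(s\omega)u(s)\,ds$.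 *Uniform dichotomy of a cocycle correspondence.* $P_\omega$ $(\omega\in M)$ are projections in $L(Z_0,Z_0)$, $P^c_\omega=\mathrm{id}-P_\omega$, $X_\omega=R(P_\omega)$, $Y_\omega=R(P_\omega^c)$; $T_1(t,\omega):X_\omega\to X_{t\omega}$ and $S_1(-t,t\omega):Y_{t\omega}\to Y_\omega$ $(t\ge0)$ are linear cocycles of bounded operators, i.e. $T_1(0,\omega)=\mathrm{id}$, $T_1(t+s,\omega)=T_1(t,s\omega)T_1(s,\omega)$, $S_1(0,\omega)=\mathrm{id}$, $S_1(-t-s,(t+s)\omega)=S_1(-s,s\omega)S_1(-t,t(s\omega))$; the maps $(\omega,z)\mapsto P_\omega z$, $(t,\omega,z)\mapsto T_1(t,\omega)P_\omega z$ and $(t,\omega,z)\mapsto S_1(-t,t\omega)P^c_{t\omega}z$ are continuous; $C_1>0$, $|P_\omega|,|P_\omega^c|\le C_1$; and for all $t,r\ge0$, $\omega\in M$, $|T_1(t,r\omega)|\le e^{\mu_s(\omega)t}$, $|S_1(-t,t(r\omega))|\le e^{-\mu_u(\omega)t}$. The correspondence is *generated by* $z'=Az+L(t\omega)z$ if for all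 $\omega\in M$, $r\ge0$, $x\in X_\omega$, $y\in Y_{r\omega}$ the function $z(t)=T_1(t,\omega)x+S_1(t-r,r\omega)y$ is the unique mild solution on $[0,r]$ with $P_\omega z(0)=x$, $P^c_{r\omega}z(r)=y$. *Uniform dichotomy of a cocycle.* $T_0(t,\omega)\in L(Z_0,Z_0)$ is the cocycle generated by $z'=Az+L(t\omega)z$, i.e. $T_0(0,\omega)=\mathrm{id}$ and $t\mapsto T_0(t,\omega)x$ is a mild solution for all $\omega\in M$, $x\in Z_0$. $P_\omega$, $X_\omega$, $Y_\omega$ are as above, with $\omega\mapsto P_\omega z$ continuous for every $z$; $C_1>0$, $|P_\omega|,|P^c_\omega|\le C_1$; $T_0(t,\omega)X_\omega\subset X_{t\omega}$; $T_0(t,\omega):Y_\omega\to Y_{t\omega}$ is bijective; and for all $t,r\ge0$, $\omega\in M$, $|T_0(t,r\omega)x|\le e^{\mu_s(\omega)t}|x|$ $(x\in X_{r\omega})$ and $|y|\le e^{-\mu_u(\omega)t}|T_0(t,r\omega)y|$ $(y\in Y_{r\omega})$. $A$ *generates a $C_0$ bi-semigroup* if $Z=X_1\oplus X_2$ with closed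 subspaces and $A=A_1\oplus(-A_2)$, where $A_i$ generates a $C_0$ semigroup on $X_i$. $A$ is an *MR operator with modulus $\delta$* if the part of $A$ in $\overline{D(A)}$ generates a $C_0$ semigroup $T$ on $\overline{D(A)}$ with $|T(t)|\le e^{\mu t}$ for some $\mu\in\mathbb R$, and $A$ generates an exponentially bounded once integrated semigroup $S$ on $Z$ such that, with $(S\Diamond g)(t)=\frac{d}{dt}\int_0^tS(t-s)g(s)\,ds$, $\sup_{[0,t]}|S\Diamond g|\le\delta(t)\sup_{[0,t]}|g|$ for all $g\in C^1$, $t>0$, where $\delta$ is increasing on $(0,\infty)$ and $\delta(t)\to0$ as $t\to0^+$. **The equations.** Consider one of the following cases; in each of them a function $\hat\varepsilon:M\to[0,\infty)$ and a function $\beta:M\to\mathbb R$ are specified. (i) $Z_0=Z$, $T_1,S_1$ satisfy uniform dichotomy, (D2) holds, and the equation is the integral equation, for $z(t)=(x(t),y(t))\in X_{t\omega}\oplus Y_{t\omega}$ continuous and $0\le t\le r$ (for all $r\ge0$), $$x(t)=T_1(t,\omega)x(0)+\int_0^tT_1(t-s,s\omega)P_{s\omega}f(s\omega)z(s)\,ds,\qquad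 y(t)=S_1(t-r,r\omega)y(r)-\int_t^rS_1(t-s,s\omega)P^c_{s\omega}f(s\omega)z(s)\,ds .$$ Here $\hat\varepsilon(\omega)=\varepsilon_m(\omega)=\sup_{t\ge0}\operatorname{Lip}_mf(t\omega)$, where $\operatorname{Lip}_mf(\omega)$ is the Lipschitz constant of $f(\omega)$ for the norm $\max\{|P_\omega z|,|P_\omega^cz|\}$ on both sides. (ii) The equation is $z'=Az+L(t\omega)z+f(t\omega)z$ (mild solutions), $\hat\varepsilon=\varepsilon'$, (D1) and (D2) hold, and either $A$ generates a $C_0$ bi-semigroup, $Z_0=Z$, and $z'=Az+L(t\omega)z$ generates a cocycle correspondence with uniform dichotomy; or $A$ is an MR operator whose modulus satisfies $\delta(t)/t\to1$ as $t\to0^+$, $Z_0=\overline{D(A)}$, and the cocycle $T_0$ generated by $z'=Az+L(t\omega)z$ satisfies uniform dichotomy. In (i) and (ii) assume $\inf_\omega\{\mu_u(\omega)-\mu_s(\omega)-(1+c)\hat\varepsilon(\omega)\}>0$, and let $\beta$ be any function with $\dfrac{\hat\varepsilon(\omega)}{\mu_u(\omega)-\mu_s(\omega)-\hat\varepsilon(\omega)}\le\beta(\omega)<1$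 for all $\omega$. (iii) Let $\delta$, $\tau$ and $\eta:M\to(0,\infty)$ be given with $\eta(t\omega)\le\eta(\omega)$ for $t\ge0$ and $\inf_\omega\{\mu_u(\omega)-\mu_s(\omega)-(1+c)\eta(\omega)\}>0$; put $\hat\varepsilon=\eta$. The claim is that there are $\vartheta:M\to(0,\infty)$ and $\beta:M\to[0,1)$ with $\sup_\omega\beta(\omega)<1$, depending only on $\delta,\tau,\mu_s,\mu_u,C_1,\eta$, such that the conclusions below hold whenever $A$ is an MR operator with modulus $\delta$, $Z_0=\overline{D(A)}$, (D1) (with this $\tau$) and (D2) hold, the cocycle $T_0$ generated by $z'=Az+L(t\omega)z$ satisfies uniform dichotomy, $\varepsilon(\omega)<\vartheta(\omega)$ for all $\omega$, and the equation is $z'=Az+L(t\omega)z+f(t\omega)z$ (mild solutions). **Conclusions.** For $\mathcal M=\bigcup_{\omega}\{\omega\}\times\mathcal M_\omega\subset M\times Z_0$ consider: (1) $0\in\mathcal M_\omega$ for every $\omega$; (2) $\mathcal M_\omega=\operatorname{Graph}\Psi_\omega=\{x+\Psi_\omega(x):x\in X_\omega\}$ for a map $\Psi_\omega:X_\omega\to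 Y_\omega$ with $\operatorname{Lip}\Psi_\omega\le\beta(\omega)$; (3) $\mathcal M$ is positively invariant: for each $(\omega,z)\in\mathcal M$ there is a solution $u$ of the equation over $\omega$ on $[0,\infty)$ with $u(0)=z$ and $u(t)\in\mathcal M_{t\omega}$ for all $t\ge0$; (4) if $f(\omega)$ is $C^1$ for every $\omega$ (in case (iii): and $(\omega,z)\mapsto D_zf(\omega)(z)$ is continuous), then $\Psi_\omega$ is $C^1$ for every $\omega$. *Case I.* If $f(\omega)(0)=0$ for all $\omega$, then there is a unique $\mathcal M$ with (1)–(3); it satisfies (4). *Case II.* If $\sup_{t\ge0}\sup_z|f(t\omega)(z)|<\infty$ for every $\omega$, and $\inf_\omega\{\mu_u(\omega)-\hat\varepsilon(\omega)\}>0$, then there is a unique $\mathcal M$ with (2), (3) and $\sup_{t\ge0}|\Psi_{t\omega}(0)|<\infty$ for every $\omega$; it satisfies (4). If in addition $\mu_s,\mu_u,\hat\varepsilon$ are bounded and $\sup_\omega\sup_z|f(\omega)(z)|<\infty$ (in case (iii) also $\sup_\omega\tau(\omega)<\infty$), then $\sup_\omega|\Psi_\omega(0)|<\infty$. -/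

import Mathlib

open Filter Topology Set MeasureTheory
open scoped NNReal ENNReal

universe u v

noncomputable section

namespace InvGraph

/-! ### Splittings, Lipschitz constants and the nonlinearity -/

section Split

variable {M : Type u} {E : Type v} [NormedAddCommGroup E] [NormedSpace ℝ E]

/-- The spectral space `X_ω = R(P_ω)`. -/
def specX (P : M → E →L[ℝ] E) (ω : M) : Submodule ℝ E :=
  LinearMap.range (P ω : E →ₗ[ℝ] E)

/-- The spectral space `Y_ω = R(P_ω^c)`, where `P_ω^c = id - P_ω`. -/
def specY (P : M → E →L[ℝ] E) (ω : M) : Submodule ℝ E :=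
  LinearMap.range ((ContinuousLinearMap.id ℝ E - P ω : E →L[ℝ] E) : E →ₗ[ℝ] E)

/-- `P_ω` as a map onto `X_ω`. -/
def projX (P : M → E →L[ℝ] E) (ω : M) : E →L[ℝ] specX P ω :=
  (P ω).codRestrict (specX P ω) (fun z => LinearMap.mem_range_self (P ω : E →ₗ[ℝ] E) z)

/-- `P_ω^c` as a map onto `Y_ω`. -/
def projY (P : M → E →L[ℝ] E) (ω : M) : E →L[ℝ] specY P ω :=
  (ContinuousLinearMap.id ℝ E - P ω).codRestrict (specY P ω)
    (fun z => LinearMap.mem_range_self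
      ((ContinuousLinearMap.id ℝ E - P ω : E →L[ℝ] E) : E →ₗ[ℝ] E) z)

/-- The max norm `max {|P_ω z|, |P_ω^c z|}` of `X_ω ⊕ Y_ω`. -/
def maxNorm (P : M → E →L[ℝ] E) (ω : M) (z : E) : ℝ :=
  max ‖P ω z‖ ‖z - P ω z‖

end Split

/-- The (least) Lipschitz constant of a map, `⊤` if the map is not Lipschitz. -/
def lipConst {E F : Type v} [NormedAddCommGroup E] [NormedAddCommGroup F] (g : E → F) : ℝ≥0∞ :=
  sInf {K : ℝ≥0∞ | ∀ x y, edist (g x) (g y) ≤ K * edist x y}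

/-- The (least) Lipschitz constant of `g` with respect to the max norm of `X_ω ⊕ Y_ω`. -/
def lipConstMax {M : Type u} {E : Type v} [NormedAddCommGroup E] [NormedSpace ℝ E]
    (P : M → E →L[ℝ] E) (ω : M) (g : E → E) : ℝ≥0∞ :=
  sInf {K : ℝ≥0∞ | ∀ x y, ENNReal.ofReal (maxNorm P ω (g x - g y)) ≤
    K * ENNReal.ofReal (maxNorm P ω (x - y))}

section Setting

variable {M : Type u} [TopologicalSpace M]

/-- The point `tω` for a real time `t` (used for `t ≥ 0` only). -/
def orb (φ : Flow ℝ≥0 M) (ω : M) (t : ℝ) : M := φ t.toNNReal ω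

/-- `sup_{t ≥ 0} Lip f(tω)`, as an extended number. -/
def lipSup {E F : Type v} [NormedAddCommGroup E] [NormedAddCommGroup F]
    (φ : Flow ℝ≥0 M) (f : M → E → F) (ω : M) : ℝ≥0∞ :=
  ⨆ t : ℝ≥0, lipConst (f (φ t ω))

/-- `ε(ω) = sup_{t ≥ 0} Lip f(tω)`. -/
def eps {E F : Type v} [NormedAddCommGroup E] [NormedAddCommGroup F]
    (φ : Flow ℝ≥0 M) (f : M → E → F) (ω : M) : ℝ :=
  (lipSup φ f ω).toReal

/-- `ε_m(ω)`: the supremum over `t ≥ 0` of the Lipschitz constants of `f(tω)` computed in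
`X_{tω} ⊕ Y_{tω}` with the max norm. -/
def epsMax {E : Type v} [NormedAddCommGroup E] [NormedSpace ℝ E]
    (φ : Flow ℝ≥0 M) (P : M → E →L[ℝ] E) (f : M → E → E) (ω : M) : ℝ :=
  (⨆ t : ℝ≥0, lipConstMax P (φ t ω) (f (φ t ω))).toReal

/-- Standing assumption on the nonlinearity: `f` is continuous, `ε(ω) < ∞` for every `ω`, and
`ω ↦ ε(ω)` is locally bounded. -/
structure CondF {E F : Type v} [NormedAddCommGroup E] [NormedAddCommGroup F]
    (φ : Flow ℝ≥0 M) (f : M → E → F) : Prop where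
  cont : Continuous fun p : M × E => f p.1 p.2
  finite : ∀ ω, lipSup φ f ω < ⊤
  locBdd : ∀ ω, ∃ U ∈ 𝓝 ω, BddAbove (eps φ f '' U)

/-- Standing assumption on the linear perturbation: `L` is strongly continuous,
`τ(ω) = sup_{t ≥ 0} |L(tω)| < ∞`, and `τ` is locally bounded. -/
structure CondL {E Z : Type v} [NormedAddCommGroup E] [NormedSpace ℝ E]
    [NormedAddCommGroup Z] [NormedSpace ℝ Z]
    (φ : Flow ℝ≥0 M) (L : M → E →L[ℝ] Z) (τ : M → ℝ) : Prop where
  cont : Continuous fun p : M × E => L p.1 p.2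
  lub : ∀ ω, IsLUB (range fun t : ℝ≥0 => ‖L (φ t ω)‖) (τ ω)
  locBdd : ∀ ω, ∃ U ∈ 𝓝 ω, BddAbove (τ '' U)

/-! ### Solutions -/

/-- `u` is a mild solution on `[0, r]` of `u' (t) = A u(t) + g(tω) u(t)`. Here `u` takes values in
`E`, which is the whole space `Z` (`J = id`) or the closure of `D(A)` (`J` the inclusion). -/
def IsMildOn {E Z : Type v} [NormedAddCommGroup E] [NormedSpace ℝ E]
    [NormedAddCommGroup Z] [NormedSpace ℝ Z]
    (φ : Flow ℝ≥0 M) (A : Z →ₗ.[ℝ] Z) (J : E →L[ℝ] Z) (g : M → E → Z)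
    (ω : M) (r : ℝ) (w : ℝ → E) : Prop :=
  ContinuousOn w (Icc 0 r) ∧
  ∀ t ∈ Icc (0 : ℝ) r, ∃ h : (∫ s in (0 : ℝ)..t, J (w s)) ∈ A.domain,
    J (w t) = J (w 0) + A ⟨∫ s in (0 : ℝ)..t, J (w s), h⟩
      + ∫ s in (0 : ℝ)..t, g (orb φ ω s) (w s)

/-- Mild solutions on `[0, ∞)`. -/
def IsMild {E Z : Type v} [NormedAddCommGroup E] [NormedSpace ℝ E]
    [NormedAddCommGroup Z] [NormedSpace ℝ Z]
    (φ : Flow ℝ≥0 M) (A : Z →ₗ.[ℝ] Z) (J : E →L[ℝ] Z) (g : M → E → Z)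
    (ω : M) (w : ℝ → E) : Prop :=
  ∀ r : ℝ, 0 ≤ r → IsMildOn φ A J g ω r w

variable {E : Type v} [NormedAddCommGroup E] [NormedSpace ℝ E]

/-- `z(t) = (x(t), y(t)) ∈ X_{tω} ⊕ Y_{tω}` solves on `[0, r]` the integral equation
`x(t) = T₁(t, ω) x(0) + ∫_0^t T₁(t-s, sω) P_{sω} f(sω) z(s) ds`,
`y(t) = S₁(t-r, rω) y(r) - ∫_t^r S₁(t-s, sω) P^c_{sω} f(sω) z(s) ds`.
The map written `S₁(-t, tω) : Y_{tω} → Y_ω` is `S₁ t ω` here. -/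
def IsIntegralSolOn (φ : Flow ℝ≥0 M) (P : M → E →L[ℝ] E)
    (T₁ : ∀ (t : ℝ≥0) (ω : M), specX P ω →L[ℝ] specX P (φ t ω))
    (S₁ : ∀ (t : ℝ≥0) (ω : M), specY P (φ t ω) →L[ℝ] specY P ω)
    (f : M → E → E) (ω : M) (r : ℝ) (z : ℝ → E) : Prop :=
  ContinuousOn z (Icc 0 r) ∧
  ∀ t ∈ Icc (0 : ℝ) r,
    (P (orb φ ω t) (z t) = (T₁ t.toNNReal ω (projX P ω (z 0)) : E)
      + ∫ s in (0 : ℝ)..t, (T₁ (t - s).toNNReal (orb φ ω s)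
          (projX P (orb φ ω s) (f (orb φ ω s) (z s))) : E)) ∧
    (z t - P (orb φ ω t) (z t) =
      (S₁ (r - t).toNNReal (orb φ ω t)
          (projY P (φ (r - t).toNNReal (orb φ ω t)) (z r)) : E)
      - ∫ s in t..r, (S₁ (s - t).toNNReal (orb φ ω t)
          (projY P (φ (s - t).toNNReal (orb φ ω t)) (f (orb φ ω s) (z s))) : E))

/-- Solutions of the integral equation on `[0, ∞)`. -/
def IsIntegralSol (φ : Flow ℝ≥0 M) (P : M → E →L[ℝ] E)
    (T₁ : ∀ (t : ℝ≥0) (ω : M), specX P ω →L[ℝ] specX P (φ t ω))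
    (S₁ : ∀ (t : ℝ≥0) (ω : M), specY P (φ t ω) →L[ℝ] specY P ω)
    (f : M → E → E) (ω : M) (z : ℝ → E) : Prop :=
  ∀ r : ℝ, 0 ≤ r → IsIntegralSolOn φ P T₁ S₁ f ω r z

/-! ### Uniform dichotomy -/

/-- The `C₀` linear cocycles `T₁`, `S₁` form a cocycle correspondence that satisfies uniform
dichotomy on `ℝ₊`. The map written `S₁(-t, tω) : Y_{tω} → Y_ω` is `S₁ t ω` here. -/
structure UniformDichotomy (φ : Flow ℝ≥0 M) (P : M → E →L[ℝ] E)
    (T₁ : ∀ (t : ℝ≥0) (ω : M), specX P ω →L[ℝ] specX P (φ t ω))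
    (S₁ : ∀ (t : ℝ≥0) (ω : M), specY P (φ t ω) →L[ℝ] specY P ω)
    (C₁ : ℝ) (μs μu : M → ℝ) : Prop where
  proj : ∀ ω z, P ω (P ω z) = P ω z
  proj_cont : Continuous fun p : M × E => P p.1 p.2
  T_zero : ∀ (ω : M) (x : specX P ω), (T₁ 0 ω x : E) = x
  T_add : ∀ (t s : ℝ≥0) (ω : M) (x : specX P ω),
    (T₁ (t + s) ω x : E) = T₁ t (φ s ω) (T₁ s ω x)
  T_cont : Continuous fun q : ℝ≥0 × M × E => (T₁ q.1 q.2.1 (projX P q.2.1 q.2.2) : E)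
  S_zero : ∀ (ω : M) (y : specY P (φ 0 ω)), (S₁ 0 ω y : E) = y
  S_add : ∀ (t s : ℝ≥0) (ω : M) (z : E),
    (S₁ (t + s) ω (projY P (φ (t + s) ω) z) : E) =
      S₁ s ω (S₁ t (φ s ω) (projY P (φ t (φ s ω)) z))
  S_cont : Continuous fun q : ℝ≥0 × M × E =>
    (S₁ q.1 q.2.1 (projY P (φ q.1 q.2.1) q.2.2) : E)
  C_pos : 0 < C₁
  norm_P : ∀ ω, ‖P ω‖ ≤ C₁
  norm_Pc : ∀ ω, ‖ContinuousLinearMap.id ℝ E - P ω‖ ≤ C₁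
  norm_T : ∀ (t r : ℝ≥0) (ω : M), ‖T₁ t (φ r ω)‖ ≤ Real.exp (μs ω * t)
  norm_S : ∀ (t r : ℝ≥0) (ω : M), ‖S₁ t (φ r ω)‖ ≤ Real.exp (-μu ω * t)

/-- The cocycle correspondence `(T₁, S₁)` is generated by `z'(t) = A z(t) + L(tω) z(t)`:
for `x ∈ X_ω`, `y ∈ Y_{rω}` the function
`t ↦ T₁(t, ω) x + S₁(t - r, rω) y` is the (unique) mild solution `z` on `[0, r]` with
`P_ω z(0) = x`, `P^c_{rω} z(r) = y`. -/
def GeneratesCorrespondence (φ : Flow ℝ≥0 M) (A : E →ₗ.[ℝ] E) (L : M → E →L[ℝ] E)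
    (P : M → E →L[ℝ] E)
    (T₁ : ∀ (t : ℝ≥0) (ω : M), specX P ω →L[ℝ] specX P (φ t ω))
    (S₁ : ∀ (t : ℝ≥0) (ω : M), specY P (φ t ω) →L[ℝ] specY P ω) : Prop :=
  ∀ (ω : M) (r : ℝ), 0 ≤ r → ∀ (x : specX P ω) (y : specY P (orb φ ω r)),
    ∀ w : ℝ → E,
      (IsMildOn φ A (ContinuousLinearMap.id ℝ E) (fun ω z => L ω z) ω r w ∧
        P ω (w 0) = x ∧ w r - P (orb φ ω r) (w r) = y) ↔
      ∀ t ∈ Icc (0 : ℝ) r, w t = (T₁ t.toNNReal ω x : E) +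
        (S₁ (r - t).toNNReal (orb φ ω t)
          (projY P (φ (r - t).toNNReal (orb φ ω t)) (y : E)) : E)

/-- `T₀(t, ω)` is the linear cocycle on the closure of `D(A)` generated by
`z'(t) = A z(t) + L(tω) z(t)`, that is, `t ↦ T₀(t, ω) x` is the mild solution starting at `x`. -/
def GeneratesCocycle {Z : Type v} [NormedAddCommGroup Z] [NormedSpace ℝ Z]
    (φ : Flow ℝ≥0 M) (A : Z →ₗ.[ℝ] Z) (J : E →L[ℝ] Z) (L : M → E →L[ℝ] Z)
    (T₀ : ℝ≥0 → M → E →L[ℝ] E) : Prop :=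
  ∀ (ω : M) (x : E), T₀ 0 ω x = x ∧
    IsMild φ A J (fun ω z => L ω z) ω (fun t => T₀ t.toNNReal ω x)

/-- Uniform dichotomy on `ℝ₊` of a linear cocycle `T₀`. The last condition is the bound
`e^{-μ_u(ω) t}` for the norm of the inverse of `T₀(t, rω) : Y_{rω} → Y_{t(rω)}`. -/
structure UniformDichotomyCocycle (φ : Flow ℝ≥0 M) (T₀ : ℝ≥0 → M → E →L[ℝ] E)
    (P : M → E →L[ℝ] E) (C₁ : ℝ) (μs μu : M → ℝ) : Prop where
  proj : ∀ ω z, P ω (P ω z) = P ω z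
  proj_cont : ∀ z, Continuous fun ω => P ω z
  inv_X : ∀ (t : ℝ≥0) (ω : M), MapsTo (T₀ t ω) (specX P ω) (specX P (φ t ω))
  bij_Y : ∀ (t : ℝ≥0) (ω : M), BijOn (T₀ t ω) (specY P ω) (specY P (φ t ω))
  C_pos : 0 < C₁
  norm_P : ∀ ω, ‖P ω‖ ≤ C₁
  norm_Pc : ∀ ω, ‖ContinuousLinearMap.id ℝ E - P ω‖ ≤ C₁
  norm_T : ∀ (t r : ℝ≥0) (ω : M), ∀ x ∈ specX P (φ r ω),
    ‖T₀ t (φ r ω) x‖ ≤ Real.exp (μs ω * t) * ‖x‖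
  norm_S : ∀ (t r : ℝ≥0) (ω : M), ∀ y ∈ specY P (φ r ω),
    ‖y‖ ≤ Real.exp (-μu ω * t) * ‖T₀ t (φ r ω) y‖

end Setting

/-! ### Semigroups, bi-semigroups, MR operators -/

section Semigroup

/-- `C₀` semigroups. -/
structure IsC0Semigroup {E : Type v} [NormedAddCommGroup E] [NormedSpace ℝ E]
    (T : ℝ≥0 → E →L[ℝ] E) : Prop where
  zero : ∀ x, T 0 x = x
  add : ∀ t s x, T (t + s) x = T t (T s x)
  cont : ∀ x, Continuous fun t => T t x

/-- `x` lies in the domain of the generator of `T`, and the generator maps it to `y`. -/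
def GeneratorRel {E : Type v} [NormedAddCommGroup E] [NormedSpace ℝ E]
    (T : ℝ≥0 → E →L[ℝ] E) (x y : E) : Prop :=
  Tendsto (fun t : ℝ => t⁻¹ • (T t.toNNReal x - x)) (𝓝[>] 0) (𝓝 y)

variable {Z : Type v} [NormedAddCommGroup Z] [NormedSpace ℝ Z]

/-- `A` generates a `C₀` bi-semigroup: `A = A₁ ⊕ (-A₂)` in a decomposition `Z = X₁ ⊕ X₂` into closed
subspaces, where `Aᵢ` generates a `C₀` semigroup on `Xᵢ`. -/
def GeneratesBiSemigroup (A : Z →ₗ.[ℝ] Z) : Prop :=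
  ∃ X₁ X₂ : Submodule ℝ Z, IsClosed (X₁ : Set Z) ∧ IsClosed (X₂ : Set Z) ∧ IsCompl X₁ X₂ ∧
    ∃ (T : ℝ≥0 → X₁ →L[ℝ] X₁) (S : ℝ≥0 → X₂ →L[ℝ] X₂), IsC0Semigroup T ∧ IsC0Semigroup S ∧
      ∀ z w : Z, (z, w) ∈ A.graph ↔
        ∃ (x x' : X₁) (y y' : X₂), z = x + y ∧ w = x' - y' ∧
          GeneratorRel T x x' ∧ GeneratorRel S y y'

/-- `R = (l - A)⁻¹` as a bounded operator (so `l` is in the resolvent set of `A`). -/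
def IsResolventAt (A : Z →ₗ.[ℝ] Z) (l : ℝ) (R : Z →L[ℝ] Z) : Prop :=
  (∀ z : Z, ∃ h : R z ∈ A.domain, l • R z - A ⟨R z, h⟩ = z) ∧
  (∀ x : A.domain, R (l • (x : Z) - A x) = x)

/-- `A` generates the once integrated (exponentially bounded) semigroup `S`. -/
def GeneratesIntegratedSemigroup (A : Z →ₗ.[ℝ] Z) (S : ℝ≥0 → Z →L[ℝ] Z) : Prop :=
  (∀ z, Continuous fun t => S t z) ∧
  ∃ K w : ℝ, (∀ t : ℝ≥0, ‖S t‖ ≤ K * Real.exp (w * t)) ∧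
    ∀ l : ℝ, w < l → ∃ R : Z →L[ℝ] Z, IsResolventAt A l R ∧
      ∀ z, R z = l • ∫ t in Ioi (0 : ℝ), Real.exp (-l * t) • S t.toNNReal z

/-- The closure of `D(A)`. -/
abbrev closDom (A : Z →ₗ.[ℝ] Z) : Submodule ℝ Z := A.domain.topologicalClosure

/-- `(S ◇ g)(t) = d/dt ∫_0^t S(t - s) g(s) ds`, `t ≥ 0`. -/
def diamond (S : ℝ≥0 → Z →L[ℝ] Z) (g : ℝ → Z) (t : ℝ) : Z :=
  derivWithin (fun r : ℝ => ∫ s in (0 : ℝ)..r, S (r - s).toNNReal (g s)) (Ici 0) t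

/-- `A` is an MR operator with modulus `δ`: the part of `A` in the closure of `D(A)` generates a
`C₀` semigroup `T` there with `|T(t)| ≤ e^{μ t}`; moreover `A` generates a once integrated
semigroup `S` with `|S ◇ g|_{[0,t]} ≤ δ(t) |g|_{[0,t]}` for all `C¹` functions `g`, where `δ` is
increasing and tends to `0` as `t → 0+`. -/
structure IsMROperator (A : Z →ₗ.[ℝ] Z) (δ : ℝ → ℝ) : Prop where
  semigroup : ∃ (T : ℝ≥0 → closDom A →L[ℝ] closDom A) (μ : ℝ), IsC0Semigroup T ∧
    (∀ t : ℝ≥0, ‖T t‖ ≤ Real.exp (μ * t)) ∧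
    ∀ x y : closDom A, ((x : Z), (y : Z)) ∈ A.graph ↔ GeneratorRel T x y
  integrated : ∃ S : ℝ≥0 → Z →L[ℝ] Z, GeneratesIntegratedSemigroup A S ∧
    ∀ g : ℝ → Z, ContDiff ℝ 1 g → ∀ t : ℝ, 0 < t → ∀ b : ℝ, (∀ s ∈ Icc 0 t, ‖g s‖ ≤ b) →
      ∀ s ∈ Icc 0 t, ‖diamond S g s‖ ≤ δ t * b
  mono : MonotoneOn δ (Ioi 0)
  lim : Tendsto δ (𝓝[>] 0) (𝓝 0)

end Semigroup

/-! ### Invariant graphs -/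

section Graphs

variable {M : Type u} [TopologicalSpace M] {E : Type v} [NormedAddCommGroup E] [NormedSpace ℝ E]

/-- `𝓜_ω = Graph Ψ_ω` with `Ψ_ω : X_ω → Y_ω`, `Lip Ψ_ω ≤ β(ω)`, and `𝓜` is positively invariant
under the equation whose solutions on `[0, ∞)` over `ω` are given by `Sol ω`. -/
structure IsInvariantGraph (φ : Flow ℝ≥0 M) (P : M → E →L[ℝ] E) (Sol : M → (ℝ → E) → Prop)
    (β : M → ℝ) (𝓜 : Set (M × E)) (Ψ : ∀ ω, specX P ω → specY P ω) : Prop where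
  graph : ∀ ω z, (ω, z) ∈ 𝓜 ↔ ∃ x : specX P ω, z = x + Ψ ω x
  lip : ∀ ω x x', ‖Ψ ω x - Ψ ω x'‖ ≤ β ω * ‖x - x'‖
  inv : ∀ ω z, (ω, z) ∈ 𝓜 → ∃ w : ℝ → E, Sol ω w ∧ w 0 = z ∧ ∀ t : ℝ≥0, (φ t ω, w t) ∈ 𝓜

/-- Conclusion for `f(ω)(0) = 0`: there is a unique positively invariant family of Lipschitz graphs
through `0`, and it is `C¹` if `smooth` holds. -/
def ConclusionI (φ : Flow ℝ≥0 M) (P : M → E →L[ℝ] E) (Sol : M → (ℝ → E) → Prop)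
    (β : M → ℝ) (smooth : Prop) : Prop :=
  (∃! 𝓜 : Set (M × E), (∀ ω, (ω, (0 : E)) ∈ 𝓜) ∧ ∃ Ψ, IsInvariantGraph φ P Sol β 𝓜 Ψ) ∧
  ∀ (𝓜 : Set (M × E)) (Ψ : ∀ ω, specX P ω → specY P ω),
    (∀ ω, (ω, (0 : E)) ∈ 𝓜) → IsInvariantGraph φ P Sol β 𝓜 Ψ →
    smooth → ∀ ω, ContDiff ℝ 1 (Ψ ω)

/-- Conclusion for bounded `f`: there is a unique positively invariant family of Lipschitz graphs
with `sup_{t ≥ 0} |Ψ_{tω}(0)| < ∞` for each `ω`; it is `C¹` if `smooth` holds, and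
`sup_ω |Ψ_ω(0)| < ∞` if `unif` holds. -/
def ConclusionII (φ : Flow ℝ≥0 M) (P : M → E →L[ℝ] E) (Sol : M → (ℝ → E) → Prop)
    (β : M → ℝ) (smooth unif : Prop) : Prop :=
  (∃! 𝓜 : Set (M × E), ∃ Ψ, IsInvariantGraph φ P Sol β 𝓜 Ψ ∧
    ∀ ω, ∃ K : ℝ, ∀ t : ℝ≥0, ‖Ψ (φ t ω) 0‖ ≤ K) ∧
  ∀ (𝓜 : Set (M × E)) (Ψ : ∀ ω, specX P ω → specY P ω),
    IsInvariantGraph φ P Sol β 𝓜 Ψ → (∀ ω, ∃ K : ℝ, ∀ t : ℝ≥0, ‖Ψ (φ t ω) 0‖ ≤ K) →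
    (smooth → ∀ ω, ContDiff ℝ 1 (Ψ ω)) ∧
    (unif → ∃ K : ℝ, ∀ ω, ‖Ψ ω 0‖ ≤ K)

/-- `g : M → ℝ` is bounded. -/
def IsBdd (g : M → ℝ) : Prop := ∃ K : ℝ, ∀ ω, |g ω| ≤ K

/-- `inf_ω g(ω) > 0`. -/
def InfPos (g : M → ℝ) : Prop := ∃ d : ℝ, 0 < d ∧ ∀ ω, d ≤ g ω

/-- Both cases together; `e` is the function `ε_m`, `ε'` or `η` of the spectral gap, `smooth` is the
regularity assumption on `f`, and `extra` a further assumption in the uniform bound. -/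
def InvariantGraphTheorem {F : Type v} [NormedAddCommGroup F] (φ : Flow ℝ≥0 M)
    (P : M → E →L[ℝ] E) (Sol : M → (ℝ → E) → Prop) (f : M → E → F) (μs μu e : M → ℝ) (β : M → ℝ)
    (smooth extra : Prop) : Prop :=
  ((∀ ω, f ω 0 = 0) → ConclusionI φ P Sol β smooth) ∧
  ((∀ ω, ∃ K : ℝ, ∀ (t : ℝ≥0) (z : E), ‖f (φ t ω) z‖ ≤ K) →
    InfPos (fun ω => μu ω - e ω) →
    ConclusionII φ P Sol β smooth
      (IsBdd μs ∧ IsBdd μu ∧ IsBdd e ∧ (∃ K : ℝ, ∀ ω z, ‖f ω z‖ ≤ K) ∧ extra))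

end Graphs

end InvGraph

end

set_option linter.unusedSectionVars false

namespace InvGraph

/-! ### Auxiliary analysis -/

/-! The method is that of Lyapunov and Perron with exponential weights. Uniform dichotomy controls
the X-part of a solution forward in time with rate `μs` and its Y-part backward in time with rate
`μu`. For a weight e^{γt} with γ strictly in between, the forced linear equation on the half line
has exactly one solution of growth e^{γt} with prescribed X-part at time 0; its weighted size is at
most the initial X-part plus κ times that of the forcing. If κ times the Lipschitz constant ε of the
nonlinearity is below one, contraction gives the same for the nonlinear equation
(`Adm.exists_nonlinear`, `Adm.diff_le`).

The invariant set consists of the initial values of these solutions (`solGraph`). It is a graph over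
X because the X-part determines the solution, and it is invariant because a time shift of such a
solution is again one. Conversely, on any invariant family of graphs with Lipschitz constants at
most one the Y-part is controlled by the X-part and by Ψ(0). Solutions inside the family therefore
grow no faster than the weight, the family lies in `solGraph`, and of two graphs over X one cannot
properly contain the other (`eq_solGraph`). The values Ψ(0) are controlled by f(0) = 0 in Case I. In
Case II they are controlled by boundedness of f together with a weight γ ≥ 0, which dominates
constants.

For smoothness one compares two difference quotients of solutions with respect to the initial value.
Their difference solves a linear equation whose forcing is at most ε times its own size plus a
defect. The defect tends to zero by the mean value inequality and grows at most like e^{γt}; against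
a slightly larger weight this makes the whole difference tend to zero (`DefectStable`), and
`contDiff_one_of_quotients` turns the convergence into C¹.

All this is done for an abstract `LinearTheory`; the cases differ in how weights are produced. If
solutions satisfy the inequalities of the variation of constants formula (`IntegralBound`), every γ
between μs + ε and μu - ε is admissible and the graph has the sharp Lipschitz constant ε / (μu - μs
- ε). This is immediate for the integral equation, and for bi-semigroups it follows because mild and
integral solutions coincide (`GeneratesCorrespondence.mild_iff`). For MR operators the variation of
constants formula is replaced by an estimate over a short step h in terms of δ(h) (`LocalBound`). If
δ(h)/h → 1, the steps add up to the integral inequalities (`sub_le_integral_of_local`). In general a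
discrete Gronwall argument with a fixed step still gives a finite gain (`LocalBound.adm`), which is
why the nonlinearity must then be small. -/

/-- A weighted bound which improves itself affinely with factor `θ < 1` can be replaced by the
fixed point of the affine map. -/
theorem bound_of_self_improving {ι : Type*} {m w : ι → ℝ} {θ c N : ℝ} (hθ : 0 ≤ θ) (hθ' : θ < 1)
    (hc : 0 ≤ c) (hN : 0 ≤ N) (h0 : ∀ i, m i ≤ N * w i)
    (step : ∀ N', 0 ≤ N' → (∀ i, m i ≤ N' * w i) → ∀ i, m i ≤ (θ * N' + c) * w i) (i : ι) :
    m i ≤ c / (1 - θ) * w i := by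
  have h1 : 0 < 1 - θ := by linarith
  set q := c / (1 - θ) with hq
  have hqc : θ * q + c = q := by rw [hq]; field_simp; ring
  -- The k-th iterate of N ↦ θN + c in closed form; it tends to q whether N lies above or below q.
  have key : ∀ k : ℕ, 0 ≤ q + θ ^ k * (N - q) ∧ ∀ i, m i ≤ (q + θ ^ k * (N - q)) * w i := by
    intro k
    induction k with
    | zero => simpa using ⟨hN, h0⟩
    | succ k ih =>
      have e : q + θ ^ (k + 1) * (N - q) = θ * (q + θ ^ k * (N - q)) + c := by
        rw [pow_succ]; linear_combination -hqc
      rw [e]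
      exact ⟨by have := mul_nonneg hθ ih.1; linarith, step _ ih.1 ih.2⟩
  have hl : Tendsto (fun k : ℕ => (q + θ ^ k * (N - q)) * w i) atTop (𝓝 ((q + 0 * (N - q)) * w i)) :=
    ((((tendsto_pow_atTop_nhds_zero_of_lt_one hθ hθ').mul_const _).const_add _).mul_const _)
  simpa using ge_of_tendsto' hl fun k => (key k).2 i

/-- A Lipschitz map is `C¹` if the difference quotients at nearby points with small increments are
close, uniformly in directions of norm at most one. -/
theorem contDiff_one_of_quotients {X Y : Type*} [NormedAddCommGroup X] [NormedSpace ℝ X]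
    [NormedAddCommGroup Y] [NormedSpace ℝ Y] [CompleteSpace Y] {Ψ : X → Y} {K : ℝ}
    (hK : ∀ x x', ‖Ψ x - Ψ x'‖ ≤ K * ‖x - x'‖)
    (H : ∀ (x : X) (x₁ x₂ h : ℕ → X) (t s : ℕ → ℝ), Tendsto x₁ atTop (𝓝 x) →
      Tendsto x₂ atTop (𝓝 x) → (∀ n, ‖h n‖ ≤ 1) → Tendsto t atTop (𝓝 0) → Tendsto s atTop (𝓝 0) →
      (∀ n, t n ≠ 0) → (∀ n, s n ≠ 0) →
      Tendsto (fun n => (t n)⁻¹ • (Ψ (x₁ n + t n • h n) - Ψ (x₁ n)) -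
        (s n)⁻¹ • (Ψ (x₂ n + s n • h n) - Ψ (x₂ n))) atTop (𝓝 0)) :
    ContDiff ℝ 1 Ψ := by
  set Q : X → ℝ → X → Y := fun x t h => t⁻¹ • (Ψ (x + t • h) - Ψ x) with hQ
  -- Negating the uniform statement with radius 1/(n+1) yields exactly the sequences that `H` speaks
  -- about. Every limit below is read off from this Cauchy estimate.
  have U : ∀ x : X, ∀ η > 0, ∃ ρ > 0, ∀ x₁ x₂ h t s, dist x₁ x < ρ → dist x₂ x < ρ → ‖h‖ ≤ 1 →
      |t| < ρ → |s| < ρ → t ≠ 0 → s ≠ 0 → ‖Q x₁ t h - Q x₂ s h‖ < η := by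
    intro x η hη
    by_contra! hcon
    have hp : ∀ n : ℕ, (0 : ℝ) < 1 / (n + 1) := fun n => Nat.one_div_pos_of_nat
    choose x₁ x₂ h t s h1 h2 h3 h4 h5 h6 h7 h8 using fun n : ℕ => hcon (1 / (n + 1)) (hp n)
    have l0 := tendsto_one_div_add_atTop_nhds_zero_nat (𝕜 := ℝ)
    have := H x x₁ x₂ h t s
      (tendsto_iff_dist_tendsto_zero.2 (squeeze_zero (fun _ => dist_nonneg) (fun n => (h1 n).le) l0))
      (tendsto_iff_dist_tendsto_zero.2 (squeeze_zero (fun _ => dist_nonneg) (fun n => (h2 n).le) l0))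
      h3 (squeeze_zero_norm (fun n => (h4 n).le) l0) (squeeze_zero_norm (fun n => (h5 n).le) l0) h6 h7
    obtain ⟨n, hn⟩ := ((this.norm).eventually (gt_mem_nhds (by simpa using hη))).exists
    exact absurd hn (not_lt.2 (h8 n))
  have hne : (𝓝[≠] (0 : ℝ)).NeBot := inferInstance
  have hsm : ∀ ρ > 0, ∀ᶠ t : ℝ in 𝓝[≠] 0, |t| < ρ ∧ t ≠ 0 := by
    intro ρ hρ
    refine (eventually_nhdsWithin_iff.2 ?_)
    filter_upwards [Metric.ball_mem_nhds (0 : ℝ) hρ] with t ht ht0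
    exact ⟨by simpa using ht, ht0⟩
  have hex1 : ∀ x h, ‖h‖ ≤ 1 → ∃ y, Tendsto (fun t => Q x t h) (𝓝[≠] 0) (𝓝 y) := by
    intro x h hh
    refine cauchy_map_iff_exists_tendsto.1 (Metric.cauchy_iff.2 ⟨inferInstance, fun η hη => ?_⟩)
    obtain ⟨ρ, hρ, hU⟩ := U x η hη
    refine ⟨_, image_mem_map (hsm ρ hρ), ?_⟩
    rintro _ ⟨t, ht, rfl⟩ _ ⟨s, hs, rfl⟩
    rw [dist_eq_norm]
    exact hU x x h t s (by simpa) (by simpa) hh ht.1 hs.1 ht.2 hs.2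
  -- `U` only sees directions of norm at most one; the substitution t ↦ tc carries limits to all
  -- directions.
  have hscale : ∀ x h (c : ℝ), c ≠ 0 → ∀ y, Tendsto (fun t => Q x t h) (𝓝[≠] 0) (𝓝 y) →
      Tendsto (fun t => Q x t (c • h)) (𝓝[≠] 0) (𝓝 (c • y)) := by
    intro x h c hc y hy
    have h1 : Tendsto (fun t : ℝ => t * c) (𝓝[≠] 0) (𝓝[≠] 0) := by
      refine tendsto_nhdsWithin_iff.2 ⟨?_, ?_⟩
      · have : Tendsto (fun t : ℝ => t * c) (𝓝 0) (𝓝 (0 * c)) := tendsto_id.mul_const c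
        rw [zero_mul] at this
        exact this.mono_left nhdsWithin_le_nhds
      · filter_upwards [self_mem_nhdsWithin] with t ht
        exact mul_ne_zero ht hc
    refine ((hy.comp h1).const_smul c).congr' ?_
    filter_upwards [self_mem_nhdsWithin] with t ht
    have ht' : t ≠ 0 := ht
    simp only [Function.comp, hQ, smul_smul]
    congr 1
    field_simp
  have hex : ∀ x h, ∃ y, Tendsto (fun t => Q x t h) (𝓝[≠] 0) (𝓝 y) := by
    intro x h
    rcases eq_or_ne h 0 with rfl | hh
    · exact hex1 x 0 (by simp)
    · have hn : ‖h‖ ≠ 0 := norm_ne_zero_iff.2 hh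
      obtain ⟨y, hy⟩ := hex1 x (‖h‖⁻¹ • h) (by rw [norm_smul, norm_inv, norm_norm, inv_mul_cancel₀ hn])
      have := hscale x _ ‖h‖ hn y hy
      rw [smul_inv_smul₀ hn] at this
      exact ⟨_, this⟩
  choose D hD using hex
  have hDclose : ∀ x : X, ∀ η > 0, ∃ ρ > 0, ∀ x₁ x₂ h t, dist x₁ x < ρ → dist x₂ x < ρ → ‖h‖ ≤ 1 →
      |t| < ρ → t ≠ 0 → ‖Q x₁ t h - D x₂ h‖ ≤ η := by
    intro x η hη
    obtain ⟨ρ, hρ, hU⟩ := U x η hη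
    refine ⟨ρ, hρ, fun x₁ x₂ h t h1 h2 h3 h4 h5 => ?_⟩
    refine le_of_tendsto ((hD x₂ h).const_sub (Q x₁ t h)).norm ?_
    filter_upwards [hsm ρ hρ] with s hs
    exact (hU x₁ x₂ h t s h1 h2 h3 h4 hs.1 h5 hs.2).le
  have hDdiff : ∀ x : X, ∀ η > 0, ∃ ρ > 0, ∀ x₁ x₂ h, dist x₁ x < ρ → dist x₂ x < ρ → ‖h‖ ≤ 1 →
      ‖D x₁ h - D x₂ h‖ ≤ η := by
    intro x η hη
    obtain ⟨ρ, hρ, hU⟩ := hDclose x η hη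
    refine ⟨ρ, hρ, fun x₁ x₂ h h1 h2 h3 => ?_⟩
    refine le_of_tendsto ((hD x₁ h).sub_const (D x₂ h)).norm ?_
    filter_upwards [hsm ρ hρ] with s hs
    exact (hU x₁ x₂ h s h1 h2 h3 hs.1 hs.2)
  have hDsmul : ∀ x (c : ℝ) h, D x (c • h) = c • D x h := by
    intro x c h
    rcases eq_or_ne c 0 with rfl | hc
    · refine tendsto_nhds_unique (hD x _) ?_
      simp [hQ]
    · exact tendsto_nhds_unique (hD x _) (hscale x h c hc _ (hD x h))
  have hDbd : ∀ x h, ‖D x h‖ ≤ K * ‖h‖ := by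
    intro x h
    refine le_of_tendsto (hD x h).norm ?_
    filter_upwards [self_mem_nhdsWithin] with t ht
    have ht' : t ≠ 0 := ht
    have := hK (x + t • h) x
    rw [add_sub_cancel_left, norm_smul] at this
    simp only [hQ]
    rw [norm_smul, norm_inv, inv_mul_le_iff₀ (norm_pos_iff.2 ht')]
    linarith
  have hDadd1 : ∀ x h k, ‖h‖ ≤ 1 → ‖k‖ ≤ 1 → D x (h + k) = D x h + D x k := by
    intro x h k hh hk
    refine tendsto_nhds_unique (hD x _) ?_
    -- The increment along h + k is one along k from x followed by one along h from x + t k. The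
    -- moving base point of the second is the reason why quotients at different base points have to
    -- be compared.
    have hs : Tendsto (fun t : ℝ => Q (x + t • k) t h) (𝓝[≠] 0) (𝓝 (D x h)) := by
      rw [Metric.tendsto_nhds]
      intro η hη
      obtain ⟨ρ, hρ, hU⟩ := hDclose x (η / 2) (by linarith)
      filter_upwards [hsm ρ hρ] with t ht
      rw [dist_eq_norm]
      refine (hU (x + t • k) x h t ?_ (by simpa) hh ht.1 ht.2).trans_lt (by linarith)
      rw [dist_eq_norm, add_sub_cancel_left, norm_smul]
      calc ‖t‖ * ‖k‖ ≤ ‖t‖ * 1 := by gcongr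
        _ < ρ := by simpa using ht.1
    refine (hs.add (hD x k)).congr fun t => ?_
    simp only [hQ, ← smul_add]
    congr 1
    rw [show x + t • k + t • h = x + t • (h + k) by rw [smul_add]; abel]
    abel
  have hDadd : ∀ x h k, D x (h + k) = D x h + D x k := by
    intro x h k
    set c : ℝ := 1 + ‖h‖ + ‖k‖ with hc
    have hc0 : 0 < c := by positivity
    have e : ∀ v : X, v = c • (c⁻¹ • v) := fun v => (smul_inv_smul₀ hc0.ne' v).symm
    have b : ∀ v : X, ‖v‖ ≤ c → ‖c⁻¹ • v‖ ≤ 1 := fun v hv => by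
      rw [norm_smul, norm_inv, Real.norm_of_nonneg hc0.le, inv_mul_le_iff₀ hc0]; linarith
    rw [e (h + k), hDsmul, smul_add, hDadd1 x _ _ (b h (by linarith [norm_nonneg k]))
      (b k (by linarith [norm_nonneg h])), smul_add, ← hDsmul, ← hDsmul, ← e, ← e]
  set L : X → X →L[ℝ] Y := fun x =>
    LinearMap.mkContinuous ⟨⟨D x, hDadd x⟩, hDsmul x⟩ K (hDbd x) with hL
  have hLap : ∀ x h, L x h = D x h := fun x h => rfl
  have hfd : ∀ x, HasFDerivAt Ψ (L x) x := by
    intro x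
    rw [hasFDerivAt_iff_isLittleO_nhds_zero, Asymptotics.isLittleO_iff]
    intro η hη
    obtain ⟨ρ, hρ, hU⟩ := hDclose x η hη
    filter_upwards [Metric.ball_mem_nhds (0 : X) hρ] with h hh
    rcases eq_or_ne h 0 with rfl | h0
    · simp
    have hn : ‖h‖ ≠ 0 := norm_ne_zero_iff.2 h0
    -- The increment h is a step of length ‖h‖ in a unit direction, and closeness is uniform in the
    -- direction: this is Fréchet differentiability.
    have h1 := hU x x (‖h‖⁻¹ • h) ‖h‖ (by simpa) (by simpa)
      (by rw [norm_smul, norm_inv, norm_norm, inv_mul_cancel₀ hn]) (by simpa using hh) hn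
    simp only [hQ, smul_inv_smul₀ hn] at h1
    rw [hDsmul, ← smul_sub, norm_smul, norm_inv, norm_norm,
      inv_mul_le_iff₀ (norm_pos_iff.2 h0)] at h1
    rw [hLap]
    linarith
  rw [contDiff_one_iff_fderiv]
  refine ⟨fun x => (hfd x).differentiableAt, ?_⟩
  have : fderiv ℝ Ψ = L := funext fun x => (hfd x).fderiv
  rw [this, Metric.continuous_iff]
  intro x η hη
  obtain ⟨ρ, hρ, hU⟩ := hDdiff x (η / 2) (by linarith)
  refine ⟨ρ, hρ, fun x' hx' => ?_⟩
  rw [dist_eq_norm]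
  refine lt_of_le_of_lt (ContinuousLinearMap.opNorm_le_of_unit_norm (by linarith) fun h hh => ?_)
    (show η / 2 < η by linarith)
  exact hU x' x h hx' (by simpa) hh.le

/-- Fubini's theorem on a triangle. -/
theorem integral_triangle_swap {E : Type*} [NormedAddCommGroup E] [NormedSpace ℝ E]
    {G : ℝ → ℝ → E} (hG : Continuous (Function.uncurry G)) {a b : ℝ} (hab : a ≤ b) :
    ∫ t in a..b, ∫ s in a..t, G t s = ∫ s in a..b, ∫ t in s..b, G t s := by
  set F : ℝ → ℝ → E := fun t s => if s ≤ t then G t s else 0 with hF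
  have hmeas : MeasurableSet {p : ℝ × ℝ | p.2 ≤ p.1} := measurableSet_le measurable_snd measurable_fst
  have hFi : Function.uncurry F = {p : ℝ × ℝ | p.2 ≤ p.1}.indicator (Function.uncurry G) := by
    ext ⟨t, s⟩
    simp [hF, Set.indicator, Function.uncurry]
  have hint : IntegrableOn (Function.uncurry F) (uIoc a b ×ˢ uIoc a b) := by
    rw [hFi]
    refine IntegrableOn.indicator ?_ hmeas
    refine IntegrableOn.mono_set (t := Icc a b ×ˢ Icc a b) ?_ ?_
    · exact hG.continuousOn.integrableOn_compact (isCompact_Icc.prod isCompact_Icc)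
    · rw [uIoc_of_le hab]; exact prod_mono Ioc_subset_Icc_self Ioc_subset_Icc_self
  have hsw := intervalIntegral_intervalIntegral_swap (F := F) (a := a) (b := b) (c := a) (d := b) hint
  have e1 : ∀ t ∈ uIcc a b, ∫ s in a..b, F t s = ∫ s in a..t, G t s := by
    intro t ht
    rw [uIcc_of_le hab] at ht
    rw [intervalIntegral.integral_of_le hab, intervalIntegral.integral_of_le ht.1,
      show (fun s => F t s) = (Iic t).indicator (G t) by ext s; simp [hF, Set.indicator],
      setIntegral_indicator measurableSet_Iic]
    congr 2
    ext s
    simp only [mem_inter_iff, mem_Ioc, mem_Iic]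
    exact ⟨fun h => ⟨h.1.1, h.2⟩, fun h => ⟨⟨h.1, h.2.trans ht.2⟩, h.2⟩⟩
  have e2 : ∀ s ∈ uIcc a b, ∫ t in a..b, F t s = ∫ t in s..b, G t s := by
    intro s hs
    rw [uIcc_of_le hab] at hs
    -- Cutting `Ioc a b` by `Ici s` leaves a closed interval when a < s, so both integrals are first
    -- moved to closed intervals.
    rw [intervalIntegral.integral_of_le hab, intervalIntegral.integral_of_le hs.2,
      ← integral_Icc_eq_integral_Ioc, ← integral_Icc_eq_integral_Ioc,
      show (fun t => F t s) = (Ici s).indicator (fun t => G t s) by ext t; simp [hF, Set.indicator],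
      setIntegral_indicator measurableSet_Ici]
    congr 2
    ext t
    simp only [mem_inter_iff, mem_Icc, mem_Ici]
    exact ⟨fun h => ⟨h.2, h.1.2⟩, fun h => ⟨⟨hs.1.trans h.1, h.2⟩, h.1⟩⟩
  rw [← intervalIntegral.integral_congr e1, ← intervalIntegral.integral_congr e2]
  exact hsw

/-- The integral of a function with values in a closed subspace lies in the subspace. -/
theorem integral_mem_of_isClosed {E : Type*} [NormedAddCommGroup E] [NormedSpace ℝ E]
    [CompleteSpace E] {G : Submodule ℝ E} (hG : IsClosed (G : Set E)) {φ : ℝ → E} {a b : ℝ}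
    (hφ : IntervalIntegrable φ volume a b) (h : ∀ s ∈ uIcc a b, φ s ∈ G) :
    ∫ s in a..b, φ s ∈ G := by
  have : IsClosed (G : Set E) := hG
  -- The integrand dies in the quotient by G, a normed space since G is closed, and the quotient map
  -- commutes with the integral.
  have h1 := G.mkQL.intervalIntegral_comp_comm hφ
  have h2 : ∫ s in a..b, G.mkQL (φ s) = 0 := by
    rw [intervalIntegral.integral_congr (g := fun _ => (0 : E ⧸ G))]
    · simp
    · intro s hs
      exact (Submodule.Quotient.mk_eq_zero G).2 (h s hs)
  rw [h2] at h1
  exact (Submodule.Quotient.mk_eq_zero G).1 h1.symm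

/-- Hille's theorem for interval integrals: a closed operator can be moved out of the integral. -/
theorem integral_mem_graph {Z : Type*} [NormedAddCommGroup Z] [NormedSpace ℝ Z] [CompleteSpace Z]
    {A : Z →ₗ.[ℝ] Z} (hA : IsClosed (A.graph : Set (Z × Z))) {φ ψ : ℝ → Z} {a b : ℝ}
    (hφ : IntervalIntegrable φ volume a b) (hψ : IntervalIntegrable ψ volume a b)
    (h : ∀ s ∈ uIcc a b, (φ s, ψ s) ∈ A.graph) :
    (∫ s in a..b, φ s, ∫ s in a..b, ψ s) ∈ A.graph := by
  have hp : IntervalIntegrable (fun s => (φ s, ψ s)) volume a b :=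
    ⟨hφ.1.prodMk hψ.1, hφ.2.prodMk hψ.2⟩
  have h1 := integral_mem_of_isClosed hA hp h
  have h2 := (ContinuousLinearMap.fst ℝ Z Z).intervalIntegral_comp_comm hp
  have h3 := (ContinuousLinearMap.snd ℝ Z Z).intervalIntegral_comp_comm hp
  convert h1 using 1
  exact Prod.ext h2 h3

end InvGraph

namespace InvGraph

/-! ### Orbits and the max norm -/

section Basic

variable {M : Type u} [TopologicalSpace M] {E : Type v} [NormedAddCommGroup E] [NormedSpace ℝ E]

theorem orb_zero (φ : Flow ℝ≥0 M) (ω : M) : orb φ ω 0 = ω := by simp [orb]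

theorem orb_coe (φ : Flow ℝ≥0 M) (ω : M) (t : ℝ≥0) : orb φ ω t = φ t ω := by simp [orb]

theorem orb_orb (φ : Flow ℝ≥0 M) (ω : M) {s t : ℝ} (hs : 0 ≤ s) (ht : 0 ≤ t) :
    orb φ (orb φ ω s) t = orb φ ω (s + t) := by
  rw [orb, orb, orb, ← φ.map_add, Real.toNNReal_add hs ht, add_comm]

theorem continuous_orb (φ : Flow ℝ≥0 M) (ω : M) : Continuous (orb φ ω) :=
  φ.continuous continuous_real_toNNReal continuous_const

variable (P : M → E →L[ℝ] E)

theorem norm_apply_le_maxNorm (ω : M) (z : E) : ‖P ω z‖ ≤ maxNorm P ω z := le_max_left _ _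

theorem norm_sub_apply_le_maxNorm (ω : M) (z : E) : ‖z - P ω z‖ ≤ maxNorm P ω z := le_max_right _ _

theorem maxNorm_nonneg (ω : M) (z : E) : 0 ≤ maxNorm P ω z :=
  (norm_nonneg _).trans (norm_apply_le_maxNorm P ω z)

/-- The 2 lost in recombining the two components is the 2 in ε' = 2C₁ε. -/
theorem norm_le_two_mul_maxNorm (ω : M) (z : E) : ‖z‖ ≤ 2 * maxNorm P ω z := by
  have : ‖z‖ ≤ ‖P ω z‖ + ‖z - P ω z‖ := by simpa using norm_add_le (P ω z) (z - P ω z)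
  linarith [norm_apply_le_maxNorm P ω z, norm_sub_apply_le_maxNorm P ω z]

theorem maxNorm_add_le (ω : M) (z w : E) : maxNorm P ω (z + w) ≤ maxNorm P ω z + maxNorm P ω w := by
  refine max_le ?_ ?_
  · rw [map_add]
    exact (norm_add_le _ _).trans
      (add_le_add (norm_apply_le_maxNorm P ω z) (norm_apply_le_maxNorm P ω w))
  · rw [map_add, add_sub_add_comm]
    exact (norm_add_le _ _).trans
      (add_le_add (norm_sub_apply_le_maxNorm P ω z) (norm_sub_apply_le_maxNorm P ω w))

theorem maxNorm_smul (ω : M) (c : ℝ) (z : E) : maxNorm P ω (c • z) = |c| * maxNorm P ω z := by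
  simp only [maxNorm, map_smul, ← smul_sub, norm_smul, Real.norm_eq_abs]
  rw [mul_max_of_nonneg _ _ (abs_nonneg c)]

theorem maxNorm_neg (ω : M) (z : E) : maxNorm P ω (-z) = maxNorm P ω z := by
  have := maxNorm_smul P ω (-1) z
  simpa using this

theorem maxNorm_sub_le (ω : M) (z w : E) : maxNorm P ω (z - w) ≤ maxNorm P ω z + maxNorm P ω w := by
  rw [sub_eq_add_neg]
  exact (maxNorm_add_le P ω z (-w)).trans_eq (by rw [maxNorm_neg])

theorem maxNorm_zero (ω : M) : maxNorm P ω 0 = 0 := by simp [maxNorm]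

variable {P}

theorem continuous_maxNorm (hP : Continuous fun p : M × E => P p.1 p.2) :
    Continuous fun p : M × E => maxNorm P p.1 p.2 :=
  hP.norm.max (continuous_snd.sub hP).norm

theorem continuous_maxNorm_right (ω : M) : Continuous fun z : E => maxNorm P ω z :=
  (P ω).continuous.norm.max (continuous_id.sub (P ω).continuous).norm

theorem proj_specX (hP : ∀ ω z, P ω (P ω z) = P ω z) {ω : M} (x : specX P ω) : P ω (x : E) = x := by
  obtain ⟨x, ⟨y, rfl⟩⟩ := x
  exact hP ω y

theorem proj_specY (hP : ∀ ω z, P ω (P ω z) = P ω z) {ω : M} (y : specY P ω) : P ω (y : E) = 0 := by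
  obtain ⟨y, ⟨z, rfl⟩⟩ := y
  simp [hP]

theorem mem_specY (ω : M) {z : E} (h : P ω z = 0) : z ∈ specY P ω := ⟨z, by simp [h]⟩

/-- `Y_ω` is the kernel of a bounded operator, hence closed. Completeness of this target is needed
for difference quotients of Ψ to converge. -/
theorem completeSpace_specY [CompleteSpace E] (hP : ∀ ω z, P ω (P ω z) = P ω z) (ω : M) :
    CompleteSpace (specY P ω) := by
  have : (specY P ω : Set E) = (P ω) ⁻¹' {0} := by
    ext z
    exact ⟨fun h => proj_specY hP ⟨z, h⟩, fun h => mem_specY ω h⟩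
  have hc : IsClosed (specY P ω : Set E) := by
    rw [this]; exact isClosed_singleton.preimage (P ω).continuous
  exact hc.completeSpace_coe

theorem continuousOn_Ici_of_Icc {X : Type*} [TopologicalSpace X] {z : ℝ → X}
    (h : ∀ r : ℝ, 0 ≤ r → ContinuousOn z (Icc 0 r)) : ContinuousOn z (Ici 0) := by
  intro t ht
  have ht' : (0 : ℝ) ≤ t := ht
  refine ((h (t + 1) (by linarith)) t ⟨ht, by linarith⟩).mono_of_mem_nhdsWithin ?_
  filter_upwards [self_mem_nhdsWithin, mem_nhdsWithin_of_mem_nhds (Iio_mem_nhds (lt_add_one t))]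
    with s hs hs'
  exact ⟨hs, le_of_lt hs'⟩

/-- A contribution `e^{-μ(r-t)} b(r)` of the far end disappears if `b` grows slower than `e^{μ t}`. -/
theorem le_of_forall_far_end {γ μ N B X t : ℝ} (h : γ < μ) {b : ℝ → ℝ}
    (hb : ∀ r, t ≤ r → b r ≤ N * Real.exp (γ * r))
    (hB : ∀ r, t ≤ r → B ≤ Real.exp (-μ * (r - t)) * b r + X) : B ≤ X := by
  have hl : Tendsto (fun r : ℝ => N * Real.exp (μ * t) * Real.exp (-((μ - γ) * r)) + X) atTop
      (𝓝 (N * Real.exp (μ * t) * 0 + X)) := by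
    refine ((Real.tendsto_exp_neg_atTop_nhds_zero.comp ?_).const_mul _).add_const _
    exact tendsto_id.const_mul_atTop (sub_pos.2 h)
  rw [mul_zero, zero_add] at hl
  refine ge_of_tendsto hl ?_
  filter_upwards [eventually_ge_atTop t] with r hr
  refine (hB r hr).trans (add_le_add_left ?_ _)
  refine (mul_le_mul_of_nonneg_left (hb r hr) (Real.exp_pos _).le).trans_eq ?_
  rw [mul_left_comm, ← Real.exp_add, mul_assoc, ← Real.exp_add]
  congr 2; ring

end Basic

/-! ### Abstract Lyapunov–Perron theory -/

section Abstract

variable {M : Type u} [TopologicalSpace M] {E F : Type v} [NormedAddCommGroup E] [NormedSpace ℝ E]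
  [NormedAddCommGroup F] [NormedSpace ℝ F]

/-- What is used of a linear inhomogeneous evolution equation: `LS ω r z g` means that `z` solves on
`[0, r]` the equation over `ω` with forcing `g`, and `σ ω` is the size of the forcing. -/
structure LinearTheory (φ : Flow ℝ≥0 M) (P : M → E →L[ℝ] E)
    (LS : M → ℝ → (ℝ → E) → (ℝ → F) → Prop) (σ : M → F → ℝ) : Prop where
  proj : ∀ ω z, P ω (P ω z) = P ω z
  proj_cont : Continuous fun p : M × E => P p.1 p.2
  contOn : ∀ {ω r z g}, LS ω r z g → ContinuousOn z (Icc 0 r)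
  congr : ∀ {ω r z z' g g'}, 0 ≤ r → (∀ t ∈ Icc 0 r, z t = z' t) → (∀ t ∈ Icc 0 r, g t = g' t) →
    LS ω r z g → LS ω r z' g'
  sub : ∀ {ω r z z' g g'}, 0 ≤ r → ContinuousOn g (Icc 0 r) → ContinuousOn g' (Icc 0 r) →
    LS ω r z g → LS ω r z' g' → LS ω r (fun t => z t - z' t) (fun t => g t - g' t)
  smul : ∀ {ω r z g} (c : ℝ), 0 ≤ r → LS ω r z g → LS ω r (fun t => c • z t) (fun t => c • g t)
  mono : ∀ {ω r r' z g}, 0 ≤ r' → r' ≤ r → ContinuousOn g (Icc 0 r) → LS ω r z g → LS ω r' z g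
  shift : ∀ {ω s r z g}, 0 ≤ s → 0 ≤ r → ContinuousOn g (Icc 0 (s + r)) → LS ω (s + r) z g →
    LS (orb φ ω s) r (fun t => z (s + t)) (fun t => g (s + t))
  limit : ∀ {ω r g} {zn : ℕ → ℝ → E} {z : ℝ → E}, 0 ≤ r → ContinuousOn g (Icc 0 r) →
    (∀ᶠ n in atTop, LS ω r (zn n) g) →
    TendstoUniformlyOn zn z atTop (Icc 0 r) → LS ω r z g
  solve : ∀ {ω r g}, 0 ≤ r → ContinuousOn g (Icc 0 r) → ∀ x : E, ∃ z, LS ω r z g ∧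
    P ω (z 0) = P ω x ∧ P (orb φ ω r) (z r) = z r
  size_add : ∀ ω u v, σ ω (u + v) ≤ σ ω u + σ ω v
  size_smul : ∀ ω (c : ℝ) u, σ ω (c • u) = |c| * σ ω u
  size_le : ∃ C, 0 ≤ C ∧ ∀ ω u, σ ω u ≤ C * ‖u‖
  size_cont : Continuous fun p : M × F => σ p.1 p.2

/-- Solutions on `[0, ∞)` of the equation with nonlinearity `f`. -/
def NonlinearSol (φ : Flow ℝ≥0 M) (LS : M → ℝ → (ℝ → E) → (ℝ → F) → Prop) (f : M → E → F) (ω : M)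
    (w : ℝ → E) : Prop :=
  ∀ r : ℝ, 0 ≤ r → LS ω r w (fun t => f (orb φ ω t) (w t))

/-- The exponential weight `e^{γ t}` is admissible for the equation over `ω`: `κ` bounds the gain of
the linear equation in this weight and `ε` the Lipschitz constant of `f` along the orbit. -/
structure Adm (φ : Flow ℝ≥0 M) (P : M → E →L[ℝ] E) (LS : M → ℝ → (ℝ → E) → (ℝ → F) → Prop)
    (σ : M → F → ℝ) (f : M → E → F) (ω : M) (γ μ κ ε : ℝ) : Prop where
  lt : γ < μ
  gain_nonneg : 0 ≤ κ
  lip_nonneg : 0 ≤ ε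
  contr : κ * ε < 1
  lip : ∀ t, 0 ≤ t → ∀ z z', σ (orb φ ω t) (f (orb φ ω t) z - f (orb φ ω t) z') ≤
    ε * maxNorm P (orb φ ω t) (z - z')
  gain : ∀ s, 0 ≤ s → ∀ (r : ℝ) z g C, 0 ≤ r → 0 ≤ C → LS (orb φ ω s) r z g →
    ContinuousOn g (Icc 0 r) →
    (∀ t ∈ Icc 0 r, σ (orb φ ω (s + t)) (g t) ≤ C * Real.exp (γ * t)) → ∀ t ∈ Icc 0 r,
    ‖P (orb φ ω (s + t)) (z t)‖ ≤ (‖P (orb φ ω s) (z 0)‖ + κ * C) * Real.exp (γ * t) ∧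
    ‖z t - P (orb φ ω (s + t)) (z t)‖ ≤
      Real.exp (-μ * (r - t)) * ‖z r - P (orb φ ω (s + r)) (z r)‖ + κ * C * Real.exp (γ * t)

/-- Solutions of the nonlinear equation with admissible growth. -/
def GoodSol (φ : Flow ℝ≥0 M) (P : M → E →L[ℝ] E) (LS : M → ℝ → (ℝ → E) → (ℝ → F) → Prop)
    (σ : M → F → ℝ) (f : M → E → F) (ω : M) (z : ℝ → E) : Prop :=
  NonlinearSol φ LS f ω z ∧ ∃ γ μ κ ε N, Adm φ P LS σ f ω γ μ κ ε ∧
    ∀ t, 0 ≤ t → maxNorm P (orb φ ω t) (z t) ≤ N * Real.exp (γ * t)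

variable {φ : Flow ℝ≥0 M} {P : M → E →L[ℝ] E} {LS : M → ℝ → (ℝ → E) → (ℝ → F) → Prop}
  {σ : M → F → ℝ} {f : M → E → F} {ω : M} {γ μ κ ε : ℝ}

theorem LinearTheory.size_zero (H : LinearTheory φ P LS σ) (ω : M) : σ ω 0 = 0 := by
  simpa using H.size_smul ω 0 0

theorem LinearTheory.size_sub (H : LinearTheory φ P LS σ) (ω : M) (u v : F) :
    σ ω (u - v) ≤ σ ω u + σ ω v := by
  have h1 := H.size_add ω u ((-1 : ℝ) • v)
  rw [H.size_smul] at h1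
  simpa [sub_eq_add_neg] using h1

theorem LinearTheory.continuousOn_maxNorm (H : LinearTheory φ P LS σ) {z : ℝ → E} {s : Set ℝ}
    (hz : ContinuousOn z s) (ω : M) : ContinuousOn (fun t => maxNorm P (orb φ ω t) (z t)) s :=
  (continuous_maxNorm H.proj_cont).comp_continuousOn ((continuous_orb φ ω).continuousOn.prodMk hz)

theorem LinearTheory.continuousOn_size (H : LinearTheory φ P LS σ) {g : ℝ → F} {s : Set ℝ}
    (hg : ContinuousOn g s) (ω : M) : ContinuousOn (fun t => σ (orb φ ω t) (g t)) s :=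
  H.size_cont.comp_continuousOn ((continuous_orb φ ω).continuousOn.prodMk hg)

theorem LinearTheory.contOn_Ici (H : LinearTheory φ P LS σ) {z : ℝ → E} {g : ℝ → F}
    (h : ∀ r : ℝ, 0 ≤ r → LS ω r z g) : ContinuousOn z (Ici 0) :=
  continuousOn_Ici_of_Icc fun r hr => H.contOn (h r hr)

theorem continuousOn_nonlinearity (φ : Flow ℝ≥0 M) (ω : M)
    (hf : Continuous fun p : M × E => f p.1 p.2) {z : ℝ → E} {s : Set ℝ}
    (hz : ContinuousOn z s) : ContinuousOn (fun t => f (orb φ ω t) (z t)) s :=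
  hf.comp_continuousOn ((continuous_orb φ ω).continuousOn.prodMk hz)

/-- The Lipschitz and gain conditions are imposed at all points of the forward orbit, so the
constants found at ω serve the whole orbit. -/
theorem Adm.shift (h : Adm φ P LS σ f ω γ μ κ ε) {s : ℝ} (hs : 0 ≤ s) :
    Adm φ P LS σ f (orb φ ω s) γ μ κ ε where
  lt := h.lt
  gain_nonneg := h.gain_nonneg
  lip_nonneg := h.lip_nonneg
  contr := h.contr
  lip t ht z z' := by
    rw [orb_orb φ ω hs ht]; exact h.lip _ (add_nonneg hs ht) z z'
  gain s' hs' r z g C hr hC h1 h2 h3 t ht := by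
    have e : ∀ t, 0 ≤ t → orb φ (orb φ ω s) (s' + t) = orb φ ω ((s + s') + t) := fun t ht => by
      rw [orb_orb φ ω hs (add_nonneg hs' ht), add_assoc]
    rw [e t ht.1, e r hr, orb_orb φ ω hs hs']
    refine h.gain (s + s') (add_nonneg hs hs') r z g C hr hC ?_ h2 ?_ t ht
    · rwa [orb_orb φ ω hs hs'] at h1
    · intro t ht
      rw [← e t ht.1]; exact h3 t ht

/-- The gain estimate on the half line, for solutions of admissible growth. -/
theorem Adm.gain_Ici (h : Adm φ P LS σ f ω γ μ κ ε) {z : ℝ → E} {g : ℝ → F} {C N : ℝ}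
    (hC : 0 ≤ C) (hz : ∀ r : ℝ, 0 ≤ r → LS ω r z g) (hg : ContinuousOn g (Ici 0))
    (hgC : ∀ t, 0 ≤ t → σ (orb φ ω t) (g t) ≤ C * Real.exp (γ * t))
    (hN : ∀ t, 0 ≤ t → maxNorm P (orb φ ω t) (z t) ≤ N * Real.exp (γ * t)) {t : ℝ} (ht : 0 ≤ t) :
    maxNorm P (orb φ ω t) (z t) ≤ (‖P ω (z 0)‖ + κ * C) * Real.exp (γ * t) ∧
    ‖z t - P (orb φ ω t) (z t)‖ ≤ κ * C * Real.exp (γ * t) := by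
  have key : ∀ r, t ≤ r → _ := fun r hr => h.gain 0 le_rfl r z g C (ht.trans hr) hC
    (by rw [orb_zero]; exact hz r (ht.trans hr)) (hg.mono Icc_subset_Ici_self)
    (fun t ht => by rw [zero_add]; exact hgC t ht.1) t ⟨ht, hr⟩
  simp only [zero_add, orb_zero] at key
  have hY : ‖z t - P (orb φ ω t) (z t)‖ ≤ κ * C * Real.exp (γ * t) :=
    le_of_forall_far_end h.lt (b := fun r => ‖z r - P (orb φ ω r) (z r)‖)
      (fun r hr => (norm_sub_apply_le_maxNorm P _ _).trans (hN r (ht.trans hr)))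
      (fun r hr => (key r hr).2)
  refine ⟨max_le (key t le_rfl).1 (hY.trans ?_), hY⟩
  gcongr
  linarith [norm_nonneg (P ω (z 0))]

/-- Solutions of the linear equation on the half line. -/
theorem Adm.exists_linear [CompleteSpace E] (H : LinearTheory φ P LS σ)
    (h : Adm φ P LS σ f ω γ μ κ ε) {g : ℝ → F}
    {C : ℝ} (hC : 0 ≤ C) (hg : ContinuousOn g (Ici 0))
    (hgC : ∀ t, 0 ≤ t → σ (orb φ ω t) (g t) ≤ C * Real.exp (γ * t)) (x : E) :
    ∃ z : ℝ → E, (∀ r : ℝ, 0 ≤ r → LS ω r z g) ∧ P ω (z 0) = P ω x ∧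
      ∀ t, 0 ≤ t → maxNorm P (orb φ ω t) (z t) ≤ (‖P ω x‖ + κ * C) * Real.exp (γ * t) := by
  have hgr : ∀ r, ContinuousOn g (Icc 0 r) := fun r => hg.mono Icc_subset_Ici_self
  -- Boundary value problems on [0, n] with zero Y-part at the far end; in the limit the far end
  -- disappears.
  choose zn h1 h2 h3 using fun n : ℕ => H.solve (ω := ω) n.cast_nonneg (hgr n) x
  have hκC : 0 ≤ κ * C := mul_nonneg h.gain_nonneg hC
  have hb : ∀ n : ℕ, ∀ t ∈ Icc (0 : ℝ) n, ‖P (orb φ ω t) (zn n t)‖ ≤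
      (‖P ω x‖ + κ * C) * Real.exp (γ * t) ∧
      ‖zn n t - P (orb φ ω t) (zn n t)‖ ≤ κ * C * Real.exp (γ * t) := by
    intro n t ht
    have := h.gain 0 le_rfl n (zn n) g C n.cast_nonneg hC (by rw [orb_zero]; exact h1 n) (hgr n)
      (fun t ht => by rw [zero_add]; exact hgC t ht.1) t ht
    simpa only [zero_add, orb_zero, h2, h3, sub_self, norm_zero, mul_zero] using this
  have hbm : ∀ n : ℕ, ∀ t ∈ Icc (0 : ℝ) n, maxNorm P (orb φ ω t) (zn n t) ≤
      (‖P ω x‖ + κ * C) * Real.exp (γ * t) := by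
    intro n t ht
    refine max_le (hb n t ht).1 ((hb n t ht).2.trans ?_)
    gcongr
    linarith [norm_nonneg (P ω x)]
  -- For n ≤ k the difference of two approximations solves the unforced equation on [0, n] with zero
  -- X-part at 0, so only its Y-part at n drives it. That part is at most κ C e^{γn} and is damped
  -- by e^{-μ(n - t)}; the product is D n e^{μt}.
  set D : ℕ → ℝ := fun n => κ * C * Real.exp (-((μ - γ) * n)) with hD
  have hD0 : Tendsto D atTop (𝓝 0) := by
    have : Tendsto (fun n : ℕ => (μ - γ) * (n : ℝ)) atTop atTop :=
      tendsto_natCast_atTop_atTop.const_mul_atTop (sub_pos.2 h.lt)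
    simpa [hD] using (Real.tendsto_exp_neg_atTop_nhds_zero.comp this).const_mul (κ * C)
  have hdiff : ∀ n k : ℕ, n ≤ k → ∀ t ∈ Icc (0 : ℝ) n,
      ‖zn k t - zn n t‖ ≤ D n * Real.exp (μ * t) := by
    intro n k hnk t ht
    have hnk' : (n : ℝ) ≤ k := Nat.cast_le.2 hnk
    have hL := H.sub n.cast_nonneg (hgr n) (hgr n) (H.mono n.cast_nonneg hnk' (hgr k) (h1 k)) (h1 n)
    have := h.gain 0 le_rfl n _ _ 0 n.cast_nonneg le_rfl (by rw [orb_zero]; exact hL)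
      ((hgr n).sub (hgr n)) (fun t ht => by simp [H.size_zero]) t ht
    simp only [zero_add, orb_zero, mul_zero, add_zero, map_sub, h2, h3, sub_self, norm_zero,
      zero_mul] at this
    have e1 : P (orb φ ω t) (zn k t) - P (orb φ ω t) (zn n t) = 0 := norm_le_zero_iff.1 this.1
    have e2 := this.2
    rw [e1, sub_zero, sub_sub_sub_comm, sub_self, sub_zero] at e2
    refine e2.trans ((mul_le_mul_of_nonneg_left (hb k n ⟨n.cast_nonneg, hnk'⟩).2
      (Real.exp_pos _).le).trans_eq ?_)
    simp only [hD]
    rw [mul_left_comm, ← Real.exp_add, mul_assoc (κ * C), ← Real.exp_add]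
    congr 2; ring
  have hcau : ∀ t, 0 ≤ t → ∃ y, Tendsto (fun n => zn n t) atTop (𝓝 y) := by
    intro t ht
    refine cauchySeq_tendsto_of_complete (Metric.cauchySeq_iff'.2 fun η hη => ?_)
    have : Tendsto (fun n => D n * Real.exp (μ * t)) atTop (𝓝 0) := by
      simpa using hD0.mul_const (Real.exp (μ * t))
    obtain ⟨n, hn, hn'⟩ := ((this.eventually (gt_mem_nhds hη)).and
      (eventually_ge_atTop ⌈t⌉₊)).exists
    refine ⟨n, fun k hk => ?_⟩
    rw [dist_eq_norm]
    exact (hdiff n k hk t ⟨ht, (Nat.le_ceil t).trans (Nat.cast_le.2 hn')⟩).trans_lt hn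
  choose! z hz using hcau
  have hzdiff : ∀ n : ℕ, ∀ t ∈ Icc (0 : ℝ) n, ‖z t - zn n t‖ ≤ D n * Real.exp (μ * t) := by
    intro n t ht
    refine le_of_tendsto ((hz t ht.1).sub_const _).norm ?_
    filter_upwards [eventually_ge_atTop n] with k hk
    exact hdiff n k hk t ht
  refine ⟨z, fun r hr => ?_, ?_, fun t ht => ?_⟩
  · refine H.limit hr (zn := zn) (hgr r) ?_ ?_
    · filter_upwards [eventually_ge_atTop ⌈r⌉₊] with n hn
      exact H.mono hr ((Nat.le_ceil r).trans (Nat.cast_le.2 hn)) (hgr n) (h1 n)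
    · rw [Metric.tendstoUniformlyOn_iff]
      intro η hη
      have : Tendsto (fun n => D n * Real.exp (|μ| * r)) atTop (𝓝 0) := by
        simpa using hD0.mul_const (Real.exp (|μ| * r))
      filter_upwards [this.eventually (gt_mem_nhds hη), eventually_ge_atTop ⌈r⌉₊] with n hn hn' t ht
      rw [dist_eq_norm]
      refine (hzdiff n t ⟨ht.1, ht.2.trans ((Nat.le_ceil r).trans (Nat.cast_le.2 hn'))⟩).trans_lt
        (lt_of_le_of_lt ?_ hn)
      gcongr
      · exact ht.1
      · exact le_abs_self μ
      · exact ht.2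
  · refine tendsto_nhds_unique (((P ω).continuous.tendsto _).comp (hz 0 le_rfl)) ?_
    simp only [Function.comp_def, h2]
    exact tendsto_const_nhds
  · refine le_of_tendsto (((continuous_maxNorm_right (P := P) (orb φ ω t)).tendsto _).comp (hz t ht)) ?_
    filter_upwards [eventually_ge_atTop ⌈t⌉₊] with n hn
    exact hbm n t ⟨ht, (Nat.le_ceil t).trans (Nat.cast_le.2 hn)⟩

/-- Lipschitz estimate of the nonlinearity along two curves whose distance has a weighted bound. -/
theorem Adm.size_sub_le (h : Adm φ P LS σ f ω γ μ κ ε) {z z' : ℝ → E} {N t : ℝ} (ht : 0 ≤ t)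
    (hN : maxNorm P (orb φ ω t) (z t - z' t) ≤ N * Real.exp (γ * t)) :
    σ (orb φ ω t) (f (orb φ ω t) (z t) - f (orb φ ω t) (z' t)) ≤ ε * N * Real.exp (γ * t) := by
  refine (h.lip t ht _ _).trans ?_
  rw [mul_assoc]
  exact mul_le_mul_of_nonneg_left hN h.lip_nonneg

theorem Adm.size_le (H : LinearTheory φ P LS σ) (h : Adm φ P LS σ f ω γ μ κ ε) {z : ℝ → E}
    {N C t : ℝ} (ht : 0 ≤ t)
    (hN : maxNorm P (orb φ ω t) (z t) ≤ N * Real.exp (γ * t))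
    (hC : σ (orb φ ω t) (f (orb φ ω t) 0) ≤ C * Real.exp (γ * t)) :
    σ (orb φ ω t) (f (orb φ ω t) (z t)) ≤ (ε * N + C) * Real.exp (γ * t) := by
  have h1 := h.size_sub_le (z := z) (z' := 0) ht (by simpa using hN)
  have h2 := H.size_add (orb φ ω t) (f (orb φ ω t) (z t) - f (orb φ ω t) 0) (f (orb φ ω t) 0)
  rw [sub_add_cancel] at h2
  simp only [Pi.zero_apply] at h1
  linarith

/-- The difference solves the linear equation with forcing at most ε times its own size. A weighted
bound N therefore improves to κεN plus the initial X-part, and the fixed point of this map is the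
claimed constant. -/
theorem Adm.diff_le (H : LinearTheory φ P LS σ) (hf : Continuous fun p : M × E => f p.1 p.2)
    (h : Adm φ P LS σ f ω γ μ κ ε) {z z' : ℝ → E} {N : ℝ}
    (hz : NonlinearSol φ LS f ω z) (hz' : NonlinearSol φ LS f ω z')
    (hN : ∀ t, 0 ≤ t → maxNorm P (orb φ ω t) (z t - z' t) ≤ N * Real.exp (γ * t)) {t : ℝ}
    (ht : 0 ≤ t) :
    maxNorm P (orb φ ω t) (z t - z' t) ≤
      ‖P ω (z 0 - z' 0)‖ / (1 - κ * ε) * Real.exp (γ * t) := by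
  have hN0 : 0 ≤ N := by
    have := (maxNorm_nonneg P _ _).trans (hN 0 le_rfl)
    simpa using this
  have hc : ContinuousOn (fun t => f (orb φ ω t) (z t)) (Ici 0) :=
    continuousOn_nonlinearity φ ω hf (H.contOn_Ici hz)
  have hc' : ContinuousOn (fun t => f (orb φ ω t) (z' t)) (Ici 0) :=
    continuousOn_nonlinearity φ ω hf (H.contOn_Ici hz')
  refine bound_of_self_improving (ι := Ici (0 : ℝ))
    (m := fun t => maxNorm P (orb φ ω t) (z t - z' t))
    (w := fun t => Real.exp (γ * t)) (mul_nonneg h.gain_nonneg h.lip_nonneg) h.contr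
    (norm_nonneg _) hN0 (fun t => hN t t.2) (fun N' hN' hb t => ?_) ⟨t, ht⟩
  have := (h.gain_Ici (z := fun t => z t - z' t) (mul_nonneg h.lip_nonneg hN')
    (fun r hr => H.sub hr (hc.mono Icc_subset_Ici_self) (hc'.mono Icc_subset_Ici_self)
      (hz r hr) (hz' r hr)) (hc.sub hc')
    (fun t ht => h.size_sub_le ht (hb ⟨t, ht⟩)) hN t.2).1
  refine this.trans_eq ?_
  ring

/-- The same improvement for a single solution, where f(0) contributes C to the forcing. -/
theorem Adm.growth_le (H : LinearTheory φ P LS σ) (hf : Continuous fun p : M × E => f p.1 p.2)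
    (h : Adm φ P LS σ f ω γ μ κ ε) {z : ℝ → E} {N C : ℝ} (hC0 : 0 ≤ C)
    (hz : NonlinearSol φ LS f ω z)
    (hC : ∀ t, 0 ≤ t → σ (orb φ ω t) (f (orb φ ω t) 0) ≤ C * Real.exp (γ * t))
    (hN : ∀ t, 0 ≤ t → maxNorm P (orb φ ω t) (z t) ≤ N * Real.exp (γ * t)) {t : ℝ}
    (ht : 0 ≤ t) :
    maxNorm P (orb φ ω t) (z t) ≤
      (‖P ω (z 0)‖ + κ * C) / (1 - κ * ε) * Real.exp (γ * t) := by
  have hN0 : 0 ≤ N := by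
    have := (maxNorm_nonneg P _ _).trans (hN 0 le_rfl)
    simpa using this
  have hc : ContinuousOn (fun t => f (orb φ ω t) (z t)) (Ici 0) :=
    continuousOn_nonlinearity φ ω hf (H.contOn_Ici hz)
  refine bound_of_self_improving (ι := Ici (0 : ℝ))
    (m := fun t => maxNorm P (orb φ ω t) (z t))
    (w := fun t => Real.exp (γ * t)) (mul_nonneg h.gain_nonneg h.lip_nonneg) h.contr
    (add_nonneg (norm_nonneg _) (mul_nonneg h.gain_nonneg hC0)) hN0 (fun t => hN t t.2)
    (fun N' hN' hb t => ?_) ⟨t, ht⟩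
  have := (h.gain_Ici (add_nonneg (mul_nonneg h.lip_nonneg hN') hC0) hz hc
    (fun t ht => h.size_le H ht (hb ⟨t, ht⟩) (hC t ht)) hN t.2).1
  refine this.trans_eq ?_
  ring

/-- Picard iteration: solutions of the nonlinear equation of admissible growth exist for every
component in `X_ω` of the initial value. -/
theorem Adm.exists_nonlinear [CompleteSpace E] (H : LinearTheory φ P LS σ)
    (hf : Continuous fun p : M × E => f p.1 p.2)
    (h : Adm φ P LS σ f ω γ μ κ ε) {C : ℝ} (hC0 : 0 ≤ C)
    (hC : ∀ t, 0 ≤ t → σ (orb φ ω t) (f (orb φ ω t) 0) ≤ C * Real.exp (γ * t)) (x : E) :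
    ∃ z : ℝ → E, NonlinearSol φ LS f ω z ∧ P ω (z 0) = P ω x ∧
      ∃ N, ∀ t, 0 ≤ t → maxNorm P (orb φ ω t) (z t) ≤ N * Real.exp (γ * t) := by
  set 𝒞 : Set (ℝ → E) := {z | ContinuousOn z (Ici 0) ∧ ∃ N, 0 ≤ N ∧
    ∀ t, 0 ≤ t → maxNorm P (orb φ ω t) (z t) ≤ N * Real.exp (γ * t)} with h𝒞
  have hstep : ∀ z : 𝒞, ∃ z' : 𝒞, (∀ r : ℝ, 0 ≤ r →
      LS ω r (z' : ℝ → E) (fun t => f (orb φ ω t) ((z : ℝ → E) t))) ∧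
      P ω ((z' : ℝ → E) 0) = P ω x := by
    rintro ⟨z, hzc, N, hN0, hN⟩
    obtain ⟨z', h1, h2, h3⟩ := h.exists_linear H (add_nonneg (mul_nonneg h.lip_nonneg hN0) hC0)
      (continuousOn_nonlinearity φ ω hf hzc) (fun t ht => h.size_le H ht (hN t ht) (hC t ht)) x
    exact ⟨⟨z', H.contOn_Ici h1, _, add_nonneg (norm_nonneg _) (mul_nonneg h.gain_nonneg
      (add_nonneg (mul_nonneg h.lip_nonneg hN0) hC0)), h3⟩, h1, h2⟩
  choose Λ hΛ1 hΛ2 using hstep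
  -- Both images have the same X-part at time 0, so the gain estimate has no initial term and the
  -- factor is exactly κε.
  have hcontr : ∀ (z w : 𝒞) (N : ℝ), 0 ≤ N → (∀ t, 0 ≤ t →
      maxNorm P (orb φ ω t) ((z : ℝ → E) t - (w : ℝ → E) t) ≤ N * Real.exp (γ * t)) → ∀ t, 0 ≤ t →
      maxNorm P (orb φ ω t) ((Λ z : ℝ → E) t - (Λ w : ℝ → E) t) ≤
        κ * ε * N * Real.exp (γ * t) := by
    intro z w N hN0 hN t ht
    have hc := continuousOn_nonlinearity φ ω hf z.2.1
    have hc' := continuousOn_nonlinearity φ ω hf w.2.1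
    obtain ⟨-, N₁, -, hN₁⟩ := (Λ z).2
    obtain ⟨-, N₂, -, hN₂⟩ := (Λ w).2
    have := (h.gain_Ici (z := fun t => (Λ z : ℝ → E) t - (Λ w : ℝ → E) t) (N := N₁ + N₂)
      (mul_nonneg h.lip_nonneg hN0)
      (fun r hr => H.sub hr (hc.mono Icc_subset_Ici_self) (hc'.mono Icc_subset_Ici_self)
        (hΛ1 z r hr) (hΛ1 w r hr)) (hc.sub hc')
      (fun t ht => h.size_sub_le ht (hN t ht))
      (fun t ht => by
        rw [add_mul]
        exact (maxNorm_sub_le P _ _ _).trans (add_le_add (hN₁ t ht) (hN₂ t ht))) ht).1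
    rw [map_sub, hΛ2, hΛ2, sub_self, norm_zero, zero_add, ← mul_assoc] at this
    exact this
  have hθ0 : 0 ≤ κ * ε := mul_nonneg h.gain_nonneg h.lip_nonneg
  set Z : ℕ → 𝒞 := fun n => Λ^[n] ⟨0, continuousOn_const, 0, le_rfl, by simp [maxNorm_zero]⟩ with hZ
  have hZs : ∀ n, Z (n + 1) = Λ (Z n) := fun n => Function.iterate_succ_apply' _ _ _
  obtain ⟨-, N₀, hN₀0, hN₀⟩ := (Z 1).2
  have hgeo : ∀ n : ℕ, ∀ t, 0 ≤ t → maxNorm P (orb φ ω t)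
      ((Z (n + 1) : ℝ → E) t - (Z n : ℝ → E) t) ≤ (κ * ε) ^ n * N₀ * Real.exp (γ * t) := by
    intro n
    induction n with
    | zero => intro t ht; simpa [hZ] using hN₀ t ht
    | succ n ih =>
      intro t ht
      rw [hZs (n + 1), hZs n, pow_succ', mul_assoc (κ * ε)]
      rw [hZs n] at ih
      exact hcontr (Λ (Z n)) (Z n) _ (mul_nonneg (pow_nonneg hθ0 n) hN₀0) ih t ht
  have hdist : ∀ t, 0 ≤ t → ∀ n : ℕ, dist ((Z n : ℝ → E) t) ((Z (n + 1) : ℝ → E) t) ≤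
      2 * N₀ * Real.exp (γ * t) * (κ * ε) ^ n := by
    intro t ht n
    rw [dist_eq_norm, ← norm_neg, neg_sub]
    refine (norm_le_two_mul_maxNorm P (orb φ ω t) _).trans ?_
    have := hgeo n t ht
    nlinarith
  -- The limit is meaningful for t ≥ 0 only; at negative times z is arbitrary, so the fixed point
  -- equation holds on the half line and not as an equality of functions.
  choose! z hz using fun (t : ℝ) (ht : 0 ≤ t) =>
    cauchySeq_tendsto_of_complete (cauchySeq_of_le_geometric _ _ h.contr (hdist t ht))
  have hzn : ∀ t, 0 ≤ t → ∀ n : ℕ, dist ((Z n : ℝ → E) t) (z t) ≤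
      2 * N₀ * Real.exp (γ * t) * (κ * ε) ^ n / (1 - κ * ε) := fun t ht n =>
    dist_le_of_le_geometric_of_tendsto _ _ h.contr (hdist t ht) (hz t ht) n
  have h1θ : 0 < 1 - κ * ε := by linarith [h.contr]
  -- distance of the iterates in the max norm
  have hmd : ∀ n k : ℕ, ∀ t, 0 ≤ t → maxNorm P (orb φ ω t)
      ((Z (n + k) : ℝ → E) t - (Z n : ℝ → E) t) ≤
      (κ * ε) ^ n * N₀ * ((1 - (κ * ε) ^ k) / (1 - κ * ε)) * Real.exp (γ * t) := by
    intro n k t ht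
    induction k with
    | zero => simp [maxNorm_zero]
    | succ k ih =>
      have e : (Z (n + (k + 1)) : ℝ → E) t - (Z n : ℝ → E) t =
        ((Z (n + k + 1) : ℝ → E) t - (Z (n + k) : ℝ → E) t) +
          ((Z (n + k) : ℝ → E) t - (Z n : ℝ → E) t) := by
        rw [← add_assoc]; abel
      rw [e]
      refine (maxNorm_add_le P _ _ _).trans ((add_le_add (hgeo (n + k) t ht) ih).trans_eq ?_)
      rw [pow_add, pow_succ]
      field_simp
      ring
  have hmz : ∀ n : ℕ, ∀ t, 0 ≤ t → maxNorm P (orb φ ω t) (z t - (Z n : ℝ → E) t) ≤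
      (κ * ε) ^ n * N₀ / (1 - κ * ε) * Real.exp (γ * t) := by
    intro n t ht
    have hl : Tendsto (fun k => (Z (n + k) : ℝ → E) t) atTop (𝓝 (z t)) := by
      have := (hz t ht).comp (tendsto_add_atTop_nat n)
      simpa [Function.comp_def, add_comm] using this
    refine le_of_tendsto' (((continuous_maxNorm_right (P := P) (orb φ ω t)).tendsto _).comp
      (hl.sub_const ((Z n : ℝ → E) t))) fun k => (hmd n k t ht).trans ?_
    rw [mul_div_assoc', mul_comm _ (1 - (κ * ε) ^ k)]
    refine mul_le_mul_of_nonneg_right (div_le_div_of_nonneg_right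
      (mul_le_of_le_one_left (mul_nonneg (pow_nonneg hθ0 n) hN₀0) ?_) h1θ.le) (Real.exp_pos _).le
    linarith [pow_nonneg hθ0 k]
  have hzC : z ∈ 𝒞 := by
    refine ⟨continuousOn_Ici_of_Icc fun r hr => ?_, N₀ / (1 - κ * ε), div_nonneg hN₀0 h1θ.le,
      fun t ht => by simpa [hZ] using hmz 0 t ht⟩
    refine TendstoUniformlyOn.continuousOn (F := fun n => (Z n : ℝ → E)) (p := atTop) ?_
      (Frequently.of_forall fun n => (Z n).2.1.mono Icc_subset_Ici_self)
    rw [Metric.tendstoUniformlyOn_iff]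
    intro η hη
    have : Tendsto (fun n => 2 * N₀ * Real.exp (|γ| * r) * (κ * ε) ^ n / (1 - κ * ε)) atTop
        (𝓝 (2 * N₀ * Real.exp (|γ| * r) * 0 / (1 - κ * ε))) :=
      ((tendsto_pow_atTop_nhds_zero_of_lt_one hθ0 h.contr).const_mul _).div_const _
    rw [mul_zero, zero_div] at this
    filter_upwards [this.eventually (gt_mem_nhds hη)] with n hn t ht
    rw [dist_comm]
    refine (hzn t ht.1 n).trans_lt (lt_of_le_of_lt ?_ hn)
    gcongr
    · exact ht.1
    · exact le_abs_self γ
    · exact ht.2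
  have hfix : ∀ t, 0 ≤ t → z t = (Λ ⟨z, hzC⟩ : ℝ → E) t := by
    intro t ht
    have hb : ∀ n : ℕ, maxNorm P (orb φ ω t) ((Z (n + 1) : ℝ → E) t - (Λ ⟨z, hzC⟩ : ℝ → E) t) ≤
        κ * ε * ((κ * ε) ^ n * N₀ / (1 - κ * ε)) * Real.exp (γ * t) := by
      intro n
      rw [hZs]
      refine hcontr (Z n) ⟨z, hzC⟩ _ (by positivity) (fun t ht => ?_) t ht
      rw [← maxNorm_neg, neg_sub]
      exact hmz n t ht
    have hl1 : Tendsto (fun n => maxNorm P (orb φ ω t)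
        ((Z (n + 1) : ℝ → E) t - (Λ ⟨z, hzC⟩ : ℝ → E) t)) atTop
        (𝓝 (maxNorm P (orb φ ω t) (z t - (Λ ⟨z, hzC⟩ : ℝ → E) t))) :=
      ((continuous_maxNorm_right (P := P) (orb φ ω t)).tendsto _).comp
        (((hz t ht).comp (tendsto_add_atTop_nat 1)).sub_const _)
    have hl2 : Tendsto (fun n : ℕ => κ * ε * ((κ * ε) ^ n * N₀ / (1 - κ * ε)) * Real.exp (γ * t))
        atTop (𝓝 (κ * ε * (0 * N₀ / (1 - κ * ε)) * Real.exp (γ * t))) :=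
      ((((tendsto_pow_atTop_nhds_zero_of_lt_one hθ0 h.contr).mul_const _).div_const _).const_mul
        _).mul_const _
    have h0 := le_of_tendsto_of_tendsto' hl1 hl2 hb
    rw [zero_mul, zero_div, mul_zero, zero_mul] at h0
    have := norm_le_two_mul_maxNorm P (orb φ ω t) (z t - (Λ ⟨z, hzC⟩ : ℝ → E) t)
    exact sub_eq_zero.1 (norm_le_zero_iff.1 (by linarith))
  refine ⟨z, fun r hr => ?_, ?_, ?_⟩
  · exact H.congr hr (fun t ht => (hfix t ht.1).symm) (fun t ht => rfl) (hΛ1 ⟨z, hzC⟩ r hr)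
  · rw [hfix 0 le_rfl]; exact hΛ2 _
  · obtain ⟨-, N, -, hN⟩ := hzC
    exact ⟨N, hN⟩

end Abstract

end InvGraph

namespace InvGraph

/-! ### The invariant graph: existence, uniqueness and smoothness -/

section Abstract

variable {M : Type u} [TopologicalSpace M] {E F : Type v} [NormedAddCommGroup E] [NormedSpace ℝ E]
  [NormedAddCommGroup F] [NormedSpace ℝ F]

/-- Initial values of the solutions of admissible growth. -/
def solGraph (φ : Flow ℝ≥0 M) (P : M → E →L[ℝ] E) (LS : M → ℝ → (ℝ → E) → (ℝ → F) → Prop)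
    (σ : M → F → ℝ) (f : M → E → F) : Set (M × E) :=
  {p | ∃ z, GoodSol φ P LS σ f p.1 z ∧ z 0 = p.2}

variable {φ : Flow ℝ≥0 M} {P : M → E →L[ℝ] E} {LS : M → ℝ → (ℝ → E) → (ℝ → F) → Prop}
  {σ : M → F → ℝ} {f : M → E → F} {ω : M} {γ μ κ ε : ℝ}

theorem GoodSol.shift (H : LinearTheory φ P LS σ) (hf : Continuous fun p : M × E => f p.1 p.2)
    {z : ℝ → E} (hz : GoodSol φ P LS σ f ω z) {s : ℝ} (hs : 0 ≤ s) :
    GoodSol φ P LS σ f (orb φ ω s) (fun t => z (s + t)) := by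
  obtain ⟨hz, γ, μ, κ, ε, N, hA, hN⟩ := hz
  refine ⟨fun r hr => ?_, γ, μ, κ, ε, N * Real.exp (γ * s), hA.shift hs, fun t ht => ?_⟩
  · have hsr := add_nonneg hs hr
    refine H.congr hr (fun t _ => rfl) (fun t ht => ?_) (H.shift hs hr
      ((continuousOn_nonlinearity φ ω hf (H.contOn_Ici hz)).mono Icc_subset_Ici_self)
      (hz _ hsr))
    simp only [orb_orb φ ω hs ht.1]
  · rw [orb_orb φ ω hs ht, mul_assoc, ← Real.exp_add, ← mul_add]
    exact hN _ (add_nonneg hs ht)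

theorem Adm.growth_mono {γ γ' N : ℝ} {z : ℝ → E} (h : γ ≤ γ')
    (hN : ∀ t, 0 ≤ t → maxNorm P (orb φ ω t) (z t) ≤ N * Real.exp (γ * t)) {t : ℝ} (ht : 0 ≤ t) :
    maxNorm P (orb φ ω t) (z t) ≤ N * Real.exp (γ' * t) := by
  have hN0 : 0 ≤ N := by
    have := (maxNorm_nonneg P _ _).trans (hN 0 le_rfl)
    simpa using this
  exact (hN t ht).trans (by gcongr)

/-- The two solutions may come with different weights. Both obey the one with the larger exponent,
which is admissible, and there a difference without X-part at time 0 vanishes. -/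
theorem GoodSol.eq_zero_time (H : LinearTheory φ P LS σ)
    (hf : Continuous fun p : M × E => f p.1 p.2) {z z' : ℝ → E} (hz : GoodSol φ P LS σ f ω z)
    (hz' : GoodSol φ P LS σ f ω z') (h : P ω (z 0) = P ω (z' 0)) : z 0 = z' 0 := by
  obtain ⟨hz, γ, μ, κ, ε, N, hA, hN⟩ := hz
  obtain ⟨hz', γ', μ', κ', ε', N', hA', hN'⟩ := hz'
  have key : ∀ {γ₁ μ₁ κ₁ ε₁}, Adm φ P LS σ f ω γ₁ μ₁ κ₁ ε₁ → γ ≤ γ₁ → γ' ≤ γ₁ → z 0 = z' 0 := by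
    intro γ₁ μ₁ κ₁ ε₁ hA₁ h1 h2
    have := hA₁.diff_le H hf hz hz' (N := N + N') (fun t ht => by
      rw [add_mul]
      exact (maxNorm_sub_le P _ _ _).trans
        (add_le_add (Adm.growth_mono h1 hN ht) (Adm.growth_mono h2 hN' ht))) le_rfl
    rw [map_sub, h, sub_self, norm_zero, zero_div, zero_mul] at this
    have h3 := norm_le_two_mul_maxNorm P (orb φ ω 0) (z 0 - z' 0)
    exact sub_eq_zero.1 (norm_le_zero_iff.1 (by linarith))
  rcases le_total γ γ' with hle | hle
  · exact key hA' hle le_rfl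
  · exact key hA le_rfl hle

/-- Ψ sends x to the Y-part at time 0 of the solution of admissible growth with X-part x; uniqueness
makes this independent of the weight, and invariance is a time shift. The cone estimate `hβ` is an
assumption because its sharp constant depends on the kind of equation. -/
theorem exists_isInvariantGraph_solGraph [CompleteSpace E] (H : LinearTheory φ P LS σ)
    (hf : Continuous fun p : M × E => f p.1 p.2) {Sol : M → (ℝ → E) → Prop}
    (hSol : ∀ ω w, Sol ω w ↔ NonlinearSol φ LS f ω w) {β : M → ℝ}
    {γ : M → ℝ} (hβ : ∀ ω z z' N, NonlinearSol φ LS f ω z → NonlinearSol φ LS f ω z' →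
      (∀ t, 0 ≤ t → maxNorm P (orb φ ω t) (z t - z' t) ≤ N * Real.exp (γ ω * t)) →
      ‖z 0 - z' 0 - P ω (z 0 - z' 0)‖ ≤ β ω * ‖P ω (z 0 - z' 0)‖)
    (hw : ∀ ω, ∃ μ κ ε C, 0 ≤ C ∧ Adm φ P LS σ f ω (γ ω) μ κ ε ∧
      ∀ t, 0 ≤ t → σ (orb φ ω t) (f (orb φ ω t) 0) ≤ C * Real.exp (γ ω * t)) :
    ∃ Ψ, IsInvariantGraph φ P Sol β (solGraph φ P LS σ f) Ψ := by
  have hex : ∀ (ω : M) (x : specX P ω), ∃ z, GoodSol φ P LS σ f ω z ∧ P ω (z 0) = x ∧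
      ∃ N, ∀ t, 0 ≤ t → maxNorm P (orb φ ω t) (z t) ≤ N * Real.exp (γ ω * t) := by
    intro ω x
    obtain ⟨μ, κ, ε, C, hC0, hA, hC⟩ := hw ω
    obtain ⟨z, h1, h2, N, hN⟩ := hA.exists_nonlinear H hf hC0 hC (x : E)
    exact ⟨z, ⟨h1, γ ω, μ, κ, ε, N, hA, hN⟩, h2.trans (proj_specX H.proj x), N, hN⟩
  choose Z hZ hZP N hN using hex
  refine ⟨fun ω x => projY P ω (Z ω x 0), ?_, ?_, ?_⟩
  · intro ω z
    constructor
    · rintro ⟨w, hw, rfl⟩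
      refine ⟨projX P ω (w 0), ?_⟩
      have := hw.eq_zero_time H hf (hZ ω (projX P ω (w 0))) (by rw [hZP]; rfl)
      have h2 := hZP ω (projX P ω (w 0))
      change w 0 = P ω (w 0) + (Z ω (projX P ω (w 0)) 0 - P ω (Z ω (projX P ω (w 0)) 0))
      rw [← this]; abel
    · rintro ⟨x, rfl⟩
      refine ⟨Z ω x, hZ ω x, ?_⟩
      change Z ω x 0 = (x : E) + (Z ω x 0 - P ω (Z ω x 0))
      rw [hZP]; abel
  · intro ω x x'
    have := hβ ω _ _ (N ω x + N ω x') (hZ ω x).1 (hZ ω x').1 (fun t ht => by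
      rw [add_mul]
      exact (maxNorm_sub_le P _ _ _).trans (add_le_add (hN ω x t ht) (hN ω x' t ht)))
    rw [map_sub, hZP, hZP, sub_sub_sub_comm] at this
    have e : ((projY P ω (Z ω x 0) - projY P ω (Z ω x' 0) : specY P ω) : E) =
        Z ω x 0 - (x : E) - (Z ω x' 0 - (x' : E)) := by
      rw [← hZP ω x, ← hZP ω x']; rfl
    rw [Submodule.coe_norm, e]
    exact this
  · rintro ω z ⟨w, hw, rfl⟩
    refine ⟨w, (hSol ω w).2 hw.1, rfl, fun t => ?_⟩
    rw [← orb_coe]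
    exact ⟨_, hw.shift H hf t.2, by simp⟩

theorem IsInvariantGraph.proj_eq (hP : ∀ ω z, P ω (P ω z) = P ω z) {ω : M} {x : specX P ω}
    {y : specY P ω} : P ω ((x : E) + y) = x := by
  rw [map_add, proj_specX hP, proj_specY hP, add_zero]

/-- An invariant family of Lipschitz graphs whose values at `0` grow admissibly is the graph of
the solutions of admissible growth. -/
theorem eq_solGraph (H : LinearTheory φ P LS σ)
    (hf : Continuous fun p : M × E => f p.1 p.2) {Sol : M → (ℝ → E) → Prop}
    (hSol : ∀ ω w, Sol ω w ↔ NonlinearSol φ LS f ω w) {β : M → ℝ} (hβ : ∀ ω, β ω ≤ 1)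
    {Ψ₀ : ∀ ω, specX P ω → specY P ω}
    (h₀ : IsInvariantGraph φ P Sol β (solGraph φ P LS σ f) Ψ₀)
    {𝓜 : Set (M × E)} {Ψ : ∀ ω, specX P ω → specY P ω} (h : IsInvariantGraph φ P Sol β 𝓜 Ψ)
    (hw : ∀ ω, ∃ γ μ κ ε C, 0 ≤ C ∧ Adm φ P LS σ f ω γ μ κ ε ∧
      (∀ t, 0 ≤ t → σ (orb φ ω t) (f (orb φ ω t) 0) ≤ C * Real.exp (γ * t)) ∧
      ∀ t : ℝ≥0, ‖Ψ (φ t ω) 0‖ ≤ C * Real.exp (γ * t)) :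
    𝓜 = solGraph φ P LS σ f := by
  have hsub : 𝓜 ⊆ solGraph φ P LS σ f := by
    rintro ⟨ω, z⟩ hz
    obtain ⟨γ, μ, κ, ε, C, hC0, hA, hC, hΨ⟩ := hw ω
    obtain ⟨w, hw, hw0, hwM⟩ := h.inv ω z hz
    rw [hSol] at hw
    refine ⟨w, ⟨hw, γ, μ, κ, ε, (‖P ω (w 0)‖ + κ * C + C) / (1 - κ * ε), hA, ?_⟩, hw0⟩
    -- Along a solution inside the family the Y-part is at most the X-part plus Ψ(0). This replaces
    -- the gain estimate for Y, which would require knowledge of the far end.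
    have hcone : ∀ t, 0 ≤ t →
        ‖w t - P (orb φ ω t) (w t)‖ ≤ ‖P (orb φ ω t) (w t)‖ + C * Real.exp (γ * t) := by
      intro t ht
      lift t to ℝ≥0 using ht
      rw [orb_coe]
      obtain ⟨x, hx⟩ := (h.graph _ _).1 (hwM t)
      have e : P (φ t ω) (w t) = x := by rw [hx]; exact IsInvariantGraph.proj_eq H.proj
      rw [e, hx, add_sub_cancel_left]
      have h1 := h.lip (φ t ω) x 0
      rw [sub_zero] at h1
      have h2 : ‖Ψ (φ t ω) x‖ ≤ ‖Ψ (φ t ω) x - Ψ (φ t ω) 0‖ + ‖Ψ (φ t ω) 0‖ := by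
        simpa using norm_add_le (Ψ (φ t ω) x - Ψ (φ t ω) 0) (Ψ (φ t ω) 0)
      have h3 : β (φ t ω) * ‖x‖ ≤ 1 * ‖x‖ := by gcongr; exact hβ _
      rw [← Submodule.coe_norm, ← Submodule.coe_norm]
      linarith [hΨ t]
    intro r hr
    have hwc : ContinuousOn w (Icc 0 r) := H.contOn (hw r hr)
    -- On [0, r] compactness supplies some weighted bound depending on r; self-improvement replaces
    -- it by a fixed point that does not depend on r.
    obtain ⟨B, hB⟩ := (isCompact_Icc (a := (0 : ℝ)) (b := r)).exists_bound_of_continuousOn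
      (f := fun t => maxNorm P (orb φ ω t) (w t) * Real.exp (-(γ * t)))
      ((H.continuousOn_maxNorm hwc ω).mul (by fun_prop))
    have hκε := mul_nonneg hA.gain_nonneg hA.lip_nonneg
    have hκC := mul_nonneg hA.gain_nonneg hC0
    refine bound_of_self_improving (ι := Icc (0 : ℝ) r)
      (m := fun t => maxNorm P (orb φ ω t) (w t)) (w := fun t => Real.exp (γ * t))
      (N := max B 0) hκε hA.contr (by positivity) (le_max_right _ _) (fun t => ?_)
      (fun N' hN' hb t => ?_) ⟨r, hr, le_rfl⟩
    · have h1 := (le_abs_self _).trans (hB t t.2)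
      have h2 : maxNorm P (orb φ ω t) (w t) * Real.exp (-(γ * t)) ≤ max B 0 :=
        h1.trans (le_max_left _ _)
      rwa [Real.exp_neg, ← div_eq_mul_inv, div_le_iff₀ (Real.exp_pos _)] at h2
    · have h1 := (hA.gain 0 le_rfl r w _ (ε * N' + C) hr
        (add_nonneg (mul_nonneg hA.lip_nonneg hN') hC0) (by rw [orb_zero]; exact hw r hr)
        (continuousOn_nonlinearity φ ω hf hwc)
        (fun t ht => by rw [zero_add]; exact hA.size_le H ht.1 (hb ⟨t, ht⟩) (hC t ht.1)) t t.2).1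
      rw [zero_add, orb_zero] at h1
      have h2 := hcone t t.2.1
      have h3 : (κ * ε * N' + (‖P ω (w 0)‖ + κ * C + C)) * Real.exp (γ * t) =
        (‖P ω (w 0)‖ + κ * (ε * N' + C)) * Real.exp (γ * t) + C * Real.exp (γ * t) := by ring
      rw [h3]
      have h4 : 0 ≤ C * Real.exp (γ * t) := mul_nonneg hC0 (Real.exp_pos _).le
      exact max_le (by linarith) (by linarith)
  refine Subset.antisymm hsub ?_
  rintro ⟨ω, z⟩ hz
  obtain ⟨x, rfl⟩ := (h₀.graph ω z).1 hz
  -- Over the same x both graphs have exactly one point, so inclusion forces equality.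
  have h1 : (ω, (x : E) + Ψ ω x) ∈ 𝓜 := (h.graph _ _).2 ⟨x, rfl⟩
  obtain ⟨x', hx'⟩ := (h₀.graph _ _).1 (hsub h1)
  have hxx' : x = x' := by
    have := congrArg (P ω) hx'
    rw [IsInvariantGraph.proj_eq H.proj, IsInvariantGraph.proj_eq H.proj] at this
    exact Subtype.ext this
  subst hxx'
  rw [← hx']; exact h1

theorem IsInvariantGraph.exists_goodSol {Sol : M → (ℝ → E) → Prop} {β : M → ℝ}
    {Ψ : ∀ ω, specX P ω → specY P ω}
    (h : IsInvariantGraph φ P Sol β (solGraph φ P LS σ f) Ψ) (ω : M) (x : specX P ω) :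
    ∃ z, GoodSol φ P LS σ f ω z ∧ z 0 = x + Ψ ω x :=
  (h.graph ω _).2 ⟨x, rfl⟩

/-- The solution with zero X-part at time 0 starts at Ψ(0); in its growth bound at t = 0 only the
contribution of f(0) is left. -/
theorem IsInvariantGraph.norm_zero_le [CompleteSpace E] (H : LinearTheory φ P LS σ)
    (hf : Continuous fun p : M × E => f p.1 p.2) {Sol : M → (ℝ → E) → Prop} {β : M → ℝ}
    {Ψ : ∀ ω, specX P ω → specY P ω} (h : IsInvariantGraph φ P Sol β (solGraph φ P LS σ f) Ψ)
    (hA : Adm φ P LS σ f ω γ μ κ ε) {C : ℝ} (hC0 : 0 ≤ C)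
    (hC : ∀ t, 0 ≤ t → σ (orb φ ω t) (f (orb φ ω t) 0) ≤ C * Real.exp (γ * t)) :
    ‖Ψ ω 0‖ ≤ κ / (1 - κ * ε) * C := by
  obtain ⟨z, h1, h2, N, hN⟩ := hA.exists_nonlinear H hf hC0 hC (0 : E)
  obtain ⟨z', hz', hz0⟩ := h.exists_goodSol ω 0
  have e : z 0 = z' 0 := GoodSol.eq_zero_time H hf ⟨h1, γ, μ, κ, ε, N, hA, hN⟩ hz' (by
    rw [h2, hz0, IsInvariantGraph.proj_eq H.proj]; simp)
  have h3 := hA.growth_le H hf hC0 h1 hC hN le_rfl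
  rw [h2, map_zero, norm_zero, zero_add, mul_zero, Real.exp_zero, mul_one, e, hz0, orb_zero] at h3
  have h4 := (norm_sub_apply_le_maxNorm P _ _).trans h3
  rw [IsInvariantGraph.proj_eq H.proj, add_sub_cancel_left] at h4
  rw [Submodule.coe_norm]
  exact h4.trans_eq (by ring)

/-- Small defects lead to small solutions: the property of the linear equation behind the
smoothness of invariant graphs. `𝓕 τ` describes the mode of convergence at time `τ`. -/
def DefectStable (φ : Flow ℝ≥0 M) (P : M → E →L[ℝ] E) (LS : M → ℝ → (ℝ → E) → (ℝ → F) → Prop)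
    (σ : M → F → ℝ) (𝓕 : ℝ → Filter ℝ) (ω : M) (γ₀ ε : ℝ) : Prop :=
  ∀ (zn : ℕ → ℝ → E) (gn : ℕ → ℝ → F) (rn : ℕ → ℝ → ℝ) (N : ℝ),
    (∀ n, ∀ r : ℝ, 0 ≤ r → LS ω r (zn n) (gn n)) → (∀ n, ContinuousOn (gn n) (Ici 0)) →
    (∀ n, P ω (zn n 0) = 0) →
    (∀ n t, 0 ≤ t → maxNorm P (orb φ ω t) (zn n t) ≤ N * Real.exp (γ₀ * t)) →
    (∀ n, ContinuousOn (rn n) (Ici 0)) →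
    (∀ n t, 0 ≤ t → 0 ≤ rn n t ∧ rn n t ≤ N * Real.exp (γ₀ * t)) →
    (∀ n t, 0 ≤ t → σ (orb φ ω t) (gn n t) ≤ ε * maxNorm P (orb φ ω t) (zn n t) + rn n t) →
    (∀ τ, 0 ≤ τ → Tendsto (Function.uncurry rn) (atTop ×ˢ 𝓕 τ) (𝓝 0)) →
    Tendsto (fun n => ‖zn n 0 - P ω (zn n 0)‖) atTop (𝓝 0)

/-- The derivative of a map inherits its Lipschitz estimate. -/
theorem size_fderiv_le (H : LinearTheory φ P LS σ) {g : E → F} {z : E} (hg : DifferentiableAt ℝ g z)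
    (hε : ∀ z z', σ ω (g z - g z') ≤ ε * maxNorm P ω (z - z')) (w : E) :
    σ ω (fderiv ℝ g z w) ≤ ε * maxNorm P ω w := by
  have h1 : Tendsto (fun t : ℝ => t⁻¹ • (g (z + t • w) - g z)) (𝓝[≠] 0) (𝓝 (fderiv ℝ g z w)) :=
    (hg.hasFDerivAt.hasLineDerivAt w).tendsto_slope_zero
  have h2 : Continuous fun u : F => σ ω u :=
    H.size_cont.comp (continuous_const.prodMk continuous_id)
  refine le_of_tendsto ((h2.tendsto _).comp h1) ?_
  filter_upwards [self_mem_nhdsWithin] with t ht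
  have ht' : t ≠ 0 := ht
  simp only [Function.comp, H.size_smul]
  rw [abs_inv, inv_mul_le_iff₀ (abs_pos.2 ht')]
  refine (hε _ _).trans_eq ?_
  rw [add_sub_cancel_left, maxNorm_smul]; ring

/-- Smoothness of the invariant graph. -/
theorem IsInvariantGraph.contDiff [CompleteSpace E] (H : LinearTheory φ P LS σ)
    (hf : Continuous fun p : M × E => f p.1 p.2) {Sol : M → (ℝ → E) → Prop} {β : M → ℝ}
    {Ψ : ∀ ω, specX P ω → specY P ω} (h : IsInvariantGraph φ P Sol β (solGraph φ P LS σ f) Ψ)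
    (hA : Adm φ P LS σ f ω γ μ κ ε) {C : ℝ} (hC0 : 0 ≤ C)
    (hC : ∀ t, 0 ≤ t → σ (orb φ ω t) (f (orb φ ω t) 0) ≤ C * Real.exp (γ * t))
    {𝓕 : ℝ → Filter ℝ} (h𝓕 : ∀ τ, 0 ≤ τ → 𝓕 τ ≤ 𝓝[Ici 0] τ)
    (hdef : DefectStable φ P LS σ 𝓕 ω γ ε)
    (hd : ∀ ω, Differentiable ℝ (f ω))
    (hd' : ∀ τ, 0 ≤ τ → ∀ w, Tendsto (fun q : ℝ × E => fderiv ℝ (f (orb φ ω q.1)) q.2)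
      (𝓕 τ ×ˢ 𝓝 w) (𝓝 (fderiv ℝ (f (orb φ ω τ)) w))) :
    ContDiff ℝ 1 (Ψ ω) := by
  have := completeSpace_specY H.proj ω
  choose Z hZ hZP N hN using fun x : specX P ω => hA.exists_nonlinear H hf hC0 hC (x : E)
  have hZP' : ∀ x : specX P ω, P ω (Z x 0) = x := fun x => (hZP x).trans (proj_specX H.proj x)
  have hΨ : ∀ x : specX P ω, (Ψ ω x : E) = Z x 0 - x := by
    intro x
    obtain ⟨z', hz', hz0⟩ := h.exists_goodSol ω x
    have e : Z x 0 = z' 0 := GoodSol.eq_zero_time H hf ⟨hZ x, γ, μ, κ, ε, N x, hA, hN x⟩ hz' (by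
      rw [hZP', hz0, IsInvariantGraph.proj_eq H.proj])
    rw [e, hz0, add_sub_cancel_left]
  have hZc : ∀ x, ContinuousOn (Z x) (Ici 0) := fun x => H.contOn_Ici (hZ x)
  have hfZ : ∀ x, ContinuousOn (fun t => f (orb φ ω t) (Z x t)) (Ici 0) := fun x =>
    continuousOn_nonlinearity φ ω hf (hZc x)
  have h1θ : 0 < 1 - κ * ε := by linarith [hA.contr]
  set B : ℝ := 1 / (1 - κ * ε) with hB
  have hB0 : 0 < B := by positivity
  have hdiff : ∀ x x' t, 0 ≤ t → maxNorm P (orb φ ω t) (Z x t - Z x' t) ≤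
      B * ‖x - x'‖ * Real.exp (γ * t) := by
    intro x x' t ht
    have := hA.diff_le H hf (hZ x) (hZ x') (N := N x + N x') (fun t ht => by
      rw [add_mul]
      exact (maxNorm_sub_le P _ _ _).trans (add_le_add (hN x t ht) (hN x' t ht))) ht
    rw [map_sub, hZP', hZP', ← Submodule.coe_sub, Submodule.norm_coe] at this
    refine this.trans_eq ?_
    rw [hB]; ring
  refine contDiff_one_of_quotients (h.lip ω) ?_
  intro x x₁ x₂ k t s hx₁ hx₂ hk ht hs ht0 hs0
  -- increments
  set q : (ℕ → specX P ω) → (ℕ → ℝ) → ℕ → ℝ → E := fun y t n τ =>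
    (t n)⁻¹ • (Z (y n + t n • k n) τ - Z (y n) τ) with hq
  set G : (ℕ → specX P ω) → (ℕ → ℝ) → ℕ → ℝ → F := fun y t n τ =>
    (t n)⁻¹ • (f (orb φ ω τ) (Z (y n + t n • k n) τ) - f (orb φ ω τ) (Z (y n) τ)) with hG
  have hqm : ∀ y t, (∀ n, t n ≠ 0) → ∀ n τ, 0 ≤ τ →
      maxNorm P (orb φ ω τ) (q y t n τ) ≤ B * Real.exp (γ * τ) := by
    intro y t ht0 n τ hτ
    simp only [hq]
    rw [maxNorm_smul, abs_inv, inv_mul_le_iff₀ (abs_pos.2 (ht0 n))]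
    refine (hdiff _ _ τ hτ).trans ?_
    rw [add_sub_cancel_left, norm_smul, Real.norm_eq_abs]
    have : |t n| * ‖k n‖ ≤ |t n| * 1 := by gcongr; exact hk n
    calc B * (|t n| * ‖k n‖) * Real.exp (γ * τ) ≤ B * (|t n| * 1) * Real.exp (γ * τ) := by gcongr
      _ = _ := by ring
  have hGm : ∀ y t, (∀ n, t n ≠ 0) → ∀ n τ, 0 ≤ τ →
      σ (orb φ ω τ) (G y t n τ) ≤ ε * B * Real.exp (γ * τ) := by
    intro y t ht0 n τ hτ
    simp only [hG]
    rw [H.size_smul, abs_inv, inv_mul_le_iff₀ (abs_pos.2 (ht0 n))]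
    refine (hA.lip τ hτ _ _).trans ?_
    have := hqm y t ht0 n τ hτ
    simp only [hq] at this
    rw [maxNorm_smul, abs_inv, inv_mul_le_iff₀ (abs_pos.2 (ht0 n))] at this
    calc _ ≤ ε * (|t n| * (B * Real.exp (γ * τ))) := by gcongr; exact hA.lip_nonneg
      _ = _ := by ring
  have hLS : ∀ y t n r, 0 ≤ r → LS ω r (q y t n) (G y t n) := fun y t n r hr =>
    H.smul _ hr (H.sub hr ((hfZ _).mono Icc_subset_Ici_self) ((hfZ _).mono Icc_subset_Ici_self)
      (hZ _ r hr) (hZ _ r hr))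
  have hGc : ∀ y t n, ContinuousOn (G y t n) (Ici 0) := fun y t n =>
    ((hfZ _).sub (hfZ _)).const_smul _
  have hqc : ∀ y t n, ContinuousOn (q y t n) (Ici 0) := fun y t n =>
    ((hZc _).sub (hZc _)).const_smul _
  set zn : ℕ → ℝ → E := fun n τ => q x₁ t n τ - q x₂ s n τ with hzn
  set gn : ℕ → ℝ → F := fun n τ => G x₁ t n τ - G x₂ s n τ with hgn
  -- The part of the forcing that exceeds the Lipschitz bound. It becomes small because both
  -- quotients see almost the same derivative of f, and that derivative obeys the bound ε itself.
  set rn : ℕ → ℝ → ℝ := fun n τ => max 0 (σ (orb φ ω τ) (gn n τ) -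
    ε * maxNorm P (orb φ ω τ) (zn n τ)) with hrn
  obtain ⟨Cσ, hCσ0, hCσ⟩ := H.size_le
  have hconv : ∀ τ, 0 ≤ τ → Tendsto (Function.uncurry rn) (atTop ×ˢ 𝓕 τ) (𝓝 0) := by
    intro τ hτ
    set w := Z x τ with hw
    -- convergence of the base curves
    have hZconv : ∀ y : ℕ → specX P ω, Tendsto y atTop (𝓝 x) →
        Tendsto (fun p : ℕ × ℝ => Z (y p.1) p.2) (atTop ×ˢ 𝓕 τ) (𝓝 w) := by
      intro y hy
      have h0 : Tendsto (fun p : ℕ × ℝ => Z x p.2) (atTop ×ˢ 𝓕 τ) (𝓝 w) :=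
        ((hZc x τ hτ).tendsto.mono_left (h𝓕 τ hτ)).comp tendsto_snd
      have h1 : Tendsto (fun p : ℕ × ℝ => 2 * (B * ‖y p.1 - x‖ * Real.exp (γ * p.2)))
          (atTop ×ˢ 𝓕 τ) (𝓝 (2 * (B * 0 * Real.exp (γ * τ)))) := by
        have h2 : Tendsto (fun p : ℕ × ℝ => ‖y p.1 - x‖) (atTop ×ˢ 𝓕 τ) (𝓝 0) :=
          (tendsto_iff_norm_sub_tendsto_zero.1 hy).comp tendsto_fst
        have h3 : Tendsto (fun p : ℕ × ℝ => Real.exp (γ * p.2)) (atTop ×ˢ 𝓕 τ)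
            (𝓝 (Real.exp (γ * τ))) := by
          have : Continuous fun s : ℝ => Real.exp (γ * s) := by fun_prop
          exact ((this.tendsto τ).mono_left ((h𝓕 τ hτ).trans nhdsWithin_le_nhds)).comp tendsto_snd
        exact ((h2.const_mul B).mul h3).const_mul 2
      rw [mul_zero, zero_mul, mul_zero] at h1
      have h4 : Tendsto (fun p : ℕ × ℝ => Z (y p.1) p.2 - Z x p.2) (atTop ×ˢ 𝓕 τ) (𝓝 0) := by
        refine squeeze_zero_norm' ?_ h1
        have : ∀ᶠ s in 𝓕 τ, 0 ≤ s := (h𝓕 τ hτ) self_mem_nhdsWithin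
        filter_upwards [tendsto_snd.eventually this] with p hp
        refine (norm_le_two_mul_maxNorm P (orb φ ω p.2) _).trans ?_
        gcongr
        exact hdiff _ _ _ hp
      simpa using h4.add h0
    have hinc : ∀ (y : ℕ → specX P ω) (t : ℕ → ℝ), Tendsto y atTop (𝓝 x) → Tendsto t atTop (𝓝 0) →
        Tendsto (fun n => y n + t n • k n) atTop (𝓝 x) := by
      intro y t hy ht
      have : Tendsto (fun n => t n • k n) atTop (𝓝 0) := by
        refine squeeze_zero_norm (fun n => ?_) (tendsto_norm_zero.comp ht)
        rw [norm_smul]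
        exact mul_le_of_le_one_right (norm_nonneg _) (hk n)
      simpa using hy.add this
    -- the defect of the difference quotients
    set D' : ℝ → E →L[ℝ] F := fun τ' => fderiv ℝ (f (orb φ ω τ')) w with hD'
    have hquot : ∀ (y : ℕ → specX P ω) (t : ℕ → ℝ), Tendsto y atTop (𝓝 x) →
        Tendsto t atTop (𝓝 0) → (∀ n, t n ≠ 0) → ∀ η > 0, ∀ᶠ p : ℕ × ℝ in atTop ×ˢ 𝓕 τ,
        -- The mean value inequality on a ball around w, where the derivative differs from its value
        -- at w by at most 2η. Eventually both solution values lie in this ball.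
        ‖G y t p.1 p.2 - D' p.2 (q y t p.1 p.2)‖ ≤ 2 * η * ‖q y t p.1 p.2‖ := by
      intro y t hy ht ht0 η hη
      have hev := (hd' τ hτ w).eventually (Metric.closedBall_mem_nhds _ hη)
      rw [((𝓕 τ).basis_sets.prod (Metric.nhds_basis_ball (x := w))).eventually_iff] at hev
      obtain ⟨⟨S, ρ⟩, ⟨hS, hρ⟩, hev⟩ := hev
      have hρ : 0 < ρ := hρ
      have hS' : ∀ᶠ s in 𝓕 τ, s ∈ S := hS
      filter_upwards [tendsto_snd.eventually hS',
        (hZconv y hy).eventually (Metric.ball_mem_nhds w hρ),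
        (hZconv _ (hinc y t hy ht)).eventually (Metric.ball_mem_nhds w hρ)] with p hp1 hp2 hp3
      have hbd : ∀ v ∈ Metric.ball w ρ, ‖fderiv ℝ (f (orb φ ω p.2)) v - D' p.2‖ ≤ 2 * η := by
        intro v hv
        have e1 : dist (fderiv ℝ (f (orb φ ω p.2)) v) (fderiv ℝ (f (orb φ ω τ)) w) ≤ η :=
          hev (x := (p.2, v)) ⟨hp1, hv⟩
        have e2 : dist (fderiv ℝ (f (orb φ ω p.2)) w) (fderiv ℝ (f (orb φ ω τ)) w) ≤ η :=
          hev (x := (p.2, w)) ⟨hp1, Metric.mem_ball_self hρ⟩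
        rw [← dist_eq_norm]
        refine (dist_triangle_right _ _ (fderiv ℝ (f (orb φ ω τ)) w)).trans ?_
        linarith
      have hmv := (convex_ball w ρ).norm_image_sub_le_of_norm_hasFDerivWithin_le'
        (f := f (orb φ ω p.2)) (f' := fun v => fderiv ℝ (f (orb φ ω p.2)) v) (φ := D' p.2)
        (fun v _ => ((hd _) v).hasFDerivAt.hasFDerivWithinAt) hbd hp2 hp3
      simp only [hG, hq, map_smul, ← smul_sub, norm_smul]
      rw [mul_left_comm]
      gcongr
    rw [Metric.tendsto_nhds]
    intro η hη
    set c : ℝ := Real.exp (γ * τ) + 1 with hc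
    have hc0 : 0 < c := by positivity
    -- The 8 collects two quotients, the factor in 2η' and the bound 2Bc of each quotient; Cσ + 1
    -- keeps the denominator positive. The total is η/2.
    set η' : ℝ := η / (2 * ((Cσ + 1) * (8 * (B * c)))) with hη'
    have hη'0 : 0 < η' := by positivity
    have hexp : ∀ᶠ s in 𝓕 τ, Real.exp (γ * s) < c := by
      have : Continuous fun s : ℝ => Real.exp (γ * s) := by fun_prop
      exact ((this.tendsto τ).mono_left ((h𝓕 τ hτ).trans nhdsWithin_le_nhds)).eventually
        (gt_mem_nhds (by rw [hc]; linarith))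
    have hpos : ∀ᶠ s in 𝓕 τ, 0 ≤ s := (h𝓕 τ hτ) self_mem_nhdsWithin
    filter_upwards [hquot x₁ t hx₁ ht ht0 η' hη'0, hquot x₂ s hx₂ hs hs0 η' hη'0,
      tendsto_snd.eventually hexp, tendsto_snd.eventually hpos] with p h1 h2 h3 h4
    have hqn : ∀ y t, (∀ n, t n ≠ 0) → ‖q y t p.1 p.2‖ ≤ 2 * (B * c) := by
      intro y t ht0
      refine (norm_le_two_mul_maxNorm P (orb φ ω p.2) _).trans ?_
      have := hqm y t ht0 p.1 p.2 h4
      have h5 : B * Real.exp (γ * p.2) ≤ B * c := by gcongr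
      linarith
    set e : F := (G x₁ t p.1 p.2 - D' p.2 (q x₁ t p.1 p.2)) -
      (G x₂ s p.1 p.2 - D' p.2 (q x₂ s p.1 p.2)) with he
    have he' : ‖e‖ ≤ η' * (8 * (B * c)) := by
      have e1 := hqn x₁ t ht0
      have e2 := hqn x₂ s hs0
      have e3 : 2 * η' * ‖q x₁ t p.1 p.2‖ ≤ 2 * η' * (2 * (B * c)) := by gcongr
      have e4 : 2 * η' * ‖q x₂ s p.1 p.2‖ ≤ 2 * η' * (2 * (B * c)) := by gcongr
      refine (norm_sub_le _ _).trans ?_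
      linarith
    have hge : gn p.1 p.2 = D' p.2 (zn p.1 p.2) + e := by
      simp only [hgn, hzn, he, map_sub]; abel
    have hσ : σ (orb φ ω p.2) (gn p.1 p.2) ≤ ε * maxNorm P (orb φ ω p.2) (zn p.1 p.2) +
        Cσ * ‖e‖ := by
      rw [hge]
      refine (H.size_add _ _ _).trans (add_le_add ?_ (hCσ _ _))
      exact size_fderiv_le H ((hd _) _) (hA.lip p.2 h4) _
    have hr : rn p.1 p.2 ≤ Cσ * ‖e‖ := max_le (by positivity) (by linarith)
    have hr0 : 0 ≤ rn p.1 p.2 := le_max_left _ _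
    change dist (rn p.1 p.2) 0 < η
    rw [Real.dist_0_eq_abs, abs_of_nonneg hr0]
    have h8 : η' * (8 * (B * c)) * (Cσ + 1) = η / 2 := by
      rw [hη']; field_simp
    have h9 : Cσ * ‖e‖ ≤ (Cσ + 1) * (η' * (8 * (B * c))) :=
      mul_le_mul (by linarith) he' (norm_nonneg _) (by positivity)
    linarith
  -- One constant for both requirements: 2B bounds the difference of the quotients and 2εB the
  -- defect.
  have hres := hdef zn gn rn (2 * B + 2 * (ε * B))
    (fun n r hr => H.sub hr ((hGc _ _ _).mono Icc_subset_Ici_self)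
      ((hGc _ _ _).mono Icc_subset_Ici_self) (hLS _ _ _ r hr) (hLS _ _ _ r hr))
    (fun n => (hGc _ _ _).sub (hGc _ _ _)) ?_ ?_ ?_ ?_ ?_ hconv
  · rw [tendsto_zero_iff_norm_tendsto_zero]
    refine hres.congr fun n => ?_
    rw [Submodule.coe_norm]
    congr 1
    simp only [hzn, hq, map_sub, map_smul, hZP', Submodule.coe_sub, Submodule.coe_smul, hΨ,
      Submodule.coe_add]
    simp only [smul_sub, smul_add]
    abel
  -- Both quotients have X-part `k n` at time 0, whatever their base points and step lengths, so
  -- their difference has none.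
  · intro n
    simp only [hzn, hq, map_sub, map_smul, hZP', Submodule.coe_add, Submodule.coe_smul,
      add_sub_cancel_left, inv_smul_smul₀ (ht0 n), inv_smul_smul₀ (hs0 n), sub_self]
  · intro n τ hτ
    refine (maxNorm_sub_le P _ _ _).trans ?_
    have h1 := hqm x₁ t ht0 n τ hτ
    have h2 := hqm x₂ s hs0 n τ hτ
    have h3 : 0 ≤ 2 * (ε * B) * Real.exp (γ * τ) := by
      have := hA.lip_nonneg; positivity
    rw [add_mul]
    linarith
  · intro n
    exact continuousOn_const.sup ((H.continuousOn_size ((hGc _ _ _).sub (hGc _ _ _)) ω).sub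
      (continuousOn_const.mul (H.continuousOn_maxNorm ((hqc _ _ _).sub (hqc _ _ _)) ω)))
  · intro n τ hτ
    refine ⟨le_max_left _ _, max_le ?_ ?_⟩
    · have := hA.lip_nonneg; positivity
    · have h1 := hGm x₁ t ht0 n τ hτ
      have h2 := hGm x₂ s hs0 n τ hτ
      have h3 := H.size_sub (orb φ ω τ) (G x₁ t n τ) (G x₂ s n τ)
      have h4 : 0 ≤ ε * maxNorm P (orb φ ω τ) (zn n τ) :=
        mul_nonneg hA.lip_nonneg (maxNorm_nonneg P _ _)
      have h5 : 0 ≤ 2 * B * Real.exp (γ * τ) := by positivity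
      rw [add_mul]
      simp only [hgn]
      linarith
  · intro n τ hτ
    have : σ (orb φ ω τ) (gn n τ) - ε * maxNorm P (orb φ ω τ) (zn n τ) ≤ rn n τ := le_max_right _ _
    linarith

/-! ### The two conclusions -/

/-- Weights at `ω` that are good enough for smoothness. -/
def SmoothWeights (φ : Flow ℝ≥0 M) (P : M → E →L[ℝ] E) (LS : M → ℝ → (ℝ → E) → (ℝ → F) → Prop)
    (σ : M → F → ℝ) (f : M → E → F) (𝓕 : ℝ → Filter ℝ) (smooth : Prop) (ω : M) (γ : ℝ) : Prop :=
  ∃ μ κ ε, Adm φ P LS σ f ω γ μ κ ε ∧ (smooth → DefectStable φ P LS σ 𝓕 ω γ ε ∧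
    ∀ τ, 0 ≤ τ → ∀ w, Tendsto (fun q : ℝ × E => fderiv ℝ (f (orb φ ω q.1)) q.2)
      (𝓕 τ ×ˢ 𝓝 w) (𝓝 (fderiv ℝ (f (orb φ ω τ)) w)))

/-- Since f(0) = 0, all inhomogeneous constants are 0: the zero section belongs to `solGraph`, and a
competitor through 0 satisfies Ψ(0) = 0 along every orbit. No sign of the weight is needed. -/
theorem conclusionI_of [CompleteSpace E] (H : LinearTheory φ P LS σ)
    (hf : Continuous fun p : M × E => f p.1 p.2) {Sol : M → (ℝ → E) → Prop}
    (hSol : ∀ ω w, Sol ω w ↔ NonlinearSol φ LS f ω w) {β : M → ℝ} (hβ1 : ∀ ω, β ω ≤ 1)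
    {γ : M → ℝ} (hβ : ∀ ω z z' N, NonlinearSol φ LS f ω z → NonlinearSol φ LS f ω z' →
      (∀ t, 0 ≤ t → maxNorm P (orb φ ω t) (z t - z' t) ≤ N * Real.exp (γ ω * t)) →
      ‖z 0 - z' 0 - P ω (z 0 - z' 0)‖ ≤ β ω * ‖P ω (z 0 - z' 0)‖)
    {smooth : Prop} (hsm : smooth → ∀ ω, ContDiff ℝ 1 (f ω))
    {𝓕 : ℝ → Filter ℝ} (h𝓕 : ∀ τ, 0 ≤ τ → 𝓕 τ ≤ 𝓝[Ici 0] τ)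
    (hw : ∀ ω, SmoothWeights φ P LS σ f 𝓕 smooth ω (γ ω)) (hf0 : ∀ ω, f ω 0 = 0) :
    ConclusionI φ P Sol β smooth := by
  have hσ0 : ∀ ω γ t, σ (orb φ ω t) (f (orb φ ω t) 0) ≤ 0 * Real.exp (γ * t) := fun ω γ t => by
    rw [hf0, H.size_zero, zero_mul]
  obtain ⟨Ψ₀, hΨ₀⟩ := exists_isInvariantGraph_solGraph H hf hSol hβ (fun ω => by
    obtain ⟨μ, κ, ε, hA, -⟩ := hw ω
    exact ⟨μ, κ, ε, 0, le_rfl, hA, fun t _ => hσ0 ω (γ ω) t⟩)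
  have huniq : ∀ (𝓜 : Set (M × E)) (Ψ : ∀ ω, specX P ω → specY P ω),
      (∀ ω, (ω, (0 : E)) ∈ 𝓜) → IsInvariantGraph φ P Sol β 𝓜 Ψ → 𝓜 = solGraph φ P LS σ f := by
    intro 𝓜 Ψ h0 h
    refine eq_solGraph H hf hSol hβ1 hΨ₀ h fun ω => ?_
    obtain ⟨μ, κ, ε, hA, -⟩ := hw ω
    refine ⟨γ ω, μ, κ, ε, 0, le_rfl, hA, fun t _ => hσ0 ω (γ ω) t, fun t => ?_⟩
    obtain ⟨x, hx⟩ := (h.graph _ _).1 (h0 (φ t ω))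
    have hx0 : x = 0 := by
      have := congrArg (P (φ t ω)) hx
      rw [IsInvariantGraph.proj_eq H.proj, map_zero] at this
      exact Subtype.ext this.symm
    subst hx0
    have : (Ψ (φ t ω) 0 : E) = 0 := by simpa using hx.symm
    rw [Submodule.coe_norm, this, norm_zero, zero_mul]
  have h0 : ∀ ω, (ω, (0 : E)) ∈ solGraph φ P LS σ f := by
    intro ω
    obtain ⟨μ, κ, ε, hA, -⟩ := hw ω
    have h1 : ‖Ψ₀ ω 0‖ ≤ 0 := by
      simpa using hΨ₀.norm_zero_le H hf hA le_rfl fun t _ => hσ0 ω (γ ω) t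
    refine (hΨ₀.graph _ _).2 ⟨0, ?_⟩
    rw [norm_le_zero_iff.1 h1]; simp
  refine ⟨⟨_, ⟨h0, Ψ₀, hΨ₀⟩, fun 𝓜 h => ?_⟩, fun 𝓜 Ψ h1 h2 hs ω => ?_⟩
  · obtain ⟨h1, Ψ, h2⟩ := h
    exact huniq 𝓜 Ψ h1 h2
  · obtain rfl := huniq 𝓜 Ψ h1 h2
    obtain ⟨μ, κ, ε, hA, hd⟩ := hw ω
    exact h2.contDiff H hf hA le_rfl (fun t _ => hσ0 ω (γ ω) t) h𝓕 (hd hs).1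
      (fun ω => (hsm hs ω).differentiable one_ne_zero) (hd hs).2

/-- Since γ ≥ 0, constants are dominated by the weight, so bounds on f and on Ψ(0) along an orbit
are admissible growth bounds. The uniform bound on Ψ(0) may use weights of its own; it only needs κ
/ (1 - κε) to be bounded in ω. -/
theorem conclusionII_of [CompleteSpace E] (H : LinearTheory φ P LS σ)
    (hf : Continuous fun p : M × E => f p.1 p.2) {Sol : M → (ℝ → E) → Prop}
    (hSol : ∀ ω w, Sol ω w ↔ NonlinearSol φ LS f ω w) {β : M → ℝ} (hβ1 : ∀ ω, β ω ≤ 1)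
    {γ : M → ℝ} (hβ : ∀ ω z z' N, NonlinearSol φ LS f ω z → NonlinearSol φ LS f ω z' →
      (∀ t, 0 ≤ t → maxNorm P (orb φ ω t) (z t - z' t) ≤ N * Real.exp (γ ω * t)) →
      ‖z 0 - z' 0 - P ω (z 0 - z' 0)‖ ≤ β ω * ‖P ω (z 0 - z' 0)‖)
    {smooth : Prop} (hsm : smooth → ∀ ω, ContDiff ℝ 1 (f ω))
    {𝓕 : ℝ → Filter ℝ} (h𝓕 : ∀ τ, 0 ≤ τ → 𝓕 τ ≤ 𝓝[Ici 0] τ)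
    (hγ : ∀ ω, 0 ≤ γ ω) (hw : ∀ ω, SmoothWeights φ P LS σ f 𝓕 smooth ω (γ ω))
    (hfb : ∀ ω, ∃ K : ℝ, ∀ (t : ℝ≥0) (z : E), ‖f (φ t ω) z‖ ≤ K)
    {unif : Prop} (hub : unif → ∃ K : ℝ, ∀ ω z, ‖f ω z‖ ≤ K)
    (huw : unif → ∃ B : ℝ, ∀ ω, ∃ γ μ κ ε, 0 ≤ γ ∧ Adm φ P LS σ f ω γ μ κ ε ∧
      κ / (1 - κ * ε) ≤ B) :
    ConclusionII φ P Sol β smooth unif := by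
  obtain ⟨Cσ, hCσ0, hCσ⟩ := H.size_le
  have hone : ∀ {γ t : ℝ}, 0 ≤ γ → 0 ≤ t → 1 ≤ Real.exp (γ * t) := fun hγ ht =>
    Real.one_le_exp (mul_nonneg hγ ht)
  have hσ0 : ∀ ω, ∃ C, 0 ≤ C ∧ ∀ γ, 0 ≤ γ → ∀ t, 0 ≤ t →
      σ (orb φ ω t) (f (orb φ ω t) 0) ≤ C * Real.exp (γ * t) := by
    intro ω
    obtain ⟨K, hK⟩ := hfb ω
    have hK0 : 0 ≤ K := (norm_nonneg _).trans (hK 0 0)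
    refine ⟨Cσ * K, mul_nonneg hCσ0 hK0, fun γ hγ t ht => ?_⟩
    lift t to ℝ≥0 using ht
    rw [orb_coe]
    refine (hCσ _ _).trans ((mul_le_mul_of_nonneg_left (hK t 0) hCσ0).trans ?_)
    exact le_mul_of_one_le_right (mul_nonneg hCσ0 hK0) (hone hγ t.2)
  obtain ⟨Ψ₀, hΨ₀⟩ := exists_isInvariantGraph_solGraph H hf hSol hβ (fun ω => by
    obtain ⟨μ, κ, ε, hA, -⟩ := hw ω
    obtain ⟨C, hC0, hC⟩ := hσ0 ω
    exact ⟨μ, κ, ε, C, hC0, hA, hC _ (hγ ω)⟩)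
  have huniq : ∀ (𝓜 : Set (M × E)) (Ψ : ∀ ω, specX P ω → specY P ω),
      IsInvariantGraph φ P Sol β 𝓜 Ψ → (∀ ω, ∃ K : ℝ, ∀ t : ℝ≥0, ‖Ψ (φ t ω) 0‖ ≤ K) →
      𝓜 = solGraph φ P LS σ f := by
    intro 𝓜 Ψ h hK
    refine eq_solGraph H hf hSol hβ1 hΨ₀ h fun ω => ?_
    obtain ⟨μ, κ, ε, hA, -⟩ := hw ω
    obtain ⟨C, hC0, hC⟩ := hσ0 ω
    obtain ⟨K, hK⟩ := hK ω
    have hK0 : 0 ≤ K := (norm_nonneg _).trans (hK 0)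
    refine ⟨γ ω, μ, κ, ε, C + K, by positivity, hA, fun t ht => (hC _ (hγ ω) t ht).trans ?_, fun t => ?_⟩
    · gcongr; linarith
    · refine (hK t).trans ((le_mul_of_one_le_right hK0 (hone (hγ ω) t.2)).trans ?_)
      exact mul_le_mul_of_nonneg_right (by linarith) (Real.exp_pos _).le
  have hbd : ∀ ω, ∃ K : ℝ, ∀ t : ℝ≥0, ‖Ψ₀ (φ t ω) 0‖ ≤ K := by
    intro ω
    obtain ⟨μ, κ, ε, hA, -⟩ := hw ω
    obtain ⟨K, hK⟩ := hfb ω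
    have hK0 : 0 ≤ K := (norm_nonneg _).trans (hK 0 0)
    -- The constants at ω remain valid at tω, which makes the bound independent of t.
    refine ⟨κ / (1 - κ * ε) * (Cσ * K), fun t => ?_⟩
    rw [← orb_coe]
    refine hΨ₀.norm_zero_le H hf (hA.shift t.2) (mul_nonneg hCσ0 hK0) fun s hs => ?_
    rw [orb_orb φ ω t.2 hs]
    have hts : 0 ≤ (t : ℝ) + s := add_nonneg t.2 hs
    refine (hCσ _ _).trans ((mul_le_mul_of_nonneg_left (hK ((t : ℝ) + s).toNNReal 0) hCσ0).trans ?_)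
    exact le_mul_of_one_le_right (mul_nonneg hCσ0 hK0) (hone (hγ ω) hs)
  refine ⟨⟨_, ⟨Ψ₀, hΨ₀, hbd⟩, fun 𝓜 h => ?_⟩, fun 𝓜 Ψ h1 h2 => ⟨fun hs ω => ?_, fun hu => ?_⟩⟩
  · obtain ⟨Ψ, h1, h2⟩ := h
    exact huniq 𝓜 Ψ h1 h2
  · obtain rfl := huniq 𝓜 Ψ h1 h2
    obtain ⟨μ, κ, ε, hA, hd⟩ := hw ω
    obtain ⟨C, hC0, hC⟩ := hσ0 ω
    exact h1.contDiff H hf hA hC0 (hC _ (hγ ω)) h𝓕 (hd hs).1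
      (fun ω => (hsm hs ω).differentiable one_ne_zero) (hd hs).2
  · obtain rfl := huniq 𝓜 Ψ h1 h2
    obtain ⟨K, hK⟩ := hub hu
    obtain ⟨B, hB⟩ := huw hu
    refine ⟨B * (Cσ * |K|), fun ω => ?_⟩
    obtain ⟨γ, μ, κ, ε, hγ, hA, hκ⟩ := hB ω
    refine (h1.norm_zero_le H hf hA (C := Cσ * |K|) (by positivity) fun s hs => ?_).trans ?_
    · refine (hCσ _ _).trans ((mul_le_mul_of_nonneg_left ((hK _ 0).trans (le_abs_self K)) hCσ0).trans ?_)
      exact le_mul_of_one_le_right (by positivity) (hone hγ hs)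
    · gcongr

end Abstract

end InvGraph

namespace InvGraph

/-! ### Equations with integral bounds -/

section Exp

/-- Kept multiplied by γ - a so that it survives γ = a; the cone estimate uses it with difference ε,
which may be zero. -/
theorem mul_integral_exp_left (a γ t : ℝ) :
    (γ - a) * ∫ τ in (0 : ℝ)..t, Real.exp (a * (t - τ)) * Real.exp (γ * τ) =
      Real.exp (γ * t) - Real.exp (a * t) := by
  have h : ∀ τ ∈ uIcc 0 t, HasDerivAt (fun τ => Real.exp (a * (t - τ)) * Real.exp (γ * τ))
      ((γ - a) * (Real.exp (a * (t - τ)) * Real.exp (γ * τ))) τ := by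
    intro τ _
    have h1 : HasDerivAt (fun τ => Real.exp (a * (t - τ))) (Real.exp (a * (t - τ)) * (a * (0 - 1))) τ :=
      (((hasDerivAt_const τ t).sub (hasDerivAt_id τ)).const_mul a).exp
    have h2 : HasDerivAt (fun τ => Real.exp (γ * τ)) (Real.exp (γ * τ) * (γ * 1)) τ :=
      ((hasDerivAt_id τ).const_mul γ).exp
    exact (h1.mul h2).congr_deriv (by ring)
  have := intervalIntegral.integral_eq_sub_of_hasDerivAt h
    (Continuous.intervalIntegrable (by fun_prop) _ _)
  rw [intervalIntegral.integral_const_mul] at this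
  rw [this]; simp

theorem mul_integral_exp_right (b γ t r : ℝ) :
    (b - γ) * ∫ τ in t..r, Real.exp (-b * (τ - t)) * Real.exp (γ * τ) =
      Real.exp (γ * t) - Real.exp (-b * (r - t)) * Real.exp (γ * r) := by
  have h : ∀ τ ∈ uIcc t r, HasDerivAt (fun τ => -(Real.exp (-b * (τ - t)) * Real.exp (γ * τ)))
      ((b - γ) * (Real.exp (-b * (τ - t)) * Real.exp (γ * τ))) τ := by
    intro τ _
    have h1 : HasDerivAt (fun τ => Real.exp (-b * (τ - t)))
        (Real.exp (-b * (τ - t)) * (-b * (1 - 0))) τ :=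
      (((hasDerivAt_id τ).sub (hasDerivAt_const τ t)).const_mul (-b)).exp
    have h2 : HasDerivAt (fun τ => Real.exp (γ * τ)) (Real.exp (γ * τ) * (γ * 1)) τ :=
      ((hasDerivAt_id τ).const_mul γ).exp
    exact (h1.mul h2).neg.congr_deriv (by ring)
  have := intervalIntegral.integral_eq_sub_of_hasDerivAt h
    (Continuous.intervalIntegrable (by fun_prop) _ _)
  rw [intervalIntegral.integral_const_mul] at this
  rw [this]; simp; ring

theorem integral_exp_left_le {a γ κ t : ℝ} (h : a < γ) (hκ : 1 ≤ κ * (γ - a)) :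
    ∫ τ in (0 : ℝ)..t, Real.exp (a * (t - τ)) * Real.exp (γ * τ) ≤ κ * Real.exp (γ * t) := by
  have h1 := mul_integral_exp_left a γ t
  have h2 : 0 < γ - a := sub_pos.2 h
  refine le_of_mul_le_mul_left ?_ h2
  rw [h1]
  have := mul_le_mul_of_nonneg_right hκ (Real.exp_pos (γ * t)).le
  linarith [Real.exp_pos (a * t)]

theorem integral_exp_right_le {b γ κ t r : ℝ} (h : γ < b) (hκ : 1 ≤ κ * (b - γ)) :
    ∫ τ in t..r, Real.exp (-b * (τ - t)) * Real.exp (γ * τ) ≤ κ * Real.exp (γ * t) := by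
  have h1 := mul_integral_exp_right b γ t r
  have h2 : 0 < b - γ := sub_pos.2 h
  refine le_of_mul_le_mul_left ?_ h2
  rw [h1]
  have := mul_le_mul_of_nonneg_right hκ (Real.exp_pos (γ * t)).le
  have := mul_pos (Real.exp_pos (-b * (r - t))) (Real.exp_pos (γ * r))
  linarith

end Exp

section IntegralBound

variable {M : Type u} [TopologicalSpace M] {E F : Type v} [NormedAddCommGroup E] [NormedSpace ℝ E]
  [NormedAddCommGroup F] [NormedSpace ℝ F]

/-- Solutions of the linear equation satisfy the integral inequalities of the variation of constants
formula. -/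
def IntegralBound (φ : Flow ℝ≥0 M) (P : M → E →L[ℝ] E) (LS : M → ℝ → (ℝ → E) → (ℝ → F) → Prop)
    (σ : M → F → ℝ) (ω : M) (a b : ℝ) : Prop :=
  ∀ s, 0 ≤ s → ∀ (r : ℝ) z g (ρ : ℝ → ℝ), 0 ≤ r → LS (orb φ ω s) r z g →
    ContinuousOn g (Icc 0 r) → ContinuousOn ρ (Icc 0 r) →
    (∀ t ∈ Icc 0 r, σ (orb φ ω (s + t)) (g t) ≤ ρ t) → ∀ t ∈ Icc 0 r,
    ‖P (orb φ ω (s + t)) (z t)‖ ≤ Real.exp (a * t) * ‖P (orb φ ω s) (z 0)‖ +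
      ∫ τ in (0 : ℝ)..t, Real.exp (a * (t - τ)) * ρ τ ∧
    ‖z t - P (orb φ ω (s + t)) (z t)‖ ≤
      Real.exp (-b * (r - t)) * ‖z r - P (orb φ ω (s + r)) (z r)‖ +
      ∫ τ in t..r, Real.exp (-b * (τ - t)) * ρ τ

variable {φ : Flow ℝ≥0 M} {P : M → E →L[ℝ] E} {LS : M → ℝ → (ℝ → E) → (ℝ → F) → Prop}
  {σ : M → F → ℝ} {f : M → E → F} {ω : M} {a b γ ε : ℝ}

/-- The weight γ has distance at least ε + d from both rates, so each exponential kernel integrates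
to at most 1/(ε + d) times the weight. The margin d makes κε < 1. -/
theorem IntegralBound.adm (hI : IntegralBound φ P LS σ ω a b) (hε : 0 ≤ ε)
    (hlip : ∀ t, 0 ≤ t → ∀ z z', σ (orb φ ω t) (f (orb φ ω t) z - f (orb φ ω t) z') ≤
      ε * maxNorm P (orb φ ω t) (z - z')) {d : ℝ} (hd : 0 < d) (ha : a + ε + d ≤ γ)
    (hb : γ ≤ b - ε - d) : Adm φ P LS σ f ω γ b (1 / (ε + d)) ε where
  lt := by linarith
  gain_nonneg := by positivity
  lip_nonneg := hε
  contr := by rw [one_div, inv_mul_lt_iff₀ (by linarith)]; linarith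
  lip := hlip
  gain s hs r z g C hr hC hz hg hgC t ht := by
    have h0 : 0 < ε + d := by linarith
    have hκa : 1 ≤ 1 / (ε + d) * (γ - a) := by
      rw [one_div, ← div_eq_inv_mul, one_le_div h0]; linarith
    have hκb : 1 ≤ 1 / (ε + d) * (b - γ) := by
      rw [one_div, ← div_eq_inv_mul, one_le_div h0]; linarith
    obtain ⟨h1, h2⟩ := hI s hs r z g (fun τ => C * Real.exp (γ * τ)) hr hz hg (by fun_prop) hgC t ht
    simp only [mul_left_comm _ C, intervalIntegral.integral_const_mul] at h1 h2
    have h3 := mul_le_mul_of_nonneg_left (integral_exp_left_le (t := t) (by linarith) hκa) hC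
    have h4 := mul_le_mul_of_nonneg_left (integral_exp_right_le (t := t) (r := r) (by linarith) hκb) hC
    constructor
    · have h5 : Real.exp (a * t) * ‖P (orb φ ω s) (z 0)‖ ≤
          Real.exp (γ * t) * ‖P (orb φ ω s) (z 0)‖ := by
        gcongr
        · exact ht.1
        · linarith
      calc _ ≤ Real.exp (γ * t) * ‖P (orb φ ω s) (z 0)‖ + C * (1 / (ε + d) * Real.exp (γ * t)) := by
            linarith
        _ = _ := by ring
    · calc _ ≤ _ + C * (1 / (ε + d) * Real.exp (γ * t)) := h2.trans (add_le_add_right h4 _)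
        _ = _ := by ring

/-- The sharp cone estimate. -/
theorem IntegralBound.cone (H : LinearTheory φ P LS σ)
    (hf : Continuous fun p : M × E => f p.1 p.2) (hI : IntegralBound φ P LS σ ω a b) (hε : 0 ≤ ε)
    (hlip : ∀ t, 0 ≤ t → ∀ z z', σ (orb φ ω t) (f (orb φ ω t) z - f (orb φ ω t) z') ≤
      ε * maxNorm P (orb φ ω t) (z - z')) (ha : a + ε < γ) (hb : γ < b - ε) {z z' : ℝ → E} {N : ℝ}
    (hz : NonlinearSol φ LS f ω z) (hz' : NonlinearSol φ LS f ω z')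
    (hN : ∀ t, 0 ≤ t → maxNorm P (orb φ ω t) (z t - z' t) ≤ N * Real.exp (γ * t)) :
    ‖z 0 - z' 0 - P ω (z 0 - z' 0)‖ ≤ ε / (b - a - ε) * ‖P ω (z 0 - z' 0)‖ := by
  set w : ℝ → E := fun t => z t - z' t with hw
  set a₀ := ‖P ω (w 0)‖ with ha₀
  have hc : ContinuousOn (fun t => f (orb φ ω t) (z t)) (Ici 0) :=
    continuousOn_nonlinearity φ ω hf (H.contOn_Ici hz)
  have hc' : ContinuousOn (fun t => f (orb φ ω t) (z' t)) (Ici 0) :=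
    continuousOn_nonlinearity φ ω hf (H.contOn_Ici hz')
  obtain ⟨d, hd, hda, hdb⟩ : ∃ d, 0 < d ∧ a + ε + d ≤ γ ∧ γ ≤ b - ε - d :=
    ⟨min (γ - a - ε) (b - ε - γ), lt_min (by linarith) (by linarith),
      by linarith [min_le_left (γ - a - ε) (b - ε - γ)],
      by linarith [min_le_right (γ - a - ε) (b - ε - γ)]⟩
  have h0 : 0 < ε + d := by linarith
  set κ := 1 / (ε + d) with hκ
  have hκa : 1 ≤ κ * (γ - a) := by
    rw [hκ, one_div, ← div_eq_inv_mul, one_le_div h0]; linarith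
  have hκb : 1 ≤ κ * (b - γ) := by
    rw [hκ, one_div, ← div_eq_inv_mul, one_le_div h0]; linarith
  have hκ0 : 0 ≤ κ := by positivity
  have hN0 : 0 ≤ N := by
    have := (maxNorm_nonneg P _ _).trans (hN 0 le_rfl)
    simpa using this
  have hg : 0 < b - a - ε := by linarith
  -- the two estimates under an a priori bound
  have key : ∀ N', 0 ≤ N' → (∀ t, 0 ≤ t → maxNorm P (orb φ ω t) (w t) ≤
      a₀ * Real.exp ((a + ε) * t) + N' * Real.exp (γ * t)) → ∀ t, 0 ≤ t →
      ‖P (orb φ ω t) (w t)‖ ≤ a₀ * Real.exp ((a + ε) * t) + κ * ε * N' * Real.exp (γ * t) ∧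
      ‖w t - P (orb φ ω t) (w t)‖ ≤ ε / (b - a - ε) * a₀ * Real.exp ((a + ε) * t) +
        κ * ε * N' * Real.exp (γ * t) := by
    intro N' hN' hb' t ht
    have hest : ∀ r, t ≤ r → _ := fun r hr => hI 0 le_rfl r w _
      (fun τ => ε * a₀ * Real.exp ((a + ε) * τ) + ε * N' * Real.exp (γ * τ)) (ht.trans hr)
      (by
        rw [orb_zero]
        exact H.sub (ht.trans hr) (hc.mono Icc_subset_Ici_self) (hc'.mono Icc_subset_Ici_self)
          (hz _ (ht.trans hr)) (hz' _ (ht.trans hr)))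
      ((hc.sub hc').mono Icc_subset_Ici_self) (by fun_prop)
      (fun τ hτ => by
        rw [zero_add]
        refine (hlip τ hτ.1 _ _).trans ((mul_le_mul_of_nonneg_left (hb' τ hτ.1) hε).trans_eq ?_)
        ring) t ⟨ht, hr⟩
    simp only [zero_add, orb_zero] at hest
    have eL : ∫ τ in (0 : ℝ)..t, Real.exp (a * (t - τ)) *
        (ε * a₀ * Real.exp ((a + ε) * τ) + ε * N' * Real.exp (γ * τ)) =
        a₀ * ((a + ε - a) * ∫ τ in (0 : ℝ)..t, Real.exp (a * (t - τ)) * Real.exp ((a + ε) * τ)) +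
        ε * N' * ∫ τ in (0 : ℝ)..t, Real.exp (a * (t - τ)) * Real.exp (γ * τ) := by
      rw [← mul_assoc, ← intervalIntegral.integral_const_mul, ← intervalIntegral.integral_const_mul,
        ← intervalIntegral.integral_add (Continuous.intervalIntegrable (by fun_prop) _ _)
          (Continuous.intervalIntegrable (by fun_prop) _ _)]
      congr 1; ext τ; ring
    have eR : ∀ r, ∫ τ in t..r, Real.exp (-b * (τ - t)) *
        (ε * a₀ * Real.exp ((a + ε) * τ) + ε * N' * Real.exp (γ * τ)) =
        ε * a₀ * (∫ τ in t..r, Real.exp (-b * (τ - t)) * Real.exp ((a + ε) * τ)) +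
        ε * N' * ∫ τ in t..r, Real.exp (-b * (τ - t)) * Real.exp (γ * τ) := by
      intro r
      rw [← intervalIntegral.integral_const_mul, ← intervalIntegral.integral_const_mul,
        ← intervalIntegral.integral_add (Continuous.intervalIntegrable (by fun_prop) _ _)
          (Continuous.intervalIntegrable (by fun_prop) _ _)]
      congr 1; ext τ; ring
    have hεN := mul_nonneg hε hN'
    constructor
    · have h1 := (hest t le_rfl).1
      rw [eL, mul_integral_exp_left] at h1
      have h2 := mul_le_mul_of_nonneg_left (integral_exp_left_le (t := t) (by linarith) hκa) hεN
      calc _ ≤ _ := h1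
        _ ≤ Real.exp (a * t) * a₀ + (a₀ * (Real.exp ((a + ε) * t) - Real.exp (a * t)) +
            ε * N' * (κ * Real.exp (γ * t))) := by gcongr
        _ = _ := by ring
    · refine le_of_forall_far_end (μ := b) (γ := γ) (N := N) (by linarith)
        (b := fun r => ‖w r - P (orb φ ω r) (w r)‖)
        (fun r hr => (norm_sub_apply_le_maxNorm P _ _).trans (hN r (ht.trans hr))) (fun r hr => ?_)
      have h1 := (hest r hr).2
      rw [eR] at h1
      have h2 := mul_le_mul_of_nonneg_left (integral_exp_right_le (t := t) (r := r)
        (by linarith) hκb) hεN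
      have h3 := mul_le_mul_of_nonneg_left (integral_exp_right_le (b := b) (γ := a + ε)
        (κ := 1 / (b - a - ε)) (t := t) (r := r) (by linarith)
        (by rw [one_div, ← div_eq_inv_mul, one_le_div hg]; linarith))
        (mul_nonneg hε (norm_nonneg (P ω (w 0))))
      refine h1.trans (add_le_add_right ((add_le_add h3 h2).trans_eq ?_) _)
      rw [ha₀]; ring
  -- The function a₀ e^{(a+ε)t} solves the scalar comparison equation exactly. The excess of the
  -- solution over it improves itself without inhomogeneous term, hence is not positive.
  have hA : ∀ t, 0 ≤ t → maxNorm P (orb φ ω t) (w t) ≤ a₀ * Real.exp ((a + ε) * t) := by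
    intro t ht
    have hkε : κ * ε < 1 := by rw [hκ, one_div, inv_mul_lt_iff₀ h0]; linarith
    have := bound_of_self_improving (ι := Ici (0 : ℝ))
      (m := fun t => maxNorm P (orb φ ω t) (w t) - a₀ * Real.exp ((a + ε) * t))
      (w := fun t => Real.exp (γ * t)) (c := 0) (θ := κ * ε) (mul_nonneg hκ0 hε) hkε le_rfl hN0
      (fun t => by
        have h1 := hN t t.2
        have : 0 ≤ a₀ * Real.exp ((a + ε) * t) := by positivity
        linarith)
      (fun N' hN' hb t => by
        obtain ⟨h1, h2⟩ := key N' hN' (fun t ht => by have := hb ⟨t, ht⟩; simp only at this; linarith)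
          t t.2
        have h3 : ε / (b - a - ε) * a₀ * Real.exp ((a + ε) * t) ≤ 1 * a₀ * Real.exp ((a + ε) * t) := by
          gcongr
          rw [div_le_one hg]; linarith
        have : maxNorm P (orb φ ω t) (w t) ≤ a₀ * Real.exp ((a + ε) * t) +
            κ * ε * N' * Real.exp (γ * t) := max_le h1 (by linarith)
        rw [add_zero]
        linarith) ⟨t, ht⟩
    rw [zero_div, zero_mul] at this
    linarith
  -- With N' = 0 the backward estimate at t = 0 is ε times the integral of e^{-(b-a-ε)τ} over the
  -- half line, which is the cone constant.
  have := (key 0 le_rfl (fun t ht => by simpa using hA t ht) 0 le_rfl).2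
  simpa only [hw, orb_zero, mul_zero, Real.exp_zero, mul_one, zero_mul, add_zero] using this

/-- Pointwise convergence of the defects suffices for equations with integral bounds. -/
theorem IntegralBound.defectStable (hI : IntegralBound φ P LS σ ω a b)
    (hε : 0 ≤ ε) (ha : a + ε < γ) (hb : γ < b - ε) :
    DefectStable φ P LS σ (fun τ => pure τ) ω γ ε := by
  intro zn gn rn N hLS hgc hP0 hzN hrc hrN hσ hconv
  -- A larger weight still inside the window: defects of size e^{γτ} are integrable against
  -- e^{-γ₁τ}, so dominated convergence applies.
  set γ₁ := (γ + (b - ε)) / 2 with hγ₁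
  have hγ : γ < γ₁ := by rw [hγ₁]; linarith
  have hγb : γ₁ < b - ε := by rw [hγ₁]; linarith
  have hN0 : 0 ≤ N := by
    have := (maxNorm_nonneg P _ _).trans (hzN 0 0 le_rfl)
    simpa using this
  obtain ⟨d, hd, hda, hdb⟩ : ∃ d, 0 < d ∧ a + ε + d ≤ γ₁ ∧ γ₁ ≤ b - ε - d :=
    ⟨min (γ₁ - a - ε) (b - ε - γ₁), lt_min (by linarith) (by linarith),
      by linarith [min_le_left (γ₁ - a - ε) (b - ε - γ₁)],
      by linarith [min_le_right (γ₁ - a - ε) (b - ε - γ₁)]⟩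
  have h0 : 0 < ε + d := by linarith
  set κ := 1 / (ε + d) with hκ
  have hκa : 1 ≤ κ * (γ₁ - a) := by
    rw [hκ, one_div, ← div_eq_inv_mul, one_le_div h0]; linarith
  have hκb : 1 ≤ κ * (b - γ₁) := by
    rw [hκ, one_div, ← div_eq_inv_mul, one_le_div h0]; linarith
  have hκ0 : 0 ≤ κ := by positivity
  have hkε : κ * ε < 1 := by rw [hκ, one_div, inv_mul_lt_iff₀ h0]; linarith
  -- The total weighted defect. It enters both components only through a summand I n e^{γ₁t}, since
  -- both kernels are dominated by e^{γ₁(t - τ)} on their domains.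
  set I : ℕ → ℝ := fun n => ∫ τ in Ioi (0 : ℝ), Real.exp (-γ₁ * τ) * rn n τ with hIdef
  have hdom : ∀ n, ∀ τ ∈ Ioi (0 : ℝ), ‖Real.exp (-γ₁ * τ) * rn n τ‖ ≤
      N * Real.exp (-(γ₁ - γ) * τ) := by
    intro n τ hτ
    have hτ0 : 0 ≤ τ := le_of_lt hτ
    rw [Real.norm_of_nonneg (mul_nonneg (Real.exp_pos _).le (hrN n τ hτ0).1)]
    refine (mul_le_mul_of_nonneg_left (hrN n τ hτ0).2 (Real.exp_pos _).le).trans_eq ?_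
    rw [mul_left_comm, ← Real.exp_add]
    congr 2; ring
  have hdomint : IntegrableOn (fun τ => N * Real.exp (-(γ₁ - γ) * τ)) (Ioi 0) :=
    (exp_neg_integrableOn_Ioi 0 (sub_pos.2 hγ)).const_mul N
  have hmeas : ∀ n, AEStronglyMeasurable (fun τ => Real.exp (-γ₁ * τ) * rn n τ)
      (volume.restrict (Ioi 0)) := fun n =>
    (((by fun_prop : Continuous fun τ => Real.exp (-γ₁ * τ)).continuousOn.mul
      ((hrc n).mono Ioi_subset_Ici_self)).aestronglyMeasurable measurableSet_Ioi)
  have hint : ∀ n, IntegrableOn (fun τ => Real.exp (-γ₁ * τ) * rn n τ) (Ioi 0) := fun n =>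
    hdomint.mono' (hmeas n) ((ae_restrict_iff' measurableSet_Ioi).2 (ae_of_all _ (hdom n)))
  have hI0 : Tendsto I atTop (𝓝 0) := by
    have := tendsto_integral_of_dominated_convergence (μ := volume.restrict (Ioi (0 : ℝ)))
      (F := fun n τ => Real.exp (-γ₁ * τ) * rn n τ) (f := fun _ => 0) _ hmeas hdomint
      (fun n => (ae_restrict_iff' measurableSet_Ioi).2 (ae_of_all _ (hdom n)))
      ((ae_restrict_iff' measurableSet_Ioi).2 (ae_of_all _ fun τ hτ => by
        have h1 : Tendsto (fun n : ℕ => (n, τ)) atTop (atTop ×ˢ pure τ) :=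
          tendsto_id.prodMk tendsto_const_pure
        have := ((hconv τ (le_of_lt hτ)).comp h1).const_mul (Real.exp (-γ₁ * τ))
        simpa using this))
    simpa only [integral_zero] using this
  have hpart : ∀ n, ∀ t r, 0 ≤ t → t ≤ r →
      ∫ τ in t..r, Real.exp (-γ₁ * τ) * rn n τ ≤ I n := by
    intro n t r ht htr
    rw [intervalIntegral.integral_of_le htr]
    refine setIntegral_mono_set (hint n) ?_ ?_
    · exact (ae_restrict_iff' measurableSet_Ioi).2 (ae_of_all _ fun τ hτ =>
        mul_nonneg (Real.exp_pos _).le (hrN n τ (le_of_lt hτ)).1)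
    · exact Eventually.of_forall fun τ hτ => lt_of_le_of_lt ht hτ.1
  have hI0' : ∀ n, 0 ≤ I n := fun n => by simpa using hpart n 0 0 le_rfl le_rfl
  have hzN' : ∀ n t, 0 ≤ t → maxNorm P (orb φ ω t) (zn n t) ≤ N * Real.exp (γ₁ * t) :=
    fun n t ht => Adm.growth_mono hγ.le (hzN n) ht
  have key : ∀ n t, 0 ≤ t → maxNorm P (orb φ ω t) (zn n t) ≤
      I n / (1 - κ * ε) * Real.exp (γ₁ * t) := by
    intro n t ht
    refine bound_of_self_improving (ι := Ici (0 : ℝ))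
      (m := fun t => maxNorm P (orb φ ω t) (zn n t))
      (w := fun t => Real.exp (γ₁ * t)) (mul_nonneg hκ0 hε) hkε (hI0' n) hN0
      (fun t => hzN' n t t.2) (fun N' hN' hb' t => ?_) ⟨t, ht⟩
    obtain ⟨t, ht⟩ := t
    have ht : 0 ≤ t := ht
    have hest : ∀ r, t ≤ r → _ := fun r hr => hI 0 le_rfl r (zn n) (gn n)
      (fun τ => ε * N' * Real.exp (γ₁ * τ) + rn n τ) (ht.trans hr)
      (by rw [orb_zero]; exact hLS n r (ht.trans hr))
      ((hgc n).mono Icc_subset_Ici_self)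
      ((by fun_prop : Continuous fun τ => ε * N' * Real.exp (γ₁ * τ)).continuousOn.add
        ((hrc n).mono Icc_subset_Ici_self))
      (fun τ hτ => by
        rw [zero_add]
        refine (hσ n τ hτ.1).trans ?_
        have := mul_le_mul_of_nonneg_left (hb' ⟨τ, hτ.1⟩) hε
        simp only at this
        linarith) t ⟨ht, hr⟩
    simp only [zero_add, orb_zero, hP0, norm_zero, mul_zero] at hest
    have hεN := mul_nonneg hε hN'
    have hri : ∀ {x y : ℝ} (c : ℝ → ℝ), Continuous c → 0 ≤ x → x ≤ y →
        IntervalIntegrable (fun τ => c τ * rn n τ) volume x y := by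
      intro x y c hc hx hxy
      refine ContinuousOn.intervalIntegrable (hc.continuousOn.mul ((hrc n).mono ?_))
      rw [uIcc_of_le hxy]
      exact fun τ hτ => hx.trans hτ.1
    have hX : ‖P (orb φ ω t) (zn n t)‖ ≤ (κ * ε * N' + I n) * Real.exp (γ₁ * t) := by
      refine (hest t le_rfl).1.trans ?_
      simp only [mul_add]
      rw [intervalIntegral.integral_add (Continuous.intervalIntegrable (by fun_prop) _ _)
        (hri _ (by fun_prop) le_rfl ht)]
      simp only [mul_left_comm _ (ε * N'), intervalIntegral.integral_const_mul]
      have h2 := mul_le_mul_of_nonneg_left (integral_exp_left_le (t := t) (by linarith) hκa) hεN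
      have h3 : ∫ τ in (0 : ℝ)..t, Real.exp (a * (t - τ)) * rn n τ ≤
          ∫ τ in (0 : ℝ)..t, Real.exp (γ₁ * t) * (Real.exp (-γ₁ * τ) * rn n τ) := by
        refine intervalIntegral.integral_mono_on ht (hri _ (by fun_prop) le_rfl ht)
          ((hri _ (by fun_prop) le_rfl ht).const_mul _) fun τ hτ => ?_
        rw [← mul_assoc, ← Real.exp_add]
        refine mul_le_mul_of_nonneg_right (Real.exp_le_exp.2 ?_) (hrN n τ hτ.1).1
        nlinarith [hτ.2]
      rw [intervalIntegral.integral_const_mul] at h3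
      have h4 := mul_le_mul_of_nonneg_left (hpart n 0 t le_rfl ht) (Real.exp_pos (γ₁ * t)).le
      linarith
    have hY : ‖zn n t - P (orb φ ω t) (zn n t)‖ ≤ (κ * ε * N' + I n) * Real.exp (γ₁ * t) := by
      refine le_of_forall_far_end (μ := b) (γ := γ₁) (N := N) (by linarith)
        (b := fun r => ‖zn n r - P (orb φ ω r) (zn n r)‖)
        (fun r hr => (norm_sub_apply_le_maxNorm P _ _).trans (hzN' n r (ht.trans hr)))
        (fun r hr => ?_)
      refine (hest r hr).2.trans (add_le_add_right ?_ _)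
      simp only [mul_add]
      rw [intervalIntegral.integral_add (Continuous.intervalIntegrable (by fun_prop) _ _)
        (hri _ (by fun_prop) ht hr)]
      simp only [mul_left_comm _ (ε * N'), intervalIntegral.integral_const_mul]
      have h2 := mul_le_mul_of_nonneg_left
        (integral_exp_right_le (t := t) (r := r) (by linarith) hκb) hεN
      have h3 : ∫ τ in t..r, Real.exp (-b * (τ - t)) * rn n τ ≤
          ∫ τ in t..r, Real.exp (γ₁ * t) * (Real.exp (-γ₁ * τ) * rn n τ) := by
        refine intervalIntegral.integral_mono_on hr (hri _ (by fun_prop) ht hr)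
          ((hri _ (by fun_prop) ht hr).const_mul _) fun τ hτ => ?_
        rw [← mul_assoc, ← Real.exp_add]
        refine mul_le_mul_of_nonneg_right (Real.exp_le_exp.2 ?_) (hrN n τ (ht.trans hτ.1)).1
        nlinarith [hτ.1]
      rw [intervalIntegral.integral_const_mul] at h3
      have h4 := mul_le_mul_of_nonneg_left (hpart n t r ht hr) (Real.exp_pos (γ₁ * t)).le
      linarith
    exact max_le hX hY
  have hl : Tendsto (fun n => I n / (1 - κ * ε)) atTop (𝓝 0) := by
    simpa using hI0.div_const (1 - κ * ε)
  refine squeeze_zero (fun n => norm_nonneg _) (fun n => ?_) hl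
  have := (norm_sub_apply_le_maxNorm P _ _).trans (key n 0 le_rfl)
  simpa [orb_zero] using this

/-- The invariant graph theorem for equations with integral bounds. -/
theorem invariantGraphTheorem_of_integralBound [CompleteSpace E] (H : LinearTheory φ P LS σ)
    (hf : Continuous fun p : M × E => f p.1 p.2) {Sol : M → (ℝ → E) → Prop}
    (hSol : ∀ ω w, Sol ω w ↔ NonlinearSol φ LS f ω w) {μs μu e β : M → ℝ} {c : ℝ} (hc : 1 < c)
    (hI : ∀ ω, IntegralBound φ P LS σ ω (μs ω) (μu ω)) (he : ∀ ω, 0 ≤ e ω)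
    (hlip : ∀ ω t, 0 ≤ t → ∀ z z', σ (orb φ ω t) (f (orb φ ω t) z - f (orb φ ω t) z') ≤
      e ω * maxNorm P (orb φ ω t) (z - z'))
    (hgap : InfPos (fun ω => μu ω - μs ω - (1 + c) * e ω))
    (hβ : ∀ ω, e ω / (μu ω - μs ω - e ω) ≤ β ω ∧ β ω < 1) :
    InvariantGraphTheorem φ P Sol f μs μu e β (∀ ω, ContDiff ℝ 1 (f ω)) True := by
  obtain ⟨d, hd, hgap⟩ := hgap
  -- The assumption c > 1 enters only here, to leave room for e on both sides of the gap.
  have hgap' : ∀ ω, d ≤ μu ω - μs ω - 2 * e ω := fun ω => by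
    have := hgap ω
    nlinarith [he ω]
  have hcone : ∀ γ : M → ℝ, (∀ ω, μs ω + e ω < γ ω) → (∀ ω, γ ω < μu ω - e ω) →
      ∀ ω z z' N, NonlinearSol φ LS f ω z → NonlinearSol φ LS f ω z' →
      (∀ t, 0 ≤ t → maxNorm P (orb φ ω t) (z t - z' t) ≤ N * Real.exp (γ ω * t)) →
      ‖z 0 - z' 0 - P ω (z 0 - z' 0)‖ ≤ β ω * ‖P ω (z 0 - z' 0)‖ := by
    intro γ h1 h2 ω z z' N hz hz' hN
    refine ((hI ω).cone H hf (he ω) (hlip ω) (h1 ω) (h2 ω) hz hz' hN).trans ?_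
    gcongr
    exact (hβ ω).1
  have hweights : ∀ ω γ d', 0 < d' → μs ω + e ω + d' ≤ γ → γ ≤ μu ω - e ω - d' →
      SmoothWeights φ P LS σ f (fun τ => pure τ) (∀ ω, ContDiff ℝ 1 (f ω)) ω γ := by
    intro ω γ d' hd' h1 h2
    refine ⟨_, _, _, (hI ω).adm (he ω) (hlip ω) hd' h1 h2, fun hs =>
      ⟨(hI ω).defectStable (he ω) (by linarith) (by linarith), fun τ _ w => ?_⟩⟩
    -- Defects need to converge only pointwise in time, so continuity of the derivative in the space
    -- variable at a fixed orbit point is enough.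
    rw [pure_prod, tendsto_map'_iff]
    exact ((hs _).continuous_fderiv one_ne_zero).tendsto w
  have hsm : (∀ ω, ContDiff ℝ 1 (f ω)) → ∀ ω, ContDiff ℝ 1 (f ω) := id
  have h𝓕 : ∀ τ : ℝ, 0 ≤ τ → (pure τ : Filter ℝ) ≤ 𝓝[Ici 0] τ := fun τ hτ => pure_le_nhdsWithin hτ
  refine ⟨fun hf0 => ?_, fun hfb hpos => ?_⟩
  -- The midpoint of the gap stays d/2 away from μs + e and from μu - e.
  · refine conclusionI_of H hf hSol (fun ω => (hβ ω).2.le)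
      (hcone (fun ω => (μs ω + μu ω) / 2) ?_ ?_) hsm h𝓕 (fun ω => hweights ω _ (d / 2) ?_ ?_ ?_) hf0
    · intro ω; linarith [hgap' ω]
    · intro ω; linarith [hgap' ω]
    · linarith
    · linarith [hgap' ω]
    · linarith [hgap' ω]
  · obtain ⟨d₁, hd₁, hpos⟩ := hpos
    set d' := min d d₁ / 2 with hd'
    have hd'0 : 0 < d' := by rw [hd']; have := lt_min hd hd₁; linarith
    -- A nonnegative weight in the window; it exists because both μu - μs - 2e and μu - e are
    -- bounded below by positive constants.
    set γ : M → ℝ := fun ω => max (μs ω + e ω) 0 + d' with hγ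
    have hγ1 : ∀ ω, μs ω + e ω + d' ≤ γ ω := fun ω => by
      simp only [hγ]; linarith [le_max_left (μs ω + e ω) 0]
    have hγ2 : ∀ ω, γ ω ≤ μu ω - e ω - d' := fun ω => by
      have h1 : max (μs ω + e ω) 0 ≤ μu ω - e ω - min d d₁ :=
        max_le (by linarith [hgap' ω, min_le_left d d₁]) (by linarith [hpos ω, min_le_right d d₁])
      simp only [hγ]
      linarith
    have hγ0 : ∀ ω, 0 ≤ γ ω := fun ω => by
      simp only [hγ]; linarith [le_max_right (μs ω + e ω) 0]
    refine conclusionII_of H hf hSol (fun ω => (hβ ω).2.le)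
      (hcone γ (fun ω => by linarith [hγ1 ω]) (fun ω => by linarith [hγ2 ω])) hsm h𝓕
      hγ0 (fun ω => hweights ω _ d' hd'0 (hγ1 ω) (hγ2 ω)) hfb (fun h => h.2.2.2.1) (fun _ => ?_)
    -- With κ = 1/(e + d') one has κ / (1 - κe) = 1/d' exactly, uniformly in ω.
    refine ⟨1 / d', fun ω => ⟨γ ω, _, _, _, hγ0 ω,
      (hI ω).adm (he ω) (hlip ω) hd'0 (hγ1 ω) (hγ2 ω), le_of_eq ?_⟩⟩
    have : 0 < e ω + d' := by linarith [he ω]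
    field_simp
    rw [add_sub_cancel_left, div_self hd'0.ne']

end IntegralBound

end InvGraph

noncomputable section

namespace InvGraph

/-! ### Cocycle correspondences with uniform dichotomy -/

section Correspondence

variable {M : Type u} [TopologicalSpace M] {E : Type v} [NormedAddCommGroup E] [NormedSpace ℝ E]
  {φ : Flow ℝ≥0 M}

/-- `T₁(t, ω) P_ω` as an operator on the whole space. -/
def cocX (P : M → E →L[ℝ] E) (T₁ : ∀ (t : ℝ≥0) (ω : M), specX P ω →L[ℝ] specX P (φ t ω))
    (t : ℝ≥0) (ω : M) : E →L[ℝ] E :=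
  (specX P (φ t ω)).subtypeL ∘L T₁ t ω ∘L projX P ω

/-- `S₁(-t, tω) P^c_{tω}` as an operator on the whole space. -/
def cocY (P : M → E →L[ℝ] E) (S₁ : ∀ (t : ℝ≥0) (ω : M), specY P (φ t ω) →L[ℝ] specY P ω)
    (t : ℝ≥0) (ω : M) : E →L[ℝ] E :=
  (specY P ω).subtypeL ∘L S₁ t ω ∘L projY P (φ t ω)

/-- The evolution operator `T₁(t - s, sω) P_{sω}` along the orbit of `ω`. -/
def evoX (P : M → E →L[ℝ] E) (T₁ : ∀ (t : ℝ≥0) (ω : M), specX P ω →L[ℝ] specX P (φ t ω))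
    (ω : M) (t s : ℝ) : E →L[ℝ] E :=
  cocX P T₁ (t - s).toNNReal (orb φ ω s)

/-- The evolution operator `S₁(t - s, sω) P^c_{sω}`, `t ≤ s`, along the orbit of `ω`. -/
def evoY (P : M → E →L[ℝ] E) (S₁ : ∀ (t : ℝ≥0) (ω : M), specY P (φ t ω) →L[ℝ] specY P ω)
    (ω : M) (t s : ℝ) : E →L[ℝ] E :=
  cocY P S₁ (s - t).toNNReal (orb φ ω t)

/-- The linear inhomogeneous integral equation. -/
def IntegralLS (P : M → E →L[ℝ] E)
    (T₁ : ∀ (t : ℝ≥0) (ω : M), specX P ω →L[ℝ] specX P (φ t ω))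
    (S₁ : ∀ (t : ℝ≥0) (ω : M), specY P (φ t ω) →L[ℝ] specY P ω)
    (ω : M) (r : ℝ) (z g : ℝ → E) : Prop :=
  ContinuousOn z (Icc 0 r) ∧
  ∀ t ∈ Icc (0 : ℝ) r,
    P (orb φ ω t) (z t) = cocX P T₁ t.toNNReal ω (z 0) +
      ∫ s in (0 : ℝ)..t, evoX P T₁ ω t s (g s) ∧
    z t - P (orb φ ω t) (z t) = evoY P S₁ ω t r (z r) - ∫ s in t..r, evoY P S₁ ω t s (g s)

variable {P : M → E →L[ℝ] E} {T₁ : ∀ (t : ℝ≥0) (ω : M), specX P ω →L[ℝ] specX P (φ t ω)}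
  {S₁ : ∀ (t : ℝ≥0) (ω : M), specY P (φ t ω) →L[ℝ] specY P ω} {C₁ : ℝ} {μs μu : M → ℝ}

theorem isIntegralSol_iff {f : M → E → E} (ω : M) (w : ℝ → E) :
    IsIntegralSol φ P T₁ S₁ f ω w ↔ NonlinearSol φ (IntegralLS P T₁ S₁) f ω w := Iff.rfl

theorem toNNReal_sub_add_sub {r s t : ℝ} (h1 : r ≤ s) (h2 : s ≤ t) :
    (t - s).toNNReal + (s - r).toNNReal = (t - r).toNNReal := by
  rw [← Real.toNNReal_add (by linarith) (by linarith)]; congr 1; ring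

theorem flow_toNNReal_sub_orb (ω : M) {s t : ℝ} (hs : 0 ≤ s) (hst : s ≤ t) :
    φ (t - s).toNNReal (orb φ ω s) = orb φ ω t := by
  have := orb_orb φ ω hs (sub_nonneg.2 hst)
  rwa [add_sub_cancel] at this

section

variable (hU : UniformDichotomy φ P T₁ S₁ C₁ μs μu)
include hU

theorem cocX_zero (ω : M) (z : E) : cocX P T₁ 0 ω z = P ω z := hU.T_zero ω _

theorem cocY_zero (ω : M) (z : E) : cocY P S₁ 0 ω z = z - P ω z := by
  have h := hU.S_zero ω (projY P (φ 0 ω) z)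
  change ((S₁ 0 ω (projY P (φ 0 ω) z) : specY P ω) : E) = _
  rw [h]
  change z - P (φ 0 ω) z = _
  rw [φ.map_zero_apply]

theorem cocX_add (t s : ℝ≥0) (ω : M) (z : E) :
    cocX P T₁ (t + s) ω z = cocX P T₁ t (φ s ω) (cocX P T₁ s ω z) := by
  have h := hU.T_add t s ω (projX P ω z)
  have e : projX P (φ s ω) (T₁ s ω (projX P ω z) : E) = T₁ s ω (projX P ω z) :=
    Subtype.ext (proj_specX hU.proj _)
  change ((T₁ (t + s) ω (projX P ω z) : specX P (φ (t + s) ω)) : E) =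
    (T₁ t (φ s ω) (projX P (φ s ω) (T₁ s ω (projX P ω z) : E)) : E)
  rw [h, e]

theorem projY_specY (ω : M) (y : specY P ω) : projY P ω (y : E) = y :=
  Subtype.ext (by change (y : E) - P ω y = y; rw [proj_specY hU.proj, sub_zero])

theorem cocY_add (t s : ℝ≥0) (ω : M) (z : E) :
    cocY P S₁ (t + s) ω z = cocY P S₁ s ω (cocY P S₁ t (φ s ω) z) := by
  have h := hU.S_add t s ω z
  change ((S₁ (t + s) ω (projY P (φ (t + s) ω) z) : specY P ω) : E) =
    (S₁ s ω (projY P (φ s ω) (S₁ t (φ s ω) (projY P (φ t (φ s ω)) z) : E)) : E)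
  rw [h, projY_specY hU]

theorem cocX_proj (t : ℝ≥0) (ω : M) (z : E) : cocX P T₁ t ω (P ω z) = cocX P T₁ t ω z := by
  have e : projX P ω (P ω z) = projX P ω z := Subtype.ext (hU.proj ω z)
  simp only [cocX, ContinuousLinearMap.comp_apply, e]

theorem cocY_proj (t : ℝ≥0) (ω : M) (z : E) : cocY P S₁ t ω (P (φ t ω) z) = 0 := by
  have e : projY P (φ t ω) (P (φ t ω) z) = 0 := Subtype.ext (by
    change P (φ t ω) z - P (φ t ω) (P (φ t ω) z) = 0
    rw [hU.proj, sub_self])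
  simp only [cocY, ContinuousLinearMap.comp_apply, e, map_zero]

theorem proj_cocX (t : ℝ≥0) (ω : M) (z : E) :
    P (φ t ω) (cocX P T₁ t ω z) = cocX P T₁ t ω z := proj_specX hU.proj _

theorem proj_cocY (t : ℝ≥0) (ω : M) (z : E) : P ω (cocY P S₁ t ω z) = 0 := proj_specY hU.proj _

theorem norm_cocX_le (t r : ℝ≥0) (ω : M) (z : E) :
    ‖cocX P T₁ t (φ r ω) z‖ ≤ Real.exp (μs ω * t) * ‖P (φ r ω) z‖ := by
  have := (T₁ t (φ r ω)).le_of_opNorm_le (hU.norm_T t r ω) (projX P (φ r ω) z)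
  exact this

theorem norm_cocY_le (t r : ℝ≥0) (ω : M) (z : E) :
    ‖cocY P S₁ t (φ r ω) z‖ ≤ Real.exp (-μu ω * t) * ‖z - P (φ t (φ r ω)) z‖ := by
  have := (S₁ t (φ r ω)).le_of_opNorm_le (hU.norm_S t r ω) (projY P (φ t (φ r ω)) z)
  exact this

theorem evoX_self (ω : M) (t : ℝ) (z : E) : evoX P T₁ ω t t z = P (orb φ ω t) z := by
  rw [evoX, sub_self, Real.toNNReal_zero, cocX_zero hU]

theorem evoY_self (ω : M) (t : ℝ) (z : E) : evoY P S₁ ω t t z = z - P (orb φ ω t) z := by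
  rw [evoY, sub_self, Real.toNNReal_zero, cocY_zero hU]

theorem evoX_comp (ω : M) {r s t : ℝ} (hr : 0 ≤ r) (hrs : r ≤ s) (hst : s ≤ t) (z : E) :
    evoX P T₁ ω t s (evoX P T₁ ω s r z) = evoX P T₁ ω t r z := by
  have := cocX_add hU (t - s).toNNReal (s - r).toNNReal (orb φ ω r) z
  rw [flow_toNNReal_sub_orb ω hr hrs, toNNReal_sub_add_sub hrs hst] at this
  exact this.symm

theorem evoY_comp (ω : M) {r s t : ℝ} (hr : 0 ≤ r) (hrs : r ≤ s) (hst : s ≤ t) (z : E) :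
    evoY P S₁ ω r s (evoY P S₁ ω s t z) = evoY P S₁ ω r t z := by
  have := cocY_add hU (t - s).toNNReal (s - r).toNNReal (orb φ ω r) z
  rw [flow_toNNReal_sub_orb ω hr hrs, toNNReal_sub_add_sub hrs hst] at this
  exact this.symm

theorem evoX_proj (ω : M) (t s : ℝ) (z : E) :
    evoX P T₁ ω t s (P (orb φ ω s) z) = evoX P T₁ ω t s z := cocX_proj hU _ _ _

theorem evoY_proj (ω : M) {t s : ℝ} (ht : 0 ≤ t) (hts : t ≤ s) (z : E) :
    evoY P S₁ ω t s (P (orb φ ω s) z) = 0 := by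
  have := cocY_proj hU (s - t).toNNReal (orb φ ω t) z
  rwa [flow_toNNReal_sub_orb ω ht hts] at this

theorem evoY_sub_proj (ω : M) {t s : ℝ} (ht : 0 ≤ t) (hts : t ≤ s) (z : E) :
    evoY P S₁ ω t s (z - P (orb φ ω s) z) = evoY P S₁ ω t s z := by
  rw [map_sub, evoY_proj hU ω ht hts, sub_zero]

theorem proj_evoX (ω : M) {t s : ℝ} (hs : 0 ≤ s) (hst : s ≤ t) (z : E) :
    P (orb φ ω t) (evoX P T₁ ω t s z) = evoX P T₁ ω t s z := by
  have := proj_cocX hU (t - s).toNNReal (orb φ ω s) z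
  rwa [flow_toNNReal_sub_orb ω hs hst] at this

theorem proj_evoY (ω : M) (t s : ℝ) (z : E) : P (orb φ ω t) (evoY P S₁ ω t s z) = 0 :=
  proj_cocY hU _ _ _

theorem evoX_zero_right (ω : M) (t : ℝ) (z : E) :
    evoX P T₁ ω t 0 z = cocX P T₁ t.toNNReal ω z := by
  rw [evoX, sub_zero, orb_zero]

theorem evoX_orb (ω : M) {a t s : ℝ} (ha : 0 ≤ a) (hs : 0 ≤ s) :
    evoX P T₁ (orb φ ω a) t s = evoX P T₁ ω (a + t) (a + s) := by
  rw [evoX, evoX, orb_orb φ ω ha hs, add_sub_add_left_eq_sub]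

theorem evoY_orb (ω : M) {a t s : ℝ} (ha : 0 ≤ a) (ht : 0 ≤ t) :
    evoY P S₁ (orb φ ω a) t s = evoY P S₁ ω (a + t) (a + s) := by
  rw [evoY, evoY, orb_orb φ ω ha ht, add_sub_add_left_eq_sub]

theorem continuous_evoX (ω : M) :
    Continuous fun q : ℝ × ℝ × E => evoX P T₁ ω q.1 q.2.1 q.2.2 := by
  have h1 : Continuous fun q : ℝ × ℝ × E => ((q.1 - q.2.1).toNNReal, orb φ ω q.2.1, q.2.2) :=
    (continuous_real_toNNReal.comp (by fun_prop)).prodMk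
      (((continuous_orb φ ω).comp (by fun_prop)).prodMk (by fun_prop))
  exact hU.T_cont.comp h1

theorem continuous_evoY (ω : M) :
    Continuous fun q : ℝ × ℝ × E => evoY P S₁ ω q.1 q.2.1 q.2.2 := by
  have h1 : Continuous fun q : ℝ × ℝ × E => ((q.2.1 - q.1).toNNReal, orb φ ω q.1, q.2.2) :=
    (continuous_real_toNNReal.comp (by fun_prop)).prodMk
      (((continuous_orb φ ω).comp (by fun_prop)).prodMk (by fun_prop))
  exact hU.S_cont.comp h1

theorem continuousOn_evoX (ω : M) (t : ℝ) {g : ℝ → E} {K : Set ℝ} (hg : ContinuousOn g K) :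
    ContinuousOn (fun s => evoX P T₁ ω t s (g s)) K :=
  Continuous.comp_continuousOn (f := fun s => ((t, s, g s) : ℝ × ℝ × E))
    (g := fun q : ℝ × ℝ × E => evoX P T₁ ω q.1 q.2.1 q.2.2) (continuous_evoX hU ω)
    (continuousOn_const.prodMk (continuousOn_id.prodMk hg))

theorem continuousOn_evoY (ω : M) (t : ℝ) {g : ℝ → E} {K : Set ℝ} (hg : ContinuousOn g K) :
    ContinuousOn (fun s => evoY P S₁ ω t s (g s)) K :=
  Continuous.comp_continuousOn (f := fun s => ((t, s, g s) : ℝ × ℝ × E))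
    (g := fun q : ℝ × ℝ × E => evoY P S₁ ω q.1 q.2.1 q.2.2) (continuous_evoY hU ω)
    (continuousOn_const.prodMk (continuousOn_id.prodMk hg))

theorem intervalIntegrable_evoX (ω : M) (t : ℝ) {g : ℝ → E} {a b r : ℝ}
    (hg : ContinuousOn g (Icc 0 r)) (ha : 0 ≤ a) (hab : a ≤ b) (hb : b ≤ r) :
    IntervalIntegrable (fun s => evoX P T₁ ω t s (g s)) volume a b := by
  refine (continuousOn_evoX hU ω t (hg.mono ?_)).intervalIntegrable
  rw [uIcc_of_le hab]; exact Icc_subset_Icc ha hb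

theorem intervalIntegrable_evoY (ω : M) (t : ℝ) {g : ℝ → E} {a b r : ℝ}
    (hg : ContinuousOn g (Icc 0 r)) (ha : 0 ≤ a) (hab : a ≤ b) (hb : b ≤ r) :
    IntervalIntegrable (fun s => evoY P S₁ ω t s (g s)) volume a b := by
  refine (continuousOn_evoY hU ω t (hg.mono ?_)).intervalIntegrable
  rw [uIcc_of_le hab]; exact Icc_subset_Icc ha hb

theorem norm_evoX_le (ω : M) {a t s : ℝ} (ha : 0 ≤ a) (hs : 0 ≤ s) (hst : s ≤ t) (z : E) :
    ‖evoX P T₁ (orb φ ω a) t s z‖ ≤ Real.exp (μs ω * (t - s)) * ‖P (orb φ ω (a + s)) z‖ := by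
  have := norm_cocX_le hU (t - s).toNNReal (a + s).toNNReal ω z
  rw [Real.coe_toNNReal _ (sub_nonneg.2 hst)] at this
  rw [evoX, orb_orb φ ω ha hs]
  exact this

theorem norm_evoY_le (ω : M) {a t s : ℝ} (ha : 0 ≤ a) (ht : 0 ≤ t) (hts : t ≤ s) (z : E) :
    ‖evoY P S₁ (orb φ ω a) t s z‖ ≤
      Real.exp (-μu ω * (s - t)) * ‖z - P (orb φ ω (a + s)) z‖ := by
  have := norm_cocY_le hU (s - t).toNNReal (a + t).toNNReal ω z
  rw [Real.coe_toNNReal _ (sub_nonneg.2 hts)] at this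
  have e : φ (s - t).toNNReal (orb φ ω (a + t)) = orb φ ω (a + s) := by
    have := flow_toNNReal_sub_orb (φ := φ) ω (add_nonneg ha ht) (add_le_add_right hts a)
    rwa [add_sub_add_left_eq_sub] at this
  rw [← e, evoY, orb_orb φ ω ha ht]
  exact this

/-- The two-point form of the integral equation in `X`. -/
theorem IntegralLS.two_point_X [CompleteSpace E] {ω : M} {r : ℝ} {z g : ℝ → E}
    (h : IntegralLS P T₁ S₁ ω r z g)
    (hg : ContinuousOn g (Icc 0 r)) {s t : ℝ} (hs : 0 ≤ s) (hst : s ≤ t) (ht : t ≤ r) :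
    P (orb φ ω t) (z t) = evoX P T₁ ω t s (z s) + ∫ τ in s..t, evoX P T₁ ω t τ (g τ) := by
  have h1 := (h.2 t ⟨hs.trans hst, ht⟩).1
  have h2 := (h.2 s ⟨hs, hst.trans ht⟩).1
  rw [← evoX_proj hU, h2, h1, ← evoX_zero_right hU, ← evoX_zero_right hU, map_add,
    evoX_comp hU ω le_rfl hs hst,
    ← ContinuousLinearMap.intervalIntegral_comp_comm _
      (intervalIntegrable_evoX hU ω s hg le_rfl hs (hst.trans ht)), add_assoc]
  congr 1
  rw [← intervalIntegral.integral_add_adjacent_intervals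
    (intervalIntegrable_evoX hU ω t hg le_rfl hs (hst.trans ht))
    (intervalIntegrable_evoX hU ω t hg hs hst ht)]
  congr 1
  refine intervalIntegral.integral_congr fun τ hτ => ?_
  rw [uIcc_of_le hs] at hτ
  exact (evoX_comp hU ω hτ.1 hτ.2 hst _).symm

/-- The two-point form of the integral equation in `Y`. -/
theorem IntegralLS.two_point_Y [CompleteSpace E] {ω : M} {r : ℝ} {z g : ℝ → E}
    (h : IntegralLS P T₁ S₁ ω r z g)
    (hg : ContinuousOn g (Icc 0 r)) {s t : ℝ} (hs : 0 ≤ s) (hst : s ≤ t) (ht : t ≤ r) :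
    z s - P (orb φ ω s) (z s) = evoY P S₁ ω s t (z t) - ∫ τ in s..t, evoY P S₁ ω s τ (g τ) := by
  have h1 := (h.2 s ⟨hs, hst.trans ht⟩).2
  have h2 := (h.2 t ⟨hs.trans hst, ht⟩).2
  have e : ∫ τ in t..r, evoY P S₁ ω s t (evoY P S₁ ω t τ (g τ)) =
      ∫ τ in t..r, evoY P S₁ ω s τ (g τ) := by
    refine intervalIntegral.integral_congr fun τ hτ => ?_
    rw [uIcc_of_le ht] at hτ
    exact evoY_comp hU ω hs hst hτ.1 _
  rw [← evoY_sub_proj hU ω hs hst (z t), h2, h1, map_sub, evoY_comp hU ω hs hst ht,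
    ← ContinuousLinearMap.intervalIntegral_comp_comm _
      (intervalIntegrable_evoY hU ω t hg (hs.trans hst) ht le_rfl), e,
    ← intervalIntegral.integral_add_adjacent_intervals
    (intervalIntegrable_evoY hU ω s hg hs hst ht)
    (intervalIntegrable_evoY hU ω s hg (hs.trans hst) ht le_rfl)]
  abel

/-- The solution of the integral equation with `P_ω z(0) = P_ω x` and `P^c_{rω} z(r) = 0`. -/
def forcedSol (P : M → E →L[ℝ] E)
    (T₁ : ∀ (t : ℝ≥0) (ω : M), specX P ω →L[ℝ] specX P (φ t ω))
    (S₁ : ∀ (t : ℝ≥0) (ω : M), specY P (φ t ω) →L[ℝ] specY P ω)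
    (ω : M) (r : ℝ) (g : ℝ → E) (x : E) (t : ℝ) : E :=
  evoX P T₁ ω t 0 x + (∫ s in (0 : ℝ)..t, evoX P T₁ ω t s (g s)) -
    ∫ s in t..r, evoY P S₁ ω t s (g s)

theorem continuous_evoX_uncurry (ω : M) {g : ℝ → E} (hg : Continuous g) :
    Continuous (Function.uncurry fun t s => evoX P T₁ ω t s (g s)) :=
  Continuous.comp (f := fun p : ℝ × ℝ => ((p.1, p.2, g p.2) : ℝ × ℝ × E))
    (g := fun q : ℝ × ℝ × E => evoX P T₁ ω q.1 q.2.1 q.2.2) (continuous_evoX hU ω)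
    (continuous_fst.prodMk (continuous_snd.prodMk (hg.comp continuous_snd)))

theorem continuous_evoY_uncurry (ω : M) {g : ℝ → E} (hg : Continuous g) :
    Continuous (Function.uncurry fun t s => evoY P S₁ ω t s (g s)) :=
  Continuous.comp (f := fun p : ℝ × ℝ => ((p.1, p.2, g p.2) : ℝ × ℝ × E))
    (g := fun q : ℝ × ℝ × E => evoY P S₁ ω q.1 q.2.1 q.2.2) (continuous_evoY hU ω)
    (continuous_fst.prodMk (continuous_snd.prodMk (hg.comp continuous_snd)))

theorem continuous_forcedSol [CompleteSpace E] (ω : M) (r : ℝ) {g : ℝ → E}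
    (hg : Continuous g) (x : E) : Continuous (forcedSol P T₁ S₁ ω r g x) := by
  have h1 : Continuous fun t : ℝ => evoX P T₁ ω t 0 x :=
    Continuous.comp (f := fun t : ℝ => ((t, 0, x) : ℝ × ℝ × E))
      (g := fun q : ℝ × ℝ × E => evoX P T₁ ω q.1 q.2.1 q.2.2) (continuous_evoX hU ω)
      (by fun_prop)
  have h2 : Continuous fun t : ℝ => ∫ s in (0 : ℝ)..t, evoX P T₁ ω t s (g s) :=
    intervalIntegral.continuous_parametric_intervalIntegral_of_continuous
      (continuous_evoX_uncurry hU ω hg) continuous_id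
  have h3 : Continuous fun t : ℝ => ∫ s in r..t, evoY P S₁ ω t s (g s) :=
    intervalIntegral.continuous_parametric_intervalIntegral_of_continuous
      (continuous_evoY_uncurry hU ω hg) continuous_id
  have h4 : forcedSol P T₁ S₁ ω r g x = fun t => (evoX P T₁ ω t 0 x +
      ∫ s in (0 : ℝ)..t, evoX P T₁ ω t s (g s)) + ∫ s in r..t, evoY P S₁ ω t s (g s) := by
    ext t
    -- Reversing the second integral puts the variable endpoint on top, where continuity of
    -- parametric integrals applies.
    rw [forcedSol, intervalIntegral.integral_symm r t, sub_neg_eq_add]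
  rw [h4]
  exact (h1.add h2).add h3

theorem proj_forcedSol [CompleteSpace E] (ω : M) {r t : ℝ} (ht : t ∈ Icc 0 r) {g : ℝ → E}
    (hg : Continuous g) (x : E) : P (orb φ ω t) (forcedSol P T₁ S₁ ω r g x t) =
      evoX P T₁ ω t 0 x + ∫ s in (0 : ℝ)..t, evoX P T₁ ω t s (g s) := by
  have hgr : ContinuousOn g (Icc 0 r) := hg.continuousOn
  rw [forcedSol, map_sub, map_add, proj_evoX hU ω le_rfl ht.1,
    ← ContinuousLinearMap.intervalIntegral_comp_comm _
      (intervalIntegrable_evoX hU ω t hgr le_rfl ht.1 ht.2),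
    ← ContinuousLinearMap.intervalIntegral_comp_comm _
      (intervalIntegrable_evoY hU ω t hgr ht.1 ht.2 le_rfl),
    intervalIntegral.integral_congr (g := fun s => evoX P T₁ ω t s (g s)) (fun s hs => ?_),
    intervalIntegral.integral_congr (a := t) (g := fun _ => (0 : E)) (fun s hs => ?_)]
  · simp
  · exact proj_evoY hU ω t s _
  · rw [uIcc_of_le ht.1] at hs
    exact proj_evoX hU ω hs.1 hs.2 _

/-- The candidate has X-part P x at 0 and Y-part 0 at r. Its two components are the two lines of the
variation of constants formula; the boundary terms are put in the required form by the cocycle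
property. -/
theorem integralLS_forcedSol [CompleteSpace E] (ω : M) {r : ℝ} (hr : 0 ≤ r) {g : ℝ → E}
    (hg : Continuous g) (x : E) : IntegralLS P T₁ S₁ ω r (forcedSol P T₁ S₁ ω r g x) g := by
  refine ⟨(continuous_forcedSol hU ω r hg x).continuousOn, fun t ht => ?_⟩
  have e1 := fun {t : ℝ} (ht : t ∈ Icc 0 r) => proj_forcedSol hU ω ht hg x
  constructor
  · rw [e1 ht, ← evoX_zero_right hU]
    congr 1
    have h0 := e1 ⟨le_rfl, hr⟩
    rw [intervalIntegral.integral_same, add_zero] at h0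
    rw [← evoX_proj hU ω t 0 (forcedSol P T₁ S₁ ω r g x 0), h0, evoX_comp hU ω le_rfl le_rfl ht.1]
  · have h1 := evoY_sub_proj hU ω ht.1 ht.2 (forcedSol P T₁ S₁ ω r g x r)
    rw [e1 ⟨hr, le_rfl⟩] at h1
    rw [e1 ht, ← h1]
    simp [forcedSol]

theorem integralLS_congr {ω : M} {r : ℝ} {z z' g g' : ℝ → E} (hr : 0 ≤ r)
    (hz : ∀ t ∈ Icc 0 r, z t = z' t) (hg : ∀ t ∈ Icc 0 r, g t = g' t)
    (h : IntegralLS P T₁ S₁ ω r z g) : IntegralLS P T₁ S₁ ω r z' g' := by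
  refine ⟨h.1.congr fun t ht => (hz t ht).symm, fun t ht => ?_⟩
  rw [← hz t ht, ← hz 0 ⟨le_rfl, hr⟩, ← hz r ⟨hr, le_rfl⟩]
  constructor
  · rw [(h.2 t ht).1]
    congr 1
    refine intervalIntegral.integral_congr fun s hs => ?_
    rw [uIcc_of_le ht.1] at hs
    simp only [hg s ⟨hs.1, hs.2.trans ht.2⟩]
  · rw [(h.2 t ht).2]
    congr 1
    refine intervalIntegral.integral_congr fun s hs => ?_
    rw [uIcc_of_le ht.2] at hs
    simp only [hg s ⟨ht.1.trans hs.1, hs.2⟩]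

/-- Restriction and time shift are the two-point forms of the equation, and solvability is an
explicit formula. Forcing is measured in the max norm, so the projections cost no constant. -/
theorem linearTheory_integralLS [CompleteSpace E] :
    LinearTheory φ P (IntegralLS P T₁ S₁) (maxNorm P) where
  proj := hU.proj
  proj_cont := hU.proj_cont
  contOn h := h.1
  congr hr hz hg h := integralLS_congr hU hr hz hg h
  sub {ω r z z' g g'} hr hg hg' h h' := by
    refine ⟨h.1.sub h'.1, fun t ht => ?_⟩
    have e1 := intervalIntegral.integral_sub (intervalIntegrable_evoX hU ω t hg le_rfl ht.1 ht.2)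
      (intervalIntegrable_evoX hU ω t hg' le_rfl ht.1 ht.2)
    have e2 := intervalIntegral.integral_sub (intervalIntegrable_evoY hU ω t hg ht.1 ht.2 le_rfl)
      (intervalIntegrable_evoY hU ω t hg' ht.1 ht.2 le_rfl)
    simp only [map_sub]
    rw [e1, e2]
    constructor
    · rw [(h.2 t ht).1, (h'.2 t ht).1]; abel
    · rw [sub_sub_sub_comm, (h.2 t ht).2, (h'.2 t ht).2]; abel
  smul {ω r z g} c hr h := by
    refine ⟨h.1.const_smul c, fun t ht => ?_⟩
    simp only [map_smul, intervalIntegral.integral_smul]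
    rw [← smul_sub, (h.2 t ht).2, (h.2 t ht).1, smul_add, smul_sub]
    exact ⟨rfl, rfl⟩
  -- The X-equation is unchanged on a shorter interval; in the Y-equation the boundary value moves
  -- from r to r'.
  mono {ω r r' z g} hr' hrr' hg h := by
    refine ⟨h.1.mono (Icc_subset_Icc_right hrr'), fun t ht => ⟨(h.2 t ⟨ht.1, ht.2.trans hrr'⟩).1, ?_⟩⟩
    exact IntegralLS.two_point_Y hU h hg ht.1 ht.2 hrr'
  shift {ω s r z g} hs hr hg h := by
    have hsub : ∀ t ∈ Icc 0 r, s + t ∈ Icc 0 (s + r) := fun t ht =>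
      ⟨add_nonneg hs ht.1, by linarith [ht.2]⟩
    refine ⟨h.1.comp (by fun_prop) hsub, fun t ht => ⟨?_, ?_⟩⟩
    · have := IntegralLS.two_point_X hU h hg (s := s) (t := s + t) hs (by linarith [ht.1])
        (by linarith [ht.2])
      rw [orb_orb φ ω hs ht.1, this, ← evoX_zero_right hU, evoX_orb hU ω hs le_rfl, add_zero]
      simp only [add_zero]
      congr 1
      have e := intervalIntegral.integral_comp_add_left
        (f := fun τ => evoX P T₁ ω (s + t) τ (g τ)) (a := 0) (b := t) s
      rw [add_zero] at e
      rw [← e]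
      refine intervalIntegral.integral_congr fun τ hτ => ?_
      rw [uIcc_of_le ht.1] at hτ
      simp only [evoX_orb hU ω hs hτ.1]
    · have := IntegralLS.two_point_Y hU h hg (s := s + t) (t := s + r) (add_nonneg hs ht.1)
        (by linarith [ht.2]) le_rfl
      rw [orb_orb φ ω hs ht.1, this, evoY_orb hU ω hs ht.1]
      congr 1
      have e := intervalIntegral.integral_comp_add_left
        (f := fun τ => evoY P S₁ ω (s + t) τ (g τ)) (a := t) (b := r) s
      rw [← e]
      refine intervalIntegral.integral_congr fun τ hτ => ?_
      simp only [evoY_orb hU ω hs ht.1]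
  limit {ω r g zn z} hr _ hzn hlim := by
    refine ⟨hlim.continuousOn (hzn.mono fun n h => h.1).frequently, fun t ht => ?_⟩
    have hl : ∀ t ∈ Icc 0 r, Tendsto (fun n => zn n t) atTop (𝓝 (z t)) := fun t ht =>
      hlim.tendsto_at ht
    have hPt := ((P (orb φ ω t)).continuous.tendsto _).comp (hl t ht)
    constructor
    · refine tendsto_nhds_unique hPt ((((cocX P T₁ t.toNNReal ω).continuous.tendsto _).comp
        (hl 0 ⟨le_rfl, hr⟩)).add_const _ |>.congr' ?_)
      filter_upwards [hzn] with n hn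
      exact ((hn.2 t ht).1).symm
    · refine tendsto_nhds_unique ((hl t ht).sub hPt) ((((evoY P S₁ ω t r).continuous.tendsto _).comp
        (hl r ⟨hr, le_rfl⟩)).sub_const _ |>.congr' ?_)
      filter_upwards [hzn] with n hn
      exact ((hn.2 t ht).2).symm
  solve {ω r g} hr hg x := by
    set g' : ℝ → E := IccExtend hr ((Icc 0 r).domRestrict g) with hg'
    have hg'c : Continuous g' := (continuousOn_iff_continuous_domRestrict.1 hg).Icc_extend'
    have hgg' : ∀ t ∈ Icc 0 r, g' t = g t := fun t ht => by
      rw [hg', IccExtend_of_mem hr _ ht]; rfl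
    have h := integralLS_forcedSol hU ω hr hg'c x
    refine ⟨_, integralLS_congr hU hr (fun _ _ => rfl) hgg' h, ?_, ?_⟩
    · have := proj_forcedSol hU ω ⟨le_rfl, hr⟩ hg'c x
      rwa [intervalIntegral.integral_same, add_zero, evoX_self hU, orb_zero] at this
    · have := proj_forcedSol hU ω ⟨hr, le_rfl⟩ hg'c x
      rw [this, forcedSol, intervalIntegral.integral_same, sub_zero]
  size_add := maxNorm_add_le P
  size_smul := maxNorm_smul P
  size_le := ⟨C₁, hU.C_pos.le, fun ω u => max_le ((P ω).le_of_opNorm_le (hU.norm_P ω) u)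
    ((ContinuousLinearMap.id ℝ E - P ω).le_of_opNorm_le (hU.norm_Pc ω) u)⟩
  size_cont := continuous_maxNorm hU.proj_cont

/-- The operators act on the components already split, so their rates appear with constant one. -/
theorem integralBound_integralLS [CompleteSpace E] (ω : M) :
    IntegralBound φ P (IntegralLS P T₁ S₁) (maxNorm P) ω (μs ω) (μu ω) := by
  intro s hs r z g ρ hr hz hg hρ hgρ t ht
  constructor
  · have h1 := (hz.2 t ht).1
    rw [orb_orb φ ω hs ht.1, ← evoX_zero_right hU] at h1
    rw [h1]
    refine (norm_add_le _ _).trans (add_le_add ?_ ?_)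
    · simpa using norm_evoX_le hU ω hs le_rfl ht.1 (z 0)
    · refine intervalIntegral.norm_integral_le_of_norm_le ht.1 (ae_of_all _ fun τ hτ => ?_)
        (ContinuousOn.intervalIntegrable ?_)
      · refine (norm_evoX_le hU ω hs hτ.1.le hτ.2 (g τ)).trans ?_
        gcongr
        exact (norm_apply_le_maxNorm P _ _).trans (hgρ τ ⟨hτ.1.le, hτ.2.trans ht.2⟩)
      · rw [uIcc_of_le ht.1]
        exact (by fun_prop : Continuous fun τ => Real.exp (μs ω * (t - τ))).continuousOn.mul
          (hρ.mono (Icc_subset_Icc_right ht.2))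
  · have h1 := (hz.2 t ht).2
    rw [orb_orb φ ω hs ht.1] at h1
    rw [h1]
    refine (norm_sub_le _ _).trans (add_le_add ?_ ?_)
    · exact norm_evoY_le hU ω hs ht.1 ht.2 (z r)
    · refine intervalIntegral.norm_integral_le_of_norm_le ht.2 (ae_of_all _ fun τ hτ => ?_)
        (ContinuousOn.intervalIntegrable ?_)
      · refine (norm_evoY_le hU ω hs ht.1 hτ.1.le (g τ)).trans ?_
        gcongr
        exact (norm_sub_apply_le_maxNorm P _ _).trans (hgρ τ ⟨ht.1.trans hτ.1.le, hτ.2⟩)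
      · rw [uIcc_of_le ht.2]
        exact (by fun_prop : Continuous fun τ => Real.exp (-μu ω * (τ - t))).continuousOn.mul
          (hρ.mono (Icc_subset_Icc_left ht.1))

end

end Correspondence

end InvGraph

end

noncomputable section

namespace InvGraph

/-! ### Lipschitz constants -/

section Lip

/-- The infimum is itself a Lipschitz constant. For d ≠ 0 one divides; for d = 0 some finite
constant must exist, which is the role of `hS`. -/
theorem le_sInf_mul {S : Set ℝ≥0∞} {a d : ℝ≥0∞} (hd : d ≠ ⊤) (hS : sInf S < ⊤)
    (h : ∀ K ∈ S, a ≤ K * d) : a ≤ sInf S * d := by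
  rcases eq_or_ne d 0 with rfl | h0
  · obtain ⟨K, hK, -⟩ := sInf_lt_iff.1 hS
    simpa using h K hK
  · exact (ENNReal.div_le_iff h0 hd).1 (le_sInf fun K hK => (ENNReal.div_le_iff h0 hd).2 (h K hK))

theorem le_toReal_mul_of_ofReal_le {a d : ℝ} {K L : ℝ≥0∞} (hd : 0 ≤ d) (hKL : K ≤ L) (hL : L < ⊤)
    (h : ENNReal.ofReal a ≤ K * ENNReal.ofReal d) : a ≤ L.toReal * d := by
  have h1 : ENNReal.ofReal a ≤ ENNReal.ofReal (L.toReal * d) := by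
    rw [ENNReal.ofReal_mul ENNReal.toReal_nonneg, ENNReal.ofReal_toReal hL.ne]
    exact h.trans (by gcongr)
  exact (ENNReal.ofReal_le_ofReal_iff (mul_nonneg ENNReal.toReal_nonneg hd)).1 h1

variable {M : Type u} [TopologicalSpace M] {E F : Type v} [NormedAddCommGroup E] [NormedSpace ℝ E]
  [NormedAddCommGroup F] {φ : Flow ℝ≥0 M}

theorem eps_nonneg (f : M → E → F) (ω : M) : 0 ≤ eps φ f ω := ENNReal.toReal_nonneg

theorem norm_sub_le_eps {f : M → E → F} (hf : CondF φ f) (ω : M) (t : ℝ) (z z' : E) :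
    ‖f (orb φ ω t) z - f (orb φ ω t) z'‖ ≤ eps φ f ω * ‖z - z'‖ := by
  have h1 : lipConst (f (orb φ ω t)) ≤ lipSup φ f ω :=
    le_iSup (fun t : ℝ≥0 => lipConst (f (φ t ω))) t.toNNReal
  refine le_toReal_mul_of_ofReal_le (norm_nonneg _) h1 (hf.finite ω) ?_
  refine le_sInf_mul ENNReal.ofReal_ne_top (h1.trans_lt (hf.finite ω)) fun K hK => ?_
  have := hK z z'
  rwa [edist_dist, edist_dist, dist_eq_norm, dist_eq_norm] at this

theorem maxNorm_le_mul_norm {P : M → E →L[ℝ] E} {C₁ : ℝ} (h : ∀ ω, ‖P ω‖ ≤ C₁)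
    (h' : ∀ ω, ‖ContinuousLinearMap.id ℝ E - P ω‖ ≤ C₁) (ω : M) (z : E) :
    maxNorm P ω z ≤ C₁ * ‖z‖ :=
  max_le ((P ω).le_of_opNorm_le (h ω) z)
    ((ContinuousLinearMap.id ℝ E - P ω).le_of_opNorm_le (h' ω) z)

/-- Origin of ε' = 2C₁ε: C₁ pays for splitting the value of f, and 2 for recombining its argument.
-/
theorem mul_norm_sub_le_maxNorm {f : M → E → F} (hf : CondF φ f) {C₁ : ℝ} (hC : 0 ≤ C₁)
    (P : M → E →L[ℝ] E) (ω : M) (t : ℝ) (z z' : E) :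
    C₁ * ‖f (orb φ ω t) z - f (orb φ ω t) z'‖ ≤
      2 * C₁ * eps φ f ω * maxNorm P (orb φ ω t) (z - z') := by
  calc C₁ * ‖f (orb φ ω t) z - f (orb φ ω t) z'‖
      ≤ C₁ * (eps φ f ω * (2 * maxNorm P (orb φ ω t) (z - z'))) := by
        gcongr
        refine (norm_sub_le_eps hf ω t z z').trans ?_
        gcongr
        · exact eps_nonneg f ω
        · exact norm_le_two_mul_maxNorm P _ _
    _ = _ := by ring

theorem maxNorm_sub_le_epsMax {P : M → E →L[ℝ] E} {C₁ : ℝ} (h : ∀ ω, ‖P ω‖ ≤ C₁)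
    (h' : ∀ ω, ‖ContinuousLinearMap.id ℝ E - P ω‖ ≤ C₁) (hC : 0 ≤ C₁) {f : M → E → E}
    (hf : CondF φ f) (ω : M) (t : ℝ) (z z' : E) :
    maxNorm P (orb φ ω t) (f (orb φ ω t) z - f (orb φ ω t) z') ≤
      epsMax φ P f ω * maxNorm P (orb φ ω t) (z - z') := by
  set L := ⨆ t : ℝ≥0, lipConstMax P (φ t ω) (f (φ t ω)) with hL
  -- Finiteness is essential, since `toReal` would turn an infinite supremum into 0. It follows from
  -- the bound 2C₁ε.
  have hLt : L < ⊤ := by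
    refine (iSup_le fun s => ?_ : L ≤ ENNReal.ofReal (2 * C₁ * eps φ f ω)).trans_lt
      ENNReal.ofReal_lt_top
    refine sInf_le fun x y => ?_
    rw [← ENNReal.ofReal_mul (by have := eps_nonneg (φ := φ) f ω; positivity)]
    refine ENNReal.ofReal_le_ofReal ?_
    have := (maxNorm_le_mul_norm h h' (orb φ ω s) _).trans
      (mul_norm_sub_le_maxNorm hf hC P ω (s : ℝ) x y)
    rwa [orb_coe] at this
  have h1 : lipConstMax P (orb φ ω t) (f (orb φ ω t)) ≤ L :=
    le_iSup (fun t : ℝ≥0 => lipConstMax P (φ t ω) (f (φ t ω))) t.toNNReal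
  refine le_toReal_mul_of_ofReal_le (maxNorm_nonneg P _ _) h1 hLt ?_
  exact le_sInf_mul ENNReal.ofReal_ne_top (h1.trans_lt hLt) fun K hK => hK z z'

end Lip

/-- The invariant graph theorem for the integral equation. -/
theorem invariantGraphTheorem_integral {M : Type u} [TopologicalSpace M] {E : Type v}
    [NormedAddCommGroup E] [NormedSpace ℝ E] [CompleteSpace E] {φ : Flow ℝ≥0 M}
    {P : M → E →L[ℝ] E} {T₁ : ∀ (t : ℝ≥0) (ω : M), specX P ω →L[ℝ] specX P (φ t ω)}
    {S₁ : ∀ (t : ℝ≥0) (ω : M), specY P (φ t ω) →L[ℝ] specY P ω} {C₁ c : ℝ} {μs μu : M → ℝ}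
    (hc : 1 < c) (hU : UniformDichotomy φ P T₁ S₁ C₁ μs μu) {f : M → E → E} (hf : CondF φ f)
    {β : M → ℝ} (hgap : InfPos (fun ω => μu ω - μs ω - (1 + c) * epsMax φ P f ω))
    (hβ : ∀ ω, epsMax φ P f ω / (μu ω - μs ω - epsMax φ P f ω) ≤ β ω ∧ β ω < 1) :
    InvariantGraphTheorem φ P (IsIntegralSol φ P T₁ S₁ f) f μs μu (epsMax φ P f) β
      (∀ ω, ContDiff ℝ 1 (f ω)) True :=
  invariantGraphTheorem_of_integralBound (linearTheory_integralLS hU) hf.cont isIntegralSol_iff hc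
    (integralBound_integralLS hU) (fun _ => ENNReal.toReal_nonneg)
    (fun ω t _ z z' => maxNorm_sub_le_epsMax hU.norm_P hU.norm_Pc hU.C_pos.le hf ω t z z') hgap hβ

/-! ### The linear mild equation -/

section Mild

variable {M : Type u} [TopologicalSpace M] {E Z : Type v} [NormedAddCommGroup E] [NormedSpace ℝ E]
  [NormedAddCommGroup Z] [NormedSpace ℝ Z]

/-- Mild solutions on `[0, r]` of `z' = A z + L(tω) z + g(t)`. -/
def MildLS (φ : Flow ℝ≥0 M) (A : Z →ₗ.[ℝ] Z) (J : E →L[ℝ] Z) (L : M → E →L[ℝ] Z) (ω : M) (r : ℝ)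
    (z : ℝ → E) (g : ℝ → Z) : Prop :=
  ContinuousOn z (Icc 0 r) ∧
  ∀ t ∈ Icc (0 : ℝ) r, (∫ s in (0 : ℝ)..t, J (z s),
    J (z t) - J (z 0) - ∫ s in (0 : ℝ)..t, (L (orb φ ω s) (z s) + g s)) ∈ A.graph

theorem mem_graph_iff_exists (A : Z →ₗ.[ℝ] Z) (x y : Z) :
    (x, y) ∈ A.graph ↔ ∃ h : x ∈ A.domain, A ⟨x, h⟩ = y := by
  rw [LinearPMap.mem_graph_iff]
  constructor
  · rintro ⟨⟨x', hx⟩, rfl, h2⟩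
    exact ⟨hx, h2⟩
  · rintro ⟨hx, h2⟩
    exact ⟨⟨x, hx⟩, rfl, h2⟩

/-- Membership in the graph of A replaces an equation with domain conditions. The graph is a
subspace, and a closed one for the operators below, so sums, multiples, integrals and limits of
solutions need no separate domain argument. -/
theorem isMildOn_iff (φ : Flow ℝ≥0 M) (A : Z →ₗ.[ℝ] Z) (J : E →L[ℝ] Z) (g : M → E → Z) (ω : M)
    (r : ℝ) (w : ℝ → E) : IsMildOn φ A J g ω r w ↔ ContinuousOn w (Icc 0 r) ∧
      ∀ t ∈ Icc (0 : ℝ) r, (∫ s in (0 : ℝ)..t, J (w s),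
        J (w t) - J (w 0) - ∫ s in (0 : ℝ)..t, g (orb φ ω s) (w s)) ∈ A.graph := by
  refine and_congr_right fun _ => forall₂_congr fun t _ => ?_
  rw [mem_graph_iff_exists]
  refine exists_congr fun h => ?_
  constructor
  · intro e; rw [e]; abel
  · intro e; rw [e]; abel

theorem isMild_iff (φ : Flow ℝ≥0 M) (A : Z →ₗ.[ℝ] Z) (J : E →L[ℝ] Z) (L : M → E →L[ℝ] Z)
    (f : M → E → Z) (ω : M) (w : ℝ → E) :
    IsMild φ A J (fun ω z => L ω z + f ω z) ω w ↔ NonlinearSol φ (MildLS φ A J L) f ω w :=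
  forall₂_congr fun r _ => isMildOn_iff φ A J _ ω r w

theorem mildLS_zero_iff (φ : Flow ℝ≥0 M) (A : Z →ₗ.[ℝ] Z) (J : E →L[ℝ] Z) (L : M → E →L[ℝ] Z)
    (ω : M) (r : ℝ) (w : ℝ → E) :
    MildLS φ A J L ω r w (fun _ => 0) ↔ IsMildOn φ A J (fun ω z => L ω z) ω r w := by
  rw [isMildOn_iff, MildLS]
  simp only [add_zero]

variable {φ : Flow ℝ≥0 M} {A : Z →ₗ.[ℝ] Z} {J : E →L[ℝ] Z} {L : M → E →L[ℝ] Z}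

theorem continuousOn_linear (hL : Continuous fun p : M × E => L p.1 p.2) (ω : M) {z : ℝ → E}
    {s : Set ℝ} (hz : ContinuousOn z s) : ContinuousOn (fun t => L (orb φ ω t) (z t)) s :=
  hL.comp_continuousOn ((continuous_orb φ ω).continuousOn.prodMk hz)

theorem MildLS.congr {ω : M} {r : ℝ} {z z' : ℝ → E} {g g' : ℝ → Z} (hr : 0 ≤ r)
    (hz : ∀ t ∈ Icc 0 r, z t = z' t) (hg : ∀ t ∈ Icc 0 r, g t = g' t)
    (h : MildLS φ A J L ω r z g) : MildLS φ A J L ω r z' g' := by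
  refine ⟨h.1.congr fun t ht => (hz t ht).symm, fun t ht => ?_⟩
  have hsub : ∀ s ∈ uIcc 0 t, s ∈ Icc 0 r := fun s hs => by
    rw [uIcc_of_le ht.1] at hs; exact ⟨hs.1, hs.2.trans ht.2⟩
  have e1 : ∫ s in (0 : ℝ)..t, J (z' s) = ∫ s in (0 : ℝ)..t, J (z s) :=
    intervalIntegral.integral_congr fun s hs => by simp only [hz s (hsub s hs)]
  have e2 : ∫ s in (0 : ℝ)..t, (L (orb φ ω s) (z' s) + g' s) =
      ∫ s in (0 : ℝ)..t, (L (orb φ ω s) (z s) + g s) :=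
    intervalIntegral.integral_congr fun s hs => by
      simp only [hz s (hsub s hs), hg s (hsub s hs)]
  rw [e1, e2, ← hz t ht, ← hz 0 ⟨le_rfl, hr⟩]
  exact h.2 t ht

theorem MildLS.sub (hL : Continuous fun p : M × E => L p.1 p.2) {ω : M} {r : ℝ} {z z' : ℝ → E}
    {g g' : ℝ → Z} (hg : ContinuousOn g (Icc 0 r)) (hg' : ContinuousOn g' (Icc 0 r))
    (h : MildLS φ A J L ω r z g) (h' : MildLS φ A J L ω r z' g') :
    MildLS φ A J L ω r (fun t => z t - z' t) (fun t => g t - g' t) := by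
  refine ⟨h.1.sub h'.1, fun t ht => ?_⟩
  have hsub : uIcc 0 t ⊆ Icc 0 r := by
    rw [uIcc_of_le ht.1]; exact Icc_subset_Icc_right ht.2
  have i1 : IntervalIntegrable (fun s => J (z s)) volume 0 t :=
    (J.continuous.comp_continuousOn (h.1.mono hsub)).intervalIntegrable
  have i1' : IntervalIntegrable (fun s => J (z' s)) volume 0 t :=
    (J.continuous.comp_continuousOn (h'.1.mono hsub)).intervalIntegrable
  have i2 : IntervalIntegrable (fun s => L (orb φ ω s) (z s) + g s) volume 0 t :=
    (((continuousOn_linear hL ω h.1).add hg).mono hsub).intervalIntegrable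
  have i2' : IntervalIntegrable (fun s => L (orb φ ω s) (z' s) + g' s) volume 0 t :=
    (((continuousOn_linear hL ω h'.1).add hg').mono hsub).intervalIntegrable
  have e1 := intervalIntegral.integral_sub i1 i1'
  have e2 := intervalIntegral.integral_sub i2 i2'
  have := A.graph.sub_mem (h.2 t ht) (h'.2 t ht)
  rw [Prod.mk_sub_mk, ← e1] at this
  convert this using 2
  · simp only [map_sub]
  · simp only [map_sub]
    rw [sub_sub_sub_comm (J (z t) - _), ← e2, sub_sub_sub_comm]
    congr 2
    ext s
    abel

theorem MildLS.smul {ω : M} {r : ℝ} {z : ℝ → E} {g : ℝ → Z} (c : ℝ)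
    (h : MildLS φ A J L ω r z g) :
    MildLS φ A J L ω r (fun t => c • z t) (fun t => c • g t) := by
  refine ⟨h.1.const_smul c, fun t ht => ?_⟩
  have := A.graph.smul_mem c (h.2 t ht)
  simp only [map_smul, ← smul_add, ← smul_sub, intervalIntegral.integral_smul]
  exact this

theorem MildLS.mono {ω : M} {r r' : ℝ} {z : ℝ → E} {g : ℝ → Z} (hr : r' ≤ r)
    (h : MildLS φ A J L ω r z g) : MildLS φ A J L ω r' z g :=
  ⟨h.1.mono (Icc_subset_Icc_right hr), fun t ht => h.2 t ⟨ht.1, ht.2.trans hr⟩⟩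

/-- Subtract the relation at time s from the relation at time s + t. -/
theorem MildLS.shift (hL : Continuous fun p : M × E => L p.1 p.2) {ω : M} {s r : ℝ} {z : ℝ → E}
    {g : ℝ → Z} (hs : 0 ≤ s) (hr : 0 ≤ r) (hg : ContinuousOn g (Icc 0 (s + r)))
    (h : MildLS φ A J L ω (s + r) z g) :
    MildLS φ A J L (orb φ ω s) r (fun t => z (s + t)) (fun t => g (s + t)) := by
  have hmem : ∀ t ∈ Icc 0 r, s + t ∈ Icc 0 (s + r) := fun t ht =>
    ⟨add_nonneg hs ht.1, by linarith [ht.2]⟩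
  refine ⟨h.1.comp (by fun_prop) hmem, fun t ht => ?_⟩
  have hs' : s ∈ Icc 0 (s + r) := ⟨hs, by linarith⟩
  have hsub : ∀ t ∈ Icc 0 (s + r), uIcc 0 t ⊆ Icc 0 (s + r) := fun t ht => by
    rw [uIcc_of_le ht.1]; exact Icc_subset_Icc_right ht.2
  have i1 : ∀ t ∈ Icc 0 (s + r), IntervalIntegrable (fun s => J (z s)) volume 0 t := fun t ht =>
    (J.continuous.comp_continuousOn (h.1.mono (hsub t ht))).intervalIntegrable
  have i2 : ∀ t ∈ Icc 0 (s + r),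
      IntervalIntegrable (fun s => L (orb φ ω s) (z s) + g s) volume 0 t := fun t ht =>
    (((continuousOn_linear hL ω h.1).add hg).mono (hsub t ht)).intervalIntegrable
  have e1 := intervalIntegral.integral_interval_sub_left (i1 _ (hmem t ht)) (i1 _ hs')
  have e2 := intervalIntegral.integral_interval_sub_left (i2 _ (hmem t ht)) (i2 _ hs')
  have c1 := intervalIntegral.integral_comp_add_left (f := fun τ => J (z τ)) (a := 0) (b := t) s
  have c2 := intervalIntegral.integral_comp_add_left
    (f := fun τ => L (orb φ ω τ) (z τ) + g τ) (a := 0) (b := t) s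
  have c3 : ∫ τ in (0 : ℝ)..t, (L (orb φ (orb φ ω s) τ) (z (s + τ)) + g (s + τ)) =
      ∫ τ in (0 : ℝ)..t, (L (orb φ ω (s + τ)) (z (s + τ)) + g (s + τ)) :=
    intervalIntegral.integral_congr fun τ hτ => by
      rw [uIcc_of_le ht.1] at hτ
      simp only [orb_orb φ ω hs hτ.1]
  rw [add_zero] at c1 c2
  simp only [add_zero]
  rw [c3, c1, c2, ← e1, ← e2]
  have := A.graph.sub_mem (h.2 _ (hmem t ht)) (h.2 _ hs')
  rw [Prod.mk_sub_mk] at this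
  convert this using 2
  abel

end Mild

end InvGraph

end

noncomputable section

namespace InvGraph

/-! ### Generators of semigroups and bi-semigroups -/

section Generator

variable {E : Type v} [NormedAddCommGroup E] [NormedSpace ℝ E] {T : ℝ≥0 → E →L[ℝ] E}

theorem IsC0Semigroup.continuous_toNNReal (hT : IsC0Semigroup T) (x : E) :
    Continuous fun t : ℝ => T t.toNNReal x := (hT.cont x).comp continuous_real_toNNReal

/-- The semigroup law transports the right derivative from 0 to t; right derivatives suffice for the
fundamental theorem and for the uniqueness argument. -/
theorem IsC0Semigroup.hasDerivWithinAt (hT : IsC0Semigroup T) {x y : E} (h : GeneratorRel T x y)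
    {t : ℝ} (ht : 0 ≤ t) :
    HasDerivWithinAt (fun t : ℝ => T t.toNNReal x) (T t.toNNReal y) (Ioi t) t := by
  rw [hasDerivWithinAt_iff_tendsto_slope' (by simp)]
  have h1 : Tendsto (fun s : ℝ => s - t) (𝓝[>] t) (𝓝[>] 0) := by
    refine tendsto_nhdsWithin_iff.2 ⟨?_, ?_⟩
    · have : Tendsto (fun s : ℝ => s - t) (𝓝 t) (𝓝 (t - t)) := by
        exact (continuous_id.sub continuous_const).tendsto t
      rw [sub_self] at this
      exact this.mono_left nhdsWithin_le_nhds
    · filter_upwards [self_mem_nhdsWithin] with s hs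
      exact sub_pos.2 (mem_Ioi.1 hs)
  refine (((T t.toNNReal).continuous.tendsto y).comp (h.comp h1)).congr' ?_
  filter_upwards [self_mem_nhdsWithin] with s hs
  have hs' : t ≤ s := le_of_lt hs
  have e : T s.toNNReal x = T t.toNNReal (T (s - t).toNNReal x) := by
    rw [← hT.add, ← Real.toNNReal_add ht (sub_nonneg.2 hs'), add_sub_cancel]
  simp only [Function.comp_apply, slope_def_module, map_smul, map_sub, e]

/-- Unlike the difference quotient, the integral form passes to limits in (x, y); closedness of the
generator rests on it. -/
theorem IsC0Semigroup.generatorRel_iff [CompleteSpace E] (hT : IsC0Semigroup T) (x y : E) :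
    GeneratorRel T x y ↔ ∀ t : ℝ, 0 ≤ t →
      T t.toNNReal x - x = ∫ s in (0 : ℝ)..t, T s.toNNReal y := by
  constructor
  · intro h t ht
    have := intervalIntegral.integral_eq_sub_of_hasDeriv_right_of_le ht
      (hT.continuous_toNNReal x).continuousOn
      (fun s hs => hT.hasDerivWithinAt h (le_of_lt hs.1))
      ((hT.continuous_toNNReal y).intervalIntegrable _ _)
    rw [this, Real.toNNReal_zero, hT.zero]
  · intro h
    have hc := hT.continuous_toNNReal y
    have h1 : HasDerivAt (fun t : ℝ => ∫ s in (0 : ℝ)..t, T s.toNNReal y) (T (0 : ℝ).toNNReal y) 0 :=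
      intervalIntegral.integral_hasDerivAt_right (hc.intervalIntegrable _ _)
        (hc.stronglyMeasurableAtFilter _ _) hc.continuousAt
    rw [Real.toNNReal_zero, hT.zero, hasDerivAt_iff_tendsto_slope] at h1
    refine (h1.mono_left (nhdsWithin_mono _ fun s hs => ne_of_gt hs)).congr' ?_
    filter_upwards [self_mem_nhdsWithin] with s hs
    rw [h s (le_of_lt hs), slope_def_module, intervalIntegral.integral_same, sub_zero, sub_zero]

theorem IsC0Semigroup.bounded_Icc [CompleteSpace E] (hT : IsC0Semigroup T) (t : ℝ) :
    ∃ C, ∀ s ∈ Icc 0 t, ‖T s.toNNReal‖ ≤ C := by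
  obtain ⟨C, hC⟩ := banach_steinhaus (g := fun s : Icc (0 : ℝ) t => T (s : ℝ).toNNReal) fun x => by
    obtain ⟨C, hC⟩ := isCompact_Icc.exists_bound_of_continuousOn
      (hT.continuous_toNNReal x).continuousOn (s := Icc 0 t)
    exact ⟨C, fun s => hC s s.2⟩
  exact ⟨C, fun s hs => hC ⟨s, hs⟩⟩

theorem IsC0Semigroup.isClosed_generator [CompleteSpace E] (hT : IsC0Semigroup T) :
    IsClosed {p : E × E | GeneratorRel T p.1 p.2} := by
  simp only [hT.generatorRel_iff]
  refine isClosed_iff_clusterPt.2 fun p hp => ?_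
  rw [← mem_closure_iff_clusterPt, mem_closure_iff_seq_limit] at hp
  obtain ⟨q, hq, hqp⟩ := hp
  intro t ht
  have h1 : Tendsto (fun n => (q n).1) atTop (𝓝 p.1) := (continuous_fst.tendsto p).comp hqp
  have h2 : Tendsto (fun n => (q n).2) atTop (𝓝 p.2) := (continuous_snd.tendsto p).comp hqp
  have h3 : Tendsto (fun n => T t.toNNReal (q n).1 - (q n).1) atTop
      (𝓝 (T t.toNNReal p.1 - p.1)) :=
    (((T t.toNNReal).continuous.tendsto _).comp h1).sub h1
  refine tendsto_nhds_unique h3 (Tendsto.congr (fun n => (hq n t ht).symm) ?_)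
  obtain ⟨C, hC⟩ := hT.bounded_Icc t
  refine tendsto_iff_norm_sub_tendsto_zero.2 (squeeze_zero (fun n => norm_nonneg _) (fun n => ?_)
    (g := fun n => C * ‖(q n).2 - p.2‖ * |t - 0|) ?_)
  · rw [← intervalIntegral.integral_sub ((hT.continuous_toNNReal _).intervalIntegrable _ _)
      ((hT.continuous_toNNReal _).intervalIntegrable _ _)]
    refine intervalIntegral.norm_integral_le_of_norm_le_const fun s hs => ?_
    rw [uIoc_of_le ht] at hs
    rw [← map_sub]
    exact (T s.toNNReal).le_of_opNorm_le (hC s ⟨hs.1.le, hs.2⟩) _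
  · have := ((tendsto_iff_norm_sub_tendsto_zero.1 h2).const_mul C).mul_const |t - 0|
    simpa using this

/-- In the topological direct sum the graph is the intersection of preimages of the two generator
graphs, with a sign on the second component. -/
theorem isClosed_graph_of_generatesBiSemigroup {Z : Type v} [NormedAddCommGroup Z]
    [NormedSpace ℝ Z] [CompleteSpace Z] {A : Z →ₗ.[ℝ] Z} (hA : GeneratesBiSemigroup A) :
    IsClosed (A.graph : Set (Z × Z)) := by
  obtain ⟨X₁, X₂, hX₁, hX₂, hc, T, S, hT, hS, hG⟩ := hA
  have : CompleteSpace X₁ := hX₁.completeSpace_coe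
  have : CompleteSpace X₂ := hX₂.completeSpace_coe
  set e := X₁.prodEquivOfIsTopCompl X₂ (Submodule.IsCompl.isTopCompl_of_isClosed hc hX₁ hX₂) with he
  have hes : ∀ (x : X₁) (y : X₂), e.symm ((x : Z) + y) = (x, y) := fun x y => by
    rw [ContinuousLinearEquiv.symm_apply_eq]
    rfl
  have hez : ∀ z : Z, z = ((e.symm z).1 : Z) + (e.symm z).2 := fun z => (e.apply_symm_apply z).symm
  have h1 : (A.graph : Set (Z × Z)) =
      (fun p : Z × Z => ((e.symm p.1).1, (e.symm p.2).1)) ⁻¹' {p | GeneratorRel T p.1 p.2} ∩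
      (fun p : Z × Z => ((e.symm p.1).2, -(e.symm p.2).2)) ⁻¹' {p | GeneratorRel S p.1 p.2} := by
    ext ⟨z, w⟩
    rw [SetLike.mem_coe, hG]
    constructor
    · rintro ⟨x, x', y, y', rfl, rfl, h1, h2⟩
      have e2 : e.symm ((x' : Z) - y') = (x', -y') := by
        rw [sub_eq_add_neg, ← Submodule.coe_neg, hes]
      simp only [mem_inter_iff, mem_preimage, mem_ofPred_eq, hes, e2, neg_neg]
      exact ⟨h1, h2⟩
    · rintro ⟨h1, h2⟩
      refine ⟨_, _, _, _, hez z, ?_, h1, h2⟩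
      rw [Submodule.coe_neg, sub_neg_eq_add]
      exact hez w
  rw [h1]
  refine (hT.isClosed_generator.preimage ?_).inter (hS.isClosed_generator.preimage ?_)
  · exact ((continuous_fst.comp (e.symm.continuous.comp continuous_fst)).prodMk
      (continuous_fst.comp (e.symm.continuous.comp continuous_snd)))
  · exact ((continuous_snd.comp (e.symm.continuous.comp continuous_fst)).prodMk
      (continuous_snd.comp (e.symm.continuous.comp continuous_snd)).neg)

end Generator

/-! ### Mild solutions and the integral equation -/

/-- Fubini for a time integral of the variation of constants formula. The integral from τ to r is
split at t, so that one part lives on a triangle and the other on a rectangle. -/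
theorem integral_sub_triangle {E : Type*} [NormedAddCommGroup E] [NormedSpace ℝ E]
    [CompleteSpace E] {U W : ℝ → ℝ → E} (hU : Continuous (Function.uncurry U))
    (hW : Continuous (Function.uncurry W)) {t r : ℝ} (ht : 0 ≤ t) (htr : t ≤ r) :
    ∫ τ in (0 : ℝ)..t, ((∫ s in (0 : ℝ)..τ, U τ s) - ∫ s in τ..r, W τ s) =
      (∫ s in (0 : ℝ)..t, ∫ τ in s..t, U τ s) - (∫ s in (0 : ℝ)..t, ∫ τ in (0 : ℝ)..s, W τ s) -
        ∫ s in t..r, ∫ τ in (0 : ℝ)..t, W τ s := by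
  have hW' : Continuous (Function.uncurry fun s τ => W τ s) := hW.comp continuous_swap
  have c1 : Continuous fun τ : ℝ => ∫ s in (0 : ℝ)..τ, U τ s :=
    intervalIntegral.continuous_parametric_intervalIntegral_of_continuous hU continuous_id
  have c2 : Continuous fun τ : ℝ => ∫ s in t..τ, W τ s :=
    intervalIntegral.continuous_parametric_intervalIntegral_of_continuous hW continuous_id
  have c3 : Continuous fun τ : ℝ => ∫ s in t..r, W τ s :=
    intervalIntegral.continuous_parametric_intervalIntegral_of_continuous hW continuous_const
  have e1 : ∀ τ, ∫ s in τ..r, W τ s = (∫ s in t..r, W τ s) - ∫ s in t..τ, W τ s := fun τ => by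
    have hi : ∀ a b, IntervalIntegrable (W τ) volume a b := fun a b =>
      (hW.comp (Continuous.prodMk_right τ)).intervalIntegrable a b
    rw [intervalIntegral.integral_interval_sub_left (hi _ _) (hi _ _)]
  have e2 : ∀ τ, (∫ s in (0 : ℝ)..τ, U τ s) - ∫ s in τ..r, W τ s =
      (∫ s in (0 : ℝ)..τ, U τ s) + (∫ s in t..τ, W τ s) - ∫ s in t..r, W τ s := fun τ => by
    rw [e1]; abel
  simp only [e2]
  rw [intervalIntegral.integral_sub ((c1.intervalIntegrable _ _).add (c2.intervalIntegrable _ _)) (c3.intervalIntegrable _ _),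
    intervalIntegral.integral_add (c1.intervalIntegrable _ _) (c2.intervalIntegrable _ _),
    integral_triangle_swap hU ht, integral_triangle_swap hW' ht]
  have e3 : ∫ τ in (0 : ℝ)..t, ∫ s in t..τ, W τ s = -∫ τ in (0 : ℝ)..t, ∫ s in τ..t, W τ s := by
    rw [← intervalIntegral.integral_neg]
    congr 1
    ext τ
    exact intervalIntegral.integral_symm τ t
  have e4 : ∫ τ in (0 : ℝ)..t, ∫ s in t..r, W τ s = ∫ s in t..r, ∫ τ in (0 : ℝ)..t, W τ s := by
    refine intervalIntegral_intervalIntegral_swap (IntegrableOn.mono_set (t := Icc 0 t ×ˢ Icc t r)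
      (hW.continuousOn.integrableOn_compact (isCompact_Icc.prod isCompact_Icc)) ?_)
    rw [uIoc_of_le ht, uIoc_of_le htr]
    exact prod_mono Ioc_subset_Icc_self Ioc_subset_Icc_self
  rw [e3, e4]
  abel

section Correspondence

variable {M : Type u} [TopologicalSpace M] {E : Type v} [NormedAddCommGroup E] [NormedSpace ℝ E]
  [CompleteSpace E] {φ : Flow ℝ≥0 M} {P : M → E →L[ℝ] E}
  {T₁ : ∀ (t : ℝ≥0) (ω : M), specX P ω →L[ℝ] specX P (φ t ω)}
  {S₁ : ∀ (t : ℝ≥0) (ω : M), specY P (φ t ω) →L[ℝ] specY P ω} {C₁ : ℝ} {μs μu : M → ℝ}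
  {A : E →ₗ.[ℝ] E} {L : M → E →L[ℝ] E}

theorem GeneratesCorrespondence.mild_evo (hU : UniformDichotomy φ P T₁ S₁ C₁ μs μu)
    (hG : GeneratesCorrespondence φ A L P T₁ S₁) (ω : M) {r : ℝ} (hr : 0 ≤ r) (x y : E) :
    MildLS φ A (ContinuousLinearMap.id ℝ E) L ω r
      (fun t => evoX P T₁ ω t 0 x + evoY P S₁ ω t r y) (fun _ => 0) := by
  rw [mildLS_zero_iff]
  refine ((hG ω r hr (projX P ω x) (projY P (orb φ ω r) y) _).2 fun t ht => ?_).1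
  rw [evoX_zero_right hU]
  congr 1
  exact (evoY_sub_proj hU ω ht.1 ht.2 y).symm

/-- Uniqueness in the generation hypothesis identifies an unforced mild solution with the one built
from its own boundary data; existence gives the converse. -/
theorem GeneratesCorrespondence.mild_zero_iff (hU : UniformDichotomy φ P T₁ S₁ C₁ μs μu)
    (hG : GeneratesCorrespondence φ A L P T₁ S₁) (ω : M) {r : ℝ} (hr : 0 ≤ r) (w : ℝ → E) :
    MildLS φ A (ContinuousLinearMap.id ℝ E) L ω r w (fun _ => 0) ↔
      IntegralLS P T₁ S₁ ω r w (fun _ => 0) := by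
  constructor
  · intro h
    refine ⟨h.1, fun t ht => ?_⟩
    rw [mildLS_zero_iff] at h
    have := (hG ω r hr (projX P ω (w 0)) (projY P (orb φ ω r) (w r)) w).1 ⟨h, rfl, rfl⟩ t ht
    have e : w t = evoX P T₁ ω t 0 (w 0) + evoY P S₁ ω t r (w r) := by
      rw [this, evoX_zero_right hU]
      congr 1
      exact evoY_sub_proj hU ω ht.1 ht.2 (w r)
    have e' : P (orb φ ω t) (w t) = evoX P T₁ ω t 0 (w 0) := by
      rw [e, map_add, proj_evoX hU ω le_rfl ht.1, proj_evoY hU, add_zero]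
    simp only [map_zero, intervalIntegral.integral_zero, add_zero, sub_zero]
    rw [← evoX_zero_right hU, e']
    exact ⟨rfl, by rw [e]; abel⟩
  · intro h
    have h1 := hG.mild_evo hU ω hr (w 0) (w r)
    refine h1.congr hr (fun t ht => ?_) fun _ _ => rfl
    obtain ⟨h2, h3⟩ := h.2 t ht
    simp only [map_zero, intervalIntegral.integral_zero, add_zero, sub_zero] at h2 h3
    rw [evoX_zero_right hU, ← h2, ← h3]
    abel

/-- Superposition: each slice U(·, s) is a mild solution started at s with value p(s), each W(·, s)
one that runs up to s. Integrating the graph relations over s gives the relation for z, and the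
jumps p(s) and W(s, s) = g(s) - p(s) add up to the forcing g(s). -/
theorem mem_graph_of_kernels (hA : IsClosed (A.graph : Set (E × E)))
    (hL : Continuous fun p : M × E => L p.1 p.2) (ω : M) {U W : ℝ → ℝ → E} {z g p : ℝ → E}
    (cU : Continuous (Function.uncurry U)) (cW : Continuous (Function.uncurry W))
    (hg : Continuous g) (cP : Continuous p) (hzc : Continuous z) {t r : ℝ} (ht : t ∈ Icc 0 r)
    (hz : ∀ τ, z τ = (∫ s in (0 : ℝ)..τ, U τ s) - ∫ s in τ..r, W τ s)
    (hd : ∀ s, W s s = g s - p s)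
    (p1 : ∀ s ∈ Icc 0 t, (∫ τ in s..t, U τ s,
      U t s - p s - ∫ τ in s..t, L (orb φ ω τ) (U τ s)) ∈ A.graph)
    (p2 : ∀ s, 0 ≤ s → ∀ t ∈ Icc 0 s, (∫ τ in (0 : ℝ)..t, W τ s,
      W t s - W 0 s - ∫ τ in (0 : ℝ)..t, L (orb φ ω τ) (W τ s)) ∈ A.graph) :
    (∫ s in (0 : ℝ)..t, z s, z t - z 0 - ∫ s in (0 : ℝ)..t, (L (orb φ ω s) (z s) + g s))
      ∈ A.graph := by
  have cLU : Continuous (Function.uncurry fun τ s => L (orb φ ω τ) (U τ s)) :=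
    Continuous.comp (f := fun p : ℝ × ℝ => (orb φ ω p.1, Function.uncurry U p))
      (g := fun p : M × E => L p.1 p.2) hL (((continuous_orb φ ω).comp continuous_fst).prodMk cU)
  have cLW : Continuous (Function.uncurry fun τ s => L (orb φ ω τ) (W τ s)) :=
    Continuous.comp (f := fun p : ℝ × ℝ => (orb φ ω p.1, Function.uncurry W p))
      (g := fun p : M × E => L p.1 p.2) hL (((continuous_orb φ ω).comp continuous_fst).prodMk cW)
  have cUt : ∀ t, Continuous (U t) := fun t => cU.comp (Continuous.prodMk_right t)
  have cWt : ∀ t, Continuous (W t) := fun t => cW.comp (Continuous.prodMk_right t)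
  have ii : ∀ {h : ℝ → E}, Continuous h → ∀ a b, IntervalIntegrable h volume a b :=
    fun hh a b => hh.intervalIntegrable a b
  have hLz : ∀ τ, L (orb φ ω τ) (z τ) =
      (∫ s in (0 : ℝ)..τ, L (orb φ ω τ) (U τ s)) - ∫ s in τ..r, L (orb φ ω τ) (W τ s) := fun τ => by
    rw [hz, map_sub, ContinuousLinearMap.intervalIntegral_comp_comm _ (ii (cUt τ) _ _),
      ContinuousLinearMap.intervalIntegral_comp_comm _ (ii (cWt τ) _ _)]
  have d1 : Continuous fun s => ∫ τ in s..t, U τ s := by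
    have := intervalIntegral.continuous_parametric_intervalIntegral_of_continuous (μ := volume)
      (f := fun s τ => U τ s) (a₀ := t) (cU.comp continuous_swap) continuous_id
    refine this.neg.congr fun s => ?_
    exact (intervalIntegral.integral_symm t s).symm
  have d1' : Continuous fun s => ∫ τ in s..t, L (orb φ ω τ) (U τ s) := by
    have := intervalIntegral.continuous_parametric_intervalIntegral_of_continuous (μ := volume)
      (f := fun s τ => L (orb φ ω τ) (U τ s)) (a₀ := t) (cLU.comp continuous_swap) continuous_id
    refine this.neg.congr fun s => ?_
    exact (intervalIntegral.integral_symm t s).symm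
  have d2 : ∀ b : ℝ → ℝ, Continuous b → Continuous fun s => ∫ τ in (0 : ℝ)..b s, W τ s := fun b hb =>
    intervalIntegral.continuous_parametric_intervalIntegral_of_continuous (μ := volume)
      (f := fun s τ => W τ s) (cW.comp continuous_swap) hb
  have d2' : ∀ b : ℝ → ℝ, Continuous b →
      Continuous fun s => ∫ τ in (0 : ℝ)..b s, L (orb φ ω τ) (W τ s) := fun b hb =>
    intervalIntegral.continuous_parametric_intervalIntegral_of_continuous (μ := volume)
      (f := fun s τ => L (orb φ ω τ) (W τ s)) (cLW.comp continuous_swap) hb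
  have d2i : Continuous fun s => ∫ τ in (0 : ℝ)..s, L (orb φ ω τ) (W τ s) := d2' id continuous_id
  have cWd : Continuous fun s => W s s := cW.comp (continuous_id.prodMk continuous_id)
  -- The three regions of Fubini: U for s ≤ τ ≤ t, W for τ ≤ s ≤ t, and W for τ ≤ t ≤ s ≤ r.
  have g1 := integral_mem_graph hA (a := 0) (b := t) (d1.intervalIntegrable _ _)
    ((((cUt t).sub cP).sub d1').intervalIntegrable _ _)
    (fun s hs => p1 s (by rwa [uIcc_of_le ht.1] at hs))
  have g2 := integral_mem_graph hA (a := 0) (b := t) ((d2 id continuous_id).intervalIntegrable _ _)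
    (((cWd.sub (cWt 0)).sub (d2' id continuous_id)).intervalIntegrable _ _) (fun s hs => by
      rw [uIcc_of_le ht.1] at hs
      exact p2 s hs.1 s ⟨hs.1, le_rfl⟩)
  have g3 := integral_mem_graph hA (a := t) (b := r)
    ((d2 (fun _ => t) continuous_const).intervalIntegrable _ _)
    ((((cWt t).sub (cWt 0)).sub (d2' (fun _ => t) continuous_const)).intervalIntegrable _ _)
    (fun s hs => by
      rw [uIcc_of_le ht.2] at hs
      exact p2 s (ht.1.trans hs.1) t ⟨ht.1, hs.1⟩)
  have g4 := A.graph.sub_mem (A.graph.sub_mem g1 g2) g3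
  simp only [Prod.mk_sub_mk, id] at g4
  have hLi : IntervalIntegrable (fun τ => L (orb φ ω τ) (z τ)) volume 0 t :=
    (continuousOn_linear hL ω hzc.continuousOn (s := uIcc 0 t)).intervalIntegrable
  convert g4 using 2
  · simp only [hz]
    exact integral_sub_triangle cU cW ht.1 ht.2
  · rw [intervalIntegral.integral_add hLi (ii hg _ _)]
    simp only [hLz, Pi.sub_apply]
    rw [integral_sub_triangle cLU cLW ht.1 ht.2, hz, hz,
      intervalIntegral.integral_sub ((ii (cUt t) _ _).sub (ii cP _ _)) (ii d1' _ _),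
      intervalIntegral.integral_sub (ii (cUt t) _ _) (ii cP _ _),
      intervalIntegral.integral_sub ((ii cWd _ _).sub (ii (cWt 0) _ _)) (ii d2i _ _),
      intervalIntegral.integral_sub (ii cWd _ _) (ii (cWt 0) _ _),
      intervalIntegral.integral_sub ((ii (cWt t) _ _).sub (ii (cWt 0) _ _))
        (ii (d2' (fun _ => t) continuous_const) _ _),
      intervalIntegral.integral_sub (ii (cWt t) _ _) (ii (cWt 0) _ _),
      intervalIntegral.integral_same,
      ← intervalIntegral.integral_add_adjacent_intervals (ii (cWt 0) 0 t) (ii (cWt 0) t r)]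
    have e5 : ∫ s in (0 : ℝ)..t, W s s =
        (∫ s in (0 : ℝ)..t, g s) - ∫ s in (0 : ℝ)..t, p s := by
      rw [← intervalIntegral.integral_sub (ii hg _ _) (ii cP _ _)]
      simp only [hd]
    rw [e5]
    abel

/-- The evolution operators, applied to a fixed vector, are unforced mild solutions. The forward
ones are started at s by passing to the orbit point of time s. -/
theorem GeneratesCorrespondence.mild_forcedSol (hU : UniformDichotomy φ P T₁ S₁ C₁ μs μu)
    (hG : GeneratesCorrespondence φ A L P T₁ S₁) (hA : IsClosed (A.graph : Set (E × E)))
    (hL : Continuous fun p : M × E => L p.1 p.2) (ω : M) {r : ℝ} {g : ℝ → E} (hg : Continuous g) :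
    MildLS φ A (ContinuousLinearMap.id ℝ E) L ω r (forcedSol P T₁ S₁ ω r g 0) g := by
  refine ⟨(continuous_forcedSol hU ω r hg 0).continuousOn, fun t ht => ?_⟩
  have cP : Continuous fun s => P (orb φ ω s) (g s) :=
    Continuous.comp (f := fun s => (orb φ ω s, g s)) (g := fun p : M × E => P p.1 p.2)
      hU.proj_cont ((continuous_orb φ ω).prodMk hg)
  refine mem_graph_of_kernels hA hL ω (continuous_evoX_uncurry hU ω hg)
    (continuous_evoY_uncurry hU ω hg) hg cP (continuous_forcedSol hU ω r hg 0) ht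
    (fun τ => by simp only [forcedSol, map_zero, zero_add]) (fun s => evoY_self hU ω s (g s))
    (fun s hs => ?_) (fun s hs t ht => ?_)
  · have h1 := (hG.mild_evo hU (orb φ ω s) (sub_nonneg.2 hs.2) (g s) 0).2 (t - s)
      ⟨sub_nonneg.2 hs.2, le_rfl⟩
    simp only [map_zero, add_zero, ContinuousLinearMap.id_apply] at h1
    have e0 : ∀ τ, evoX P T₁ (orb φ ω s) τ 0 (g s) = evoX P T₁ ω (s + τ) s (g s) := fun τ => by
      rw [evoX_orb hU ω hs.1 le_rfl, add_zero]
    simp only [e0, add_sub_cancel, add_zero] at h1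
    have c1 := intervalIntegral.integral_comp_add_left
      (f := fun τ => evoX P T₁ ω τ s (g s)) (a := 0) (b := t - s) s
    have c2 := intervalIntegral.integral_comp_add_left
      (f := fun τ => L (orb φ ω τ) (evoX P T₁ ω τ s (g s))) (a := 0) (b := t - s) s
    have c3 : ∫ τ in (0 : ℝ)..(t - s), L (orb φ (orb φ ω s) τ) (evoX P T₁ ω (s + τ) s (g s)) =
        ∫ τ in (0 : ℝ)..(t - s), L (orb φ ω (s + τ)) (evoX P T₁ ω (s + τ) s (g s)) :=
      intervalIntegral.integral_congr fun τ hτ => by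
        rw [uIcc_of_le (sub_nonneg.2 hs.2)] at hτ
        simp only [orb_orb φ ω hs.1 hτ.1]
    rw [add_zero, add_sub_cancel] at c1 c2
    rwa [c3, c1, c2, evoX_self hU ω s (g s)] at h1
  · have h1 := (hG.mild_evo hU ω hs 0 (g s)).2 t ht
    simpa only [map_zero, zero_add, add_zero, ContinuousLinearMap.id_apply] using h1

/-- One explicit function solves both forced equations. Subtracting it reduces the claim to the
unforced equations, whose solutions agree. -/
theorem GeneratesCorrespondence.mild_iff (hU : UniformDichotomy φ P T₁ S₁ C₁ μs μu)
    (hG : GeneratesCorrespondence φ A L P T₁ S₁) (hA : IsClosed (A.graph : Set (E × E)))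
    (hL : Continuous fun p : M × E => L p.1 p.2) (ω : M) {r : ℝ} (hr : 0 ≤ r) {z g : ℝ → E}
    (hg : ContinuousOn g (Icc 0 r)) :
    MildLS φ A (ContinuousLinearMap.id ℝ E) L ω r z g ↔ IntegralLS P T₁ S₁ ω r z g := by
  have H := linearTheory_integralLS hU
  set g' : ℝ → E := IccExtend hr ((Icc 0 r).domRestrict g) with hg'
  have hg'c : Continuous g' := (continuousOn_iff_continuous_domRestrict.1 hg).Icc_extend'
  have hgg' : ∀ t ∈ Icc 0 r, g' t = g t := fun t ht => by
    rw [hg', IccExtend_of_mem hr _ ht]; rfl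
  set ζ := forcedSol P T₁ S₁ ω r g' 0
  have h1 : MildLS φ A (ContinuousLinearMap.id ℝ E) L ω r ζ g :=
    (hG.mild_forcedSol hU hA hL ω hg'c).congr hr (fun _ _ => rfl) hgg'
  have h2 : IntegralLS P T₁ S₁ ω r ζ g :=
    integralLS_congr hU hr (fun _ _ => rfl) hgg' (integralLS_forcedSol hU ω hr hg'c 0)
  have h0 : ContinuousOn (fun _ : ℝ => (0 : E)) (Icc 0 r) := continuousOn_const
  constructor
  · intro h
    have h3 := (h1.sub hL hg hg h).congr hr (fun _ _ => rfl) (g' := fun _ => 0)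
      fun t _ => sub_self _
    have h4 := H.sub hr hg h0 h2 ((hG.mild_zero_iff hU ω hr _).1 h3)
    simpa only [sub_sub_cancel, sub_zero] using h4
  · intro h
    have h3 := H.congr hr (fun _ _ => rfl) (g' := fun _ => 0) (fun t _ => sub_self _)
      (H.sub hr hg hg h2 h)
    have h4 := h1.sub hL hg h0 ((hG.mild_zero_iff hU ω hr _).2 h3)
    simpa only [sub_sub_cancel, sub_zero] using h4

/-- The invariant graph theorem for semilinear equations whose linear part generates a cocycle
correspondence. -/
theorem invariantGraphTheorem_biSemigroup {c : ℝ} (hc : 1 < c)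
    (hA : GeneratesBiSemigroup A) {τ : M → ℝ} (hL : CondL φ L τ) {f : M → E → E} (hf : CondF φ f)
    (hU : UniformDichotomy φ P T₁ S₁ C₁ μs μu) (hG : GeneratesCorrespondence φ A L P T₁ S₁)
    {β : M → ℝ} (hgap : InfPos (fun ω => μu ω - μs ω - (1 + c) * (2 * C₁ * eps φ f ω)))
    (hβ : ∀ ω, 2 * C₁ * eps φ f ω / (μu ω - μs ω - 2 * C₁ * eps φ f ω) ≤ β ω ∧ β ω < 1) :
    InvariantGraphTheorem φ P (IsMild φ A (ContinuousLinearMap.id ℝ E) (fun ω z => L ω z + f ω z))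
      f μs μu (fun ω => 2 * C₁ * eps φ f ω) β (∀ ω, ContDiff ℝ 1 (f ω)) True := by
  have H := linearTheory_integralLS hU
  refine invariantGraphTheorem_of_integralBound H hf.cont (fun ω w => ?_) hc
    (integralBound_integralLS hU)
    (fun ω => mul_nonneg (mul_nonneg zero_le_two hU.C_pos.le) (eps_nonneg f ω))
    (fun ω t _ z z' => (maxNorm_le_mul_norm hU.norm_P hU.norm_Pc _ _).trans
      (mul_norm_sub_le_maxNorm hf hU.C_pos.le P ω t z z')) hgap hβ
  rw [isMild_iff]
  refine forall₂_congr fun r hr => ?_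
  constructor
  · intro h
    exact (hG.mild_iff hU (isClosed_graph_of_generatesBiSemigroup hA) hL.cont ω hr
      (continuousOn_nonlinearity φ ω hf.cont h.1)).1 h
  · intro h
    exact (hG.mild_iff hU (isClosed_graph_of_generatesBiSemigroup hA) hL.cont ω hr
      (continuousOn_nonlinearity φ ω hf.cont h.1)).2 h

end Correspondence

end InvGraph

end

noncomputable section

namespace InvGraph

/-! ### Uniqueness for the Laplace transform -/

theorem integrableOn_of_exp_bound {E : Type*} [NormedAddCommGroup E] {k : ℝ → E}
    (hk : ContinuousOn k (Ioi 0)) {C a : ℝ} (ha : 0 < a)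
    (hb : ∀ t, 0 ≤ t → ‖k t‖ ≤ C * Real.exp (-a * t)) : IntegrableOn k (Ioi 0) :=
  ((exp_neg_integrableOn_Ioi 0 ha).const_mul C).mono'
    (hk.aestronglyMeasurable measurableSet_Ioi)
    ((ae_restrict_iff' measurableSet_Ioi).2 (ae_of_all _ fun t ht => hb t (le_of_lt ht)))

/-- A continuous function of exponential decay is determined by its exponential moments. -/
theorem eq_zero_of_exp_moments {k : ℝ → ℝ} (hk : Continuous k) {C a : ℝ} (ha : 0 < a)
    (hb : ∀ t, 0 ≤ t → |k t| ≤ C * Real.exp (-a * t))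
    (h : ∀ n : ℕ, ∫ t in Ioi (0 : ℝ), Real.exp (-t) ^ n * k t = 0) : ∀ t, 0 ≤ t → k t = 0 := by
  have hC : 0 ≤ C := by simpa using (abs_nonneg _).trans (hb 0 le_rfl)
  have hki : IntegrableOn k (Ioi 0) := integrableOn_of_exp_bound hk.continuousOn ha hb
  have hint : ∀ {b : ℝ → ℝ} {B : ℝ}, Continuous b → (∀ t, 0 ≤ t → |b t| ≤ B) →
      IntegrableOn (fun t => b t * k t) (Ioi 0) := by
    intro b B hbc hB
    refine integrableOn_of_exp_bound (C := B * C) (hbc.mul hk).continuousOn ha fun t ht => ?_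
    rw [Real.norm_eq_abs, abs_mul, mul_assoc]
    exact mul_le_mul (hB t ht) (hb t ht) (abs_nonneg _) ((abs_nonneg _).trans (hB t ht))
  have hexp : ∀ t : ℝ, 0 ≤ t → Real.exp (-t) ∈ Icc (0 : ℝ) 1 := fun t ht =>
    ⟨(Real.exp_pos _).le, Real.exp_le_one_iff.2 (by linarith)⟩
  have hpoly : ∀ p : Polynomial ℝ, ∫ t in Ioi (0 : ℝ), p.eval (Real.exp (-t)) * k t = 0 := by
    intro p
    simp only [Polynomial.eval_eq_sum_range, Finset.sum_mul, mul_assoc]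
    rw [integral_finsetSum]
    · simp only [integral_const_mul, h, mul_zero, Finset.sum_const_zero]
    · intro n _
      refine Integrable.const_mul (hint (B := 1) (by fun_prop) fun t ht => ?_) _
      rw [abs_of_nonneg (pow_nonneg (hexp t ht).1 n)]
      exact pow_le_one₀ (hexp t ht).1 (hexp t ht).2
  -- Substituting u = e^{-t} moves the problem to [0, 1], where Weierstrass applies; the decay of k
  -- makes q continuous at u = 0.
  set q : ℝ → ℝ := fun u => if u = 0 then 0 else k (-Real.log u) with hq
  have hq_exp : ∀ t, q (Real.exp (-t)) = k t := fun t => by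
    simp [hq, (Real.exp_pos _).ne']
  have hqc : ContinuousOn q (Icc 0 1) := by
    intro u hu
    rcases eq_or_ne u 0 with rfl | h0
    · have hq0 : q 0 = 0 := by simp [hq]
      rw [ContinuousWithinAt, hq0]
      have hl : Tendsto (fun u : ℝ => C * u ^ a) (𝓝[Icc 0 1] 0) (𝓝 0) := by
        have : Tendsto (fun u : ℝ => C * u ^ a) (𝓝 0) (𝓝 (C * (0 : ℝ) ^ a)) :=
          (Real.continuousAt_rpow_const 0 a (Or.inr ha.le)).const_mul C
        rw [Real.zero_rpow ha.ne', mul_zero] at this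
        exact this.mono_left nhdsWithin_le_nhds
      refine squeeze_zero_norm' ?_ hl
      filter_upwards [self_mem_nhdsWithin] with u hu
      rcases eq_or_ne u 0 with rfl | h0
      · simp [hq, Real.zero_rpow ha.ne']
      · have hu0 : 0 < u := lt_of_le_of_ne hu.1 (Ne.symm h0)
        simp only [hq, h0, if_false]
        refine (hb _ (neg_nonneg.2 (Real.log_nonpos hu.1 hu.2))).trans_eq ?_
        rw [Real.rpow_def_of_pos hu0]
        congr 2; ring
    · have hu0 : 0 < u := lt_of_le_of_ne hu.1 (Ne.symm h0)
      refine ContinuousAt.continuousWithinAt ?_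
      have h1 : ContinuousAt (fun u => k (-Real.log u)) u :=
        hk.continuousAt.comp (Real.continuousAt_log h0).neg
      refine h1.congr ?_
      filter_upwards [lt_mem_nhds hu0] with x hx
      simp [hq, hx.ne']
  -- Polynomials in e^{-t} are orthogonal to k, so one factor k may be replaced by its difference to
  -- an approximating polynomial.
  have hsq : ∫ t in Ioi (0 : ℝ), k t * k t = 0 := by
    have hkk := hint hk (B := C) fun t ht => (hb t ht).trans (by
      have : Real.exp (-a * t) ≤ 1 := Real.exp_le_one_iff.2 (by nlinarith)
      nlinarith)
    refine le_antisymm (le_of_forall_pos_le_add fun ε hε => ?_)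
      (integral_nonneg fun t => mul_self_nonneg _)
    set I := ∫ t in Ioi (0 : ℝ), |k t| with hI
    have hI0 : 0 ≤ I := integral_nonneg fun t => abs_nonneg _
    obtain ⟨p, hp⟩ := exists_polynomial_near_of_continuousOn 0 1 q hqc (ε / (I + 1)) (by positivity)
    obtain ⟨B, hB⟩ := isCompact_Icc.exists_bound_of_continuousOn
      (p.continuous.continuousOn (s := Icc 0 1))
    have hpi := hint (b := fun t => p.eval (Real.exp (-t))) (B := B)
      (p.continuous.comp (by fun_prop)) fun t ht => hB _ (hexp t ht)
    calc ∫ t in Ioi (0 : ℝ), k t * k t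
        = ∫ t in Ioi (0 : ℝ), (k t * k t - p.eval (Real.exp (-t)) * k t) := by
          rw [integral_sub hkk hpi, hpoly, sub_zero]
      _ ≤ ∫ t in Ioi (0 : ℝ), ε / (I + 1) * |k t| := by
          refine setIntegral_mono_on (hkk.sub hpi) (hki.norm.const_mul _) measurableSet_Ioi
            fun t ht => ?_
          rw [← sub_mul]
          refine (le_abs_self _).trans ?_
          rw [abs_mul]
          have := hp _ (hexp t (le_of_lt ht))
          rw [hq_exp, abs_sub_comm] at this
          gcongr
      _ = ε / (I + 1) * I := by rw [integral_const_mul]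
      _ ≤ 0 + ε := by
          rw [zero_add, div_mul_eq_mul_div, div_le_iff₀ (by linarith)]
          nlinarith
  have hae : (fun t => k t * k t) =ᵐ[volume.restrict (Ioi 0)] fun _ => 0 :=
    (integral_eq_zero_iff_of_nonneg_ae (ae_of_all _ fun t => mul_self_nonneg _)
      (hint hk (B := C) fun t ht => (hb t ht).trans (by
        have : Real.exp (-a * t) ≤ 1 := Real.exp_le_one_iff.2 (by nlinarith)
        nlinarith))).1 hsq
  have heq := Measure.eqOn_open_of_ae_eq hae isOpen_Ioi (hk.mul hk).continuousOn continuousOn_const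
  have hcl : EqOn (fun t => k t * k t) (fun _ => 0) (closure (Ioi 0)) :=
    heq.closure (hk.mul hk) continuous_const
  intro t ht
  exact mul_self_eq_zero.1 (hcl (by rw [closure_Ioi]; exact ht))

section Laplace

variable {Z : Type v} [NormedAddCommGroup Z] [NormedSpace ℝ Z]

theorem norm_exp_smul_le {g : ℝ → Z} {K w l : ℝ} (hb : ∀ t, 0 ≤ t → ‖g t‖ ≤ K * Real.exp (w * t))
    {t : ℝ} (ht : 0 ≤ t) : ‖Real.exp (-l * t) • g t‖ ≤ K * Real.exp (-(l - w) * t) := by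
  rw [norm_smul, Real.norm_of_nonneg (Real.exp_pos _).le]
  refine (mul_le_mul_of_nonneg_left (hb t ht) (Real.exp_pos _).le).trans_eq ?_
  rw [mul_left_comm, ← Real.exp_add]
  congr 2; ring

theorem integrableOn_exp_smul {g : ℝ → Z} (hg : Continuous g) {K w l : ℝ}
    (hb : ∀ t, 0 ≤ t → ‖g t‖ ≤ K * Real.exp (w * t)) (hl : w < l) :
    IntegrableOn (fun t => Real.exp (-l * t) • g t) (Ioi 0) :=
  integrableOn_of_exp_bound (a := l - w) (by fun_prop) (sub_pos.2 hl)
    fun _ ht => norm_exp_smul_le hb ht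

variable [CompleteSpace Z]

theorem norm_primitive_le {g : ℝ → Z} {K w : ℝ} (hw : 0 < w)
    (hb : ∀ t, 0 ≤ t → ‖g t‖ ≤ K * Real.exp (w * t)) {t : ℝ} (ht : 0 ≤ t) :
    ‖∫ s in (0 : ℝ)..t, g s‖ ≤ K / w * Real.exp (w * t) := by
  have hK : 0 ≤ K := by simpa using (norm_nonneg _).trans (hb 0 le_rfl)
  refine (intervalIntegral.norm_integral_le_of_norm_le ht
    (ae_of_all _ fun s hs => hb s hs.1.le)
    (Continuous.intervalIntegrable (by fun_prop) _ _)).trans ?_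
  have h1 := mul_integral_exp_left 0 w t
  simp only [zero_mul, Real.exp_zero, one_mul, sub_zero] at h1
  rw [intervalIntegral.integral_const_mul, div_mul_eq_mul_div, le_div_iff₀ hw, mul_assoc,
    mul_comm _ w, h1]
  exact mul_le_mul_of_nonneg_left (by linarith) hK

/-- Integration by parts; the boundary term at infinity vanishes because the primitive also grows at
most like e^{wt}, which is why w > 0 is required. -/
theorem laplace_primitive {g : ℝ → Z} (hg : Continuous g) {K w l : ℝ} (hw : 0 < w) (hl : w < l)
    (hb : ∀ t, 0 ≤ t → ‖g t‖ ≤ K * Real.exp (w * t)) :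
    l • ∫ t in Ioi (0 : ℝ), Real.exp (-l * t) • ∫ s in (0 : ℝ)..t, g s =
      ∫ t in Ioi (0 : ℝ), Real.exp (-l * t) • g t := by
  have hGc : Continuous fun t : ℝ => ∫ s in (0 : ℝ)..t, g s :=
    intervalIntegral.continuous_primitive (fun a b => hg.intervalIntegrable a b) 0
  have hGb := fun t (ht : 0 ≤ t) => norm_primitive_le hw hb ht
  have i1 := integrableOn_exp_smul hg hb hl
  have i2 := integrableOn_exp_smul hGc hGb hl
  have hd : ∀ t ∈ Ici (0 : ℝ), HasDerivAt (fun t => Real.exp (-l * t) • ∫ s in (0 : ℝ)..t, g s)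
      (Real.exp (-l * t) • g t - l • (Real.exp (-l * t) • ∫ s in (0 : ℝ)..t, g s)) t := by
    intro t _
    have h1 : HasDerivAt (fun t : ℝ => ∫ s in (0 : ℝ)..t, g s) (g t) t :=
      intervalIntegral.integral_hasDerivAt_right (hg.intervalIntegrable _ _)
        (hg.stronglyMeasurableAtFilter _ _) hg.continuousAt
    have h2 : HasDerivAt (fun t : ℝ => Real.exp (-l * t)) (Real.exp (-l * t) * (-l)) t := by
      have := ((hasDerivAt_id t).const_mul (-l)).exp
      simpa using this
    refine (h2.fun_smul h1).congr_deriv ?_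
    rw [mul_neg, neg_smul, mul_comm (Real.exp _) l, mul_smul, sub_eq_add_neg, add_comm]
  have hlim : Tendsto (fun t => Real.exp (-l * t) • ∫ s in (0 : ℝ)..t, g s) atTop (𝓝 0) := by
    have h1 : Tendsto (fun t : ℝ => K / w * Real.exp (-(l - w) * t)) atTop (𝓝 0) := by
      have : Tendsto (fun t : ℝ => (l - w) * t) atTop atTop :=
        tendsto_id.const_mul_atTop (sub_pos.2 hl)
      simpa only [neg_mul, mul_zero, Function.comp_def] using
        (Real.tendsto_exp_neg_atTop_nhds_zero.comp this).const_mul (K / w)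
    refine squeeze_zero_norm' ?_ h1
    filter_upwards [eventually_ge_atTop 0] with t ht
    exact norm_exp_smul_le hGb ht
  have := integral_Ioi_of_hasDerivAt_of_tendsto' hd (i1.sub (i2.fun_smul l)) hlim
  rw [integral_sub i1 (i2.fun_smul l), integral_smul] at this
  simp only [intervalIntegral.integral_same, smul_zero, sub_zero] at this
  exact (sub_eq_zero.1 this).symm

/-- Functionals reduce to the scalar case. The transforms at l = w + 1 + n are the exponential
moments of the function damped by e^{-(w+1)t}. -/
theorem eq_zero_of_laplace {g : ℝ → Z} (hg : Continuous g) {K w : ℝ}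
    (hb : ∀ t, 0 ≤ t → ‖g t‖ ≤ K * Real.exp (w * t))
    (h : ∀ l, w < l → ∫ t in Ioi (0 : ℝ), Real.exp (-l * t) • g t = 0) {t : ℝ} (ht : 0 ≤ t) :
    g t = 0 := by
  refine SeparatingDual.eq_zero_of_forall_dual_eq_zero (R := ℝ) fun ℓ => ?_
  have hk : Continuous fun t => Real.exp (-(w + 1) * t) * ℓ (g t) := by fun_prop
  have := eq_zero_of_exp_moments hk (C := ‖ℓ‖ * K) (a := 1) one_pos (fun t ht => ?_) (fun n => ?_) t ht
  · exact (mul_eq_zero.1 this).resolve_left (Real.exp_pos (-(w + 1) * t)).ne'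
  · have h1 := norm_exp_smul_le (l := w + 1) hb ht
    rw [add_sub_cancel_left, norm_smul, Real.norm_of_nonneg (Real.exp_pos _).le] at h1
    rw [abs_mul, abs_of_pos (Real.exp_pos (-(w + 1) * t)), mul_assoc ‖ℓ‖]
    refine le_trans ?_ (mul_le_mul_of_nonneg_left h1 (norm_nonneg ℓ))
    rw [mul_left_comm]
    exact mul_le_mul_of_nonneg_left (ℓ.le_opNorm (g t)) (Real.exp_pos (-(w + 1) * t)).le
  · have hl : w < w + 1 + n := by have : (0 : ℝ) ≤ n := n.cast_nonneg; linarith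
    have h1 := ℓ.integral_comp_comm (integrableOn_exp_smul hg hb hl)
    rw [h _ hl, map_zero] at h1
    refine (setIntegral_congr_fun measurableSet_Ioi fun t _ => ?_).trans h1
    simp only [map_smul, smul_eq_mul]
    rw [← Real.exp_nat_mul, ← mul_assoc, ← Real.exp_add]
    congr 2; ring

end Laplace

/-! ### Resolvents and integrated semigroups -/

section Integrated

variable {Z : Type v} [NormedAddCommGroup Z] [NormedSpace ℝ Z] {A : Z →ₗ.[ℝ] Z}

/-- Turns membership in the graph of A into an equation between bounded operators; closedness of the
graph is then evident. -/
theorem IsResolventAt.mem_graph_iff {l : ℝ} {R : Z →L[ℝ] Z} (hR : IsResolventAt A l R) (x y : Z) :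
    (x, y) ∈ A.graph ↔ R (l • x - y) = x := by
  rw [mem_graph_iff_exists]
  constructor
  · rintro ⟨h, rfl⟩
    exact hR.2 ⟨x, h⟩
  · intro h
    obtain ⟨h1, h2⟩ := hR.1 (l • x - y)
    simp only [h] at h1 h2
    exact ⟨h1, sub_right_injective h2⟩

theorem IsResolventAt.isClosed_graph {l : ℝ} {R : Z →L[ℝ] Z} (hR : IsResolventAt A l R) :
    IsClosed (A.graph : Set (Z × Z)) := by
  have : (A.graph : Set (Z × Z)) = {p | R (l • p.1 - p.2) = p.1} := by
    ext ⟨x, y⟩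
    exact hR.mem_graph_iff x y
  rw [this]
  exact isClosed_eq (by fun_prop) continuous_fst

/-- The resolvent identity, obtained by applying R to z written as (l - A) R'z + (l' - l) R'z. -/
theorem IsResolventAt.sub_eq {l l' : ℝ} {R R' : Z →L[ℝ] Z} (hR : IsResolventAt A l R)
    (hR' : IsResolventAt A l' R') (z : Z) : R z = R' z + (l' - l) • R (R' z) := by
  obtain ⟨h1, h2⟩ := hR'.1 z
  have h3 := hR.2 ⟨R' z, h1⟩
  have h4 : z = (l • R' z - A ⟨R' z, h1⟩) + (l' - l) • R' z := by
    conv_lhs => rw [← h2]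
    rw [sub_smul]; abel
  conv_lhs => rw [h4]
  rw [map_add, map_smul, h3]

theorem GeneratesIntegratedSemigroup.isClosed_graph {S : ℝ≥0 → Z →L[ℝ] Z}
    (hS : GeneratesIntegratedSemigroup A S) : IsClosed (A.graph : Set (Z × Z)) := by
  obtain ⟨-, K, w, -, h⟩ := hS
  obtain ⟨R, hR, -⟩ := h (w + 1) (by linarith)
  exact hR.isClosed_graph

theorem GeneratesIntegratedSemigroup.continuous_toNNReal {S : ℝ≥0 → Z →L[ℝ] Z}
    (hS : GeneratesIntegratedSemigroup A S) (z : Z) : Continuous fun t : ℝ => S t.toNNReal z :=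
  (hS.1 z).comp continuous_real_toNNReal

/-- `S(t) z = A ∫_0^t S(s) z ds + t z`. -/
theorem GeneratesIntegratedSemigroup.mem_graph [CompleteSpace Z] {S : ℝ≥0 → Z →L[ℝ] Z}
    (hS : GeneratesIntegratedSemigroup A S) (z : Z) {t : ℝ} (ht : 0 ≤ t) :
    (∫ s in (0 : ℝ)..t, S s.toNNReal z, S t.toNNReal z - t • z) ∈ A.graph := by
  have hSc := hS.continuous_toNNReal z
  obtain ⟨-, K, w, hK, hR⟩ := hS
  have hK0 : 0 ≤ K := by simpa using (norm_nonneg _).trans (hK 0)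
  obtain ⟨R, hR0, -⟩ := hR (w + 1) (by linarith)
  set l₀ := w + 1
  -- The exponent is enlarged to a positive one, so that primitives obey the same growth bound.
  obtain ⟨w', hw0, hww⟩ : ∃ w', 0 < w' ∧ w ≤ w' :=
    ⟨max w 0 + 1, by have := le_max_right w 0; linarith, by have := le_max_left w 0; linarith⟩
  have hSb : ∀ t : ℝ, 0 ≤ t → ‖S t.toNNReal z‖ ≤ K * ‖z‖ * Real.exp (w' * t) := by
    intro t ht
    have h1 := (S t.toNNReal).le_of_opNorm_le (hK t.toNNReal) z
    rw [Real.coe_toNNReal _ ht] at h1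
    calc _ ≤ K * Real.exp (w * t) * ‖z‖ := h1
      _ ≤ K * Real.exp (w' * t) * ‖z‖ := by gcongr
      _ = _ := by ring
  -- With the resolvent at l₀ the claim reads R S(t)z = ∫ q. Both sides grow exponentially, so it is
  -- enough to compare Laplace transforms.
  set q : ℝ → Z := fun t => l₀ • R (S t.toNNReal z) - S t.toNNReal z + R z with hq
  have hRSc : Continuous fun t : ℝ => R (S t.toNNReal z) := R.continuous.comp hSc
  have hqc : Continuous q := ((hRSc.const_smul l₀).sub hSc).add continuous_const
  have hRSb : ∀ t : ℝ, 0 ≤ t → ‖R (S t.toNNReal z)‖ ≤ ‖R‖ * (K * ‖z‖) * Real.exp (w' * t) := by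
    intro t ht
    rw [mul_assoc]
    exact (R.le_opNorm _).trans (mul_le_mul_of_nonneg_left (hSb t ht) (norm_nonneg R))
  have h1b : ∀ t : ℝ, 0 ≤ t → ‖R z‖ ≤ ‖R z‖ * Real.exp (w' * t) := fun t ht =>
    le_mul_of_one_le_right (norm_nonneg _) (Real.one_le_exp (mul_nonneg hw0.le ht))
  have hqb : ∀ t : ℝ, 0 ≤ t → ‖q t‖ ≤
      (|l₀| * (‖R‖ * (K * ‖z‖)) + K * ‖z‖ + ‖R z‖) * Real.exp (w' * t) := by
    intro t ht
    refine (norm_add_le _ _).trans ((add_le_add (norm_sub_le _ _) (h1b t ht)).trans ?_)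
    rw [norm_smul, Real.norm_eq_abs, add_mul, add_mul]
    have := mul_le_mul_of_nonneg_left (hRSb t ht) (abs_nonneg l₀)
    linarith [hSb t ht]
  set g : ℝ → Z := fun t => R (S t.toNNReal z) - ∫ s in (0 : ℝ)..t, q s with hg
  have hGc : Continuous fun t : ℝ => ∫ s in (0 : ℝ)..t, q s :=
    intervalIntegral.continuous_primitive (fun a b => hqc.intervalIntegrable a b) 0
  have hGb := fun t (ht : 0 ≤ t) => norm_primitive_le hw0 hqb ht
  have hz : g t = 0 := by
    obtain ⟨Kg, hgb⟩ : ∃ Kg, ∀ t, 0 ≤ t → ‖g t‖ ≤ Kg * Real.exp (w' * t) := ⟨_, fun t ht =>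
      (norm_sub_le _ _).trans ((add_le_add (hRSb t ht) (hGb t ht)).trans_eq (add_mul _ _ _).symm)⟩
    refine eq_zero_of_laplace (hRSc.sub hGc) hgb (fun l hl => ?_) ht
    · have hl0 : 0 < l := hw0.trans hl
      obtain ⟨Rl, hRl, hLap⟩ := hR l (hww.trans_lt hl)
      have i1 := integrableOn_exp_smul hSc hSb hl
      have i2 := integrableOn_exp_smul hRSc hRSb hl
      have i3 := integrableOn_exp_smul hGc hGb hl
      have i4 := integrableOn_exp_smul (continuous_const (y := R z)) h1b hl
      have e1 : ∫ t in Ioi (0 : ℝ), Real.exp (-l * t) • S t.toNNReal z = l⁻¹ • Rl z := by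
        rw [hLap z, smul_smul, inv_mul_cancel₀ hl0.ne', one_smul]
      have e2 : ∫ t in Ioi (0 : ℝ), Real.exp (-l * t) • R (S t.toNNReal z) =
          l⁻¹ • R (Rl z) := by
        have := R.integral_comp_comm i1
        rw [e1] at this
        simpa only [map_smul] using this
      have e4 : ∫ t in Ioi (0 : ℝ), Real.exp (-l * t) • R z = l⁻¹ • R z := by
        rw [integral_smul_const, integral_exp_mul_Ioi (neg_lt_zero.2 hl0)]
        simp [neg_div_neg_eq]
      have e3 : ∫ t in Ioi (0 : ℝ), Real.exp (-l * t) • q t =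
          l₀ • l⁻¹ • R (Rl z) - l⁻¹ • Rl z + l⁻¹ • R z := by
        simp only [hq, smul_add, smul_sub]
        simp only [smul_comm _ l₀]
        have i21 : IntegrableOn (fun t : ℝ => l₀ • Real.exp (-l * t) • R (S t.toNNReal z) -
            Real.exp (-l * t) • S t.toNNReal z) (Ioi 0) := (i2.fun_smul l₀).sub i1
        rw [integral_add i21 i4, integral_sub (i2.fun_smul l₀) i1,
          integral_smul, e1, e2, e4]
      have e5 := laplace_primitive hqc hw0 hl hqb
      rw [e3] at e5
      have e6 : ∫ t in Ioi (0 : ℝ), Real.exp (-l * t) • g t =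
          l⁻¹ • R (Rl z) - ∫ t in Ioi (0 : ℝ), Real.exp (-l * t) • ∫ s in (0 : ℝ)..t, q s := by
        simp only [hg, smul_sub]
        rw [integral_sub i2 i3, e2]
      -- After multiplication by l, equality of the two transforms is the resolvent identity for l₀
      -- and l.
      have e7 : l • ∫ t in Ioi (0 : ℝ), Real.exp (-l * t) • g t = 0 := by
        obtain ⟨i, hi⟩ : ∃ i, i = l⁻¹ := ⟨_, rfl⟩
        have hi1 : l * i = 1 := by rw [hi, mul_inv_cancel₀ hl0.ne']
        rw [e6, smul_sub, e5, hR0.sub_eq hRl z, ← hi]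
        match_scalars
        · ring
        · ring
      exact (smul_eq_zero.1 e7).resolve_left hl0.ne'
  have c1 : Continuous fun t : ℝ => l₀ • R (S t.toNNReal z) := hRSc.const_smul l₀
  have c2 : Continuous fun t : ℝ => l₀ • R (S t.toNNReal z) - S t.toNNReal z := c1.sub hSc
  have e : ∫ s in (0 : ℝ)..t, q s =
      l₀ • R (∫ s in (0 : ℝ)..t, S s.toNNReal z) - (∫ s in (0 : ℝ)..t, S s.toNNReal z) + t • R z := by
    simp only [hq]
    rw [intervalIntegral.integral_add (c2.intervalIntegrable _ _)
      (continuous_const.intervalIntegrable _ _),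
      intervalIntegral.integral_sub (c1.intervalIntegrable _ _)
      (hSc.intervalIntegrable _ _), intervalIntegral.integral_smul, intervalIntegral.integral_const,
      R.intervalIntegral_comp_comm (hSc.intervalIntegrable _ _), sub_zero]
  simp only [hg, e] at hz
  rw [hR0.mem_graph_iff, map_sub, map_sub, map_smul, map_smul, sub_eq_zero.1 hz]
  abel

end Integrated

end InvGraph

end

noncomputable section

namespace InvGraph

/-! ### Inhomogeneous equations with MR operators -/

/-- A strongly continuous, locally bounded family of operators is jointly continuous. -/
theorem continuous_uncurry_of_locally_bounded {X E F : Type*} [TopologicalSpace X]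
    [NormedAddCommGroup E] [NormedSpace ℝ E] [NormedAddCommGroup F] [NormedSpace ℝ F]
    {B : X → E →L[ℝ] F} (hB : ∀ z, Continuous fun x => B x z)
    (hb : ∀ x, ∃ U ∈ 𝓝 x, ∃ C, ∀ y ∈ U, ‖B y‖ ≤ C) : Continuous fun p : X × E => B p.1 p.2 := by
  refine continuous_iff_continuousAt.2 fun ⟨x, z⟩ => ?_
  obtain ⟨U, hU, C, hC⟩ := hb x
  refine tendsto_iff_norm_sub_tendsto_zero.2 ?_
  have h1 : Tendsto (fun p : X × E => C * ‖p.2 - z‖ + ‖B p.1 z - B x z‖) (𝓝 (x, z)) (𝓝 0) := by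
    have : Tendsto (fun p : X × E => C * ‖p.2 - z‖ + ‖B p.1 z - B x z‖) (𝓝 (x, z))
        (𝓝 (C * ‖z - z‖ + ‖B x z - B x z‖)) :=
      (Continuous.tendsto (((continuous_snd.sub continuous_const).norm.const_mul C).add
        ((((hB z).comp continuous_fst).sub continuous_const).norm)) (x, z))
    simpa using this
  refine squeeze_zero' (Eventually.of_forall fun p => norm_nonneg _) ?_ h1
  filter_upwards [continuous_fst.continuousAt.preimage_mem_nhds hU] with p hp
  calc ‖B p.1 p.2 - B x z‖ = ‖B p.1 (p.2 - z) + (B p.1 z - B x z)‖ := by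
        rw [map_sub]; congr 1; abel
    _ ≤ _ := (norm_add_le _ _).trans (add_le_add_left ((B p.1).le_of_opNorm_le (hC _ hp) _) _)

section MR

variable {Z : Type v} [NormedAddCommGroup Z] [NormedSpace ℝ Z] {A : Z →ₗ.[ℝ] Z}

theorem eq_zero_of_zero_mem_graph {y : Z} (h : ((0 : Z), y) ∈ A.graph) : y = 0 :=
  A.graph_fst_eq_zero_snd h rfl

variable [CompleteSpace Z] {S : ℝ≥0 → Z →L[ℝ] Z}

theorem GeneratesIntegratedSemigroup.zero (hS : GeneratesIntegratedSemigroup A S) (z : Z) :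
    S 0 z = 0 := by
  have := hS.mem_graph z le_rfl
  rw [intervalIntegral.integral_same, zero_smul, sub_zero, Real.toNNReal_zero] at this
  exact eq_zero_of_zero_mem_graph this

theorem GeneratesIntegratedSemigroup.continuous_uncurry (hS : GeneratesIntegratedSemigroup A S) :
    Continuous fun p : ℝ × Z => S p.1.toNNReal p.2 := by
  have hc := hS.continuous_toNNReal
  obtain ⟨-, K, w, hK, -⟩ := hS
  refine continuous_uncurry_of_locally_bounded (B := fun t : ℝ => S t.toNNReal) hc fun x => ?_
  have h1 : ContinuousAt (fun t : ℝ => K * Real.exp (w * t.toNNReal)) x := by fun_prop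
  refine ⟨_, h1.eventually (gt_mem_nhds (lt_add_one _)), _, fun y hy => (hK _).trans (le_of_lt hy)⟩

theorem integral_eq_of_contDiff {g : ℝ → Z} (hg : ContDiff ℝ 1 g) (t : ℝ) :
    g t = g 0 + ∫ s in (0 : ℝ)..t, deriv g s := by
  rw [intervalIntegral.integral_deriv_eq_sub (fun x _ => hg.differentiable one_ne_zero x)
    ((hg.continuous_deriv le_rfl).intervalIntegrable _ _)]
  abel

/-- The convolution with a `C¹` function has a continuous derivative, which is a mild solution of
`V' = A V + g` with `V(0) = 0`. -/
theorem GeneratesIntegratedSemigroup.exists_mild (hS : GeneratesIntegratedSemigroup A S)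
    {g : ℝ → Z} (hg : ContDiff ℝ 1 g) : ∃ V : ℝ → Z, Continuous V ∧ V 0 = 0 ∧ ∀ t, 0 ≤ t →
      (∫ s in (0 : ℝ)..t, V s, V t - ∫ s in (0 : ℝ)..t, g s) ∈ A.graph ∧ diamond S g t = V t := by
  have hSj := hS.continuous_uncurry
  have hg' : Continuous (deriv g) := hg.continuous_deriv le_rfl
  have hG : Continuous (Function.uncurry fun t s : ℝ => S (t - s).toNNReal (deriv g s)) :=
    hSj.comp ((continuous_fst.sub continuous_snd).prodMk (hg'.comp continuous_snd))
  have hSg : Continuous fun t : ℝ => S t.toNNReal (g 0) := hS.continuous_toNNReal _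
  have hc1 : Continuous fun t : ℝ => ∫ s in (0 : ℝ)..t, S (t - s).toNNReal (deriv g s) :=
    intervalIntegral.continuous_parametric_intervalIntegral_of_continuous hG continuous_id
  -- What formal differentiation of the convolution gives when the derivative falls on g.
  set V : ℝ → Z := fun t => S t.toNNReal (g 0) + ∫ s in (0 : ℝ)..t, S (t - s).toNNReal (deriv g s)
    with hV
  have hVc : Continuous V := hSg.add hc1
  set Fz : Z → ℝ → Z := fun z t => ∫ s in (0 : ℝ)..t, S s.toNNReal z with hFz
  have hFc : Continuous fun p : ℝ × Z => Fz p.2 p.1 := by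
    refine intervalIntegral.continuous_parametric_intervalIntegral_of_continuous
      (f := fun (p : ℝ × Z) s => S s.toNNReal p.2) ?_ continuous_fst
    exact hSj.comp (continuous_snd.prodMk (continuous_snd.comp continuous_fst))
  have hIV : ∀ t, 0 ≤ t → ∫ s in (0 : ℝ)..t, V s =
      Fz (g 0) t + ∫ σ in (0 : ℝ)..t, Fz (deriv g σ) (t - σ) := by
    intro t ht
    simp only [hV]
    rw [intervalIntegral.integral_add (hSg.intervalIntegrable _ _) (hc1.intervalIntegrable _ _),
      integral_triangle_swap hG ht]
    congr 2
    ext σ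
    rw [intervalIntegral.integral_comp_sub_right (fun τ => S τ.toNNReal (deriv g σ)), sub_self]
  -- The convolution and the primitive of V reduce to the same expression, so V is indeed the
  -- derivative of the convolution.
  have hIW : ∀ t, 0 ≤ t → ∫ s in (0 : ℝ)..t, S (t - s).toNNReal (g s) =
      Fz (g 0) t + ∫ σ in (0 : ℝ)..t, Fz (deriv g σ) (t - σ) := by
    intro t ht
    have hG1 : Continuous (Function.uncurry fun s σ : ℝ => S (t - s).toNNReal (deriv g σ)) :=
      hSj.comp ((continuous_const.sub continuous_fst).prodMk (hg'.comp continuous_snd))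
    have e1 : ∀ s, S (t - s).toNNReal (g s) = S (t - s).toNNReal (g 0) +
        ∫ σ in (0 : ℝ)..s, S (t - s).toNNReal (deriv g σ) := fun s => by
      conv_lhs => rw [integral_eq_of_contDiff hg s]
      rw [map_add, ContinuousLinearMap.intervalIntegral_comp_comm _ (hg'.intervalIntegrable _ _)]
    have i1 : Continuous fun s : ℝ => S (t - s).toNNReal (g 0) := hSg.comp (by fun_prop)
    have i2 : Continuous fun s : ℝ => ∫ σ in (0 : ℝ)..s, S (t - s).toNNReal (deriv g σ) :=
      intervalIntegral.continuous_parametric_intervalIntegral_of_continuous hG1 continuous_id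
    simp only [e1]
    rw [intervalIntegral.integral_add (i1.intervalIntegrable _ _) (i2.intervalIntegrable _ _),
      integral_triangle_swap hG1 ht]
    congr 1
    · rw [intervalIntegral.integral_comp_sub_left (fun τ => S τ.toNNReal (g 0)), sub_self, sub_zero]
    · congr 1
      ext σ
      rw [intervalIntegral.integral_comp_sub_left (fun τ => S τ.toNNReal (deriv g σ)), sub_self]
  have hIg : ∀ t, 0 ≤ t → ∫ s in (0 : ℝ)..t, g s =
      t • g 0 + ∫ σ in (0 : ℝ)..t, (t - σ) • deriv g σ := by
    intro t ht
    have hG2 : Continuous (Function.uncurry fun _ σ : ℝ => deriv g σ) := hg'.comp continuous_snd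
    have i2 : Continuous fun s : ℝ => ∫ σ in (0 : ℝ)..s, deriv g σ :=
      intervalIntegral.continuous_parametric_intervalIntegral_of_continuous hG2 continuous_id
    rw [intervalIntegral.integral_congr fun s _ => integral_eq_of_contDiff hg s,
      intervalIntegral.integral_add (continuous_const.intervalIntegrable _ _)
        (i2.intervalIntegrable _ _), integral_triangle_swap hG2 ht]
    simp
  refine ⟨V, hVc, ?_, fun t ht => ⟨?_, ?_⟩⟩
  · simp [hV, hS.zero]
  · have c1 : Continuous fun σ : ℝ => Fz (deriv g σ) (t - σ) :=
      hFc.comp ((continuous_const.sub continuous_id).prodMk hg')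
    have c2 : Continuous fun σ : ℝ => S (t - σ).toNNReal (deriv g σ) :=
      hSj.comp ((continuous_const.sub continuous_id).prodMk hg')
    have c3 : Continuous fun σ : ℝ => (t - σ) • deriv g σ := by fun_prop
    -- The graph relation for S, applied to each vector g'(σ) on the remaining time t - σ and
    -- integrated over σ.
    have h1 : (∫ σ in (0 : ℝ)..t, Fz (deriv g σ) (t - σ),
        ∫ σ in (0 : ℝ)..t, (S (t - σ).toNNReal (deriv g σ) - (t - σ) • deriv g σ)) ∈ A.graph := by
      refine integral_mem_graph hS.isClosed_graph (c1.intervalIntegrable _ _)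
        ((c2.sub c3).intervalIntegrable _ _) fun σ hσ => hS.mem_graph _ ?_
      rw [uIcc_of_le ht] at hσ
      exact sub_nonneg.2 hσ.2
    have h2 := A.graph.add_mem (hS.mem_graph (g 0) ht) h1
    rw [Prod.mk_add_mk, intervalIntegral.integral_sub (c2.intervalIntegrable _ _)
      (c3.intervalIntegrable _ _)] at h2
    rw [hIV t ht, hIg t ht]
    convert h2 using 2
    simp only [hV]
    abel
  · have h1 : HasDerivAt (fun t => ∫ s in (0 : ℝ)..t, V s) (V t) t :=
      intervalIntegral.integral_hasDerivAt_right (hVc.intervalIntegrable _ _)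
        (hVc.stronglyMeasurableAtFilter _ _) hVc.continuousAt
    refine HasDerivWithinAt.derivWithin (h1.hasDerivWithinAt.congr (fun s hs => ?_) ?_)
      (uniqueDiffOn_Ici 0 t ht)
    · rw [hIW s hs, hIV s hs]
    · rw [hIW t ht, hIV t ht]

/-- V(t) is a limit of difference quotients of its primitive, all of which lie in D(A). -/
theorem mem_closDom_of_integral {V : ℝ → Z} (hV : Continuous V)
    (h : ∀ t, 0 ≤ t → ∫ s in (0 : ℝ)..t, V s ∈ A.domain) {t : ℝ} (ht : 0 ≤ t) :
    V t ∈ closDom A := by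
  have h1 : HasDerivAt (fun t => ∫ s in (0 : ℝ)..t, V s) (V t) t :=
    intervalIntegral.integral_hasDerivAt_right (hV.intervalIntegrable _ _)
      (hV.stronglyMeasurableAtFilter _ _) hV.continuousAt
  rw [hasDerivAt_iff_tendsto_slope] at h1
  refine (Submodule.isClosed_topologicalClosure A.domain).mem_of_tendsto
    (h1.mono_left (nhdsWithin_mono t (s := Ioi t) fun s hs => ne_of_gt hs)) ?_
  filter_upwards [self_mem_nhdsWithin] with s hs
  rw [slope_def_module]
  exact A.domain.le_topologicalClosure
    (A.domain.smul_mem _ (A.domain.sub_mem (h s (ht.trans (le_of_lt hs))) (h t ht)))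

/-- Mild solutions on `[0, r]` of `z' = A z + g(t)` in the closure of `D(A)`. -/
def ForcedSol (A : Z →ₗ.[ℝ] Z) (r : ℝ) (z : ℝ → closDom A) (g : ℝ → Z) : Prop :=
  ContinuousOn z (Icc 0 r) ∧
  ∀ t ∈ Icc (0 : ℝ) r, (∫ s in (0 : ℝ)..t, ((closDom A).subtypeL (z s) : Z),
    (closDom A).subtypeL (z t) - (closDom A).subtypeL (z 0) - ∫ s in (0 : ℝ)..t, g s) ∈ A.graph

theorem ForcedSol.congr_right {r : ℝ} {z : ℝ → closDom A} {g g' : ℝ → Z}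
    (hg : ∀ t ∈ Icc 0 r, g t = g' t) (h : ForcedSol A r z g) : ForcedSol A r z g' := by
  refine ⟨h.1, fun t ht => ?_⟩
  have e2 : ∫ s in (0 : ℝ)..t, g' s = ∫ s in (0 : ℝ)..t, g s :=
    intervalIntegral.integral_congr fun s hs => by
      rw [uIcc_of_le ht.1] at hs
      exact (hg s ⟨hs.1, hs.2.trans ht.2⟩).symm
  rw [e2]
  exact h.2 t ht

theorem ForcedSol.sub {r : ℝ} {z z' : ℝ → closDom A} {g g' : ℝ → Z}
    (hg : ContinuousOn g (Icc 0 r)) (hg' : ContinuousOn g' (Icc 0 r))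
    (h : ForcedSol A r z g) (h' : ForcedSol A r z' g') :
    ForcedSol A r (fun t => z t - z' t) (fun t => g t - g' t) := by
  refine ⟨h.1.sub h'.1, fun t ht => ?_⟩
  have hsub : uIcc 0 t ⊆ Icc 0 r := by
    rw [uIcc_of_le ht.1]; exact Icc_subset_Icc_right ht.2
  set J := (closDom A).subtypeL
  have i1 : IntervalIntegrable (fun s => (J (z s) : Z)) volume 0 t :=
    (J.continuous.comp_continuousOn (h.1.mono hsub)).intervalIntegrable
  have i1' : IntervalIntegrable (fun s => (J (z' s) : Z)) volume 0 t :=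
    (J.continuous.comp_continuousOn (h'.1.mono hsub)).intervalIntegrable
  have e1 := intervalIntegral.integral_sub i1 i1'
  have e2 := intervalIntegral.integral_sub (μ := volume) (hg.mono hsub).intervalIntegrable
    (hg'.mono hsub).intervalIntegrable
  have := A.graph.sub_mem (h.2 t ht) (h'.2 t ht)
  rw [Prod.mk_sub_mk, ← e1, sub_sub_sub_comm _ _ (J (z' t) - _), ← e2, sub_sub_sub_comm] at this
  simpa only [map_sub] using this

/-- Both components of the graph relation converge under uniform convergence, and the graph is
closed. -/
theorem ForcedSol.limit (hA : IsClosed (A.graph : Set (Z × Z))) {r : ℝ} {zn : ℕ → ℝ → closDom A}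
    {gn : ℕ → ℝ → Z} {z : ℝ → closDom A} {g : ℝ → Z}
    (h : ∀ᶠ n in atTop, ForcedSol A r (zn n) (gn n))
    (hgn : ∀ᶠ n in atTop, ContinuousOn (gn n) (Icc 0 r))
    (hz : TendstoUniformlyOn zn z atTop (Icc 0 r))
    (hg : TendstoUniformlyOn gn g atTop (Icc 0 r)) : ForcedSol A r z g := by
  refine ⟨hz.continuousOn (h.mono fun n hn => hn.1).frequently, fun t ht => ?_⟩
  have hsub : uIcc 0 t ⊆ Icc 0 r := by
    rw [uIcc_of_le ht.1]; exact Icc_subset_Icc_right ht.2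
  set J := (closDom A).subtypeL
  have h0 : (0 : ℝ) ∈ Icc 0 r := ⟨le_rfl, ht.1.trans ht.2⟩
  have l1 : Tendsto (fun n => ∫ s in (0 : ℝ)..t, (J (zn n s) : Z)) atTop
      (𝓝 (∫ s in (0 : ℝ)..t, (J (z s) : Z))) :=
    TendstoUniformlyOn.tendsto_intervalIntegral_of_continuousOn (μ := volume)
      (h.mono fun n hn => J.continuous.comp_continuousOn (hn.1.mono hsub))
      ((J.uniformContinuous.comp_tendstoUniformlyOn hz).mono hsub)
  have l2 : Tendsto (fun n => ∫ s in (0 : ℝ)..t, gn n s) atTop (𝓝 (∫ s in (0 : ℝ)..t, g s)) :=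
    TendstoUniformlyOn.tendsto_intervalIntegral_of_continuousOn (μ := volume)
      (hgn.mono fun n hn => hn.mono hsub) (hg.mono hsub)
  have l3 := (J.continuous.tendsto _).comp (hz.tendsto_at ht)
  have l4 := (J.continuous.tendsto _).comp (hz.tendsto_at h0)
  exact hA.mem_of_tendsto (l1.prodMk_nhds ((l3.sub l4).sub l2)) (h.mono fun n hn => hn.2 t ht)

end MR

end InvGraph

end

noncomputable section

namespace InvGraph

/-! ### Forced equations for MR operators: uniqueness, existence and bounds -/

section MRForced

variable {Z : Type v} [NormedAddCommGroup Z] [NormedSpace ℝ Z] {A : Z →ₗ.[ℝ] Z} [CompleteSpace Z]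

theorem completeSpace_closDom : CompleteSpace (closDom A) :=
  (Submodule.isClosed_topologicalClosure A.domain).completeSpace_coe

/-- A primitive of a function with values in the generator orbits vanishes. -/
theorem IsC0Semigroup.eq_zero_of_primitive {E : Type v} [NormedAddCommGroup E] [NormedSpace ℝ E]
    [CompleteSpace E] {T : ℝ≥0 → E →L[ℝ] E} (hT : IsC0Semigroup T) {z : ℝ → E}
    (hz : Continuous z) {t : ℝ} (ht : 0 ≤ t)
    (h : ∀ s ∈ Icc 0 t, GeneratorRel T (∫ σ in (0 : ℝ)..s, z σ) (z s)) :
    ∫ s in (0 : ℝ)..t, z s = 0 := by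
  set U : ℝ → E := fun t => ∫ σ in (0 : ℝ)..t, z σ with hU
  obtain ⟨C, hC⟩ := hT.bounded_Icc t
  have hUc : Continuous U := intervalIntegral.continuous_primitive
    (fun a b => hz.intervalIntegrable a b) 0
  have hC' : ∀ s ∈ Icc 0 t, ‖T (t - s).toNNReal‖ ≤ C := fun s hs =>
    hC _ ⟨sub_nonneg.2 hs.2, by linarith [hs.1]⟩
  have hc : ContinuousOn (fun s : ℝ => T (t - s).toNNReal (U s)) (Icc 0 t) := by
    intro s hs
    refine tendsto_iff_norm_sub_tendsto_zero.2 ?_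
    have h1 : Tendsto (fun s' => C * ‖U s' - U s‖ +
        ‖T (t - s').toNNReal (U s) - T (t - s).toNNReal (U s)‖) (𝓝[Icc 0 t] s) (𝓝 0) := by
      have c1 : Continuous fun s' : ℝ => T (t - s').toNNReal (U s) :=
        (hT.continuous_toNNReal (U s)).comp (continuous_const.sub continuous_id)
      have : Tendsto (fun s' => C * ‖U s' - U s‖ +
          ‖T (t - s').toNNReal (U s) - T (t - s).toNNReal (U s)‖) (𝓝 s)
          (𝓝 (C * ‖U s - U s‖ + ‖T (t - s).toNNReal (U s) - T (t - s).toNNReal (U s)‖)) :=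
        (((hUc.sub continuous_const).norm.const_mul C).add (c1.sub continuous_const).norm).tendsto s
      simp only [sub_self, norm_zero, mul_zero, add_zero] at this
      exact this.mono_left nhdsWithin_le_nhds
    refine squeeze_zero' (Eventually.of_forall fun p => norm_nonneg _) ?_ h1
    filter_upwards [self_mem_nhdsWithin] with s' hs'
    calc _ = ‖T (t - s').toNNReal (U s' - U s) +
          (T (t - s').toNNReal (U s) - T (t - s).toNNReal (U s))‖ := by
          rw [map_sub]; congr 1; abel
      _ ≤ _ := (norm_add_le _ _).trans
        (add_le_add_left ((T (t - s').toNNReal).le_of_opNorm_le (hC' _ hs') _) _)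
  -- The right derivatives of U and of the semigroup orbit through U(s) at s are both z(s), so they
  -- cancel. The function T(t - s)U(s) is therefore constant, with value 0 at s = 0 and U(t) at s =
  -- t.
  have hd : ∀ s ∈ Ico 0 t, HasDerivWithinAt (fun s : ℝ => T (t - s).toNNReal (U s)) 0 (Ici s) s := by
    intro s hs
    rw [← hasDerivWithinAt_Ioi_iff_Ici, hasDerivWithinAt_iff_tendsto_slope' (by simp)]
    have d1 : HasDerivWithinAt U (z s) (Ioi s) s :=
      (intervalIntegral.integral_hasDerivAt_right (hz.intervalIntegrable _ _)
        (hz.stronglyMeasurableAtFilter _ _) hz.continuousAt).hasDerivWithinAt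
    have d2 : HasDerivWithinAt (fun r : ℝ => T (r - s).toNNReal (U s)) (z s) (Ioi s) s := by
      have := hT.hasDerivWithinAt (h s ⟨hs.1, hs.2.le⟩) le_rfl
      rw [Real.toNNReal_zero, hT.zero, ← sub_self s] at this
      have h2 := this.scomp (h := fun r : ℝ => r - s) (s := Ioi s) s
        ((hasDerivWithinAt_id s _).sub_const s) (fun r hr => by
          simpa using sub_lt_sub_right (mem_Ioi.1 hr) s)
      simpa [Function.comp_def] using h2
    rw [hasDerivWithinAt_iff_tendsto_slope' (by simp)] at d1 d2
    have h1 := (d1.sub d2).norm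
    rw [sub_self, norm_zero] at h1
    refine tendsto_zero_iff_norm_tendsto_zero.2 (squeeze_zero' (Eventually.of_forall fun p => norm_nonneg _) ?_ (by simpa using h1.const_mul C))
    filter_upwards [self_mem_nhdsWithin, mem_nhdsWithin_of_mem_nhds (Iio_mem_nhds hs.2)] with r hr hr'
    have hr1 : s < r := hr
    have hr2 : r < t := hr'
    have e1 : T (t - s).toNNReal (U s) = T (t - r).toNNReal (T (r - s).toNNReal (U s)) := by
      rw [← hT.add, ← Real.toNNReal_add (by linarith) (by linarith), sub_add_sub_cancel]
    refine le_trans (le_of_eq ?_) ((T (t - r).toNNReal).le_of_opNorm_le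
      (hC' r ⟨hs.1.trans hr1.le, hr2.le⟩) _)
    simp only [slope_def_module]
    rw [e1, sub_self, Real.toNNReal_zero, hT.zero, ← smul_sub, map_smul, sub_sub_sub_cancel_right,
      map_sub]
  have := constant_of_has_deriv_right_zero hc hd t ⟨ht, le_rfl⟩
  simpa [hT.zero, hU] using this

variable {δ : ℝ → ℝ}

theorem IsMROperator.isClosed_graph (hA : IsMROperator A δ) : IsClosed (A.graph : Set (Z × Z)) := by
  obtain ⟨S, hS, -⟩ := hA.integrated
  exact hS.isClosed_graph

/-- Test the defining estimate with zero forcing and the non-sharp bound b = 1. -/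
theorem IsMROperator.nonneg (hA : IsMROperator A δ) {t : ℝ} (ht : 0 < t) : 0 ≤ δ t := by
  obtain ⟨S, -, hS⟩ := hA.integrated
  simpa using (norm_nonneg _).trans (hS (fun _ => 0) contDiff_const t ht 1 (by simp) 0 ⟨le_rfl, ht.le⟩)

/-- Uniqueness of mild solutions. -/
theorem IsMROperator.eq_zero (hA : IsMROperator A δ) {r : ℝ} {z : ℝ → closDom A}
    (h : ForcedSol A r z (fun _ => 0)) (h0 : z 0 = 0) : ∀ t ∈ Icc 0 r, z t = 0 := by
  intro t ht
  have := completeSpace_closDom (A := A)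
  obtain ⟨T, μ, hT, -, hG⟩ := hA.semigroup
  have hr : (0 : ℝ) ≤ r := ht.1.trans ht.2
  set y : ℝ → closDom A := IccExtend hr ((Icc 0 r).domRestrict z) with hy
  have hyc : Continuous y := (continuousOn_iff_continuous_domRestrict.1 h.1).Icc_extend'
  have hyz : ∀ s ∈ Icc 0 r, y s = z s := fun s hs => by
    rw [hy, IccExtend_of_mem _ _ hs]; rfl
  have hint : ∀ s ∈ Icc 0 r, ∫ σ in (0 : ℝ)..s, ((closDom A).subtypeL (z σ) : Z) =
      ((∫ σ in (0 : ℝ)..s, y σ : closDom A) : Z) := by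
    intro s hs
    have := (closDom A).subtypeL.intervalIntegral_comp_comm (hyc.intervalIntegrable (μ := volume) 0 s)
    refine Eq.trans (intervalIntegral.integral_congr fun σ hσ => ?_) this
    rw [uIcc_of_le hs.1] at hσ
    simp only [hyz σ ⟨hσ.1, hσ.2.trans hs.2⟩]
  have hrel : ∀ s ∈ Icc 0 r, (((∫ σ in (0 : ℝ)..s, y σ : closDom A) : Z), (z s : Z)) ∈ A.graph := by
    intro s hs
    have := h.2 s hs
    rw [hint s hs, h0, intervalIntegral.integral_zero] at this
    simpa using this
  have h1 := hT.eq_zero_of_primitive hyc ht.1 fun s hs => by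
    rw [hyz s ⟨hs.1, hs.2.trans ht.2⟩]
    exact (hG _ _).1 (hrel s ⟨hs.1, hs.2.trans ht.2⟩)
  have h2 := hrel t ht
  rw [h1] at h2
  exact Subtype.ext (eq_zero_of_zero_mem_graph h2)

/-- The derivative of the convolution takes values in the closure of D(A) and inherits the MR
estimate directly. -/
theorem IsMROperator.exists_forcedSol_of_contDiff (hA : IsMROperator A δ) {g : ℝ → Z}
    (hg : ContDiff ℝ 1 g) : ∃ z : ℝ → closDom A, z 0 = 0 ∧ ∀ r, 0 < r → ForcedSol A r z g ∧
      ∀ b, (∀ t ∈ Icc 0 r, ‖g t‖ ≤ b) → ∀ t ∈ Icc 0 r, ‖z t‖ ≤ δ r * b := by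
  obtain ⟨S, hS, hSδ⟩ := hA.integrated
  obtain ⟨V, hVc, hV0, hV⟩ := hS.exists_mild hg
  -- Negative times are clamped to 0 only to have values in the closure of D(A) everywhere.
  have hmem : ∀ t : ℝ, V (max t 0) ∈ closDom A := fun t =>
    mem_closDom_of_integral hVc (fun t ht => LinearPMap.mem_domain_of_mem_graph (hV t ht).1)
      (le_max_right t 0)
  have e0 : ∀ t, 0 ≤ t → V (max t 0) = V t := fun t ht => by rw [max_eq_left ht]
  refine ⟨fun t => ⟨V (max t 0), hmem t⟩, Subtype.ext (by simp [hV0]), fun r hr => ⟨⟨?_, ?_⟩, ?_⟩⟩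
  · exact (Continuous.subtype_mk (by fun_prop) _).continuousOn
  · intro t ht
    have := (hV t ht.1).1
    have e1 : ∫ s in (0 : ℝ)..t, ((closDom A).subtypeL ⟨V (max s 0), hmem s⟩ : Z) =
        ∫ s in (0 : ℝ)..t, V s := intervalIntegral.integral_congr fun s hs => by
      rw [uIcc_of_le ht.1] at hs
      exact e0 s hs.1
    rw [e1]
    simpa [e0 t ht.1, hV0] using this
  · intro b hb t ht
    have := hSδ g hg r hr b hb t ht
    rw [(hV t ht.1).2] at this
    simpa [e0 t ht.1] using this

theorem exists_contDiff_seq_tendstoUniformly {g : ℝ → Z} (hg : Continuous g) :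
    ∃ gn : ℕ → ℝ → Z, (∀ n, ContDiff ℝ 1 (gn n)) ∧ ∀ n t, ‖gn n t - g t‖ ≤ 1 / ((n : ℝ) + 1) := by
  choose gn h1 h2 h3 using fun n : ℕ => hg.exists_contDiff_approx 1
    (continuous_const (y := 1 / ((n : ℝ) + 1))) (fun _ => by positivity)
  exact ⟨gn, h1, fun n t => by rw [← dist_eq_norm]; exact (h2 n t).le⟩

/-- Approximate the forcing uniformly by C¹ functions. By uniqueness the difference of two
approximate solutions is the solution for the difference of the forcings, so the MR estimate makes
them uniformly Cauchy; the closed graph passes to the limit. -/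
theorem IsMROperator.exists_forcedSol (hA : IsMROperator A δ) {r : ℝ} (hr : 0 < r) {g : ℝ → Z}
    (hg : ContinuousOn g (Icc 0 r)) : ∃ z : ℝ → closDom A, ForcedSol A r z g ∧ z 0 = 0 ∧
      ∀ b, (∀ t ∈ Icc 0 r, ‖g t‖ ≤ b) → ∀ t ∈ Icc 0 r, ‖z t‖ ≤ δ r * b := by
  have := completeSpace_closDom (A := A)
  set y : ℝ → Z := IccExtend hr.le ((Icc 0 r).domRestrict g) with hy
  have hyc : Continuous y := (continuousOn_iff_continuous_domRestrict.1 hg).Icc_extend'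
  have hyg : ∀ s ∈ Icc 0 r, y s = g s := fun s hs => by
    rw [hy, IccExtend_of_mem _ _ hs]; rfl
  obtain ⟨gn, hgn, hgy⟩ := exists_contDiff_seq_tendstoUniformly hyc
  choose zn hz0 hz using fun n => hA.exists_forcedSol_of_contDiff (hgn n)
  have hδ := hA.nonneg hr
  have hlim : Tendsto (fun n : ℕ => 1 / ((n : ℝ) + 1)) atTop (𝓝 0) :=
    tendsto_one_div_add_atTop_nhds_zero_nat
  have hdiff : ∀ n m, n ≤ m → ∀ t ∈ Icc 0 r, ‖zn m t - zn n t‖ ≤ δ r * (2 * (1 / ((n : ℝ) + 1))) := by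
    intro n m hnm t ht
    obtain ⟨w, hw0, hw⟩ := hA.exists_forcedSol_of_contDiff ((hgn m).sub (hgn n))
    have hc : ∀ n, ContinuousOn (gn n) (Icc 0 r) := fun n => (hgn n).continuous.continuousOn
    have h1 := ((hz m r hr).1.sub (hc m) (hc n) (hz n r hr).1).sub ((hc m).sub (hc n))
      ((hc m).sub (hc n)) (hw r hr).1
    have h2 := hA.eq_zero (h1.congr_right fun t _ => by simp) (by simp [hz0, hw0]) t ht
    rw [sub_eq_zero.1 h2]
    refine (hw r hr).2 _ (fun t _ => ?_) t ht
    have e : gn m t - gn n t = (gn m t - y t) - (gn n t - y t) := by abel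
    have e2 : 1 / ((m : ℝ) + 1) ≤ 1 / ((n : ℝ) + 1) := by gcongr
    change ‖gn m t - gn n t‖ ≤ _
    rw [e]
    exact (norm_sub_le _ _).trans (by linarith [hgy m t, hgy n t])
  have hlim2 : Tendsto (fun n : ℕ => δ r * (2 * (1 / ((n : ℝ) + 1)))) atTop (𝓝 0) := by
    simpa using (hlim.const_mul 2).const_mul (δ r)
  have hconv : ∀ t ∈ Icc 0 r, ∃ x, Tendsto (fun n => zn n t) atTop (𝓝 x) := by
    intro t ht
    refine cauchySeq_tendsto_of_complete (Metric.cauchySeq_iff'.2 fun η hη => ?_)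
    obtain ⟨n, hn⟩ := (hlim2.eventually (gt_mem_nhds hη)).exists
    exact ⟨n, fun m hm => by rw [dist_eq_norm]; exact (hdiff n m hm t ht).trans_lt hn⟩
  choose! z hzlim using hconv
  have hunif : TendstoUniformlyOn zn z atTop (Icc 0 r) := by
    rw [Metric.tendstoUniformlyOn_iff]
    intro η hη
    filter_upwards [hlim2.eventually (gt_mem_nhds hη)] with n hn t ht
    rw [dist_eq_norm]
    refine (le_of_tendsto ((hzlim t ht).sub_const _).norm ?_).trans_lt hn
    filter_upwards [eventually_ge_atTop n] with m hm
    exact hdiff n m hm t ht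
  have hgunif : TendstoUniformlyOn gn g atTop (Icc 0 r) := by
    rw [Metric.tendstoUniformlyOn_iff]
    intro η hη
    filter_upwards [hlim.eventually (gt_mem_nhds hη)] with n hn t ht
    rw [dist_comm, dist_eq_norm, ← hyg t ht]
    exact (hgy n t).trans_lt hn
  refine ⟨z, ForcedSol.limit hA.isClosed_graph (Eventually.of_forall fun n => (hz n r hr).1)
    (Eventually.of_forall fun n => (hgn n).continuous.continuousOn) hunif hgunif, ?_, ?_⟩
  · refine tendsto_nhds_unique (hzlim 0 ⟨le_rfl, hr.le⟩) ?_
    simp only [hz0]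
    exact tendsto_const_nhds
  · intro b hb t ht
    have l2 : Tendsto (fun n : ℕ => δ r * (b + 1 / ((n : ℝ) + 1))) atTop (𝓝 (δ r * (b + 0))) :=
      (hlim.const_add b).const_mul (δ r)
    rw [add_zero] at l2
    refine le_of_tendsto_of_tendsto' (hzlim t ht).norm l2 fun n => (hz n r hr).2 _ (fun s hs => ?_) t ht
    have e : gn n s = y s + (gn n s - y s) := by abel
    rw [e]
    exact (norm_add_le _ _).trans (add_le_add ((hyg s hs).symm ▸ hb s hs) (hgy n s))

/-- Mild solutions that start at `0` are bounded by the forcing. -/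
theorem IsMROperator.norm_le (hA : IsMROperator A δ) {r : ℝ} (hr : 0 < r) {g : ℝ → Z}
    (hg : ContinuousOn g (Icc 0 r)) {z : ℝ → closDom A} (hz : ForcedSol A r z g) (h0 : z 0 = 0)
    {b : ℝ} (hb : ∀ t ∈ Icc 0 r, ‖g t‖ ≤ b) : ∀ t ∈ Icc 0 r, ‖z t‖ ≤ δ r * b := by
  obtain ⟨w, hw, hw0, hwb⟩ := hA.exists_forcedSol hr hg
  intro t ht
  have h1 := hA.eq_zero ((hz.sub hg hg hw).congr_right fun t _ => by simp) (by simp [h0, hw0]) t ht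
  rw [sub_eq_zero.1 h1]
  exact hwb b hb t ht

end MRForced

end InvGraph

end

noncomputable section

namespace InvGraph

/-! ### Concatenation of mild solutions -/

section Mild

variable {M : Type u} [TopologicalSpace M] {E Z : Type v} [NormedAddCommGroup E] [NormedSpace ℝ E]
  [NormedAddCommGroup Z] [NormedSpace ℝ Z] {φ : Flow ℝ≥0 M} {A : Z →ₗ.[ℝ] Z} {J : E →L[ℝ] Z}
  {L : M → E →L[ℝ] Z}

theorem MildLS.concat (hL : Continuous fun p : M × E => L p.1 p.2) {ω : M} {s r : ℝ} (hs : 0 ≤ s)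
    (hr : 0 ≤ r) {z₁ z₂ : ℝ → E} {g : ℝ → Z} (hg : ContinuousOn g (Icc 0 (s + r)))
    (h₁ : MildLS φ A J L ω s z₁ g) (h₂ : MildLS φ A J L (orb φ ω s) r z₂ (fun t => g (s + t)))
    (h : z₂ 0 = z₁ s) :
    MildLS φ A J L ω (s + r) (fun t => if t ≤ s then z₁ t else z₂ (t - s)) g := by
  set z : ℝ → E := fun t => if t ≤ s then z₁ t else z₂ (t - s) with hz
  have e1 : ∀ t, t ≤ s → z t = z₁ t := fun t ht => if_pos ht
  have e2 : ∀ t, 0 ≤ t → z (s + t) = z₂ t := by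
    intro t ht
    rcases ht.eq_or_lt with rfl | ht
    · rw [add_zero, e1 s le_rfl, h]
    · simp only [hz]
      rw [if_neg (by linarith), add_sub_cancel_left]
  have e2' : ∀ t, s ≤ t → z t = z₂ (t - s) := fun t ht => by
    rw [← e2 _ (sub_nonneg.2 ht), add_sub_cancel]
  have hzc : ContinuousOn z (Icc 0 (s + r)) := by
    rw [← Icc_union_Icc_eq_Icc hs (le_add_of_nonneg_right hr)]
    refine ContinuousOn.union_of_isClosed (h₁.1.congr fun t ht => e1 t ht.2) ?_ isClosed_Icc
      isClosed_Icc
    refine ContinuousOn.congr (f := fun t => z₂ (t - s)) (h₂.1.comp (by fun_prop) fun t ht => ?_)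
      fun t ht => e2' t ht.1
    exact ⟨sub_nonneg.2 ht.1, by linarith [ht.2]⟩
  have hsub : ∀ t ∈ Icc 0 (s + r), uIcc 0 t ⊆ Icc 0 (s + r) := fun t ht => by
    rw [uIcc_of_le ht.1]; exact Icc_subset_Icc_right ht.2
  have i1 : ∀ t ∈ Icc 0 (s + r), IntervalIntegrable (fun s => J (z s)) volume 0 t := fun t ht =>
    (J.continuous.comp_continuousOn (hzc.mono (hsub t ht))).intervalIntegrable
  have i2 : ∀ t ∈ Icc 0 (s + r),
      IntervalIntegrable (fun s => L (orb φ ω s) (z s) + g s) volume 0 t := fun t ht =>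
    (((continuousOn_linear hL ω hzc).add hg).mono (hsub t ht)).intervalIntegrable
  have hm1 := h₁.congr hs (fun t ht => (e1 t ht.2).symm) (fun t _ => rfl)
  refine ⟨hzc, fun t ht => ?_⟩
  rcases le_total t s with hts | hts
  · exact hm1.2 t ⟨ht.1, hts⟩
  have hs' : s ∈ Icc 0 (s + r) := ⟨hs, by linarith⟩
  have ht0 : 0 ≤ t - s := sub_nonneg.2 hts
  have f1 := intervalIntegral.integral_interval_sub_left (i1 _ ht) (i1 _ hs')
  have f2 := intervalIntegral.integral_interval_sub_left (i2 _ ht) (i2 _ hs')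
  have c1 := intervalIntegral.integral_comp_add_left (f := fun τ => J (z τ)) (a := 0) (b := t - s) s
  have c2 := intervalIntegral.integral_comp_add_left
    (f := fun τ => L (orb φ ω τ) (z τ) + g τ) (a := 0) (b := t - s) s
  rw [add_zero, add_sub_cancel] at c1 c2
  have hm2 := h₂.2 (t - s) ⟨ht0, by linarith [ht.2]⟩
  have c3 : ∫ τ in (0 : ℝ)..t - s, (L (orb φ (orb φ ω s) τ) (z₂ τ) + g (s + τ)) =
      ∫ τ in (0 : ℝ)..t - s, (L (orb φ ω (s + τ)) (z (s + τ)) + g (s + τ)) :=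
    intervalIntegral.integral_congr fun τ hτ => by
      rw [uIcc_of_le ht0] at hτ
      simp only [orb_orb φ ω hs hτ.1, e2 τ hτ.1]
  have c4 : ∫ τ in (0 : ℝ)..t - s, J (z₂ τ) = ∫ τ in (0 : ℝ)..t - s, J (z (s + τ)) :=
    intervalIntegral.integral_congr fun τ hτ => by
      rw [uIcc_of_le ht0] at hτ
      simp only [e2 τ hτ.1]
  rw [c3, c4, c1, c2, ← f1, ← f2, ← e2' t hts, h, ← e1 s le_rfl] at hm2
  have := A.graph.add_mem hm2 (hm1.2 s ⟨hs, le_rfl⟩)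
  rw [Prod.mk_add_mk] at this
  convert this using 2
  · abel
  · abel

end Mild

/-! ### Bounded linear perturbations of MR operators -/

section MRLinear

variable {M : Type u} [TopologicalSpace M] {Z : Type v} [NormedAddCommGroup Z] [NormedSpace ℝ Z]
  [CompleteSpace Z] {φ : Flow ℝ≥0 M} {A : Z →ₗ.[ℝ] Z} {δ : ℝ → ℝ} {L : M → closDom A →L[ℝ] Z}

theorem CondL.norm_le {τ : M → ℝ} (hL : CondL φ L τ) (ω : M) (t : ℝ) : ‖L (orb φ ω t)‖ ≤ τ ω :=
  (hL.lub ω).1 ⟨t.toNNReal, rfl⟩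

theorem CondL.norm_shift_le {τ : M → ℝ} (hL : CondL φ L τ) (ω : M) {s t : ℝ} (hs : 0 ≤ s)
    (ht : 0 ≤ t) : ‖L (orb φ (orb φ ω s) t)‖ ≤ τ ω := by
  rw [orb_orb φ ω hs ht]
  exact hL.norm_le ω _

theorem CondL.nonneg {τ : M → ℝ} (hL : CondL φ L τ) (ω : M) : 0 ≤ τ ω :=
  (L _).opNorm_nonneg.trans (hL.norm_le ω 0)

/-- The perturbation is treated as forcing; at the point where ‖z‖ is maximal its contribution
δ(r)K‖z‖ is absorbed on the left. -/
theorem IsMROperator.norm_mild_le (hA : IsMROperator A δ)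
    (hL : Continuous fun p : M × closDom A => L p.1 p.2) {ω : M} {r K : ℝ} (hr : 0 < r)
    (hK : ∀ t, 0 ≤ t → ‖L (orb φ ω t)‖ ≤ K) (hδ : δ r * K < 1) {z : ℝ → closDom A} {g : ℝ → Z}
    (hg : ContinuousOn g (Icc 0 r)) (hz : MildLS φ A (closDom A).subtypeL L ω r z g)
    (h0 : z 0 = 0) {b : ℝ} (hb : ∀ t ∈ Icc 0 r, ‖g t‖ ≤ b) :
    ∀ t ∈ Icc 0 r, ‖z t‖ ≤ δ r / (1 - δ r * K) * b := by
  have hK0 : 0 ≤ K := (L _).opNorm_nonneg.trans (hK 0 le_rfl)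
  have hδ0 := hA.nonneg hr
  obtain ⟨t₁, ht₁, hmax⟩ := isCompact_Icc.exists_isMaxOn (nonempty_Icc.2 hr.le) hz.1.norm
  have hmax' : ∀ t ∈ Icc 0 r, ‖z t‖ ≤ ‖z t₁‖ := fun t ht => hmax ht
  have h1 := hA.norm_le hr ((continuousOn_linear hL ω hz.1).add hg) hz h0
    (b := K * ‖z t₁‖ + b) (fun t ht => (norm_add_le _ _).trans (add_le_add
      (((L _).le_of_opNorm_le (hK t ht.1) _).trans
        (mul_le_mul_of_nonneg_left (hmax' t ht) hK0)) (hb t ht))) t₁ ht₁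
  intro t ht
  refine (hmax' t ht).trans ?_
  rw [div_mul_eq_mul_div, le_div_iff₀ (by linarith)]
  linarith

/-- Contraction in the sup norm: replacing the argument of L changes the solution by at most δ(r)K ≤
1/2 times the change. -/
theorem IsMROperator.exists_mild_local (hA : IsMROperator A δ)
    (hL : Continuous fun p : M × closDom A => L p.1 p.2) {ω : M} {r K : ℝ} (hr : 0 < r)
    (hK : ∀ t, 0 ≤ t → ‖L (orb φ ω t)‖ ≤ K) (hδ : δ r * K ≤ 1 / 2) {g : ℝ → Z}
    (hg : ContinuousOn g (Icc 0 r)) :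
    ∃ z, MildLS φ A (closDom A).subtypeL L ω r z g ∧ z 0 = 0 := by
  have := completeSpace_closDom (A := A)
  have hK0 : 0 ≤ K := (L _).opNorm_nonneg.trans (hK 0 le_rfl)
  have hδ0 := hA.nonneg hr
  have hext : ∀ u : C(Icc 0 r, closDom A), ContinuousOn (IccExtend hr.le u) (Icc 0 r) := fun u =>
    u.continuous.Icc_extend'.continuousOn
  have hG : ∀ u : C(Icc 0 r, closDom A), ContinuousOn
      (fun t => L (orb φ ω t) (IccExtend hr.le u t) + g t) (Icc 0 r) := fun u =>
    (continuousOn_linear hL ω (hext u)).add hg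
  choose sol hsol hsol0 _ using fun u => hA.exists_forcedSol hr (hG u)
  set Φ : C(Icc 0 r, closDom A) → C(Icc 0 r, closDom A) := fun u =>
    ⟨(Icc 0 r).domRestrict (sol u), continuousOn_iff_continuous_domRestrict.1 (hsol u).1⟩ with hΦ
  have hcontr : ContractingWith (1 / 2) Φ := by
    refine ⟨by rw [← NNReal.coe_lt_coe]; norm_num, LipschitzWith.of_dist_le_mul fun u v => ?_⟩
    rw [ContinuousMap.dist_le (by positivity)]
    rintro ⟨t, ht⟩
    rw [dist_eq_norm]
    have h1 := hA.norm_le hr ((hG u).sub (hG v)) ((hsol u).sub (hG u) (hG v) (hsol v))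
      (by simp [hsol0]) (b := K * dist u v) (fun s hs => ?_) t ht
    · refine h1.trans ?_
      rw [← mul_assoc]
      refine mul_le_mul_of_nonneg_right (hδ.trans_eq (by simp)) dist_nonneg
    · simp only [Pi.sub_apply]
      rw [add_sub_add_right_eq_sub, ← map_sub]
      refine ((L _).le_of_opNorm_le (hK s hs.1) _).trans (mul_le_mul_of_nonneg_left ?_ hK0)
      rw [IccExtend_of_mem _ _ hs, IccExtend_of_mem _ _ hs, ← dist_eq_norm]
      exact ContinuousMap.dist_apply_le_dist _
  obtain ⟨u, hu⟩ : ∃ u, Φ u = u := ⟨_, hcontr.fixedPoint_isFixedPt⟩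
  refine ⟨sol u, ?_, hsol0 u⟩
  refine (hsol u).congr_right fun t ht => ?_
  have : sol u t = u ⟨t, ht⟩ := congrArg (fun w : C(Icc 0 r, closDom A) => w ⟨t, ht⟩) hu
  rw [IccExtend_of_mem _ _ ht, this]

theorem GeneratesCocycle.mildLS {E : Type v} [NormedAddCommGroup E] [NormedSpace ℝ E]
    {J : E →L[ℝ] Z} {L : M → E →L[ℝ] Z} {T₀ : ℝ≥0 → M → E →L[ℝ] E}
    (hG : GeneratesCocycle φ A J L T₀) (ω : M) (x : E) {r : ℝ} (hr : 0 ≤ r) :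
    MildLS φ A J L ω r (fun t => T₀ t.toNNReal ω x) (fun _ => 0) :=
  (mildLS_zero_iff φ A J L ω r _).2 ((hG ω x).2 r hr)

variable {T₀ : ℝ≥0 → M → closDom A →L[ℝ] closDom A} {τ : M → ℝ}

theorem IsMROperator.exists_step (hA : IsMROperator A δ) (K : ℝ) : ∃ h, 0 < h ∧ δ h * K ≤ 1 / 2 := by
  have h1 : Tendsto (fun t => δ t * K) (𝓝[>] 0) (𝓝 0) := by simpa using hA.lim.mul_const K
  obtain ⟨h, h2, h3⟩ := ((h1.eventually (ge_mem_nhds (by norm_num : (0 : ℝ) < 1 / 2))).and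
    self_mem_nhdsWithin).exists
  exact ⟨h, h3, h2⟩

/-- Mild solutions of the inhomogeneous linear equation that start at `0`. -/
theorem IsMROperator.exists_mild (hA : IsMROperator A δ) (hL : CondL φ L τ)
    (hG : GeneratesCocycle φ A (closDom A).subtypeL L T₀) (ω : M) {r : ℝ} (hr : 0 ≤ r) {g : ℝ → Z}
    (hg : ContinuousOn g (Icc 0 r)) :
    ∃ z, MildLS φ A (closDom A).subtypeL L ω r z g ∧ z 0 = 0 := by
  set y : ℝ → Z := IccExtend hr ((Icc 0 r).domRestrict g) with hy
  have hyc : Continuous y := (continuousOn_iff_continuous_domRestrict.1 hg).Icc_extend'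
  have hyg : ∀ s ∈ Icc 0 r, y s = g s := fun s hs => by
    rw [hy, IccExtend_of_mem _ _ hs]; rfl
  obtain ⟨h, hh, hδ⟩ := hA.exists_step (τ ω)
  have key : ∀ n : ℕ, ∃ z, MildLS φ A (closDom A).subtypeL L ω (n * h) z y ∧ z 0 = 0 := by
    intro n
    induction n with
    | zero =>
      refine ⟨fun _ => 0, ⟨continuousOn_const, fun t ht => ?_⟩, rfl⟩
      obtain rfl : t = 0 := by simpa using ht
      simp
    | succ n ih =>
      obtain ⟨z₁, h1, h10⟩ := ih
      have hn : 0 ≤ (n : ℝ) * h := by positivity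
      -- The local solution starts at 0. The cocycle supplies the unforced solution through z₁(nh),
      -- so their sum continues z₁ without smallness of the data.
      obtain ⟨z₂, h2, h20⟩ := hA.exists_mild_local (ω := orb φ ω (n * h)) hL.cont hh
        (fun t ht => hL.norm_shift_le ω hn ht) hδ
        (hyc.comp (continuous_const.add continuous_id : Continuous fun t => (n : ℝ) * h + t)).continuousOn
      have h3 := h2.sub hL.cont (hyc.comp (continuous_const.add continuous_id :
        Continuous fun t => (n : ℝ) * h + t)).continuousOn continuousOn_const
        (hG.mildLS (orb φ ω (n * h)) (-z₁ (n * h)) hh.le)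
      have h4 := h1.concat hL.cont hn hh.le hyc.continuousOn
        (h3.congr hh.le (fun _ _ => rfl) fun t _ => by simp) (by simp [h20, (hG _ _).1])
      rw [Nat.cast_succ, add_mul, one_mul]
      exact ⟨_, h4, by simp [hn, h10]⟩
  obtain ⟨z, hz, hz0⟩ := key ⌈r / h⌉₊
  refine ⟨z, (hz.mono ?_).congr hr (fun _ _ => rfl) hyg, hz0⟩
  rw [← div_le_iff₀ hh]
  exact Nat.le_ceil _

/-! ### The linear theory of MR operators -/

variable {P : M → closDom A →L[ℝ] closDom A} {C₁ : ℝ} {μs μu : M → ℝ}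

section Cocycle

variable {E : Type v} [NormedAddCommGroup E] [NormedSpace ℝ E] {T₀ : ℝ≥0 → M → E →L[ℝ] E}
  {P : M → E →L[ℝ] E}

theorem UniformDichotomyCocycle.proj_continuous (hU : UniformDichotomyCocycle φ T₀ P C₁ μs μu) :
    Continuous fun p : M × E => P p.1 p.2 :=
  continuous_uncurry_of_locally_bounded hU.proj_cont
    fun _ => ⟨univ, univ_mem, C₁, fun y _ => hU.norm_P y⟩

/-- The cocycle preserves both families of subspaces, hence commutes with the projections. -/
theorem UniformDichotomyCocycle.proj_evo (hU : UniformDichotomyCocycle φ T₀ P C₁ μs μu)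
    (t : ℝ≥0) (ω : M) (x : E) : P (φ t ω) (T₀ t ω x) = T₀ t ω (P ω x) := by
  have h1 : P (φ t ω) (T₀ t ω (P ω x)) = T₀ t ω (P ω x) :=
    proj_specX hU.proj ⟨_, hU.inv_X t ω ⟨x, rfl⟩⟩
  have h2 : P (φ t ω) (T₀ t ω (x - P ω x)) = 0 :=
    proj_specY hU.proj ⟨_, (hU.bij_Y t ω).mapsTo (mem_specY ω (by simp [hU.proj]))⟩
  rw [map_sub, map_sub, h1, sub_eq_zero] at h2
  exact h2

end Cocycle

/-- Forcing takes values in Z, where no projection acts, so its size is the norm times C₁, which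
pays for the later splitting in the closure of D(A). -/
theorem IsMROperator.linearTheory (hA : IsMROperator A δ) (hL : CondL φ L τ)
    (hG : GeneratesCocycle φ A (closDom A).subtypeL L T₀)
    (hU : UniformDichotomyCocycle φ T₀ P C₁ μs μu) :
    LinearTheory φ P (MildLS φ A (closDom A).subtypeL L) (fun _ v => C₁ * ‖v‖) where
  proj := hU.proj
  proj_cont := hU.proj_continuous
  contOn h := h.1
  congr hr hz hg h := h.congr hr hz hg
  sub _ hg hg' h h' := h.sub hL.cont hg hg' h'
  smul c _ h := h.smul c
  mono _ hr _ h := h.mono hr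
  shift hs hr hg h := h.shift hL.cont hs hr hg
  limit {ω r g zn z} hr hg h hz := by
    refine ForcedSol.limit hA.isClosed_graph (gn := fun n t => L (orb φ ω t) (zn n t) + g t) h
      (h.mono fun n hn => (continuousOn_linear hL.cont ω hn.1).add hg) hz ?_
    rw [Metric.tendstoUniformlyOn_iff] at hz ⊢
    intro η hη
    have h0 := hL.nonneg ω
    filter_upwards [hz (η / (τ ω + 1)) (by positivity)] with n hn t ht
    rw [dist_add_right, dist_eq_norm, ← map_sub]
    have h1 := hn t ht
    rw [dist_eq_norm, lt_div_iff₀ (by positivity)] at h1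
    refine ((L _).le_of_opNorm_le (hL.norm_le ω t) _).trans_lt (lt_of_le_of_lt ?_ h1)
    nlinarith [norm_nonneg (z t - zn n t)]
  solve {ω r g} hr hg x := by
    obtain ⟨V, hV, hV0⟩ := hA.exists_mild hL hG ω hr hg
    -- Surjectivity on the Y-spaces yields the unforced solution that cancels the Y-part at time r;
    -- it does not change the X-part at 0.
    obtain ⟨y, hy, hyr⟩ := (hU.bij_Y r.toNNReal ω).surjOn
      (mem_specY (φ r.toNNReal ω) (z := -(V r - P (orb φ ω r) (V r))) (by simp [orb, hU.proj]))
    have hPy : P ω y = 0 := proj_specY hU.proj ⟨y, hy⟩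
    refine ⟨_, (hV.sub hL.cont hg continuousOn_const
      (hG.mildLS ω (-(P ω x + y)) hr)).congr hr (fun _ _ => rfl) (fun t _ => sub_zero _), ?_, ?_⟩
    · simp [hV0, (hG ω _).1, hU.proj, hPy]
    · have e1 : P (orb φ ω r) (T₀ r.toNNReal ω (P ω x + y)) = T₀ r.toNNReal ω (P ω x) := by
        rw [orb, hU.proj_evo, map_add, hU.proj, hPy, add_zero]
      simp only [map_neg, sub_neg_eq_add, map_add (P (orb φ ω r))]
      rw [e1, map_add (T₀ r.toNNReal ω), hyr]
      abel
  size_add ω u v := by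
    rw [← mul_add]
    exact mul_le_mul_of_nonneg_left (norm_add_le u v) hU.C_pos.le
  size_smul ω c u := by rw [norm_smul, Real.norm_eq_abs]; ring
  size_le := ⟨C₁, hU.C_pos.le, fun _ _ => le_rfl⟩
  size_cont := by fun_prop

end MRLinear

end InvGraph

end

noncomputable section

namespace InvGraph

/-! ### From local bounds to global bounds -/

/-- The local estimate, divided by h, bounds the right slopes at t by e^{-ct}ρ(t) in the limit
because Δ(h)/h → 1. The comparison theorem for continuous functions integrates this bound without
differentiability of f. -/
theorem sub_le_integral_of_local {f ρ Δ : ℝ → ℝ} {c h₀ r : ℝ} (hf : ContinuousOn f (Icc 0 r))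
    (hρ : ContinuousOn ρ (Icc 0 r)) (hh₀ : 0 < h₀)
    (hΔ : Tendsto (fun h => Δ h / h) (𝓝[>] 0) (𝓝 1))
    (hloc : ∀ t h R, 0 ≤ t → 0 < h → h ≤ h₀ → t + h ≤ r → (∀ τ ∈ Icc t (t + h), ρ τ ≤ R) →
      f (t + h) - f t ≤ Real.exp (-c * (t + h)) * (Δ h * R)) {t₁ t₂ : ℝ} (h1 : 0 ≤ t₁)
    (h12 : t₁ ≤ t₂) (h2 : t₂ ≤ r) :
    f t₂ - f t₁ ≤ ∫ τ in t₁..t₂, Real.exp (-c * τ) * ρ τ := by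
  have hr : 0 ≤ r := h1.trans (h12.trans h2)
  set y : ℝ → ℝ := IccExtend hr ((Icc 0 r).domRestrict ρ) with hy
  have hyc : Continuous y := (continuousOn_iff_continuous_domRestrict.1 hρ).Icc_extend'
  have hyρ : ∀ s ∈ Icc 0 r, y s = ρ s := fun s hs => by
    rw [hy, IccExtend_of_mem _ _ hs]; rfl
  have hkc : Continuous fun τ => Real.exp (-c * τ) * y τ := by fun_prop
  have e : ∫ τ in t₁..t₂, Real.exp (-c * τ) * ρ τ = ∫ τ in t₁..t₂, Real.exp (-c * τ) * y τ :=
    intervalIntegral.integral_congr fun s hs => by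
      rw [uIcc_of_le h12] at hs
      simp only [hyρ s ⟨h1.trans hs.1, hs.2.trans h2⟩]
  rw [e]
  have hB : ∀ x, HasDerivAt (fun x => f t₁ + ∫ τ in t₁..x, Real.exp (-c * τ) * y τ)
      (Real.exp (-c * x) * y x) x := fun x =>
    (intervalIntegral.integral_hasDerivAt_right (hkc.intervalIntegrable _ _)
      (hkc.stronglyMeasurableAtFilter _ _) hkc.continuousAt).const_add _
  have := image_le_of_liminf_slope_right_le_deriv_boundary (f := f) (a := t₁) (b := t₂)
    (hf.mono (Icc_subset_Icc h1 h2)) (B := fun x => f t₁ + ∫ τ in t₁..x, Real.exp (-c * τ) * y τ)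
    (by simp) (fun x _ => (hB x).continuousAt.continuousWithinAt)
    (fun x _ => (hB x).hasDerivWithinAt) (fun x hx q hq => ?_) (right_mem_Icc.2 h12)
  · linarith
  have hx0 : 0 ≤ x := h1.trans hx.1
  -- Room to replace ρ on a short interval by the constant ρ(x) + η.
  obtain ⟨η, hη, hηq⟩ : ∃ η, 0 < η ∧ Real.exp (-c * x) * (y x + η) < q := by
    have h3 : Tendsto (fun η : ℝ => Real.exp (-c * x) * (y x + η)) (𝓝[>] 0)
        (𝓝 (Real.exp (-c * x) * (y x + 0))) :=
      (Continuous.tendsto (by fun_prop : Continuous fun η : ℝ => Real.exp (-c * x) * (y x + η))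
        0).mono_left nhdsWithin_le_nhds
    rw [add_zero] at h3
    obtain ⟨η, h4, h5⟩ := ((h3.eventually (gt_mem_nhds hq)).and self_mem_nhdsWithin).exists
    exact ⟨η, h5, h4⟩
  have hz : Tendsto (fun z : ℝ => z - x) (𝓝[>] x) (𝓝[>] 0) := by
    refine tendsto_nhdsWithin_iff.2 ⟨?_, ?_⟩
    · have : Tendsto (fun s : ℝ => s - x) (𝓝 x) (𝓝 (x - x)) :=
        (continuous_id.sub continuous_const).tendsto x
      rw [sub_self] at this
      exact this.mono_left nhdsWithin_le_nhds
    · filter_upwards [self_mem_nhdsWithin] with s hs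
      exact sub_pos.2 (mem_Ioi.1 hs)
  have hlim : Tendsto (fun z => Real.exp (-c * z) * (Δ (z - x) / (z - x) * (y x + η))) (𝓝[>] x)
      (𝓝 (Real.exp (-c * x) * (1 * (y x + η)))) := by
    refine Tendsto.mul ?_ ((hΔ.comp hz).mul_const _)
    exact (Continuous.tendsto (by fun_prop : Continuous fun z => Real.exp (-c * z)) x).mono_left
      nhdsWithin_le_nhds
  rw [one_mul] at hlim
  obtain ⟨d, hd, hd'⟩ := Metric.eventually_nhds_iff.1
    (hyc.continuousAt.eventually (gt_mem_nhds (lt_add_of_pos_right (y x) hη)))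
  have hev : ∀ᶠ z in 𝓝[>] x, slope f x z < q := by
    filter_upwards [hlim.eventually (gt_mem_nhds hηq), self_mem_nhdsWithin,
      mem_nhdsWithin_of_mem_nhds (Iio_mem_nhds (hx.2)),
      mem_nhdsWithin_of_mem_nhds (Iio_mem_nhds (lt_add_of_pos_right x hh₀)),
      mem_nhdsWithin_of_mem_nhds (Iio_mem_nhds (lt_add_of_pos_right x hd))] with z k1 k2 k3 k4 k5
    have k2 : x < z := k2
    have k3 : z < t₂ := k3
    have k4 : z < x + h₀ := k4
    have k5 : z < x + d := k5
    have k6 := hloc x (z - x) (y x + η) hx0 (by linarith) (by linarith) (by linarith)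
      (fun τ hτ => by
        rw [add_sub_cancel] at hτ
        rw [← hyρ τ ⟨hx0.trans hτ.1, by linarith [hτ.2]⟩]
        refine (hd' ?_).le
        rw [Real.dist_eq, abs_of_nonneg (sub_nonneg.2 hτ.1)]
        linarith [hτ.2])
    rw [add_sub_cancel] at k6
    refine lt_of_le_of_lt ?_ k1
    rw [slope_def_field, div_le_iff₀ (by linarith)]
    refine k6.trans_eq ?_
    have : z - x ≠ 0 := by linarith
    field_simp
  exact hev.frequently

/-- A discrete Gronwall estimate. -/
theorem le_of_local_contraction {u : ℝ → ℝ} {r h q u₀ D : ℝ} (hu : ContinuousOn u (Icc 0 r))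
    (hh : 0 < h) (hq0 : 0 ≤ q) (hq : q < 1) (hu₀ : 0 ≤ u₀) (hD : 0 ≤ D)
    (h1 : ∀ t ∈ Icc 0 r, t ≤ h → u t ≤ u₀ + D)
    (h2 : ∀ t ∈ Icc 0 r, h < t → u t ≤ q * max (u (t - h)) 0 + D) :
    ∀ t ∈ Icc 0 r, u t ≤ u₀ + D / (1 - q) := by
  intro t ht
  have hq' : 0 < 1 - q := by linarith
  -- At a maximum beyond the first step, the value one step earlier is no larger, so u ≤ qu + D
  -- there unless u is negative.
  obtain ⟨t₁, ht₁, hmax⟩ := isCompact_Icc.exists_isMaxOn ⟨t, ht⟩ hu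
  refine (hmax ht).trans ?_
  have hDq : D ≤ D / (1 - q) := by
    rw [le_div_iff₀ hq']
    nlinarith
  change u t₁ ≤ _
  rcases le_or_gt t₁ h with hle | hlt
  · linarith [h1 t₁ ht₁ hle]
  · have h3 := h2 t₁ ht₁ hlt
    have h4 : u (t₁ - h) ≤ u t₁ := hmax ⟨by linarith, by linarith [ht₁.2]⟩
    rcases le_total (u t₁) 0 with h6 | h6
    · have := div_nonneg hD hq'.le
      linarith
    · have h5 : u t₁ ≤ D / (1 - q) := by
        rw [le_div_iff₀ hq']
        nlinarith [mul_le_mul_of_nonneg_left (max_le h4 h6) hq0]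
      linarith

section LocalBound

variable {M : Type u} [TopologicalSpace M] {E F : Type v} [NormedAddCommGroup E] [NormedSpace ℝ E]
  [NormedAddCommGroup F] [NormedSpace ℝ F]

/-- Solutions of the linear equation are controlled on short time intervals. -/
def LocalBound (φ : Flow ℝ≥0 M) (P : M → E →L[ℝ] E) (LS : M → ℝ → (ℝ → E) → (ℝ → F) → Prop)
    (σ : M → F → ℝ) (ω : M) (a b : ℝ) (Δ : ℝ → ℝ) (h₀ : ℝ) : Prop :=
  ∀ s, 0 ≤ s → ∀ (r : ℝ) z g, 0 ≤ r → LS (orb φ ω s) r z g → ContinuousOn g (Icc 0 r) →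
    ∀ t h R, 0 ≤ t → 0 < h → h ≤ h₀ → t + h ≤ r →
    (∀ τ ∈ Icc t (t + h), σ (orb φ ω (s + τ)) (g τ) ≤ R) →
    ‖P (orb φ ω (s + (t + h))) (z (t + h))‖ ≤
      Real.exp (a * h) * ‖P (orb φ ω (s + t)) (z t)‖ + Δ h * R ∧
    ‖z t - P (orb φ ω (s + t)) (z t)‖ ≤ Real.exp (-b * h) *
      (‖z (t + h) - P (orb φ ω (s + (t + h))) (z (t + h))‖ + Δ h * R)

variable {φ : Flow ℝ≥0 M} {P : M → E →L[ℝ] E} {LS : M → ℝ → (ℝ → E) → (ℝ → F) → Prop}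
  {σ : M → F → ℝ} {f : M → E → F} {ω : M} {a b γ ε h₀ : ℝ} {Δ : ℝ → ℝ}

theorem LinearTheory.continuousOn_proj (H : LinearTheory φ P LS σ) {z : ℝ → E} {r s : ℝ}
    (hz : ContinuousOn z (Icc 0 r)) (ω : M) :
    ContinuousOn (fun t => P (orb φ ω (s + t)) (z t)) (Icc 0 r) :=
  H.proj_cont.comp_continuousOn
    (((continuous_orb φ ω).comp (continuous_const.add continuous_id)).continuousOn.prodMk hz)

/-- After multiplication by e^{-at} the X-part, and after multiplication by -e^{-bt} the Y-part, has
local increments bounded by the forcing. The sign makes the backward estimate for Y a forward one.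
-/
theorem LocalBound.integralBound (H : LinearTheory φ P LS σ) (hh₀ : 0 < h₀)
    (hΔ : Tendsto (fun h => Δ h / h) (𝓝[>] 0) (𝓝 1))
    (hB : LocalBound φ P LS σ ω a b Δ h₀) : IntegralBound φ P LS σ ω a b := by
  intro s hs r z g ρ hr hz hg hρ hgρ t ht
  have hPc := H.continuousOn_proj (s := s) (H.contOn hz) ω
  have hQc := (H.contOn hz).sub hPc
  have hloc := fun t h R h1 h2 h3 h4 (h5 : ∀ τ ∈ Icc t (t + h), ρ τ ≤ R) =>
    hB s hs r z g hr hz hg t h R h1 h2 h3 h4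
      (fun τ hτ => (hgρ τ ⟨h1.trans hτ.1, hτ.2.trans h4⟩).trans (h5 τ hτ))
  constructor
  · have := sub_le_integral_of_local (f := fun t => Real.exp (-a * t) *
      ‖P (orb φ ω (s + t)) (z t)‖) (c := a)
      ((by fun_prop : Continuous fun t => Real.exp (-a * t)).continuousOn.mul hPc.norm) hρ hh₀ hΔ
      (fun t h R h1 h2 h3 h4 h5 => by
        have k := mul_le_mul_of_nonneg_left (hloc t h R h1 h2 h3 h4 h5).1
          (Real.exp_pos (-a * (t + h))).le
        have e : Real.exp (-a * (t + h)) * Real.exp (a * h) = Real.exp (-a * t) := by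
          rw [← Real.exp_add]; congr 1; ring
        linear_combination k + ‖P (orb φ ω (s + t)) (z t)‖ * e) le_rfl ht.1 ht.2
    have k := mul_le_mul_of_nonneg_left this (Real.exp_pos (a * t)).le
    rw [← intervalIntegral.integral_const_mul, mul_sub, ← mul_assoc, ← Real.exp_add] at k
    simp only [← mul_assoc, ← Real.exp_add] at k
    rw [show a * t + -a * t = 0 by ring, show a * t + -a * 0 = a * t by ring, Real.exp_zero,
      one_mul, add_zero] at k
    have e : ∀ τ, a * (t - τ) = a * t + -a * τ := fun τ => by ring
    simp only [e]
    linarith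
  · have := sub_le_integral_of_local (f := fun t => -(Real.exp (-b * t) *
      ‖z t - P (orb φ ω (s + t)) (z t)‖)) (c := b)
      ((by fun_prop : Continuous fun t => Real.exp (-b * t)).continuousOn.mul hQc.norm).neg hρ hh₀ hΔ
      (fun t h R h1 h2 h3 h4 h5 => by
        have k := mul_le_mul_of_nonneg_left (hloc t h R h1 h2 h3 h4 h5).2
          (Real.exp_pos (-b * t)).le
        rw [← mul_assoc, ← Real.exp_add, show -b * t + -b * h = -b * (t + h) by ring] at k
        linarith) ht.1 ht.2 le_rfl
    have k := mul_le_mul_of_nonneg_left this (Real.exp_pos (b * t)).le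
    rw [← intervalIntegral.integral_const_mul, mul_sub, mul_neg, mul_neg, ← mul_assoc, ← mul_assoc,
      ← Real.exp_add, ← Real.exp_add] at k
    simp only [← mul_assoc, ← Real.exp_add] at k
    rw [show b * t + -b * t = 0 by ring, Real.exp_zero, one_mul] at k
    have e : ∀ τ, -b * (τ - t) = b * t + -b * τ := fun τ => by ring
    simp only [e]
    linarith

theorem exp_mul_le_of_abs_sub_le {γ G h s t : ℝ} (hG : |γ| ≤ G) (hst : |s - t| ≤ h) :
    Real.exp (γ * s) ≤ Real.exp (G * h) * Real.exp (γ * t) := by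
  rw [← Real.exp_add]
  refine Real.exp_le_exp.2 ?_
  have h1 : γ * (s - t) ≤ |γ| * |s - t| := (le_abs_self _).trans_eq (abs_mul _ _)
  have h2 : |γ| * |s - t| ≤ G * h := mul_le_mul hG hst (abs_nonneg _) ((abs_nonneg _).trans hG)
  nlinarith

/-- No relation between Δ(h) and h is needed: over one fixed step the weighted quantities contract
by e^{-dh}, so the steps sum to a geometric series. The factor e^{(G+|b|)h} compares weights within
a step. -/
theorem LocalBound.adm (H : LinearTheory φ P LS σ) {h D d G : ℝ} (hh : 0 < h)
    (hB : LocalBound φ P LS σ ω a b Δ h) (hD : 0 ≤ D) (hΔ : ∀ h', 0 < h' → h' ≤ h → 0 ≤ Δ h' ∧ Δ h' ≤ D)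
    (hd : 0 < d) (ha : a + d ≤ γ) (hb : γ ≤ b - d) (hG : |γ| ≤ G) (hε : 0 ≤ ε)
    (hlip : ∀ t, 0 ≤ t → ∀ z z', σ (orb φ ω t) (f (orb φ ω t) z - f (orb φ ω t) z') ≤
      ε * maxNorm P (orb φ ω t) (z - z'))
    (hκε : D * Real.exp ((G + |b|) * h) / (1 - Real.exp (-d * h)) * ε < 1) :
    Adm φ P LS σ f ω γ b (D * Real.exp ((G + |b|) * h) / (1 - Real.exp (-d * h))) ε := by
  have hq : Real.exp (-d * h) < 1 := Real.exp_lt_one_iff.2 (by nlinarith)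
  have hq' : 0 < 1 - Real.exp (-d * h) := by linarith
  set D' := D * Real.exp ((G + |b|) * h) with hD'
  have hD'0 : 0 ≤ D' := by positivity
  refine ⟨by linarith, by positivity, hε, hκε, hlip, ?_⟩
  intro s hs r z g C hr hC hz hg hgC
  have hPc := H.continuousOn_proj (s := s) (H.contOn hz) ω
  have hQc := (H.contOn hz).sub hPc
  have hG0 : 0 ≤ G := (abs_nonneg _).trans hG
  have hexp1 : Real.exp (G * h) ≤ Real.exp ((G + |b|) * h) := by
    gcongr
    linarith [abs_nonneg b]
  -- the forcing on a short interval, compared with its size at a point of the interval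
  have hR : ∀ t h' t₀, 0 ≤ t → 0 < h' → h' ≤ h → t + h' ≤ r → t₀ ∈ Icc t (t + h') →
      ∀ τ ∈ Icc t (t + h'), σ (orb φ ω (s + τ)) (g τ) ≤ C * (Real.exp (G * h) * Real.exp (γ * t₀)) := by
    intro t h' t₀ h1 h2 h3 h4 h5 τ hτ
    refine (hgC τ ⟨h1.trans hτ.1, hτ.2.trans h4⟩).trans (mul_le_mul_of_nonneg_left ?_ hC)
    refine exp_mul_le_of_abs_sub_le hG (abs_le.2 ⟨?_, ?_⟩) <;> linarith [hτ.1, hτ.2, h5.1, h5.2]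
  have hlocX : ∀ t h', 0 ≤ t → 0 < h' → h' ≤ h → t + h' ≤ r →
      ‖P (orb φ ω (s + (t + h'))) (z (t + h'))‖ ≤ Real.exp (a * h') *
        ‖P (orb φ ω (s + t)) (z t)‖ + D' * C * Real.exp (γ * (t + h')) := by
    intro t h' h1 h2 h3 h4
    refine (hB s hs r z g hr hz hg t h' _ h1 h2 h3 h4
      (hR t h' (t + h') h1 h2 h3 h4 ⟨by linarith, le_rfl⟩)).1.trans (add_le_add_right ?_ _)
    calc _ ≤ D * (C * (Real.exp ((G + |b|) * h) * Real.exp (γ * (t + h')))) := by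
          gcongr
          exact (hΔ h' h2 h3).2
      _ = _ := by rw [hD']; ring
  have hlocY : ∀ t h', 0 ≤ t → 0 < h' → h' ≤ h → t + h' ≤ r →
      ‖z t - P (orb φ ω (s + t)) (z t)‖ ≤ Real.exp (-b * h') *
        ‖z (t + h') - P (orb φ ω (s + (t + h'))) (z (t + h'))‖ + D' * C * Real.exp (γ * t) := by
    intro t h' h1 h2 h3 h4
    refine (hB s hs r z g hr hz hg t h' _ h1 h2 h3 h4
      (hR t h' t h1 h2 h3 h4 ⟨le_rfl, by linarith⟩)).2.trans ?_
    rw [mul_add]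
    refine add_le_add_right ?_ _
    have e1 : Real.exp (-b * h') ≤ Real.exp (|b| * h) := by
      refine Real.exp_le_exp.2 ?_
      have := neg_abs_le b
      nlinarith [abs_nonneg b]
    calc _ ≤ Real.exp (|b| * h) * (D * (C * (Real.exp (G * h) * Real.exp (γ * t)))) := by
          have := (hΔ h' h2 h3).1
          gcongr
          exact (hΔ h' h2 h3).2
      _ = _ := by rw [hD', add_mul, Real.exp_add]; ring
  have hexp : ∀ x : ℝ, Real.exp (-γ * x) * Real.exp (γ * x) = 1 := fun x => by
    rw [← Real.exp_add]; simp
  have hX := le_of_local_contraction (u := fun t => Real.exp (-γ * t) *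
    ‖P (orb φ ω (s + t)) (z t)‖) (r := r) (h := h) (q := Real.exp (-d * h))
    (u₀ := ‖P (orb φ ω s) (z 0)‖) (D := D' * C)
    ((by fun_prop : Continuous fun t => Real.exp (-γ * t)).continuousOn.mul hPc.norm) hh
    (Real.exp_pos _).le hq (norm_nonneg _) (by positivity) ?_ ?_
  -- The Y-estimate runs backward from r, with the exact contribution of the far end subtracted
  -- beforehand, so that the initial bound is 0.
  · have hY := le_of_local_contraction (u := fun t => Real.exp (-γ * (r - t)) *
      (‖z (r - t) - P (orb φ ω (s + (r - t))) (z (r - t))‖ -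
        Real.exp (-b * t) * ‖z r - P (orb φ ω (s + r)) (z r)‖)) (r := r) (h := h)
      (q := Real.exp (-d * h)) (u₀ := 0) (D := D' * C) ?_ hh
      (Real.exp_pos _).le hq le_rfl (by positivity) ?_ ?_
    · intro t ht
      constructor
      · have := mul_le_mul_of_nonneg_left (hX t ht) (Real.exp_pos (γ * t)).le
        beta_reduce at this
        rw [← mul_assoc, mul_comm (Real.exp (γ * t)), hexp, one_mul] at this
        refine this.trans_eq ?_
        ring
      · have := mul_le_mul_of_nonneg_left (hY (r - t) ⟨by linarith [ht.2], by linarith [ht.1]⟩)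
          (Real.exp_pos (γ * t)).le
        simp only [sub_sub_cancel] at this
        rw [← mul_assoc, mul_comm (Real.exp (γ * t)), hexp, one_mul, zero_add] at this
        have e : D' / (1 - Real.exp (-d * h)) * C * Real.exp (γ * t) =
          Real.exp (γ * t) * (D' * C / (1 - Real.exp (-d * h))) := by ring
        rw [e]
        linarith
    · have hm : MapsTo (fun t => r - t) (Icc 0 r) (Icc 0 r) := fun t ht =>
        ⟨by linarith [ht.2], by linarith [ht.1]⟩
      have c1 : ContinuousOn (fun t => ‖z (r - t) - P (orb φ ω (s + (r - t))) (z (r - t))‖)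
          (Icc 0 r) := hQc.norm.comp (by fun_prop) hm
      exact (by fun_prop : Continuous fun t => Real.exp (-γ * (r - t))).continuousOn.mul
        (c1.sub (by fun_prop : Continuous fun t => Real.exp (-b * t) *
          ‖z r - P (orb φ ω (s + r)) (z r)‖).continuousOn)
    · intro t ht hth
      rcases ht.1.eq_or_lt with rfl | ht0
      · simp only [sub_zero, mul_zero, Real.exp_zero, one_mul, sub_self, zero_add]
        positivity
      · have k := hlocY (r - t) t (by linarith [ht.2]) ht0 hth (by linarith)
        rw [sub_add_cancel] at k
        have k2 := mul_le_mul_of_nonneg_left (sub_le_iff_le_add'.2 k)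
          (Real.exp_pos (-γ * (r - t))).le
        refine k2.trans_eq ?_
        rw [mul_left_comm, hexp]; ring
    · intro t ht hth
      have k := hlocY (r - t) h (by linarith [ht.2]) hh le_rfl (by linarith)
      rw [show r - t + h = r - (t - h) by ring] at k
      set B := ‖z (r - (t - h)) - P (orb φ ω (s + (r - (t - h)))) (z (r - (t - h)))‖
      set B' := ‖z r - P (orb φ ω (s + r)) (z r)‖
      have e1 : Real.exp (-b * t) = Real.exp (-b * h) * Real.exp (-b * (t - h)) := by
        rw [← Real.exp_add]; congr 1; ring
      have k2 : ‖z (r - t) - P (orb φ ω (s + (r - t))) (z (r - t))‖ - Real.exp (-b * t) * B' ≤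
          Real.exp (-b * h) * (B - Real.exp (-b * (t - h)) * B') +
            D' * C * Real.exp (γ * (r - t)) := by
        rw [e1]; linarith
      have k3 : Real.exp (-γ * (r - t)) * Real.exp (-b * h) ≤
          Real.exp (-d * h) * Real.exp (-γ * (r - (t - h))) := by
        rw [← Real.exp_add, ← Real.exp_add]
        refine Real.exp_le_exp.2 ?_
        nlinarith
      set G := B - Real.exp (-b * (t - h)) * B'
      calc _ ≤ Real.exp (-γ * (r - t)) *
            (Real.exp (-b * h) * G + D' * C * Real.exp (γ * (r - t))) := by gcongr
        _ = Real.exp (-γ * (r - t)) * Real.exp (-b * h) * G + D' * C := by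
            linear_combination (D' * C) * hexp (r - t)
        _ ≤ Real.exp (-γ * (r - t)) * Real.exp (-b * h) * max G 0 + D' * C := by
            gcongr
            exact le_max_left _ _
        _ ≤ Real.exp (-d * h) * Real.exp (-γ * (r - (t - h))) * max G 0 + D' * C := by
            gcongr
        _ = _ := by
            rw [mul_assoc, mul_max_of_nonneg _ _ (Real.exp_pos (-γ * (r - (t - h)))).le, mul_zero]
  · intro t ht hth
    rcases ht.1.eq_or_lt with rfl | ht0
    · simp only [mul_zero, Real.exp_zero, one_mul, add_zero]
      linarith [mul_nonneg hD'0 hC]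
    · have k := hlocX 0 t le_rfl ht0 hth (by linarith [ht.2])
      simp only [zero_add, add_zero] at k
      have k2 : Real.exp (-γ * t) * Real.exp (a * t) ≤ 1 := by
        rw [← Real.exp_add]
        exact Real.exp_le_one_iff.2 (by nlinarith)
      calc _ ≤ Real.exp (-γ * t) * (Real.exp (a * t) * ‖P (orb φ ω s) (z 0)‖ +
            D' * C * Real.exp (γ * t)) := by gcongr
        _ = Real.exp (-γ * t) * Real.exp (a * t) * ‖P (orb φ ω s) (z 0)‖ + D' * C := by
            linear_combination (D' * C) * hexp t
        _ ≤ 1 * ‖P (orb φ ω s) (z 0)‖ + D' * C := by gcongr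
        _ = _ := by rw [one_mul]
  · intro t ht hth
    have k := hlocX (t - h) h (by linarith) hh le_rfl (by linarith [ht.2])
    rw [sub_add_cancel] at k
    have k3 : Real.exp (-γ * t) * Real.exp (a * h) ≤
        Real.exp (-d * h) * Real.exp (-γ * (t - h)) := by
      rw [← Real.exp_add, ← Real.exp_add]
      refine Real.exp_le_exp.2 ?_
      nlinarith
    calc _ ≤ Real.exp (-γ * t) * (Real.exp (a * h) * ‖P (orb φ ω (s + (t - h))) (z (t - h))‖ +
          D' * C * Real.exp (γ * t)) := by gcongr
      _ = Real.exp (-γ * t) * Real.exp (a * h) * ‖P (orb φ ω (s + (t - h))) (z (t - h))‖ +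
          D' * C := by linear_combination (D' * C) * hexp t
      _ ≤ Real.exp (-d * h) * Real.exp (-γ * (t - h)) *
          ‖P (orb φ ω (s + (t - h))) (z (t - h))‖ + D' * C := by gcongr
      _ ≤ _ := by
          rw [mul_assoc]
          gcongr
          exact le_max_left _ _

/-- Cruder than the cone from integral bounds: it uses only the bound of the difference in the
weight γ, once more in the Y-estimate, and so has the constant κε / (1 - κε). -/
theorem Adm.cone (H : LinearTheory φ P LS σ) (hf : Continuous fun p : M × E => f p.1 p.2)
    {μ κ : ℝ} (h : Adm φ P LS σ f ω γ μ κ ε) {z z' : ℝ → E} {N : ℝ}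
    (hz : NonlinearSol φ LS f ω z) (hz' : NonlinearSol φ LS f ω z')
    (hN : ∀ t, 0 ≤ t → maxNorm P (orb φ ω t) (z t - z' t) ≤ N * Real.exp (γ * t)) :
    ‖z 0 - z' 0 - P ω (z 0 - z' 0)‖ ≤ κ * ε / (1 - κ * ε) * ‖P ω (z 0 - z' 0)‖ := by
  have hd := fun t (ht : 0 ≤ t) => h.diff_le H hf hz hz' hN ht
  have hκε : 0 < 1 - κ * ε := by linarith [h.contr]
  have hc : ContinuousOn (fun t => f (orb φ ω t) (z t)) (Ici 0) :=
    continuousOn_nonlinearity φ ω hf (H.contOn_Ici hz)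
  have hc' : ContinuousOn (fun t => f (orb φ ω t) (z' t)) (Ici 0) :=
    continuousOn_nonlinearity φ ω hf (H.contOn_Ici hz')
  have := (h.gain_Ici (z := fun t => z t - z' t)
    (g := fun t => f (orb φ ω t) (z t) - f (orb φ ω t) (z' t))
    (C := ε * (‖P ω (z 0 - z' 0)‖ / (1 - κ * ε)))
    (mul_nonneg h.lip_nonneg (by positivity))
    (fun r hr => H.sub hr (hc.mono Icc_subset_Ici_self) (hc'.mono Icc_subset_Ici_self)
      (hz r hr) (hz' r hr)) (hc.sub hc') (fun t ht => h.size_sub_le ht (hd t ht)) hd le_rfl).2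
  rw [orb_zero, mul_zero, Real.exp_zero, mul_one] at this
  exact this.trans_eq (by ring)

/-- If two weights are admissible, locally uniform convergence of the defects suffices. -/
theorem Adm.defectStable {γ₁ μ κ : ℝ} (hγ : γ < γ₁)
    (h : Adm φ P LS σ f ω γ₁ μ κ ε) : DefectStable φ P LS σ (fun τ => 𝓝[Ici 0] τ) ω γ ε := by
  intro zn gn rn N hLS hgc hP0 hzN hrc hrN hσ hconv
  have hκε : 0 < 1 - κ * ε := by linarith [h.contr]
  have hN0 : 0 ≤ N := by
    have := (maxNorm_nonneg P _ _).trans (hzN 0 0 le_rfl)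
    simpa using this
  -- After a time T the gap γ₁ - γ makes the a priori bound small relative to the larger weight. On
  -- [0, T] local uniform convergence does it, and compactness turns it into uniform convergence.
  have hsmall : ∀ η, 0 < η → ∀ᶠ n in atTop, ∀ t, 0 ≤ t → rn n t ≤ η * Real.exp (γ₁ * t) := by
    intro η hη
    have hdec : Tendsto (fun t : ℝ => N * Real.exp (-((γ₁ - γ) * t))) atTop (𝓝 (N * 0)) :=
      (Real.tendsto_exp_neg_atTop_nhds_zero.comp
        (tendsto_id.const_mul_atTop (sub_pos.2 hγ))).const_mul N
    rw [mul_zero] at hdec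
    obtain ⟨T, hT⟩ := eventually_atTop.1 (hdec.eventually (gt_mem_nhds hη))
    have hunif : TendstoUniformlyOn rn (fun _ => 0) atTop (Icc 0 T) := by
      rw [← tendstoLocallyUniformlyOn_iff_tendstoUniformlyOn_of_compact isCompact_Icc]
      rw [Metric.tendstoLocallyUniformlyOn_iff]
      intro η' hη' τ hτ
      obtain ⟨pa, ha, pb, hb, hab⟩ := eventually_prod_iff.1
        (Metric.tendsto_nhds.1 (hconv τ hτ.1) η' hη')
      refine ⟨{t | pb t}, nhdsWithin_mono τ Icc_subset_Ici_self hb, ha.mono fun n hn t ht => ?_⟩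
      rw [dist_comm]
      exact hab hn ht
    obtain ⟨m, hm, hmin⟩ : ∃ m : ℝ, 0 < m ∧ ∀ t ∈ Icc 0 T, m ≤ Real.exp (γ₁ * t) := by
      refine ⟨Real.exp (-(|γ₁| * |T|)), Real.exp_pos _, fun t ht => Real.exp_le_exp.2 ?_⟩
      have h1 := neg_abs_le (γ₁ * t)
      rw [abs_mul] at h1
      have h2 : |t| ≤ |T| := abs_le_abs_of_nonneg ht.1 ht.2
      nlinarith [abs_nonneg γ₁]
    filter_upwards [Metric.tendstoUniformlyOn_iff.1 hunif (η * m) (mul_pos hη hm)] with n hn t ht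
    rcases le_total t T with htT | htT
    · have h1 := hn t ⟨ht, htT⟩
      rw [dist_comm, dist_zero_right] at h1
      refine (le_abs_self _).trans (h1.le.trans ?_)
      gcongr
      exact hmin t ⟨ht, htT⟩
    · refine (hrN n t ht).2.trans ?_
      have h1 := mul_le_mul_of_nonneg_right (hT t htT).le (Real.exp_pos (γ₁ * t)).le
      refine le_trans (le_of_eq ?_) h1
      rw [mul_assoc, ← Real.exp_add]
      congr 2; ring
  have key : ∀ n η, 0 ≤ η → (∀ t, 0 ≤ t → rn n t ≤ η * Real.exp (γ₁ * t)) →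
      ‖zn n 0 - P ω (zn n 0)‖ ≤ κ * η / (1 - κ * ε) := by
    intro n η hη hr
    have := bound_of_self_improving (ι := Ici (0 : ℝ))
      (m := fun t => maxNorm P (orb φ ω t) (zn n t)) (w := fun t => Real.exp (γ₁ * t))
      (mul_nonneg h.gain_nonneg h.lip_nonneg) h.contr (mul_nonneg h.gain_nonneg hη) hN0
      (fun t => Adm.growth_mono hγ.le (hzN n) t.2) (fun N' hN' hb t => by
        have hεN := mul_nonneg h.lip_nonneg hN'
        have h1 := (h.gain_Ici (C := ε * N' + η) (by linarith) (hLS n) (hgc n) (fun t ht => by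
          have h2 := mul_le_mul_of_nonneg_left (hb ⟨t, ht⟩) h.lip_nonneg
          beta_reduce at h2
          refine (hσ n t ht).trans ((add_le_add h2 (hr t ht)).trans_eq ?_)
          ring) (fun t ht => hb ⟨t, ht⟩) t.2).1
        rw [hP0, norm_zero] at h1
        exact h1.trans_eq (by ring)) ⟨0, mem_Ici.2 le_rfl⟩
    rw [mul_zero, Real.exp_zero, mul_one, orb_zero] at this
    exact (norm_sub_apply_le_maxNorm P _ _).trans this
  have hlim : Tendsto (fun η : ℝ => κ * η / (1 - κ * ε)) (𝓝[>] 0) (𝓝 0) := by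
    have : Tendsto (fun η : ℝ => κ * η / (1 - κ * ε)) (𝓝 0) (𝓝 (κ * 0 / (1 - κ * ε))) :=
      Continuous.tendsto (by fun_prop) 0
    rw [mul_zero, zero_div] at this
    exact this.mono_left nhdsWithin_le_nhds
  rw [Metric.tendsto_nhds]
  intro η hη
  obtain ⟨η', h1, h2⟩ := ((hlim.eventually (gt_mem_nhds hη)).and self_mem_nhdsWithin).exists
  have h2 : 0 < η' := h2
  filter_upwards [hsmall η' h2] with n hn
  rw [dist_zero_right, norm_norm]
  exact (key n η' h2.le hn).trans_lt h1

end LocalBound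

end InvGraph

end

noncomputable section

namespace InvGraph

/-! ### Invariant graphs for MR operators -/

section MRGraph

variable {M : Type u} [TopologicalSpace M] {Z : Type v} [NormedAddCommGroup Z] [NormedSpace ℝ Z]
  [CompleteSpace Z] {φ : Flow ℝ≥0 M} {A : Z →ₗ.[ℝ] Z} {δ : ℝ → ℝ} {L : M → closDom A →L[ℝ] Z}
  {T₀ : ℝ≥0 → M → closDom A →L[ℝ] closDom A} {τ : M → ℝ}
  {P : M → closDom A →L[ℝ] closDom A} {C₁ : ℝ} {μs μu : M → ℝ}

/-- On a short interval z is the cocycle applied to z(t) plus a remainder v that starts at 0, and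
C₁‖v‖ is bounded by the MR estimate. Dichotomy handles the cocycle part: forward on X, through the
inverse on Y. -/
theorem IsMROperator.localBound (hA : IsMROperator A δ) (hL : CondL φ L τ)
    (hG : GeneratesCocycle φ A (closDom A).subtypeL L T₀)
    (hU : UniformDichotomyCocycle φ T₀ P C₁ μs μu) {ω : M} {h₀ : ℝ}
    (hδ : δ h₀ * τ ω < 1) :
    LocalBound φ P (MildLS φ A (closDom A).subtypeL L) (fun _ v => C₁ * ‖v‖) ω (μs ω) (μu ω)
      (fun h => δ h / (1 - δ h * τ ω)) h₀ := by
  intro s hs r z g hr hz hg t h R ht hh hh₀ hthr hR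
  have hC := hU.C_pos
  have hth : 0 ≤ t + h := by linarith
  have hst : 0 ≤ s + t := add_nonneg hs ht
  set ω' := orb φ ω (s + t) with hω'
  have hgt : ContinuousOn g (Icc 0 (t + h)) := hg.mono (Icc_subset_Icc_right hthr)
  have h1 := (hz.mono hthr).shift hL.cont ht hh.le hgt
  rw [orb_orb φ ω hs ht] at h1
  have hgs : ContinuousOn (fun τ => g (t + τ)) (Icc 0 h) :=
    hgt.comp (by fun_prop) fun τ hτ => ⟨by linarith [hτ.1], by linarith [hτ.2]⟩
  have h2 := h1.sub hL.cont hgs continuousOn_const (hG.mildLS ω' (z t) hh.le)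
  have hδ' : δ h * τ ω < 1 :=
    (mul_le_mul_of_nonneg_right (hA.mono hh (hh.trans_le hh₀) hh₀) (hL.nonneg ω)).trans_lt hδ
  have h3 := hA.norm_mild_le hL.cont hh (fun t' ht' => hL.norm_shift_le ω hst ht') hδ'
    (hgs.sub continuousOn_const) h2 (by simp [(hG _ _).1]) (b := R / C₁) (fun τ hτ => by
      rw [le_div_iff₀ hC, Pi.sub_apply, sub_zero, mul_comm]
      exact hR (t + τ) ⟨by linarith [hτ.1], by linarith [hτ.2]⟩) h ⟨hh.le, le_rfl⟩
  set v := z (t + h) - T₀ h.toNNReal ω' (z t) with hv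
  have hzv : z (t + h) = T₀ h.toNNReal ω' (z t) + v := by rw [hv]; abel
  have hΔ : C₁ * ‖v‖ ≤ δ h / (1 - δ h * τ ω) * R := by
    refine (mul_le_mul_of_nonneg_left h3 hC.le).trans_eq ?_
    field_simp
  have hω : orb φ ω (s + (t + h)) = φ h.toNNReal ω' := by
    rw [← add_assoc, ← orb_orb φ ω hst hh.le]; rfl
  have hm := maxNorm_le_mul_norm hU.norm_P hU.norm_Pc (φ h.toNNReal ω') v
  have hPv := (norm_apply_le_maxNorm P (φ h.toNNReal ω') v).trans (hm.trans hΔ)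
  have hQv := (norm_sub_apply_le_maxNorm P (φ h.toNNReal ω') v).trans (hm.trans hΔ)
  have hT := hU.norm_T h.toNNReal (s + t).toNNReal ω (P ω' (z t)) ⟨z t, rfl⟩
  have hS := hU.norm_S h.toNNReal (s + t).toNNReal ω (z t - P ω' (z t))
    (mem_specY ω' (by simp [hU.proj]))
  rw [Real.coe_toNNReal _ hh.le] at hT hS
  rw [hω, hzv]
  constructor
  · rw [map_add, hU.proj_evo]
    exact (norm_add_le _ _).trans (add_le_add hT hPv)
  · refine hS.trans (mul_le_mul_of_nonneg_left ?_ (Real.exp_pos _).le)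
    have e : T₀ h.toNNReal ω' (z t - P ω' (z t)) = (T₀ h.toNNReal ω' (z t) + v -
        P (φ h.toNNReal ω') (T₀ h.toNNReal ω' (z t) + v)) - (v - P (φ h.toNNReal ω') v) := by
      rw [map_add, hU.proj_evo, map_sub]; abel
    change ‖T₀ h.toNNReal ω' (z t - P ω' (z t))‖ ≤ _
    rw [e]
    exact (norm_sub_le _ _).trans (add_le_add_right hQv _)

/-- The invariant graph theorem for MR operators with modulus `δ(t) ∼ t`. -/
theorem invariantGraphTheorem_mr {c : ℝ} (hc : 1 < c) (hA : IsMROperator A δ)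
    (hδ : Tendsto (fun t => δ t / t) (𝓝[>] 0) (𝓝 1)) (hL : CondL φ L τ)
    {f : M → closDom A → Z} (hf : CondF φ f)
    (hG : GeneratesCocycle φ A (closDom A).subtypeL L T₀)
    (hU : UniformDichotomyCocycle φ T₀ P C₁ μs μu) {β : M → ℝ}
    (hgap : InfPos (fun ω => μu ω - μs ω - (1 + c) * (2 * C₁ * eps φ f ω)))
    (hβ : ∀ ω, 2 * C₁ * eps φ f ω / (μu ω - μs ω - 2 * C₁ * eps φ f ω) ≤ β ω ∧ β ω < 1) :
    InvariantGraphTheorem φ P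
      (IsMild φ A (closDom A).subtypeL (fun ω z => L ω z + f ω z))
      f μs μu (fun ω => 2 * C₁ * eps φ f ω) β (∀ ω, ContDiff ℝ 1 (f ω)) True := by
  have := completeSpace_closDom (A := A)
  have H := hA.linearTheory hL hG hU
  refine invariantGraphTheorem_of_integralBound H hf.cont
    (fun ω w => isMild_iff φ A _ L f ω w) hc (fun ω => ?_)
    (fun ω => by have := eps_nonneg (φ := φ) f ω; have := hU.C_pos; positivity)
    (fun ω t _ z z' => mul_norm_sub_le_maxNorm hf hU.C_pos.le P ω t z z') hgap hβ
  obtain ⟨h₀, hh₀, hδh⟩ := hA.exists_step (τ ω)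
  refine (hA.localBound hL hG hU (ω := ω) (h₀ := h₀) (by linarith)).integralBound H hh₀ ?_
  -- Since δ(t) → 0, the loss 1/(1 - δ(t)τ) tends to 1, and the bounded perturbation does not affect
  -- the limit of Δ(h)/h.
  have h1 : Tendsto (fun t => 1 - δ t * τ ω) (𝓝[>] 0) (𝓝 (1 - 0 * τ ω)) :=
    (hA.lim.mul_const _).const_sub 1
  have h2 := hδ.div h1 (by simp)
  simp only [zero_mul, sub_zero, div_one] at h2
  refine h2.congr fun t => ?_
  simp only [Pi.div_apply]
  rw [div_right_comm]

/-- A time step on which linear perturbations of norm at most `n` are harmless. -/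
def timeStep (δ : ℝ → ℝ) (n : ℕ) : ℝ :=
  -- The default 1 keeps the step defined and positive for an arbitrary δ; for the modulus of an MR
  -- operator it is never used.
  open Classical in if h : ∃ h, 0 < h ∧ δ h * n ≤ 1 / 2 then h.choose else 1

theorem timeStep_pos (δ : ℝ → ℝ) (n : ℕ) : 0 < timeStep δ n := by
  rw [timeStep]
  split_ifs with h
  · exact h.choose_spec.1
  · exact one_pos

theorem IsMROperator.timeStep_mul_le (hA : IsMROperator A δ) (n : ℕ) :
    δ (timeStep δ n) * n ≤ 1 / 2 := by
  have h := hA.exists_step n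
  rw [timeStep, dif_pos h]
  exact h.choose_spec.2

/-- The gain of the linear equation in exponential weights at distance `d` from the spectrum. -/
def stepGain (δ : ℝ → ℝ) (n : ℕ) (d K : ℝ) : ℝ :=
  -- The 2 bounds 1/(1 - δτ) on this step. The absolute value keeps the gain nonnegative for every
  -- δ, before any MR operator is given.
  2 * |δ (timeStep δ n)| * Real.exp (K * timeStep δ n) / (1 - Real.exp (-d * timeStep δ n))

theorem one_sub_exp_pos {d h : ℝ} (hd : 0 < d) (hh : 0 < h) : 0 < 1 - Real.exp (-d * h) :=
  sub_pos.2 (Real.exp_lt_one_iff.2 (by nlinarith))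

theorem stepGain_nonneg (δ : ℝ → ℝ) (n : ℕ) {d : ℝ} (hd : 0 < d) (K : ℝ) :
    0 ≤ stepGain δ n d K :=
  div_nonneg (by positivity) (one_sub_exp_pos hd (timeStep_pos δ n)).le

theorem stepGain_le (δ : ℝ → ℝ) (n : ℕ) {d d' K K' : ℝ} (hd : 0 < d) (hdd : d ≤ d') (hK : K' ≤ K) :
    stepGain δ n d' K' ≤ stepGain δ n d K := by
  have h1 := one_sub_exp_pos hd (timeStep_pos δ n)
  have h2 := (timeStep_pos δ n).le
  rw [stepGain, stepGain]
  gcongr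

/-- The lower end of the interval of weights: nonnegative if possible. -/
def lowerWeight (a b : ℝ) : ℝ := if 0 < b then max a 0 else a

theorem le_lowerWeight (a b : ℝ) : a ≤ lowerWeight a b := by
  rw [lowerWeight]; split_ifs
  · exact le_max_left _ _
  · exact le_rfl

theorem lowerWeight_lt {a b : ℝ} (h : a < b) : lowerWeight a b < b := by
  rw [lowerWeight]; split_ifs with hb
  · exact max_lt h hb
  · exact h

theorem lowerWeight_nonneg {a b : ℝ} (h : 0 < b) : 0 ≤ lowerWeight a b := by
  rw [lowerWeight, if_pos h]; exact le_max_right _ _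

theorem lowerWeight_le_sub {a b d : ℝ} (h : d ≤ b - a) (hb : d ≤ b) : lowerWeight a b ≤ b - d := by
  rw [lowerWeight]; split_ifs
  · exact max_le (by linarith) (by linarith)
  · linarith

theorem abs_lowerWeight_le (a b : ℝ) : |lowerWeight a b| ≤ |a| := by
  rw [lowerWeight]; split_ifs
  · rw [abs_of_nonneg (le_max_right _ _)]
    exact max_le (le_abs_self a) (abs_nonneg a)
  · exact le_rfl

/-- The gain of the linear equation over `ω` in the middle third of the spectral gap. -/
def orbitGain (δ : ℝ → ℝ) (τ μs μu : M → ℝ) (ω : M) : ℝ :=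
  stepGain δ ⌈τ ω⌉₊ ((μu ω - lowerWeight (μs ω) (μu ω)) / 3)
    (|lowerWeight (μs ω) (μu ω)| + |μu ω| + |μu ω|)

theorem orbitGain_nonneg (δ : ℝ → ℝ) (τ : M → ℝ) {ω : M} (h : μs ω < μu ω) :
    0 ≤ orbitGain δ τ μs μu ω :=
  stepGain_nonneg _ _ (by linarith [lowerWeight_lt h]) _

/-- Nothing is known about how time steps depend on τ. Rounding τ up to an integer leaves finitely
many steps when τ is bounded, and the sum of their gains is a bound. -/
theorem exists_orbitGain_le (δ : ℝ → ℝ) {τ μs μu : M → ℝ} (hτ : IsBdd τ) (hs : IsBdd μs)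
    (hu : IsBdd μu) {d : ℝ} (hd : 0 < d) (h1 : ∀ ω, d ≤ μu ω - μs ω) (h2 : ∀ ω, d ≤ μu ω) :
    ∃ B, ∀ ω, orbitGain δ τ μs μu ω ≤ B := by
  obtain ⟨Kτ, hτ⟩ := hτ
  obtain ⟨Ks, hs⟩ := hs
  obtain ⟨Ku, hu⟩ := hu
  have hd3 : 0 < d / 3 := by positivity
  refine ⟨∑ n ∈ Finset.range (⌈Kτ⌉₊ + 1), stepGain δ n (d / 3) (Ks + Ku + Ku), fun ω => ?_⟩
  have hn : ⌈τ ω⌉₊ ∈ Finset.range (⌈Kτ⌉₊ + 1) :=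
    Finset.mem_range.2 (Nat.lt_succ_of_le (Nat.ceil_mono ((le_abs_self _).trans (hτ ω))))
  refine le_trans ?_ (Finset.single_le_sum (fun n _ => stepGain_nonneg δ n hd3 _) hn)
  refine stepGain_le δ _ hd3 ?_ ?_
  · linarith [lowerWeight_le_sub (h1 ω) (h2 ω)]
  · linarith [abs_lowerWeight_le (μs ω) (μu ω), hs ω, hu ω]

/-- All weights in the middle third of the interval share one gain; having two such weights is what
smoothness requires. -/
theorem IsMROperator.adm (hA : IsMROperator A δ) (hL : CondL φ L τ) {f : M → closDom A → Z}
    (hf : CondF φ f) (hG : GeneratesCocycle φ A (closDom A).subtypeL L T₀)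
    (hU : UniformDichotomyCocycle φ T₀ P C₁ μs μu) {ω : M} (hlt : μs ω < μu ω)
    (hε : orbitGain δ τ μs μu ω * (2 * C₁ * eps φ f ω) < 1) {γ : ℝ}
    (h1 : lowerWeight (μs ω) (μu ω) + (μu ω - lowerWeight (μs ω) (μu ω)) / 3 ≤ γ)
    (h2 : γ ≤ μu ω - (μu ω - lowerWeight (μs ω) (μu ω)) / 3) :
    Adm φ P (MildLS φ A (closDom A).subtypeL L) (fun _ v => C₁ * ‖v‖) f ω γ (μu ω)
      (orbitGain δ τ μs μu ω) (2 * C₁ * eps φ f ω) := by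
  set p := lowerWeight (μs ω) (μu ω) with hp
  have hpu : p < μu ω := lowerWeight_lt hlt
  have hsp : μs ω ≤ p := le_lowerWeight _ _
  set h := timeStep δ ⌈τ ω⌉₊ with hh
  have hh0 : 0 < h := timeStep_pos δ _
  have hδ0 := hA.nonneg hh0
  have hδτ : ∀ h', 0 < h' → h' ≤ h → δ h' * τ ω ≤ 1 / 2 := fun h' k1 k2 =>
    (mul_le_mul (hA.mono k1 hh0 k2) (Nat.le_ceil _) (hL.nonneg ω) hδ0).trans
      (hA.timeStep_mul_le _)
  refine (hA.localBound hL hG hU (ω := ω) (h₀ := h)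
    (by linarith [hδτ h hh0 le_rfl])).adm (hA.linearTheory hL hG hU) hh0 (D := 2 * |δ h|)
    (d := (μu ω - p) / 3) (G := |p| + |μu ω|) (by positivity) (fun h' k1 k2 => ?_) (by linarith)
    (by linarith) h2 ?_ (by have := eps_nonneg (φ := φ) f ω; have := hU.C_pos; positivity)
    (fun t _ z z' => mul_norm_sub_le_maxNorm hf hU.C_pos.le P ω t z z') hε
  · have k3 := hδτ h' k1 k2
    have k4 : 0 < 1 - δ h' * τ ω := by linarith
    have k5 := hA.nonneg k1
    refine ⟨by positivity, ?_⟩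
    rw [div_le_iff₀ k4, abs_of_nonneg hδ0]
    have := hA.mono k1 hh0 k2
    nlinarith
  · rw [abs_le]
    constructor
    · linarith [neg_abs_le p, abs_nonneg (μu ω)]
    · linarith [le_abs_self (μu ω), abs_nonneg p]

/-- The invariant graph theorem for general MR operators and small nonlinearities. -/
theorem invariantGraphTheorem_mr_small (hA : IsMROperator A δ) (hL : CondL φ L τ)
    {f : M → closDom A → Z} (hf : CondF φ f)
    (hG : GeneratesCocycle φ A (closDom A).subtypeL L T₀)
    (hU : UniformDichotomyCocycle φ T₀ P C₁ μs μu) {η : M → ℝ} (hη : ∀ ω, 0 < η ω) {d : ℝ}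
    (hd : 0 < d) (hgap : ∀ ω, d ≤ μu ω - μs ω)
    (hε : ∀ ω, orbitGain δ τ μs μu ω * (2 * C₁ * eps φ f ω) ≤ 1 / 3) :
    InvariantGraphTheorem φ P
      (IsMild φ A (closDom A).subtypeL (fun ω z => L ω z + f ω z)) f μs μu η (fun _ => 1 / 2)
      ((∀ ω, ContDiff ℝ 1 (f ω)) ∧ Continuous fun p : M × closDom A => fderiv ℝ (f p.1) p.2)
      (IsBdd τ) := by
  have := completeSpace_closDom (A := A)
  have H := hA.linearTheory hL hG hU
  have hlt : ∀ ω, μs ω < μu ω := fun ω => by linarith [hgap ω]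
  -- One choice for both cases: Case I leaves the sign of μu open, Case II forces μu > 0, and then p
  -- ≥ 0.
  set p : M → ℝ := fun ω => lowerWeight (μs ω) (μu ω) with hp
  have hpu : ∀ ω, p ω < μu ω := fun ω => lowerWeight_lt (hlt ω)
  have hadm : ∀ ω γ, p ω + (μu ω - p ω) / 3 ≤ γ → γ ≤ μu ω - (μu ω - p ω) / 3 → _ :=
    fun ω γ h1 h2 => hA.adm hL hf hG hU (hlt ω) (by linarith [hε ω]) h1 h2
  -- The weight at one third carries the graph; the one at two thirds absorbs the defects.
  set γ : M → ℝ := fun ω => p ω + (μu ω - p ω) / 3 with hγ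
  have hadm₀ := fun ω => hadm ω (γ ω) le_rfl (by simp only [hγ]; linarith [hpu ω])
  have hadm₁ := fun ω => hadm ω (p ω + 2 * ((μu ω - p ω) / 3)) (by linarith [hpu ω]) (by linarith)
  have hSol := fun ω w => isMild_iff φ A (closDom A).subtypeL L f ω w
  have hcone : ∀ ω z z' N, NonlinearSol φ (MildLS φ A (closDom A).subtypeL L) f ω z →
      NonlinearSol φ (MildLS φ A (closDom A).subtypeL L) f ω z' →
      (∀ t, 0 ≤ t → maxNorm P (orb φ ω t) (z t - z' t) ≤ N * Real.exp (γ ω * t)) →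
      ‖z 0 - z' 0 - P ω (z 0 - z' 0)‖ ≤ 1 / 2 * ‖P ω (z 0 - z' 0)‖ := by
    intro ω z z' N hz hz' hN
    refine ((hadm₀ ω).cone H hf.cont hz hz' hN).trans
      (mul_le_mul_of_nonneg_right ?_ (norm_nonneg _))
    -- κε ≤ 1/3 gives κε / (1 - κε) ≤ 1/2, the Lipschitz constant of the graph.
    rw [div_le_iff₀ (by linarith [hε ω])]
    linarith [hε ω]
  have hsm : ∀ ω, SmoothWeights φ P (MildLS φ A (closDom A).subtypeL L) (fun _ v => C₁ * ‖v‖) f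
      (fun τ => 𝓝[Ici 0] τ)
      ((∀ ω, ContDiff ℝ 1 (f ω)) ∧ Continuous fun p : M × closDom A => fderiv ℝ (f p.1) p.2)
      ω (γ ω) := by
    intro ω
    refine ⟨_, _, _, hadm₀ ω, fun hs => ⟨(hadm₁ ω).defectStable ?_, fun t ht w => ?_⟩⟩
    · simp only [hγ]; linarith [hpu ω]
    · have h1 : Continuous fun q : ℝ × closDom A => fderiv ℝ (f (orb φ ω q.1)) q.2 :=
        hs.2.comp (((continuous_orb φ ω).comp continuous_fst).prodMk continuous_snd)
      have h2 := h1.tendsto (t, w)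
      rw [nhds_prod_eq] at h2
      exact h2.mono_left (Filter.prod_mono nhdsWithin_le_nhds le_rfl)
  refine ⟨fun hf0 => conclusionI_of H hf.cont hSol (fun _ => by norm_num) hcone (fun h => h.1)
    (fun _ _ => le_rfl) hsm hf0, fun hfb hpos => ?_⟩
  obtain ⟨d', hd', hpos⟩ := hpos
  have hγ0 : ∀ ω, 0 ≤ γ ω := fun ω => by
    have := lowerWeight_nonneg (a := μs ω) (b := μu ω) (by linarith [hpos ω, hη ω])
    simp only [hγ]
    linarith [hpu ω]
  refine conclusionII_of H hf.cont hSol (fun _ => by norm_num) hcone (fun h => h.1)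
    (fun _ _ => le_rfl) hγ0 hsm hfb (fun h => h.2.2.2.1) (fun h => ?_)
  obtain ⟨B, hB⟩ := exists_orbitGain_le δ h.2.2.2.2 h.1 h.2.1 (d := min d d') (lt_min hd hd')
    (fun ω => (min_le_left _ _).trans (hgap ω))
    (fun ω => (min_le_right _ _).trans (by linarith [hpos ω, hη ω]))
  -- Here κ / (1 - κε) ≤ (3/2)κ.
  refine ⟨2 * B, fun ω => ⟨γ ω, _, _, _, hγ0 ω, hadm₀ ω, ?_⟩⟩
  have h0 := orbitGain_nonneg δ τ (hlt ω)
  rw [div_le_iff₀ (by linarith [hε ω])]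
  nlinarith [hε ω, hB ω]

end MRGraph

end InvGraph

end

/-! ### The theorem: assembling the cases -/

theorem mainTheorem4 {M : Type u} [TopologicalSpace M] [T2Space M] (φ : Flow ℝ≥0 M)
    (μs μu : M → ℝ) (C₁ c : ℝ) (hc : 1 < c) :
    -- (i) integral equation of a cocycle correspondence with uniform dichotomy
    (∀ (Z : Type v) [NormedAddCommGroup Z] [NormedSpace ℝ Z] [CompleteSpace Z]
      (P : M → Z →L[ℝ] Z)
      (T₁ : ∀ (t : ℝ≥0) (ω : M), InvGraph.specX P ω →L[ℝ] InvGraph.specX P (φ t ω))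
      (S₁ : ∀ (t : ℝ≥0) (ω : M), InvGraph.specY P (φ t ω) →L[ℝ] InvGraph.specY P ω)
      (f : M → Z → Z) (β : M → ℝ),
      InvGraph.UniformDichotomy φ P T₁ S₁ C₁ μs μu →
      InvGraph.CondF φ f →
      InvGraph.InfPos (fun ω => μu ω - μs ω - (1 + c) * InvGraph.epsMax φ P f ω) →
      (∀ ω, InvGraph.epsMax φ P f ω / (μu ω - μs ω - InvGraph.epsMax φ P f ω) ≤ β ω ∧ β ω < 1) →
      InvGraph.InvariantGraphTheorem φ P (InvGraph.IsIntegralSol φ P T₁ S₁ f) f μs μu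
        (InvGraph.epsMax φ P f) β (∀ ω, ContDiff ℝ 1 (f ω)) True) ∧
    -- (ii), first part: generators of bi-semigroups
    (∀ (Z : Type v) [NormedAddCommGroup Z] [NormedSpace ℝ Z] [CompleteSpace Z]
      (A : Z →ₗ.[ℝ] Z) (L : M → Z →L[ℝ] Z) (τ : M → ℝ) (P : M → Z →L[ℝ] Z)
      (T₁ : ∀ (t : ℝ≥0) (ω : M), InvGraph.specX P ω →L[ℝ] InvGraph.specX P (φ t ω))
      (S₁ : ∀ (t : ℝ≥0) (ω : M), InvGraph.specY P (φ t ω) →L[ℝ] InvGraph.specY P ω)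
      (f : M → Z → Z) (β : M → ℝ),
      InvGraph.GeneratesBiSemigroup A →
      InvGraph.CondL φ L τ →
      InvGraph.CondF φ f →
      InvGraph.UniformDichotomy φ P T₁ S₁ C₁ μs μu →
      InvGraph.GeneratesCorrespondence φ A L P T₁ S₁ →
      InvGraph.InfPos (fun ω => μu ω - μs ω - (1 + c) * (2 * C₁ * InvGraph.eps φ f ω)) →
      (∀ ω, 2 * C₁ * InvGraph.eps φ f ω / (μu ω - μs ω - 2 * C₁ * InvGraph.eps φ f ω) ≤ β ω ∧
        β ω < 1) →
      InvGraph.InvariantGraphTheorem φ P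
        (InvGraph.IsMild φ A (ContinuousLinearMap.id ℝ Z) (fun ω z => L ω z + f ω z))
        f μs μu (fun ω => 2 * C₁ * InvGraph.eps φ f ω) β (∀ ω, ContDiff ℝ 1 (f ω)) True) ∧
    -- (ii), second part: MR operators with `δ(t) / t → 1`
    (∀ (Z : Type v) [NormedAddCommGroup Z] [NormedSpace ℝ Z] [CompleteSpace Z]
      (A : Z →ₗ.[ℝ] Z) (δ : ℝ → ℝ) (L : M → InvGraph.closDom A →L[ℝ] Z) (τ : M → ℝ)
      (T₀ : ℝ≥0 → M → InvGraph.closDom A →L[ℝ] InvGraph.closDom A)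
      (P : M → InvGraph.closDom A →L[ℝ] InvGraph.closDom A)
      (f : M → InvGraph.closDom A → Z) (β : M → ℝ),
      InvGraph.IsMROperator A δ →
      Tendsto (fun t => δ t / t) (𝓝[>] 0) (𝓝 1) →
      InvGraph.CondL φ L τ →
      InvGraph.CondF φ f →
      InvGraph.GeneratesCocycle φ A (InvGraph.closDom A).subtypeL L T₀ →
      InvGraph.UniformDichotomyCocycle φ T₀ P C₁ μs μu →
      InvGraph.InfPos (fun ω => μu ω - μs ω - (1 + c) * (2 * C₁ * InvGraph.eps φ f ω)) →
      (∀ ω, 2 * C₁ * InvGraph.eps φ f ω / (μu ω - μs ω - 2 * C₁ * InvGraph.eps φ f ω) ≤ β ω ∧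
        β ω < 1) →
      InvGraph.InvariantGraphTheorem φ P
        (InvGraph.IsMild φ A (InvGraph.closDom A).subtypeL (fun ω z => L ω z + f ω z))
        f μs μu (fun ω => 2 * C₁ * InvGraph.eps φ f ω) β (∀ ω, ContDiff ℝ 1 (f ω)) True) ∧
    -- (iii) general MR operators
    (∀ (δ : ℝ → ℝ) (τ η : M → ℝ), (∀ ω, 0 < η ω) → (∀ (t : ℝ≥0) (ω : M), η (φ t ω) ≤ η ω) →
      InvGraph.InfPos (fun ω => μu ω - μs ω - (1 + c) * η ω) →
      ∃ ϑ β : M → ℝ, (∀ ω, 0 < ϑ ω) ∧ (∀ ω, 0 ≤ β ω) ∧ (∃ b : ℝ, b < 1 ∧ ∀ ω, β ω ≤ b) ∧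
      ∀ (Z : Type v) [NormedAddCommGroup Z] [NormedSpace ℝ Z] [CompleteSpace Z]
        (A : Z →ₗ.[ℝ] Z) (L : M → InvGraph.closDom A →L[ℝ] Z)
        (T₀ : ℝ≥0 → M → InvGraph.closDom A →L[ℝ] InvGraph.closDom A)
        (P : M → InvGraph.closDom A →L[ℝ] InvGraph.closDom A)
        (f : M → InvGraph.closDom A → Z),
        InvGraph.IsMROperator A δ →
        InvGraph.CondL φ L τ →
        InvGraph.CondF φ f →
        InvGraph.GeneratesCocycle φ A (InvGraph.closDom A).subtypeL L T₀ →
        InvGraph.UniformDichotomyCocycle φ T₀ P C₁ μs μu →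
        (∀ ω, InvGraph.eps φ f ω < ϑ ω) →
        InvGraph.InvariantGraphTheorem φ P
          (InvGraph.IsMild φ A (InvGraph.closDom A).subtypeL (fun ω z => L ω z + f ω z))
          f μs μu η β
          ((∀ ω, ContDiff ℝ 1 (f ω)) ∧
            Continuous fun p : M × InvGraph.closDom A => fderiv ℝ (f p.1) p.2)
          (InvGraph.IsBdd τ)) := by
  refine ⟨?_, ?_, ?_, ?_⟩
  · intro Z _ _ _ P T₁ S₁ f β hU hf hgap hβ
    exact InvGraph.invariantGraphTheorem_integral hc hU hf hgap hβ
  · intro Z _ _ _ A L τ P T₁ S₁ f β hA hL hf hU hG hgap hβ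
    exact InvGraph.invariantGraphTheorem_biSemigroup hc hA hL hf hU hG hgap hβ
  · intro Z _ _ _ A δ L τ T₀ P f β hA hδ hL hf hG hU hgap hβ
    exact InvGraph.invariantGraphTheorem_mr hc hA hδ hL hf hG hU hgap hβ
  · intro δ τ η hη _ ⟨d, hd, hgap⟩
    have hgap' : ∀ ω, d ≤ μu ω - μs ω := fun ω => by
      have := mul_pos (by linarith : 0 < 1 + c) (hη ω)
      linarith [hgap ω]
    have hκ : ∀ ω, 0 ≤ InvGraph.orbitGain δ τ μs μu ω := fun ω =>
      InvGraph.orbitGain_nonneg δ τ (by linarith [hgap' ω])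
    -- Chosen so that gain times 2C₁ε is at most 1/3. The sign of C₁ is not known until a dichotomy
    -- is given, hence |C₁| + 1; the other + 1 covers zero gain.
    refine ⟨fun ω => 1 / (6 * (|C₁| + 1) * (InvGraph.orbitGain δ τ μs μu ω + 1)),
      fun _ => 1 / 2, fun ω => by have := hκ ω; positivity, fun _ => by norm_num,
      ⟨1 / 2, by norm_num, fun _ => le_rfl⟩, ?_⟩
    intro Z _ _ _ A L T₀ P f hA hL hf hG hU hε
    refine InvGraph.invariantGraphTheorem_mr_small hA hL hf hG hU hη hd hgap' fun ω => ?_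
    have h0 := hκ ω
    have h1 := InvGraph.eps_nonneg (φ := φ) f ω
    have h2 := (hε ω).le
    rw [le_div_iff₀ (by positivity), abs_of_nonneg hU.C_pos.le] at h2
    nlinarith [mul_nonneg h1 h0, mul_nonneg h1 hU.C_pos.le]
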